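/- **Setting.** Let $1\le n\le 4$ and let $\Omega\subset\mathbb R^n$ be bounded and open with Lipschitz boundary. Let $M=(a_{i,j})$, $d=(d_i)$, $b$ have entries in $L^\infty(\Omega)\cap W^{1,4}(\Omega)$, and suppose that the bilinear form $$a(u,v)=\int_\Omega \sum_{i,j}a_{i,j}\,\partial_i u\,\partial_j v+\sum_i d_i(\partial_i u\, v+u\,\partial_i v)+b\,u\,v\;dx$$ is symmetric and coercive on $H^1_0(\Omega)$. Let $f,\varphi,\bar y\in H^1(\Omega)$ and $\bar\lambda\in L^2(\Omega)$. Let $\max_\gamma:\mathbb R\to[0,\infty)$, $\gamma>0$, be $C^1$ functions such that: $|\max_\gamma(x)-\max(0,x)|\le g(\gamma)$ for all $x$ and $\gamma$, for some $g\colon(0,\infty)\to[0,\infty)$ with $g(\gamma)\to0$ as $\gamma\to\infty$; $\operatorname{sign}_\gamma:=\max_\gamma'$ takes values in $[0,1]$ and is nondecreasing; and, as $\gamma\to\infty$, $\operatorname{sign}_\gamma$ converges uniformly to $0$ on $(-\infty,-\delta)$ and to $1$ on $(\delta,\infty)$ for every $\delta>0$. Fix $\gamma,c>0$. Let $y\in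 H^1_0(\Omega)$ solve the fully regularized state equation $$a(y,v)+\int_\Omega \textstyle\max_\gamma(\bar\lambda+c(y-\varphi))\,v\,dx=\int_\Omega f v\,dx\qquad\forall v\in H^1_0(\Omega),$$ let $p\in H^1_0(\Omega)$ solve the adjoint equation $$a(p,v)+c\int_\Omega \operatorname{sign}_\gamma(\bar\lambda+c(y-\varphi))\,p\,v\,dx=-\int_\Omega (y-\bar y)v\,dx\qquad\forall v\in H^1_0(\Omega),$$ and assume $y,p\in W^{1,4}(\Omega)$. **Shape functional and shape derivative.** For $V\in H^1_0(\Omega,\mathbb R^n)$ Lipschitz (extended by zero) let $T_t=\mathrm{id}+tV$ and $\Omega_t=T_t(\Omega)$, and let $\mathcal J_{\gamma,c}(\Omega_t)=\frac12\int_{\Omega_t}|y_t-\bar y|^2dx$, where $y_t\in H^1_0(\Omega_t)$ is the solution of the fully regularized state equation on $\Omega_t$ in which $\bar\lambda$ is transported with the domain (replaced by $\bar\lambda\circ T_t^{-1}$), whereas $a_{i,j},d_i,b,f,\varphi,\bar y$ are fixed functions of the space variable. We say that $\mathcal J_{\gamma,c}$ has the shape derivative $D\mathcal J_{\gamma,c}(\Omega)[\cdot]$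 on $H^1_0(\Omega,\mathbb R^n)$ if this is a linear and $H^1$-continuous functional on $H^1_0(\Omega,\mathbb R^n)$ and, for every Lipschitz $V\in H^1_0(\Omega,\mathbb R^n)$, $$D\mathcal J_{\gamma,c}(\Omega)[V]=\lim_{t\searrow0}\frac{\mathcal J_{\gamma,c}(\Omega_t)-\mathcal J_{\gamma,c}(\Omega)}{t}.$$ (Lipschitz fields are dense, so the shape derivative in a direction $V\in H^1_0(\Omega,\mathbb R^n)$ is determined by these limits.) **Theorem.** For every Lipschitz $V\in H^1_0(\Omega,\mathbb R^n)$ and all sufficiently small $t\ge0$, $T_t$ is bijective and the state equation on $\Omega_t$ has a unique solution. The functional $\mathcal J_{\gamma,c}$ has a shape derivative at $\Omega$ in every direction $V\in H^1_0(\Omega,\mathbb R^n)$. With $(\nabla V)_{ij}=\partial_iV_j$, $(\nabla M\cdot V)_{ij}=\nabla a_{i,j}^TV$ and $(\nabla d^TV)_i=\nabla d_i^TV$, it is given by $$\begin{aligned}D\mathcal J_{\gamma,c}(\Omega)[V]=\int_\Omega&-(y-\bar y)\nabla\bar y^TV-\nabla y^T(\nabla V^TM-\nabla M\cdot V+M\nabla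 V)\nabla p+(\nabla b^TV)\,y\,p\\&+y\big((\nabla d^TV)^T\nabla p-d^T(\nabla V\nabla p)\big)+p\big((\nabla d^TV)^T\nabla y-d^T(\nabla V\nabla y)\big)\\&-c\,\operatorname{sign}_\gamma(\bar\lambda+c(y-\varphi))\,\nabla\varphi^TV\,p-\nabla f^TV\,p\\&+\operatorname{div}(V)\Big(\tfrac12(y-\bar y)^2+b\,y\,p+\sum_{i,j}a_{i,j}\partial_iy\,\partial_jp+\sum_id_i(\partial_iy\,p+y\,\partial_ip)\\&\qquad\qquad+\textstyle\max_\gamma(\bar\lambda+c(y-\varphi))\,p-f\,p\Big)\,dx,\end{aligned}$$ where the integrand is integrable for every $V\in H^1_0(\Omega,\mathbb R^n)$. -/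

import Mathlib

open MeasureTheory Filter Topology Set
open scoped ENNReal Gradient Matrix

noncomputable section

/-- Euclidean space of dimension `n`. -/
abbrev Eucl (n : ℕ) := EuclideanSpace ℝ (Fin n)

/-- Test functions on `Ω`: smooth, with compact support contained in `Ω`. -/
def IsTestFun {n : ℕ} (Ω : Set (Eucl n)) (θ : Eucl n → ℝ) : Prop :=
  ContDiff ℝ (⊤ : ℕ∞) θ ∧ HasCompactSupport θ ∧ tsupport θ ⊆ Ω

/-- `g` is the weak gradient of `u` on `Ω`. -/
def HasWeakGrad {n : ℕ} (Ω : Set (Eucl n)) (u : Eucl n → ℝ) (g : Eucl n → Eucl n) : Prop :=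
  LocallyIntegrableOn u Ω ∧ LocallyIntegrableOn g Ω ∧
    ∀ θ : Eucl n → ℝ, IsTestFun Ω θ →
      ∫ x in Ω, u x • (∇ θ x) = - ∫ x in Ω, θ x • g x

open Classical in
/-- The weak gradient of `u` on `Ω` (unique almost everywhere on `Ω`); `0` if there is none. -/
def weakGrad {n : ℕ} (Ω : Set (Eucl n)) (u : Eucl n → ℝ) : Eucl n → Eucl n :=
  if h : ∃ g, HasWeakGrad Ω u g then h.choose else 0

theorem weakGrad_spec {n : ℕ} {Ω : Set (Eucl n)} {u : Eucl n → ℝ}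
    (h : ∃ g, HasWeakGrad Ω u g) : HasWeakGrad Ω u (weakGrad Ω u) := by
  unfold weakGrad
  rw [dif_pos h]
  exact h.choose_spec

/-- The Sobolev space `W^{1,p}(Ω)`. -/
def MemW1 {n : ℕ} (Ω : Set (Eucl n)) (p : ℝ≥0∞) (u : Eucl n → ℝ) : Prop :=
  MemLp u p (volume.restrict Ω) ∧ (∃ g, HasWeakGrad Ω u g) ∧
    MemLp (weakGrad Ω u) p (volume.restrict Ω)

/-- The space `H^1_0(Ω)`: the closure of the test functions in `H^1(Ω)`. -/
def MemH10 {n : ℕ} (Ω : Set (Eucl n)) (u : Eucl n → ℝ) : Prop :=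
  MemW1 Ω 2 u ∧ ∃ θ : ℕ → Eucl n → ℝ, (∀ k, IsTestFun Ω (θ k)) ∧
    Tendsto (fun k => eLpNorm (fun x => θ k x - u x) 2 (volume.restrict Ω)) atTop (𝓝 0) ∧
    Tendsto (fun k => eLpNorm (fun x => ∇ (θ k) x - weakGrad Ω u x) 2 (volume.restrict Ω))
      atTop (𝓝 0)

/-- The squared norm of `H^1(Ω)`. -/
def h1NormSq {n : ℕ} (Ω : Set (Eucl n)) (u : Eucl n → ℝ) : ℝ :=
  (∫ x in Ω, (u x) ^ 2) + ∫ x in Ω, ‖weakGrad Ω u x‖ ^ 2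

/-- Vector fields in `H^1_0(Ω, ℝ^n)`. -/
def MemH10Vec {n : ℕ} (Ω : Set (Eucl n)) (V : Eucl n → Eucl n) : Prop :=
  ∀ k, MemH10 Ω (fun x => V x k)

/-- The norm of `H^1(Ω, ℝ^n)`. -/
def h1NormVec {n : ℕ} (Ω : Set (Eucl n)) (V : Eucl n → Eucl n) : ℝ :=
  Real.sqrt (∑ k, h1NormSq Ω (fun x => V x k))

/-- A bounded open set whose boundary is locally, in suitable orthogonal coordinates, the graph
of a Lipschitz function with `Ω` on one side of it. -/
def IsBoundedLipschitz {n : ℕ} (Ω : Set (Eucl n)) : Prop :=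
  IsOpen Ω ∧ Bornology.IsBounded Ω ∧
    ∀ x₀ ∈ frontier Ω, ∃ (ν : Eucl n) (r : ℝ) (K : NNReal) (γ : Eucl n → ℝ),
      ‖ν‖ = 1 ∧ 0 < r ∧ LipschitzWith K γ ∧
      ∀ x ∈ Metric.ball x₀ r,
        (x ∈ Ω ↔ inner ℝ ν x < γ (x - (inner ℝ ν x : ℝ) • ν))

/-- A smoothed maximum function `max_γ`, with smoothing parameter `γ > 0`. -/
structure IsSmoothedMax (maxγ : ℝ → ℝ → ℝ) : Prop where
  nonneg : ∀ γ > 0, ∀ x, 0 ≤ maxγ γ x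
  contDiff : ∀ γ > 0, ContDiff ℝ 1 (maxγ γ)
  approx : ∃ g : ℝ → ℝ, (∀ γ > 0, 0 ≤ g γ) ∧ Tendsto g atTop (𝓝 0) ∧
    ∀ γ > 0, ∀ x, |maxγ γ x - max 0 x| ≤ g γ
  deriv_mem : ∀ γ > 0, ∀ x, deriv (maxγ γ) x ∈ Icc (0 : ℝ) 1
  deriv_mono : ∀ γ > 0, Monotone (deriv (maxγ γ))
  deriv_neg : ∀ δ > 0, TendstoUniformlyOn (fun γ => deriv (maxγ γ)) (fun _ => 0) atTop (Iio (-δ))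
  deriv_pos : ∀ δ > 0, TendstoUniformlyOn (fun γ => deriv (maxγ γ)) (fun _ => 1) atTop (Ioi δ)

/-- The data of the model problem: coefficients `M = (a_ij)`, `d`, `b` of the bilinear form,
right-hand side `f`, obstacle `φ`, target `ybar` and shift `lam`. -/
structure ProblemData (n : ℕ) where
  M : Eucl n → Matrix (Fin n) (Fin n) ℝ
  d : Eucl n → Fin n → ℝ
  b : Eucl n → ℝ
  f : Eucl n → ℝ
  φ : Eucl n → ℝ
  ybar : Eucl n → ℝ
  lam : Eucl n → ℝ

/-- The integrand of the bilinear form,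
`∑ a_ij ∂_i u ∂_j v + ∑ d_i (∂_i u v + u ∂_i v) + b u v`. -/
def formIntegrand {n : ℕ} (D : ProblemData n) (Ω : Set (Eucl n)) (u v : Eucl n → ℝ)
    (x : Eucl n) : ℝ :=
  (∑ i, ∑ j, D.M x i j * weakGrad Ω u x i * weakGrad Ω v x j)
    + (∑ i, D.d x i * (weakGrad Ω u x i * v x + u x * weakGrad Ω v x i))
    + D.b x * u x * v x

/-- The bilinear form `a(u,v)` on `Ω`. -/
def bilinForm {n : ℕ} (D : ProblemData n) (Ω : Set (Eucl n)) (u v : Eucl n → ℝ) : ℝ :=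
  ∫ x in Ω, formIntegrand D Ω u v x

/-- `y` solves the fully regularized state equation on `Ω`, with smoothed maximum `m`. -/
def IsState {n : ℕ} (D : ProblemData n) (m : ℝ → ℝ) (c : ℝ) (Ω : Set (Eucl n))
    (y : Eucl n → ℝ) : Prop :=
  MemH10 Ω y ∧ ∀ v, MemH10 Ω v →
    bilinForm D Ω y v + ∫ x in Ω, m (D.lam x + c * (y x - D.φ x)) * v x
      = ∫ x in Ω, D.f x * v x

/-- `p` solves the adjoint equation at the state `y` on `Ω`. -/
def IsAdjoint {n : ℕ} (D : ProblemData n) (m : ℝ → ℝ) (c : ℝ) (Ω : Set (Eucl n))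
    (y p : Eucl n → ℝ) : Prop :=
  MemH10 Ω p ∧ ∀ v, MemH10 Ω v →
    bilinForm D Ω p v
        + c * ∫ x in Ω, deriv m (D.lam x + c * (y x - D.φ x)) * p x * v x
      = - ∫ x in Ω, (y x - D.ybar x) * v x

open Classical in
/-- The reduced tracking functional `(1/2) ∫_Ω |y - ybar|²`, where `y` is the solution of the
fully regularized state equation on `Ω` (`0` if there is no solution). -/
def reducedCost {n : ℕ} (D : ProblemData n) (m : ℝ → ℝ) (c : ℝ) (Ω : Set (Eucl n)) : ℝ :=
  if h : ∃ y, IsState D m c Ω y then (1 / 2) * ∫ x in Ω, |h.choose x - D.ybar x| ^ 2 else 0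

/-- The data after a deformation `T` of the domain: the shift is carried along with the domain,
all other data are fixed functions of the space variable. -/
def ProblemData.deform {n : ℕ} (D : ProblemData n) (T : Eucl n → Eucl n) : ProblemData n :=
  { D with lam := D.lam ∘ Function.invFun T }

/-- The shape functional, evaluated at the deformed domain `T(Ω)`. -/
def shapeFunctional {n : ℕ} (D : ProblemData n) (m : ℝ → ℝ) (c : ℝ) (Ω : Set (Eucl n))
    (T : Eucl n → Eucl n) : ℝ :=
  reducedCost (D.deform T) m c (T '' Ω)

/-- The perturbation of the identity in direction `V`. -/
def perturb {n : ℕ} (V : Eucl n → Eucl n) (t : ℝ) : Eucl n → Eucl n := fun x => x + t • V x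

/-- Vector fields that deform `Ω` by a bi-Lipschitz map (for small parameters): the Lipschitz
elements of `H^1_0(Ω, ℝ^n)`, extended by zero. -/
def IsAdmissibleField {n : ℕ} (Ω : Set (Eucl n)) (V : Eucl n → Eucl n) : Prop :=
  MemH10Vec Ω V ∧ (∃ K, LipschitzWith K V) ∧ ∀ x, x ∉ Ω → V x = 0

/-- `J` (a functional of the deformed domain) is shape differentiable at `Ω` with shape derivative
`dJ` on `H^1_0(Ω, ℝ^n)`: the functional `dJ` is linear and continuous on `H^1_0(Ω, ℝ^n)`, and for
Lipschitz fields it is the limit of the difference quotients. The Lipschitz fields are dense, so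
`dJ` is determined by `J`. -/
def HasShapeDerivative {n : ℕ} (Ω : Set (Eucl n)) (J : (Eucl n → Eucl n) → ℝ)
    (dJ : (Eucl n → Eucl n) → ℝ) : Prop :=
  (∀ V, IsAdmissibleField Ω V →
      Tendsto (fun t : ℝ => (J (perturb V t) - J id) / t) (𝓝[>] 0) (𝓝 (dJ V))) ∧
  (∀ V W, MemH10Vec Ω V → MemH10Vec Ω W → ∀ α β : ℝ,
      dJ (fun x => α • V x + β • W x) = α * dJ V + β * dJ W) ∧
  (∃ C : ℝ, ∀ V, MemH10Vec Ω V → |dJ V| ≤ C * h1NormVec Ω V)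

/-- The gradient of a vector field, `(∇V)_{ij} = ∂_i V_j`. -/
def gradField {n : ℕ} (Ω : Set (Eucl n)) (V : Eucl n → Eucl n) (x : Eucl n) :
    Matrix (Fin n) (Fin n) ℝ :=
  Matrix.of fun i j => weakGrad Ω (fun z => V z j) x i

/-- The divergence of a vector field. -/
def divField {n : ℕ} (Ω : Set (Eucl n)) (V : Eucl n → Eucl n) (x : Eucl n) : ℝ :=
  (gradField Ω V x).trace

/-- The directional derivative `∇uᵀ V`. -/
def dirDeriv {n : ℕ} (Ω : Set (Eucl n)) (u : Eucl n → ℝ) (V : Eucl n → Eucl n)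
    (x : Eucl n) : ℝ :=
  inner ℝ (weakGrad Ω u x) (V x)

/-- The integrand of the volume formula of the shape derivative. -/
def shapeDerivIntegrand {n : ℕ} (D : ProblemData n) (m : ℝ → ℝ) (c : ℝ) (Ω : Set (Eucl n))
    (y p : Eucl n → ℝ) (V : Eucl n → Eucl n) (x : Eucl n) : ℝ :=
  let gy : Fin n → ℝ := fun i => weakGrad Ω y x i
  let gp : Fin n → ℝ := fun i => weakGrad Ω p x i
  let gV : Matrix (Fin n) (Fin n) ℝ := gradField Ω V x
  let dM : Matrix (Fin n) (Fin n) ℝ := Matrix.of fun i j => dirDeriv Ω (fun z => D.M z i j) V x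
  let dd : Fin n → ℝ := fun i => dirDeriv Ω (fun z => D.d z i) V x;
  - (y x - D.ybar x) * dirDeriv Ω D.ybar V x
    - gy ⬝ᵥ ((gVᵀ * D.M x - dM + D.M x * gV) *ᵥ gp)
    + dirDeriv Ω D.b V x * y x * p x
    + y x * (dd ⬝ᵥ gp - D.d x ⬝ᵥ (gV *ᵥ gp))
    + p x * (dd ⬝ᵥ gy - D.d x ⬝ᵥ (gV *ᵥ gy))
    - c * deriv m (D.lam x + c * (y x - D.φ x)) * dirDeriv Ω D.φ V x * p x
    - dirDeriv Ω D.f V x * p x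
    + divField Ω V x *
      ((1 / 2) * (y x - D.ybar x) ^ 2 + D.b x * y x * p x
        + (∑ i, ∑ j, D.M x i j * gy i * gp j)
        + (∑ i, D.d x i * (gy i * p x + y x * gp i))
        + m (D.lam x + c * (y x - D.φ x)) * p x
        - D.f x * p x)

end

/-! ### Weak gradients, and H¹₀ as the closure of the pairs (θ, ∇θ) of test functions. -/

section WeakGradient

variable {n : ℕ} {Ω U : Set (Eucl n)} {u v : Eucl n → ℝ} {g h : Eucl n → Eucl n}

/-! An admissible field vanishes outside Ω, so for small t the map T_t is bi-Lipschitz, fixes the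
complement of Ω and sends Ω onto itself (`LipschitzWith.isBiLip_perturb`). Thus Ω_t = Ω, and the
deformation is felt only through the shift λ̄∘T_t⁻¹. The perturbed state equations live on the fixed
space H¹₀(Ω) and are uniquely solvable by coercivity and monotonicity
(`IsEllipticData.exists_state`, `IsEllipticData.state_unique`).

Put q = λ̄ + c(y − φ), m = max_γ, z = y_t − y, and let `shiftDefect` be ∫ (m(λ̄∘T_t⁻¹ + c(y − φ)) −
m(q)) v. Although λ̄ is merely in L², the change of variables x ↦ T_t x puts λ̄ back in place and
moves the increments onto y, φ, v and the Jacobian (`shiftDefect_eq`), all of which are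
differentiable along V. So the defect is O(t) uniformly for v bounded in H¹, whence z = O(t) in H¹,
and for v = p it has a derivative at t = 0. Test the difference of the state equations with p and
the adjoint equation with z. By symmetry of a, the change of the cost is defect(p) + c ∫ (averaged
m' − m'(q)) p z + ½ ∫ z², and the last two terms are o(t). Hence the derivative is ∫ m'(q) c (∇y −
∇φ)ᵀV p + m(q) div(pV) (`tendsto_cost_diffQuot`).

This is the volume formula in disguise (`integral_shapeDerivIntegrand`). The two integrands differ
by the divergences of ½(y − ȳ)²V and of f p V, which integrate to zero, and by an identity that
formally comes from using ∇yᵀV and ∇pᵀV as test functions. These need not lie in H¹₀(Ω); so the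
adjoint equation is tested with y∘T_t − y, the state equation with p∘T_t⁻¹ − p, and after division
by t the difference a(y∘T_t, p) − a(y, p∘T_t⁻¹) is expanded exactly by a change of variables
(`tendsto_bilinForm_transport`). Passing to the limit takes only products of three L⁴ functions,
which is what W^{1,4} supplies.

For V in H¹₀ the formula pairs V with a density in L^{4/3} and ∇V with a density in L²
(`shapeDerivIntegrand_eq_fieldPairing`), and H¹₀ ⊂ L⁴ because n ≤ 4. Two memberships are not
immediate. The term (y − ȳ)∇ȳ needs ȳ ∈ L⁴, which is obtained by folding space across the Lipschitz
graphs that bound Ω (`memLp_four_of_isBoundedLipschitz`); this is the only use of the boundary. The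
terms m(q)p and f p multiply div V and need p ∈ L^∞, which W^{1,4} does not give when n = 4; De
Giorgi's iteration applied to the adjoint equation does (`memLp_top_of_weak_solution`). -/

theorem gradient_apply (θ : Eucl n → ℝ) (x : Eucl n) (i : Fin n) :
    (∇ θ x) i = fderiv ℝ θ x (EuclideanSpace.single i 1) := by
  have h : inner ℝ (∇ θ x) (EuclideanSpace.single i (1 : ℝ)) = (∇ θ x) i := by
    rw [EuclideanSpace.inner_single_right]; simp
  rw [← h, gradient, InnerProductSpace.toDual_symm_apply]

theorem inner_gradient (θ : Eucl n → ℝ) (x v : Eucl n) : inner ℝ (∇ θ x) v = fderiv ℝ θ x v := by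
  rw [gradient, InnerProductSpace.toDual_symm_apply]

theorem norm_gradient (θ : Eucl n → ℝ) (x : Eucl n) : ‖∇ θ x‖ = ‖fderiv ℝ θ x‖ := by
  rw [gradient, LinearIsometryEquiv.norm_map]

theorem continuous_gradient {θ : Eucl n → ℝ} (h : ContDiff ℝ 1 θ) : Continuous (∇ θ) :=
  (InnerProductSpace.toDual ℝ (Eucl n)).symm.continuous.comp (h.continuous_fderiv one_ne_zero)

theorem gradient_eq_zero_of_notMem_tsupport {θ : Eucl n → ℝ} {x : Eucl n} (h : x ∉ tsupport θ) :
    ∇ θ x = 0 := by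
  have : fderiv ℝ θ x = 0 := by
    by_contra h'
    exact h (support_fderiv_subset ℝ h')
  rw [gradient, this, map_zero]

theorem HasCompactSupport.gradient {θ : Eucl n → ℝ} (h : HasCompactSupport θ) :
    HasCompactSupport (∇ θ) :=
  HasCompactSupport.intro h fun _ hx => gradient_eq_zero_of_notMem_tsupport hx

theorem gradient_mul {θ χ : Eucl n → ℝ} {x : Eucl n} (hθ : DifferentiableAt ℝ θ x)
    (hχ : DifferentiableAt ℝ χ x) :
    ∇ (fun x => θ x * χ x) x = θ x • ∇ χ x + χ x • ∇ θ x := by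
  unfold _root_.gradient
  rw [← map_smul, ← map_smul, ← map_add]
  congr 1
  exact fderiv_fun_mul hθ hχ

namespace IsTestFun

variable {θ χ : Eucl n → ℝ}

theorem contDiff (h : IsTestFun Ω θ) (m : ℕ∞) : ContDiff ℝ m θ := h.1.of_le (by exact_mod_cast le_top)

theorem contDiff_one (h : IsTestFun Ω θ) : ContDiff ℝ 1 θ := h.contDiff 1

theorem differentiable (h : IsTestFun Ω θ) : Differentiable ℝ θ :=
  h.contDiff_one.differentiable (by simp)

theorem continuous (h : IsTestFun Ω θ) : Continuous θ := h.1.continuous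

theorem memLp (h : IsTestFun Ω θ) (p : ℝ≥0∞) (s : Set (Eucl n)) :
    MemLp θ p (volume.restrict s) :=
  (h.continuous.memLp_of_hasCompactSupport h.2.1).restrict s

theorem memLp_gradient (h : IsTestFun Ω θ) (p : ℝ≥0∞) (s : Set (Eucl n)) :
    MemLp (∇ θ) p (volume.restrict s) :=
  ((continuous_gradient h.contDiff_one).memLp_of_hasCompactSupport h.2.1.gradient).restrict s

theorem eq_zero (h : IsTestFun Ω θ) {x : Eucl n} (hx : x ∉ Ω) : θ x = 0 :=
  image_eq_zero_of_notMem_tsupport fun h' => hx (h.2.2 h')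

theorem gradient_eq_zero (h : IsTestFun Ω θ) {x : Eucl n} (hx : x ∉ Ω) : ∇ θ x = 0 :=
  gradient_eq_zero_of_notMem_tsupport fun h' => hx (h.2.2 h')

theorem zero (Ω : Set (Eucl n)) : IsTestFun Ω (fun _ => 0) := by
  refine ⟨contDiff_const, HasCompactSupport.zero, ?_⟩
  have : tsupport (fun _ : Eucl n => (0 : ℝ)) = ∅ := by
    rw [tsupport_eq_empty_iff]; rfl
  simp [this]

theorem add (h : IsTestFun Ω θ) (h' : IsTestFun Ω χ) : IsTestFun Ω (fun x => θ x + χ x) :=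
  ⟨h.1.add h'.1, h.2.1.add h'.2.1, (tsupport_add θ χ).trans (union_subset h.2.2 h'.2.2)⟩

theorem const_mul (h : IsTestFun Ω θ) (a : ℝ) : IsTestFun Ω (fun x => a * θ x) :=
  ⟨contDiff_const.mul h.1, h.2.1.mul_left (f := fun _ => a),
    (tsupport_mul_subset_right (f := fun _ => a)).trans h.2.2⟩

end IsTestFun

theorem MeasureTheory.LocallyIntegrableOn.integrable_smul_of_tsupport_subset {E : Type*} [NormedAddCommGroup E]
    [NormedSpace ℝ E] {f : Eucl n → E} {θ : Eucl n → ℝ} (hf : LocallyIntegrableOn f Ω)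
    (hθ : Continuous θ) (hc : HasCompactSupport θ) (hs : tsupport θ ⊆ Ω) :
    Integrable (fun x => θ x • f x) := by
  have h1 : IntegrableOn f (tsupport θ) := hf.integrableOn_compact_subset hs hc
  have h2 := h1.continuousOn_smul hθ.continuousOn hc
  refine (integrableOn_iff_integrable_of_support_subset ?_).1 h2
  intro x hx
  by_contra h'
  exact hx (by simp [image_eq_zero_of_notMem_tsupport h'])

theorem MeasureTheory.LocallyIntegrableOn.integrable_smul_vec_of_tsupport_subset
    {f : Eucl n → ℝ} {θ : Eucl n → Eucl n} (hf : LocallyIntegrableOn f Ω)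
    (hθ : Continuous θ) (hc : HasCompactSupport θ) (hs : tsupport θ ⊆ Ω) :
    Integrable (fun x => f x • θ x) := by
  have h1 : IntegrableOn f (tsupport θ) := hf.integrableOn_compact_subset hs hc
  have h2 := h1.smul_continuousOn hθ.continuousOn hc
  refine (integrableOn_iff_integrable_of_support_subset ?_).1 h2
  intro x hx
  by_contra h'
  exact hx (by simp [image_eq_zero_of_notMem_tsupport h'])

theorem tsupport_gradient_subset (θ : Eucl n → ℝ) : tsupport (∇ θ) ⊆ tsupport θ :=
  closure_minimal (fun _ hx => by
    by_contra h'
    exact hx (gradient_eq_zero_of_notMem_tsupport h')) (isClosed_tsupport θ)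

theorem IsTestFun.integrable_smul {θ : Eucl n → ℝ} (h : IsTestFun Ω θ)
    (hg : LocallyIntegrableOn g Ω) : Integrable (fun x => θ x • g x) :=
  LocallyIntegrableOn.integrable_smul_of_tsupport_subset hg h.continuous h.2.1 h.2.2

theorem IsTestFun.integrable_smul_gradient {θ : Eucl n → ℝ} (h : IsTestFun Ω θ)
    (hu : LocallyIntegrableOn u Ω) : Integrable (fun x => u x • ∇ θ x) :=
  LocallyIntegrableOn.integrable_smul_vec_of_tsupport_subset hu
    (continuous_gradient h.contDiff_one) h.2.1.gradient
    ((tsupport_gradient_subset θ).trans h.2.2)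

/-- Fundamental lemma of the calculus of variations, applied to g − h. As `weakGrad` is a chosen
gradient, it can be computed only through this uniqueness, hence only almost everywhere. -/
theorem HasWeakGrad.ae_unique (hΩ : IsOpen Ω) (hg : HasWeakGrad Ω u g) (hh : HasWeakGrad Ω u h) :
    g =ᵐ[volume.restrict Ω] h := by
  have key := hΩ.ae_eq_zero_of_integral_contDiff_smul_eq_zero (μ := volume)
    (f := fun x => g x - h x) (hg.2.1.sub hh.2.1) (fun θ h1 h2 h3 => by
      have ht : IsTestFun Ω θ := ⟨h1, h2, h3⟩
      have e1 := hg.2.2 θ ht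
      rw [hh.2.2 θ ht, neg_inj] at e1
      have e2 : ∫ x, θ x • (g x - h x) = ∫ x in Ω, θ x • (g x - h x) := by
        rw [setIntegral_eq_integral_of_forall_compl_eq_zero]
        intro x hx
        simp [ht.eq_zero hx]
      rw [e2]
      simp only [smul_sub]
      rw [integral_sub (ht.integrable_smul hg.2.1).integrableOn
        (ht.integrable_smul hh.2.1).integrableOn, e1, sub_self])
  rw [EventuallyEq, ae_restrict_iff' hΩ.measurableSet]
  filter_upwards [key] with x hx hxΩ
  exact sub_eq_zero.1 (hx hxΩ)

theorem weakGrad_ae_eq (hΩ : IsOpen Ω) (hg : HasWeakGrad Ω u g) :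
    weakGrad Ω u =ᵐ[volume.restrict Ω] g :=
  HasWeakGrad.ae_unique hΩ (weakGrad_spec ⟨g, hg⟩) hg

theorem MeasureTheory.LocallyIntegrableOn.congr_ae {E : Type*} [NormedAddCommGroup E] {f f' : Eucl n → E}
    (hf : LocallyIntegrableOn f Ω) (h : f =ᵐ[volume.restrict Ω] f') :
    LocallyIntegrableOn f' Ω := by
  intro x hx
  obtain ⟨s, hs, hs'⟩ := hf x hx
  refine ⟨s ∩ Ω, inter_mem hs self_mem_nhdsWithin, ?_⟩
  exact (hs'.mono_set inter_subset_left).congr_fun_ae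
    (ae_mono (Measure.restrict_mono inter_subset_right le_rfl) h)

theorem HasWeakGrad.congr (hg : HasWeakGrad Ω u g)
    (h1 : u =ᵐ[volume.restrict Ω] v) (h2 : g =ᵐ[volume.restrict Ω] h) : HasWeakGrad Ω v h := by
  refine ⟨LocallyIntegrableOn.congr_ae hg.1 h1, LocallyIntegrableOn.congr_ae hg.2.1 h2,
    fun θ hθ => ?_⟩
  have e1 : ∫ x in Ω, v x • ∇ θ x = ∫ x in Ω, u x • ∇ θ x :=
    integral_congr_ae (by filter_upwards [h1] with x hx; rw [hx])
  have e2 : ∫ x in Ω, θ x • h x = ∫ x in Ω, θ x • g x :=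
    integral_congr_ae (by filter_upwards [h2] with x hx; rw [hx])
  rw [e1, e2, hg.2.2 θ hθ]

theorem HasWeakGrad.add (hg : HasWeakGrad Ω u g) (hh : HasWeakGrad Ω v h) :
    HasWeakGrad Ω (fun x => u x + v x) (fun x => g x + h x) := by
  refine ⟨hg.1.add hh.1, hg.2.1.add hh.2.1, fun θ hθ => ?_⟩
  simp only [add_smul, smul_add]
  rw [integral_add (hθ.integrable_smul_gradient hg.1).integrableOn
      (hθ.integrable_smul_gradient hh.1).integrableOn,
    integral_add (hθ.integrable_smul hg.2.1).integrableOn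
      (hθ.integrable_smul hh.2.1).integrableOn, hg.2.2 θ hθ, hh.2.2 θ hθ, neg_add]

theorem HasWeakGrad.const_mul (hg : HasWeakGrad Ω u g) (a : ℝ) :
    HasWeakGrad Ω (fun x => a * u x) (fun x => a • g x) := by
  refine ⟨fun x hx => (hg.1 x hx).smul a, fun x hx => (hg.2.1 x hx).smul a, fun θ hθ => ?_⟩
  have e1 : ∀ x, (a * u x) • ∇ θ x = a • (u x • ∇ θ x) := fun x => mul_smul _ _ _
  have e2 : ∀ x, θ x • a • g x = a • (θ x • g x) := fun x => smul_comm _ _ _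
  simp only [e1, e2, integral_smul, hg.2.2 θ hθ, smul_neg]

theorem enorm_integral_smul_le {E : Type*} [NormedAddCommGroup E] [NormedSpace ℝ E]
    {μ : Measure (Eucl n)} {f : Eucl n → ℝ} {k : Eucl n → E}
    (hf : AEStronglyMeasurable f μ) (hk : AEStronglyMeasurable k μ) :
    ‖∫ x, f x • k x ∂μ‖ₑ ≤ eLpNorm f 2 μ * eLpNorm k 2 μ := by
  refine (enorm_integral_le_lintegral_enorm _).trans ?_
  rw [← eLpNorm_one_eq_lintegral_enorm]
  exact eLpNorm_smul_le_mul_eLpNorm (p := 2) (q := 2) (r := 1) hk hf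

theorem ENNReal.eq_zero_of_forall_le_mul {a C : ℝ≥0∞} (hC : C ≠ ⊤)
    (h : ∀ ε : ℝ≥0∞, ε ≠ 0 → ε ≠ ⊤ → a ≤ ε * C) : a = 0 := by
  by_contra ha
  have h0 : Tendsto (fun ε : ℝ≥0∞ => ε * C) (𝓝[>] 0) (𝓝 (0 * C)) :=
    (ENNReal.Tendsto.mul_const tendsto_id (Or.inr hC)).mono_left nhdsWithin_le_nhds
  rw [zero_mul] at h0
  have h1 : ∀ᶠ ε : ℝ≥0∞ in 𝓝[>] 0, ε * C < a := h0.eventually_lt_const (pos_iff_ne_zero.2 ha)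
  have h2 : ∀ᶠ ε : ℝ≥0∞ in 𝓝[>] 0, ε < ⊤ :=
    (tendsto_id.mono_left nhdsWithin_le_nhds : Tendsto id (𝓝[>] (0 : ℝ≥0∞)) (𝓝 0)).eventually_lt_const
      ENNReal.zero_lt_top
  obtain ⟨ε, e1, e2, e3⟩ := (h1.and (h2.and self_mem_nhdsWithin)).exists
  exact (h ε (ne_of_gt e3) e2.ne).not_gt e1

theorem MeasureTheory.MemLp.locallyIntegrableOn_two {E : Type*} [NormedAddCommGroup E] {f : Eucl n → E}
    (hf : MemLp f 2 (volume.restrict Ω)) : LocallyIntegrableOn f Ω :=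
  (locallyIntegrableOn_of_locallyIntegrable_restrict (hf.locallyIntegrable (by norm_num)))

/-- For a fixed test function both sides of the defining identity are continuous in L² by
Cauchy–Schwarz, so the defect is at most ε(‖∇θ‖₂ + ‖θ‖₂) for every ε. -/
theorem HasWeakGrad.of_approx (hu : MemLp u 2 (volume.restrict Ω))
    (hg : MemLp g 2 (volume.restrict Ω))
    (H : ∀ ε : ℝ≥0∞, ε ≠ 0 → ε ≠ ⊤ → ∃ u' g', HasWeakGrad Ω u' g' ∧
      MemLp u' 2 (volume.restrict Ω) ∧ MemLp g' 2 (volume.restrict Ω) ∧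
      eLpNorm (fun x => u' x - u x) 2 (volume.restrict Ω) ≤ ε ∧
      eLpNorm (fun x => g' x - g x) 2 (volume.restrict Ω) ≤ ε) :
    HasWeakGrad Ω u g := by
  refine ⟨hu.locallyIntegrableOn_two, hg.locallyIntegrableOn_two, fun θ hθ => ?_⟩
  rw [← sub_eq_zero, ← enorm_eq_zero]
  refine ENNReal.eq_zero_of_forall_le_mul
    (C := eLpNorm (∇ θ) 2 (volume.restrict Ω) + eLpNorm θ 2 (volume.restrict Ω)) ?_ ?_
  · exact ENNReal.add_ne_top.2 ⟨(hθ.memLp_gradient 2 Ω).2.ne, (hθ.memLp 2 Ω).2.ne⟩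
  intro ε he he'
  obtain ⟨u', g', h1, h2, h3, h4, h5⟩ := H ε he he'
  have e1 : ∫ x in Ω, (u' x - u x) • ∇ θ x
      = (∫ x in Ω, u' x • ∇ θ x) - ∫ x in Ω, u x • ∇ θ x := by
    simp only [sub_smul]
    exact integral_sub (hθ.integrable_smul_gradient h1.1).integrableOn
      (hθ.integrable_smul_gradient hu.locallyIntegrableOn_two).integrableOn
  have e2 : ∫ x in Ω, θ x • (g' x - g x)
      = (∫ x in Ω, θ x • g' x) - ∫ x in Ω, θ x • g x := by
    simp only [smul_sub]
    exact integral_sub (hθ.integrable_smul h1.2.1).integrableOn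
      (hθ.integrable_smul hg.locallyIntegrableOn_two).integrableOn
  have e3 : (∫ x in Ω, u x • ∇ θ x) - -∫ x in Ω, θ x • g x
      = -((∫ x in Ω, (u' x - u x) • ∇ θ x) + ∫ x in Ω, θ x • (g' x - g x)) := by
    rw [e1, e2, h1.2.2 θ hθ]; abel
  rw [e3, enorm_neg, mul_add]
  refine (enorm_add_le _ _).trans (add_le_add ?_ ?_)
  · exact (enorm_integral_smul_le (h2.sub hu).1 (hθ.memLp_gradient 2 Ω).1).trans
      (mul_le_mul_left h4 _)
  · refine (enorm_integral_smul_le (hθ.memLp 2 Ω).1 (h3.sub hg).1).trans ?_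
    rw [mul_comm]
    exact mul_le_mul_left h5 _

/-- If θ is a test function on U, then θχ is one on Ω, because U ∩ tsupport χ ⊆ Ω; the product rule
for ∇(θχ) then yields the formula. The passage from Ω to another set U serves both for extension by
zero to the whole space (U = univ) and for localisation at the boundary, where U is the region on
one side of a graph. -/
theorem HasWeakGrad.indicator_mul_cutoff (hΩ : IsOpen Ω) (hg : HasWeakGrad Ω u g)
    (hui : IntegrableOn u Ω) (hgi : IntegrableOn g Ω) {χ : Eucl n → ℝ}
    (hχ : ContDiff ℝ (⊤ : ℕ∞) χ) (hχc : HasCompactSupport χ) (hχU : U ∩ tsupport χ ⊆ Ω) :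
    HasWeakGrad U (Ω.indicator fun x => χ x * u x)
      (Ω.indicator fun x => χ x • g x + u x • ∇ χ x) := by
  have hχ1 : ContDiff ℝ 1 χ := hχ.of_le (by exact_mod_cast le_top)
  have hb : ∃ C, ∀ x, ‖χ x‖ ≤ C := hχ.continuous.bounded_above_of_compact_support hχc
  have hb' : ∃ C, ∀ x, ‖∇ χ x‖ ≤ C :=
    (continuous_gradient hχ1).bounded_above_of_compact_support hχc.gradient
  obtain ⟨C, hC⟩ := hb
  obtain ⟨C', hC'⟩ := hb'
  have i1 : IntegrableOn (fun x => χ x * u x) Ω :=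
    hui.bdd_mul hχ.continuous.aestronglyMeasurable (ae_of_all _ hC)
  have i2 : IntegrableOn (fun x => χ x • g x) Ω :=
    hgi.bdd_smul C hχ.continuous.aestronglyMeasurable (ae_of_all _ hC)
  have i3 : IntegrableOn (fun x => u x • ∇ χ x) Ω :=
    hui.smul_bdd C' (continuous_gradient hχ1).aestronglyMeasurable (ae_of_all _ hC')
  refine ⟨((integrable_indicator_iff hΩ.measurableSet).2 i1).locallyIntegrable.locallyIntegrableOn U,
    ((integrable_indicator_iff hΩ.measurableSet).2
      (i2.add i3)).locallyIntegrable.locallyIntegrableOn U, fun θ hθ => ?_⟩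
  have ht : IsTestFun Ω (fun x => θ x * χ x) :=
    ⟨hθ.1.mul hχ, hθ.2.1.mul_right, fun x hx => hχU
      ⟨hθ.2.2 (tsupport_mul_subset_left hx), tsupport_mul_subset_right hx⟩⟩
  have e := hg.2.2 _ ht
  have key : ∀ F : Eucl n → Eucl n, (∀ x, x ∉ U → F x = 0) →
      ∫ x in U, Ω.indicator F x = ∫ x in Ω, F x := by
    intro F hF
    rw [setIntegral_eq_integral_of_forall_compl_eq_zero, integral_indicator hΩ.measurableSet]
    intro x hx
    by_cases hx' : x ∈ Ω
    · rw [indicator_of_mem hx', hF x hx]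
    · rw [indicator_of_notMem hx']
  have l1 : (fun x => Ω.indicator (fun x => χ x * u x) x • ∇ θ x)
      = Ω.indicator (fun x => (χ x * u x) • ∇ θ x) := by
    ext1 x; by_cases hx : x ∈ Ω <;> simp [hx]
  have l2 : (fun x => θ x • Ω.indicator (fun x => χ x • g x + u x • ∇ χ x) x)
      = Ω.indicator (fun x => θ x • (χ x • g x + u x • ∇ χ x)) := by
    ext1 x; by_cases hx : x ∈ Ω <;> simp [hx]
  rw [l1, l2, key _ (fun x hx => by simp [hθ.gradient_eq_zero hx]),
    key _ (fun x hx => by simp [hθ.eq_zero hx])]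
  have e1 : ∀ x, u x • ∇ (fun x => θ x * χ x) x
      = (χ x * u x) • ∇ θ x + θ x • u x • ∇ χ x := fun x => by
    rw [gradient_mul hθ.differentiable.differentiableAt
      (hχ1.differentiable (by simp)).differentiableAt, smul_add, smul_smul, smul_smul, smul_smul,
      add_comm, mul_comm (χ x), mul_comm (θ x)]
  obtain ⟨Cθ, hCθ⟩ := hθ.continuous.bounded_above_of_compact_support hθ.2.1
  obtain ⟨Cθ', hCθ'⟩ :=
    (continuous_gradient hθ.contDiff_one).bounded_above_of_compact_support hθ.2.1.gradient
  have j1 : IntegrableOn (fun x => (χ x * u x) • ∇ θ x) Ω :=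
    i1.smul_bdd Cθ' (continuous_gradient hθ.contDiff_one).aestronglyMeasurable (ae_of_all _ hCθ')
  have j2 : IntegrableOn (fun x => θ x • u x • ∇ χ x) Ω :=
    i3.bdd_smul Cθ hθ.continuous.aestronglyMeasurable (ae_of_all _ hCθ)
  have j3 : IntegrableOn (fun x => θ x • χ x • g x) Ω :=
    i2.bdd_smul Cθ hθ.continuous.aestronglyMeasurable (ae_of_all _ hCθ)
  simp only [e1, mul_smul (θ _)] at e
  simp only [smul_add]
  rw [integral_add j1 j2] at e
  rw [integral_add j3 j2, neg_add, ← e]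
  abel

/-- `(u, g)` is a limit in `L²(Ω) × L²(Ω, ℝⁿ)` of pairs `(θ, ∇ θ)` of test functions and
their gradients. -/
def H10Pair {n : ℕ} (Ω : Set (Eucl n)) (u : Eucl n → ℝ) (g : Eucl n → Eucl n) : Prop :=
  MemLp u 2 (volume.restrict Ω) ∧ MemLp g 2 (volume.restrict Ω) ∧
    ∀ ε : ℝ≥0∞, ε ≠ 0 → ∃ θ, IsTestFun Ω θ ∧
      eLpNorm (fun x => θ x - u x) 2 (volume.restrict Ω) ≤ ε ∧
      eLpNorm (fun x => ∇ θ x - g x) 2 (volume.restrict Ω) ≤ ε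

theorem IsTestFun.hasWeakGrad {θ : Eucl n → ℝ} (h : IsTestFun Ω θ) : HasWeakGrad Ω θ (∇ θ) := by
  refine ⟨(h.memLp 2 Ω).locallyIntegrableOn_two, (h.memLp_gradient 2 Ω).locallyIntegrableOn_two,
    fun η hη => ?_⟩
  rw [setIntegral_eq_integral_of_forall_compl_eq_zero (fun x hx => by simp [h.eq_zero hx]),
    setIntegral_eq_integral_of_forall_compl_eq_zero (fun x hx => by simp [hη.eq_zero hx])]
  have i0 : Integrable (fun x => η x * θ x) :=
    (h.continuous.mul hη.continuous |>.congr fun x => mul_comm _ _).integrable_of_hasCompactSupport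
      hη.2.1.mul_right
  have i1 : Integrable (fun x => θ x • ∇ η x) :=
    hη.integrable_smul_gradient (h.memLp 2 Ω).locallyIntegrableOn_two
  have i2 : Integrable (fun x => η x • ∇ θ x) :=
    hη.integrable_smul (h.memLp_gradient 2 Ω).locallyIntegrableOn_two
  ext i
  have hproj : ∀ z : Eucl n, (EuclideanSpace.proj (𝕜 := ℝ) i : Eucl n →L[ℝ] ℝ) z = z i :=
    fun _ => rfl
  have p1 : (∫ x, θ x • ∇ η x) i = ∫ x, θ x * fderiv ℝ η x (EuclideanSpace.single i 1) := by
    have := (EuclideanSpace.proj (𝕜 := ℝ) i : Eucl n →L[ℝ] ℝ).integral_comp_comm i1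
    simp only [hproj, PiLp.smul_apply, smul_eq_mul, gradient_apply] at this
    exact this.symm
  have p2 : (∫ x, η x • ∇ θ x) i = ∫ x, fderiv ℝ θ x (EuclideanSpace.single i 1) * η x := by
    have := (EuclideanSpace.proj (𝕜 := ℝ) i : Eucl n →L[ℝ] ℝ).integral_comp_comm i2
    simp only [hproj, PiLp.smul_apply, smul_eq_mul, gradient_apply] at this
    rw [← this]
    exact integral_congr_ae (ae_of_all _ fun x => mul_comm _ _)
  have j1 : Integrable (fun x => θ x * fderiv ℝ η x (EuclideanSpace.single i 1)) := by
    have := (EuclideanSpace.proj (𝕜 := ℝ) i : Eucl n →L[ℝ] ℝ).integrable_comp i1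
    simpa only [hproj, PiLp.smul_apply, smul_eq_mul, gradient_apply] using this
  have j2 : Integrable (fun x => fderiv ℝ θ x (EuclideanSpace.single i 1) * η x) := by
    have := (EuclideanSpace.proj (𝕜 := ℝ) i : Eucl n →L[ℝ] ℝ).integrable_comp i2
    simp only [hproj, PiLp.smul_apply, smul_eq_mul, gradient_apply] at this
    exact this.congr (ae_of_all _ fun x => mul_comm _ _)
  rw [PiLp.neg_apply, p1, p2]
  exact integral_mul_fderiv_eq_neg_fderiv_mul_of_integrable j2 j1
    (i0.congr (ae_of_all _ fun x => mul_comm _ _)) (fun x _ => h.differentiable x)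
    (fun x _ => hη.differentiable x)

namespace H10Pair

theorem hasWeakGrad (hp : H10Pair Ω u g) : HasWeakGrad Ω u g :=
  HasWeakGrad.of_approx hp.1 hp.2.1 fun ε he _ => by
    obtain ⟨θ, h1, h2, h3⟩ := hp.2.2 ε he
    exact ⟨θ, ∇ θ, h1.hasWeakGrad, h1.memLp 2 Ω, h1.memLp_gradient 2 Ω, h2, h3⟩

theorem weakGrad_ae (hΩ : IsOpen Ω) (hp : H10Pair Ω u g) :
    weakGrad Ω u =ᵐ[volume.restrict Ω] g := weakGrad_ae_eq hΩ hp.hasWeakGrad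

theorem congr (hp : H10Pair Ω u g) (h1 : u =ᵐ[volume.restrict Ω] v)
    (h2 : g =ᵐ[volume.restrict Ω] h) : H10Pair Ω v h := by
  refine ⟨hp.1.ae_eq h1, hp.2.1.ae_eq h2, fun ε he => ?_⟩
  obtain ⟨θ, a1, a2, a3⟩ := hp.2.2 ε he
  refine ⟨θ, a1, (eLpNorm_congr_ae ?_).trans_le a2, (eLpNorm_congr_ae ?_).trans_le a3⟩
  · filter_upwards [h1] with x hx; rw [hx]
  · filter_upwards [h2] with x hx; rw [hx]

theorem memH10 (hΩ : IsOpen Ω) (hp : H10Pair Ω u g) : MemH10 Ω u := by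
  have hw := hp.weakGrad_ae hΩ
  have hp' : H10Pair Ω u (weakGrad Ω u) := hp.congr (ae_eq_refl _) hw.symm
  refine ⟨⟨hp.1, ⟨g, hp.hasWeakGrad⟩, hp'.2.1⟩, ?_⟩
  obtain ⟨ε, _, hε, hlim⟩ := exists_seq_strictAnti_tendsto' (ENNReal.zero_lt_top)
  choose θ h1 h2 h3 using fun k => hp'.2.2 (ε k) (hε k).1.ne'
  exact ⟨θ, h1, tendsto_of_tendsto_of_tendsto_of_le_of_le tendsto_const_nhds hlim
    (fun _ => zero_le) h2, tendsto_of_tendsto_of_tendsto_of_le_of_le tendsto_const_nhds hlim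
    (fun _ => zero_le) h3⟩

theorem of_test {θ : Eucl n → ℝ} (h : IsTestFun Ω θ) : H10Pair Ω θ (∇ θ) :=
  ⟨h.memLp 2 Ω, h.memLp_gradient 2 Ω, fun ε _ => ⟨θ, h, by simp, by simp⟩⟩

theorem of_approx (hu : MemLp u 2 (volume.restrict Ω)) (hg : MemLp g 2 (volume.restrict Ω))
    (H : ∀ ε : ℝ≥0∞, ε ≠ 0 → ∃ u' g', H10Pair Ω u' g' ∧
      eLpNorm (fun x => u' x - u x) 2 (volume.restrict Ω) ≤ ε ∧
      eLpNorm (fun x => g' x - g x) 2 (volume.restrict Ω) ≤ ε) : H10Pair Ω u g := by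
  refine ⟨hu, hg, fun ε he => ?_⟩
  obtain ⟨u', g', h1, h2, h3⟩ := H (ε / 2) (by simpa using he)
  obtain ⟨θ, a1, a2, a3⟩ := h1.2.2 (ε / 2) (by simpa using he)
  refine ⟨θ, a1, ?_, ?_⟩
  · have : (fun x => θ x - u x) = (fun x => θ x - u' x) + fun x => u' x - u x := by
      ext1 x; simp
    rw [this]
    refine (eLpNorm_add_le ((a1.memLp 2 Ω).sub h1.1).1 (h1.1.sub hu).1 (by norm_num)).trans ?_
    exact (add_le_add a2 h2).trans (ENNReal.add_halves ε).le
  · have : (fun x => ∇ θ x - g x) = (fun x => ∇ θ x - g' x) + fun x => g' x - g x := by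
      ext1 x; simp
    rw [this]
    refine (eLpNorm_add_le ((a1.memLp_gradient 2 Ω).sub h1.2.1).1 (h1.2.1.sub hg).1
      (by norm_num)).trans ?_
    exact (add_le_add a3 h3).trans (ENNReal.add_halves ε).le

theorem of_tendsto {ι : Type*} {l : Filter ι} [l.NeBot] {w : ι → Eucl n → ℝ}
    {G : ι → Eucl n → Eucl n} (hu : MemLp u 2 (volume.restrict Ω))
    (hg : MemLp g 2 (volume.restrict Ω)) (H : ∀ᶠ i in l, H10Pair Ω (w i) (G i))
    (h1 : Tendsto (fun i => eLpNorm (fun x => w i x - u x) 2 (volume.restrict Ω)) l (𝓝 0))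
    (h2 : Tendsto (fun i => eLpNorm (fun x => G i x - g x) 2 (volume.restrict Ω)) l (𝓝 0)) :
    H10Pair Ω u g := by
  refine of_approx hu hg fun ε he => ?_
  obtain ⟨i, a, b, c⟩ := (H.and ((h1.eventually_le_const (pos_iff_ne_zero.2 he)).and
    (h2.eventually_le_const (pos_iff_ne_zero.2 he)))).exists
  exact ⟨w i, G i, a, b, c⟩

theorem add (hp : H10Pair Ω u g) (hq : H10Pair Ω v h) :
    H10Pair Ω (fun x => u x + v x) (fun x => g x + h x) := by
  refine ⟨hp.1.add hq.1, hp.2.1.add hq.2.1, fun ε he => ?_⟩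
  obtain ⟨θ, a1, a2, a3⟩ := hp.2.2 (ε / 2) (by simpa using he)
  obtain ⟨η, b1, b2, b3⟩ := hq.2.2 (ε / 2) (by simpa using he)
  refine ⟨_, a1.add b1, ?_, ?_⟩
  · have : (fun x => θ x + η x - (u x + v x)) = (fun x => θ x - u x) + fun x => η x - v x := by
      ext1 x; simp; ring
    rw [this]
    refine (eLpNorm_add_le ((a1.memLp 2 Ω).sub hp.1).1 ((b1.memLp 2 Ω).sub hq.1).1
      (by norm_num)).trans ?_
    exact (add_le_add a2 b2).trans (ENNReal.add_halves ε).le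
  · have : (fun x => ∇ (fun x => θ x + η x) x - (g x + h x))
        = (fun x => ∇ θ x - g x) + fun x => ∇ η x - h x := by
      ext1 x
      have : ∇ (fun x => θ x + η x) x = ∇ θ x + ∇ η x := by
        unfold gradient
        rw [← map_add, fderiv_fun_add a1.differentiable.differentiableAt
          b1.differentiable.differentiableAt]
      simp only [this, Pi.add_apply]; abel
    rw [this]
    refine (eLpNorm_add_le ((a1.memLp_gradient 2 Ω).sub hp.2.1).1
      ((b1.memLp_gradient 2 Ω).sub hq.2.1).1 (by norm_num)).trans ?_
    exact (add_le_add a3 b3).trans (ENNReal.add_halves ε).le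

theorem const_mul (hp : H10Pair Ω u g) (a : ℝ) :
    H10Pair Ω (fun x => a * u x) (fun x => a • g x) := by
  refine ⟨hp.1.const_mul a, hp.2.1.const_smul a, fun ε he => ?_⟩
  -- The +1 avoids a division by zero when a = 0.
  have hna : ‖a‖ₑ + 1 ≠ ⊤ := by simp
  obtain ⟨θ, a1, a2, a3⟩ := hp.2.2 (ε / (‖a‖ₑ + 1)) (ENNReal.div_ne_zero.2 ⟨he, hna⟩)
  have hle : ‖a‖ₑ * (ε / (‖a‖ₑ + 1)) ≤ ε :=
    (mul_le_mul_left le_self_add _).trans ENNReal.mul_div_le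
  refine ⟨_, a1.const_mul a, ?_, ?_⟩
  · have : (fun x => a * θ x - a * u x) = a • (fun x => θ x - u x) := by
      ext1 x; simp; ring
    rw [this, eLpNorm_const_smul]
    exact (mul_le_mul_right a2 _).trans hle
  · have : (fun x => ∇ (fun x => a * θ x) x - a • g x) = a • (fun x => ∇ θ x - g x) := by
      ext1 x
      have : ∇ (fun x => a * θ x) x = a • ∇ θ x := by
        unfold gradient
        rw [← map_smul, fderiv_const_mul a1.differentiable.differentiableAt]
      simp only [this, Pi.smul_apply, smul_sub]
    rw [this, eLpNorm_const_smul]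
    exact (mul_le_mul_right a3 _).trans hle

theorem sub (hp : H10Pair Ω u g) (hq : H10Pair Ω v h) :
    H10Pair Ω (fun x => u x - v x) (fun x => g x - h x) := by
  have := hp.add (hq.const_mul (-1))
  simpa [sub_eq_add_neg] using this

end H10Pair

theorem MemH10.pair (hu : MemH10 Ω u) : H10Pair Ω u (weakGrad Ω u) := by
  obtain ⟨⟨h1, h2, h3⟩, θ, a, b, c⟩ := hu
  exact H10Pair.of_tendsto h1 h3 (Eventually.of_forall fun k => H10Pair.of_test (a k)) b c

theorem MemH10.sub (hΩ : IsOpen Ω) (hu : MemH10 Ω u) (hv : MemH10 Ω v) :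
    MemH10 Ω (fun x => u x - v x) := (hu.pair.sub hv.pair).memH10 hΩ

end WeakGradient

/-! ### Averages over a probability measure, and composition with maps of bounded compression. -/

section AveragingAndComposition

variable {n : ℕ} {E : Type*} [NormedAddCommGroup E] [NormedSpace ℝ E]

/-- Minkowski's integral inequality for an average: |∫ F dν|ᵖ ≤ ∫ |F|ᵖ dν on a probability space,
then Tonelli. It serves for mollification (average over translations) and for Taylor's formula
(average over a segment). -/
theorem eLpNorm_integral_le_of_forall {X Z : Type*} [MeasurableSpace X] [MeasurableSpace Z]
    {μ : Measure X} {ν : Measure Z} [SFinite μ] [IsProbabilityMeasure ν] {F : X → Z → E}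
    (hF : AEStronglyMeasurable (Function.uncurry F) (μ.prod ν)) {p : ℝ≥0∞} (hp1 : 1 ≤ p)
    (hp : p ≠ ⊤) {η : ℝ≥0∞} (H : ∀ᵐ z ∂ν, eLpNorm (fun x => F x z) p μ ≤ η) :
    eLpNorm (fun x => ∫ z, F x z ∂ν) p μ ≤ η := by
  have hp0 : p ≠ 0 := (zero_lt_one.trans_le hp1).ne'
  have hpr : 0 < p.toReal := ENNReal.toReal_pos hp0 hp
  have hlp : ∀ {Y : Type _} [MeasurableSpace Y] (κ : Measure Y) (f : Y → E),
      eLpNorm f p κ ^ p.toReal = ∫⁻ y, ‖f y‖ₑ ^ p.toReal ∂κ := by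
    intro Y _ κ f
    rw [eLpNorm_eq_lintegral_rpow_enorm_toReal hp0 hp, ← ENNReal.rpow_mul,
      one_div_mul_cancel hpr.ne', ENNReal.rpow_one]
  have hlp' : ∀ (f : Z → E), eLpNorm f p ν ^ p.toReal = ∫⁻ y, ‖f y‖ₑ ^ p.toReal ∂ν := by
    intro f
    rw [eLpNorm_eq_lintegral_rpow_enorm_toReal hp0 hp, ← ENNReal.rpow_mul,
      one_div_mul_cancel hpr.ne', ENNReal.rpow_one]
  rw [← ENNReal.rpow_le_rpow_iff hpr, hlp]
  have hsec : ∀ᵐ x ∂μ, AEStronglyMeasurable (F x) ν := hF.prodMk_left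
  calc ∫⁻ x, ‖∫ z, F x z ∂ν‖ₑ ^ p.toReal ∂μ
      ≤ ∫⁻ x, ∫⁻ z, ‖F x z‖ₑ ^ p.toReal ∂ν ∂μ := by
        refine lintegral_mono_ae ?_
        filter_upwards [hsec] with x hx
        rw [← hlp' (F x)]
        refine ENNReal.rpow_le_rpow ?_ hpr.le
        refine (enorm_integral_le_lintegral_enorm _).trans ?_
        rw [← eLpNorm_one_eq_lintegral_enorm]
        exact eLpNorm_le_eLpNorm_of_exponent_le hp1 hx
    _ = ∫⁻ z, ∫⁻ x, ‖F x z‖ₑ ^ p.toReal ∂μ ∂ν :=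
        lintegral_lintegral_swap (hF.enorm.pow_const _)
    _ ≤ ∫⁻ _, η ^ p.toReal ∂ν := by
        refine lintegral_mono_ae ?_
        filter_upwards [H] with z hz
        rw [← hlp]
        exact ENNReal.rpow_le_rpow hz hpr.le
    _ = η ^ p.toReal := by simp

omit [NormedSpace ℝ E] in
-- Only a bound on the image measure is needed, so Φ may fail to be injective; the folding maps at
-- the boundary rely on this.
theorem eLpNorm_comp_le {α : Type*} [MeasurableSpace α] {μ : Measure α} {Φ : α → α} {C : ℝ≥0∞}
    (hΦ : Measurable Φ) (hC : μ.map Φ ≤ C • μ) {F : α → E} (hF : AEStronglyMeasurable F μ)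
    (p : ℝ≥0∞) :
    eLpNorm (fun x => F (Φ x)) p μ ≤ C ^ (1 / p).toReal * eLpNorm F p μ := by
  have hac : μ.map Φ ≪ μ := (Measure.absolutelyContinuous_of_le hC).trans
    Measure.smul_absolutelyContinuous
  have : eLpNorm (F ∘ Φ) p μ = eLpNorm F p (μ.map Φ) :=
    (eLpNorm_map_measure (hF.mono_ac hac) hΦ.aemeasurable).symm
  calc eLpNorm (fun x => F (Φ x)) p μ = eLpNorm F p (μ.map Φ) := this
    _ ≤ eLpNorm F p (C • μ) := eLpNorm_mono_measure _ hC
    _ ≤ _ := eLpNorm_smul_measure_le C F p μ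

omit [NormedSpace ℝ E] in
theorem aestronglyMeasurable_comp {α : Type*} [MeasurableSpace α] {μ : Measure α} {Φ : α → α}
    {C : ℝ≥0∞} (hΦ : Measurable Φ) (hC : μ.map Φ ≤ C • μ) {F : α → E}
    (hF : AEStronglyMeasurable F μ) : AEStronglyMeasurable (fun x => F (Φ x)) μ :=
  (hF.mono_ac ((Measure.absolutelyContinuous_of_le hC).trans
    Measure.smul_absolutelyContinuous)).comp_measurable hΦ

omit [NormedSpace ℝ E] in
theorem memLp_comp {α : Type*} [MeasurableSpace α] {μ : Measure α} {Φ : α → α}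
    {C : ℝ≥0∞} (hΦ : Measurable Φ) (hCt : C ≠ ⊤) (hC : μ.map Φ ≤ C • μ) {F : α → E} {p : ℝ≥0∞}
    (hF : MemLp F p μ) : MemLp (fun x => F (Φ x)) p μ :=
  ⟨aestronglyMeasurable_comp hΦ hC hF.1, (eLpNorm_comp_le hΦ hC hF.1 p).trans_lt
    (ENNReal.mul_lt_top (ENNReal.rpow_lt_top_of_nonneg ENNReal.toReal_nonneg hCt) hF.2)⟩

/-- Composition with near-identity maps is continuous in `L^p`. -/
theorem tendsto_eLpNorm_comp_sub {ι : Type*} {l : Filter ι} {Φ : ι → Eucl n → Eucl n} {C : ℝ≥0∞}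
    (hCt : C ≠ ⊤) (hΦ : ∀ᶠ i in l, Measurable (Φ i))
    (hC : ∀ᶠ i in l, (volume : Measure (Eucl n)).map (Φ i) ≤ C • volume)
    (hid : ∀ ε > 0, ∀ᶠ i in l, ∀ x, dist (Φ i x) x ≤ ε) {p : ℝ≥0∞} (hp1 : 1 ≤ p) (hp : p ≠ ⊤)
    {F : Eucl n → E} (hF : MemLp F p) :
    Tendsto (fun i => eLpNorm (fun x => F (Φ i x) - F x) p volume) l (𝓝 0) := by
  rw [ENNReal.tendsto_nhds_zero]
  intro ε hε
  set D : ℝ≥0∞ := C ^ (1 / p).toReal with hD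
  have hDt : D ≠ ⊤ := (ENNReal.rpow_lt_top_of_nonneg ENNReal.toReal_nonneg hCt).ne
  have hD1 : D + 1 ≠ ⊤ := by simp [hDt]
  -- Splitting F∘Φ − F = (F − g)∘Φ + (g∘Φ − g) − (F − g) with g continuous and compactly supported.
  -- Composition costs the factor D, hence the tolerance ε/2/(D + 1).
  obtain ⟨g, gc, gε, gcont, gm⟩ := hF.exists_hasCompactSupport_eLpNorm_sub_le hp
    (ε := ε / 2 / (D + 1)) (by
      refine ENNReal.div_ne_zero.2 ⟨?_, hD1⟩
      exact (ENNReal.div_pos hε.ne' (by norm_num)).ne')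
  -- Once Φ moves points by at most 1, g∘Φ − g vanishes off this compact set, so uniform smallness
  -- gives smallness in Lᵖ.
  set K := Metric.cthickening 1 (tsupport g) with hK
  have hKc : IsCompact K := gc.isCompact.cthickening
  have hKv : volume K ≠ ⊤ := hKc.measure_lt_top.ne
  have huc : UniformContinuous g := gc.uniformContinuous_of_continuous gcont
  set m : ℝ≥0∞ := volume K ^ p.toReal⁻¹ with hm
  have hmt : m ≠ ⊤ := (ENNReal.rpow_lt_top_of_nonneg (by positivity) hKv).ne
  obtain ⟨κ, κ0, hκ⟩ : ∃ κ : ℝ, 0 < κ ∧ m * ENNReal.ofReal κ ≤ ε / 2 := by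
    have h0 : Tendsto (fun κ : ℝ => m * ENNReal.ofReal κ) (𝓝[>] 0) (𝓝 (m * ENNReal.ofReal 0)) :=
      (ENNReal.Tendsto.const_mul (ENNReal.continuous_ofReal.tendsto 0)
        (Or.inr hmt)).mono_left nhdsWithin_le_nhds
    rw [ENNReal.ofReal_zero, mul_zero] at h0
    obtain ⟨κ, h1, h2⟩ := ((h0.eventually_le_const (u := ε / 2)
      (ENNReal.div_pos hε.ne' (by norm_num))).and self_mem_nhdsWithin).exists
    exact ⟨κ, h2, h1⟩
  obtain ⟨δ, δ0, hδ⟩ := Metric.uniformContinuous_iff.1 huc κ κ0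
  filter_upwards [hΦ, hC, hid (min (δ / 2) 1) (by positivity)] with i h1 h2 h3
  have hFg : AEStronglyMeasurable (F - g) volume := (hF.sub gm).1
  have hgΦ : AEStronglyMeasurable (fun x => g (Φ i x)) volume :=
    gcont.comp_aestronglyMeasurable h1.aestronglyMeasurable
  have e : (fun x => F (Φ i x) - F x) = (fun x => (F - g) (Φ i x)) +
      ((fun x => g (Φ i x) - g x) + fun x => -(F - g) x) := by
    ext1 x; simp
  rw [e]
  refine (eLpNorm_add_le (aestronglyMeasurable_comp h1 h2 hFg)
    ((hgΦ.sub gm.1).add hFg.neg) hp1).trans ?_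
  refine (add_le_add_right (eLpNorm_add_le (hgΦ.sub gm.1) hFg.neg hp1) _).trans ?_
  have a1 : eLpNorm (fun x => (F - g) (Φ i x)) p volume ≤ D * (ε / 2 / (D + 1)) :=
    (eLpNorm_comp_le h1 h2 hFg p).trans (mul_le_mul_right gε _)
  have a3 : eLpNorm (fun x => -(F - g) x) p volume ≤ ε / 2 / (D + 1) := by
    have : eLpNorm (fun x => -(F - g) x) p volume = eLpNorm (F - g) p volume := eLpNorm_neg _ _ _
    rw [this]; exact gε
  have a2 : eLpNorm (fun x => g (Φ i x) - g x) p volume ≤ ε / 2 := by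
    have hsup : ∀ x, x ∉ K → g (Φ i x) - g x = 0 := by
      intro x hx
      have b1 : x ∉ tsupport g := fun h => hx (Metric.self_subset_cthickening _ h)
      have b2 : Φ i x ∉ tsupport g := by
        intro h
        exact hx (Metric.mem_cthickening_of_dist_le x (Φ i x) 1 _ h
          ((dist_comm _ _).trans_le ((h3 x).trans (min_le_right _ _))))
      rw [image_eq_zero_of_notMem_tsupport b1, image_eq_zero_of_notMem_tsupport b2, sub_zero]
    have : (fun x => g (Φ i x) - g x) = K.indicator fun x => g (Φ i x) - g x := by
      ext1 x
      by_cases hx : x ∈ K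
      · rw [indicator_of_mem hx]
      · rw [indicator_of_notMem hx, hsup x hx]
    rw [this, eLpNorm_indicator_eq_eLpNorm_restrict hKc.measurableSet]
    refine (eLpNorm_le_of_ae_bound (C := κ) (ae_of_all _ fun x => ?_)).trans ?_
    · rw [← dist_eq_norm]
      exact (hδ ((h3 x).trans_lt ((min_le_left _ _).trans_lt (by linarith)))).le
    · rw [Measure.restrict_apply_univ]; exact hκ
  calc _ ≤ D * (ε / 2 / (D + 1)) + (ε / 2 + ε / 2 / (D + 1)) :=
        add_le_add a1 (add_le_add a2 a3)
    _ = (D + 1) * (ε / 2 / (D + 1)) + ε / 2 := by ring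
    _ ≤ ε / 2 + ε / 2 := by gcongr; exact ENNReal.mul_div_le
    _ = ε := ENNReal.add_halves ε

end AveragingAndComposition

/-! ### Mollification. -/

section Mollification

variable {n : ℕ} {E : Type*} [NormedAddCommGroup E] [NormedSpace ℝ E] {c : Eucl n}

open ContinuousLinearMap in
/-- Convolution with a normalized bump function. -/
noncomputable def mollify (φ : ContDiffBump c) (F : Eucl n → E) : Eucl n → E :=
  convolution (φ.normed volume) F (lsmul ℝ ℝ) volume

/-- The probability measure whose density is a normalized bump function. -/
noncomputable def bumpMeasure (φ : ContDiffBump c) : Measure (Eucl n) :=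
  volume.withDensity fun z => ENNReal.ofReal (φ.normed volume z)

instance (φ : ContDiffBump c) : IsProbabilityMeasure (bumpMeasure φ) := by
  constructor
  rw [bumpMeasure, withDensity_apply _ MeasurableSet.univ, Measure.restrict_univ,
    ← ofReal_integral_eq_lintegral_ofReal φ.integrable_normed
      (ae_of_all _ φ.nonneg_normed), φ.integral_normed, ENNReal.ofReal_one]

theorem ae_bumpMeasure (φ : ContDiffBump c) : ∀ᵐ z ∂(bumpMeasure φ), z ∈ Metric.ball c φ.rOut := by
  rw [bumpMeasure, ae_withDensity_iff
    (φ.continuous_normed.measurable.ennreal_ofReal)]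
  refine ae_of_all _ fun z hz => ?_
  rw [← φ.support_normed_eq (μ := volume)]
  intro h
  exact hz (by simp [h])

theorem mollify_apply (φ : ContDiffBump c) (F : Eucl n → E) (x : Eucl n) :
    mollify φ F x = ∫ z, φ.normed volume z • F (x - z) := rfl

/-- Seeing the convolution as an average of translates turns Lᵖ bounds into instances of
`eLpNorm_integral_le_of_forall`. -/
theorem mollify_eq_integral (φ : ContDiffBump c) (F : Eucl n → E) (x : Eucl n) :
    mollify φ F x = ∫ z, F (x - z) ∂(bumpMeasure φ) := by
  rw [bumpMeasure, integral_withDensity_eq_integral_toReal_smul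
    φ.continuous_normed.measurable.ennreal_ofReal (ae_of_all _ fun _ => ENNReal.ofReal_lt_top),
    mollify_apply]
  congr 1; ext1 z
  rw [ENNReal.toReal_ofReal (φ.nonneg_normed z)]

omit [NormedSpace ℝ E] in
theorem aestronglyMeasurable_sub_prod {ν : Measure (Eucl n)} [SFinite ν]
    {F : Eucl n → E} (hF : AEStronglyMeasurable F volume) :
    AEStronglyMeasurable (Function.uncurry fun x z => F (x - z)) ((volume : Measure (Eucl n)).prod ν) :=
  hF.comp_quasiMeasurePreserving
    (quasiMeasurePreserving_sub_of_right_invariant volume ν)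

theorem eLpNorm_mollify_le (φ : ContDiffBump c) {F : Eucl n → E} (hF : AEStronglyMeasurable F volume)
    {p : ℝ≥0∞} (hp1 : 1 ≤ p) (hp : p ≠ ⊤) :
    eLpNorm (mollify φ F) p volume ≤ eLpNorm F p volume := by
  have : mollify φ F = fun x => ∫ z, F (x - z) ∂(bumpMeasure φ) :=
    funext (mollify_eq_integral φ F)
  rw [this]
  refine eLpNorm_integral_le_of_forall (aestronglyMeasurable_sub_prod hF) hp1 hp
    (ae_of_all _ fun z => ?_)
  have := eLpNorm_comp_measurePreserving (p := p) hF (measurePreserving_sub_right volume z)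
  exact this.le

theorem contDiff_mollify [CompleteSpace E] (φ : ContDiffBump c) {F : Eucl n → E}
    (hF : LocallyIntegrable F volume) : ContDiff ℝ (⊤ : ℕ∞) (mollify φ F) :=
  φ.hasCompactSupport_normed.contDiff_convolution_left _ φ.contDiff_normed hF

theorem memLp_mollify [CompleteSpace E] (φ : ContDiffBump c) {F : Eucl n → E} {p : ℝ≥0∞}
    (hp1 : 1 ≤ p) (hp : p ≠ ⊤) (hF : MemLp F p volume) : MemLp (mollify φ F) p volume :=
  ⟨(contDiff_mollify φ (hF.locallyIntegrable hp1)).continuous.aestronglyMeasurable,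
    (eLpNorm_mollify_le φ hF.1 hp1 hp).trans_lt hF.2⟩

/-- The difference is an average of F(· − z) − F over z near 0, and translation is continuous in Lᵖ.
The bump centres may move with the index as long as they tend to 0: at the boundary the kernel is
pushed into the domain. -/
theorem tendsto_eLpNorm_mollify_sub [CompleteSpace E] {ι : Type*} {l : Filter ι} {c : ι → Eucl n}
    {φ : ∀ i, ContDiffBump (c i)} (hφ : Tendsto (fun i => ‖c i‖ + (φ i).rOut) l (𝓝 0))
    {F : Eucl n → E} {p : ℝ≥0∞} (hp1 : 1 ≤ p) (hp : p ≠ ⊤) (hF : MemLp F p volume) :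
    Tendsto (fun i => eLpNorm (fun x => mollify (φ i) F x - F x) p volume) l (𝓝 0) := by
  have ht : Tendsto (fun z : Eucl n => eLpNorm (fun x => F (x - z) - F x) p volume) (𝓝 0) (𝓝 0) := by
    refine tendsto_eLpNorm_comp_sub (C := 1) (by simp)
      (Eventually.of_forall fun z => measurable_sub_const z)
      (Eventually.of_forall fun z => ?_) (fun ε hε => ?_) hp1 hp hF
    · rw [(measurePreserving_sub_right volume z).map_eq, one_smul]
    · filter_upwards [Metric.closedBall_mem_nhds (0 : Eucl n) hε] with z hz x
      simpa [dist_eq_norm] using hz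
  rw [ENNReal.tendsto_nhds_zero] at ht ⊢
  intro ε hε
  obtain ⟨δ, δ0, hδ⟩ := Metric.eventually_nhds_iff.1 (ht ε hε)
  filter_upwards [hφ.eventually_lt_const δ0] with i hi
  have hloc := hF.locallyIntegrable hp1
  have e2 : (fun x => mollify (φ i) F x - F x)
      = fun x => ∫ z, (F (x - z) - F x) ∂(bumpMeasure (φ i)) := by
    ext1 x
    rw [integral_sub _ (integrable_const _), integral_const, mollify_eq_integral]
    · simp
    · rw [bumpMeasure, integrable_withDensity_iff_integrable_smul'
        (φ i).continuous_normed.measurable.ennreal_ofReal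
        (ae_of_all _ fun _ => ENNReal.ofReal_lt_top)]
      have := ((φ i).hasCompactSupport_normed (μ := volume)).convolutionExists_left
        (ContinuousLinearMap.lsmul ℝ ℝ : ℝ →L[ℝ] E →L[ℝ] E) (φ i).continuous_normed hloc x
      refine this.congr (ae_of_all _ fun z => ?_)
      simp [ENNReal.toReal_ofReal ((φ i).nonneg_normed z)]
  rw [e2]
  refine eLpNorm_integral_le_of_forall
    ((aestronglyMeasurable_sub_prod hF.1).sub ?_) hp1 hp ?_
  · exact hF.1.comp_fst
  · filter_upwards [ae_bumpMeasure (φ i)] with z hz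
    refine hδ ?_
    rw [dist_zero_right]
    rw [Metric.mem_ball, dist_eq_norm] at hz
    calc ‖z‖ = ‖c i + (z - c i)‖ := by congr 1; abel
      _ ≤ ‖c i‖ + ‖z - c i‖ := norm_add_le _ _
      _ < δ := by linarith

theorem mollify_eq_zero_of_notMem (φ : ContDiffBump c) {F : Eucl n → E} {K : Set (Eucl n)}
    (hK : ∀ x ∉ K, F x = 0) {x : Eucl n} (hx : x ∉ Metric.cthickening (‖c‖ + φ.rOut) K) :
    mollify φ F x = 0 := by
  rw [mollify_apply]
  refine integral_eq_zero_of_ae (ae_of_all _ fun z => ?_)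
  by_cases hz : z ∈ Metric.ball c φ.rOut
  · have : x - z ∉ K := by
      intro h
      refine hx (Metric.mem_cthickening_of_dist_le x (x - z) _ _ h ?_)
      rw [Metric.mem_ball, dist_eq_norm] at hz
      calc dist x (x - z) = ‖c + (z - c)‖ := by rw [dist_eq_norm]; congr 1; abel
        _ ≤ ‖c‖ + ‖z - c‖ := norm_add_le _ _
        _ ≤ ‖c‖ + φ.rOut := by linarith
    simp [hK _ this]
  · rw [← φ.support_normed_eq (μ := volume), Function.notMem_support] at hz
    simp [hz]

theorem tsupport_mollify_subset (φ : ContDiffBump c) {F : Eucl n → E} {K : Set (Eucl n)}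
    (hK : ∀ x ∉ K, F x = 0) : tsupport (mollify φ F) ⊆ Metric.cthickening (‖c‖ + φ.rOut) K :=
  closure_minimal (fun x hx => by
    by_contra h
    exact hx (mollify_eq_zero_of_notMem φ hK h)) Metric.isClosed_cthickening

theorem hasCompactSupport_mollify (φ : ContDiffBump c) {F : Eucl n → E}
    (hF : HasCompactSupport F) : HasCompactSupport (mollify φ F) :=
  HasCompactSupport.of_support_subset_isCompact (hF.isCompact.cthickening (r := ‖c‖ + φ.rOut))
    ((subset_tsupport _).trans
      (tsupport_mollify_subset φ fun _ h => image_eq_zero_of_notMem_tsupport h))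

/-- Mollification commutes with the weak gradient at points `x` for which `x - supp φ` lies in the
domain. -/
theorem gradient_mollify {U : Set (Eucl n)} {W : Eucl n → ℝ} {G : Eucl n → Eucl n}
    (hW : LocallyIntegrable W volume) (h : HasWeakGrad U W G)
    (φ : ContDiffBump c) {x : Eucl n} (hx : Metric.closedBall (x - c) φ.rOut ⊆ U) :
    ∇ (mollify φ W) x = mollify φ G x := by
  set ψ : Eucl n → ℝ := φ.normed volume with hψ
  have hψ1 : ContDiff ℝ 1 ψ := φ.contDiff_normed
  have hψc : HasCompactSupport ψ := φ.hasCompactSupport_normed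
  have hd := hψc.hasFDerivAt_convolution_left (ContinuousLinearMap.lsmul ℝ ℝ : ℝ →L[ℝ] ℝ →L[ℝ] ℝ)
    hψ1 hW x
  -- The reflected kernel at x is supported in the closed ball of `hx`, so it is an admissible test
  -- function on U; the sign from the reflection cancels the sign in the definition of the weak
  -- gradient.
  set θ : Eucl n → ℝ := fun z => ψ (x - z) with hθ
  have hθψ : ∀ z, ∇ θ z = -∇ ψ (x - z) := by
    intro z
    unfold gradient
    rw [← map_neg]
    congr 1
    have h1 := ((hψ1.differentiable (by simp)) (x - z)).hasFDerivAt
    have h2 := h1.comp z ((hasFDerivAt_id z).const_sub x)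
    rw [show fderiv ℝ θ z = _ from h2.fderiv]
    ext v; simp
  have hθs : Function.support θ ⊆ Metric.closedBall (x - c) φ.rOut := by
    intro z hz
    have : x - z ∈ Metric.ball c φ.rOut := by
      rw [← φ.support_normed_eq (μ := volume)]; exact hz
    rw [Metric.mem_ball, dist_eq_norm] at this
    rw [Metric.mem_closedBall, dist_eq_norm, ← norm_neg]
    have e : -(z - (x - c)) = x - z - c := by abel
    rw [e]; exact this.le
  have hθt : tsupport θ ⊆ Metric.closedBall (x - c) φ.rOut :=
    closure_minimal hθs Metric.isClosed_closedBall
  have hθT : IsTestFun U θ := by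
    refine ⟨φ.contDiff_normed.comp (contDiff_const.sub contDiff_id), ?_, hθt.trans hx⟩
    exact HasCompactSupport.of_support_subset_isCompact (isCompact_closedBall _ _) hθs
  have hw := h.2.2 θ hθT
  have e1 : ∫ z in U, W z • ∇ θ z = -∫ z, W z • ∇ ψ (x - z) := by
    rw [setIntegral_eq_integral_of_forall_compl_eq_zero
      (fun z hz => by simp [hθT.gradient_eq_zero hz])]
    simp only [hθψ, smul_neg, integral_neg]
  have e2 : ∫ z in U, θ z • G z = ∫ z, ψ (x - z) • G z :=
    setIntegral_eq_integral_of_forall_compl_eq_zero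
      (fun z hz => by simp [hθT.eq_zero hz])
  rw [e1, e2, neg_inj] at hw
  have e3 : mollify φ G x = ∫ z, W z • ∇ ψ (x - z) := by
    rw [hw, mollify_apply, ← integral_sub_left_eq_self _ volume x]
    congr 1; ext1 z; simp [hψ]
  have i1 : Integrable (fun z => W (x - z) • ∇ ψ z) := by
    have := ((hθT.integrable_smul_gradient h.1).comp_sub_left x).neg
    refine this.congr (ae_of_all _ fun z => ?_)
    simp [hθψ]
  have e4 : ∫ z, W z • ∇ ψ (x - z) = ∫ z, W (x - z) • ∇ ψ z := by
    rw [← integral_sub_left_eq_self _ volume x]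
    congr 1; ext1 z; simp
  rw [e3, e4]
  refine ext_inner_right ℝ fun v => ?_
  rw [inner_gradient, mollify, hd.fderiv]
  rw [real_inner_comm, ← integral_inner i1]
  have hce := (hψc.fderiv (𝕜 := ℝ)).convolutionExists_left
    ((ContinuousLinearMap.lsmul ℝ ℝ : ℝ →L[ℝ] ℝ →L[ℝ] ℝ).precompL (Eucl n))
    (hψ1.continuous_fderiv one_ne_zero) hW x
  rw [convolution, ContinuousLinearMap.integral_apply hce]
  congr 1; ext1 z
  rw [inner_smul_right, real_inner_comm, inner_gradient]
  simp [mul_comm]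

end Mollification

/-! ### Lipschitz functions and bi-Lipschitz changes of variables. -/

section Lipschitz

variable {n : ℕ} {Ω : Set (Eucl n)} {u : Eucl n → ℝ} {g : Eucl n → Eucl n}

/-- Lipschitz maps enlarge n-dimensional Hausdorff measure by at most Kⁿ, and by uniqueness of Haar
measure that measure is a positive multiple of Lebesgue measure. -/
theorem LipschitzWith.volume_image_le {K : NNReal} {S : Eucl n → Eucl n} (hS : LipschitzWith K S)
    (A : Set (Eucl n)) : volume (S '' A) ≤ (K : ℝ≥0∞) ^ n * volume A := by
  have h1 := hS.hausdorffMeasure_image_le (d := n) (by positivity) A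
  set κ := Measure.addHaarScalarFactor (Measure.hausdorffMeasure n) (volume : Measure (Eucl n))
  have hκ : (κ : ℝ≥0∞) ≠ 0 := by
    have := Measure.addHaarScalarFactor_pos_of_isAddHaarMeasure
      (Measure.hausdorffMeasure n : Measure (Eucl n)) volume
    exact_mod_cast this.ne'
  have h3 : (Measure.hausdorffMeasure n : Measure (Eucl n)) = κ • (volume : Measure (Eucl n)) :=
    Measure.isAddLeftInvariant_eq_smul _ _
  rw [h3] at h1
  simp only [Measure.smul_apply, ENNReal.smul_def, smul_eq_mul, ENNReal.rpow_natCast] at h1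
  rw [mul_left_comm] at h1
  exact (ENNReal.mul_le_mul_iff_right hκ ENNReal.coe_ne_top).1 h1

/-- T⁻¹(A) ⊆ S(A), so the compression caused by T is controlled by the Lipschitz constant of its
inverse. -/
theorem map_volume_le_of_leftInverse {K : NNReal} {T S : Eucl n → Eucl n} (hS : LipschitzWith K S)
    (hT : Measurable T) (h : Function.LeftInverse S T) :
    (volume : Measure (Eucl n)).map T ≤ ((K : ℝ≥0∞) ^ n) • volume := by
  refine Measure.le_iff.2 fun A hA => ?_
  rw [Measure.map_apply hT hA, Measure.smul_apply, smul_eq_mul]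
  refine le_trans (measure_mono ?_) (hS.volume_image_le A)
  intro x hx
  exact ⟨T x, hx, h x⟩

/-- The bump function of radius `r` centred at `c`. -/
noncomputable def bumpAt (c : Eucl n) {r : ℝ} (hr : 0 < r) : ContDiffBump c :=
  ⟨r / 2, r, half_pos hr, half_lt_self hr⟩

/-- The standard sequence of mollifiers. -/
noncomputable def stdBump (n k : ℕ) : ContDiffBump (0 : Eucl n) :=
  bumpAt 0 (Nat.one_div_pos_of_nat (n := k))

theorem tendsto_stdBump (n : ℕ) :
    Tendsto (fun k => ‖(0 : Eucl n)‖ + (stdBump n k).rOut) atTop (𝓝 0) := by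
  simp only [norm_zero, zero_add]
  exact tendsto_one_div_add_atTop_nhds_zero_nat

theorem measurable_gradient (h : Eucl n → ℝ) : Measurable (∇ h) :=
  (InnerProductSpace.toDual ℝ (Eucl n)).symm.continuous.measurable.comp (measurable_fderiv ℝ h)

theorem LipschitzWith.norm_gradient_le {K : NNReal} {h : Eucl n → ℝ} (hh : LipschitzWith K h)
    (x : Eucl n) : ‖∇ h x‖ ≤ K := by
  rw [norm_gradient]; exact norm_fderiv_le_of_lipschitz ℝ hh

theorem LipschitzWith.locallyIntegrable_gradient {K : NNReal} {h : Eucl n → ℝ}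
    (hh : LipschitzWith K h) : LocallyIntegrable (∇ h) volume := by
  intro x
  refine ⟨Metric.ball x 1, Metric.ball_mem_nhds x one_pos, ?_⟩
  exact Measure.integrableOn_of_bounded (M := K) measure_ball_lt_top.ne
    (measurable_gradient h).aestronglyMeasurable (ae_of_all _ hh.norm_gradient_le)

/-- The classical gradient of a Lipschitz function is its weak gradient. -/
theorem LipschitzWith.hasWeakGrad {K : NNReal} {h : Eucl n → ℝ} (hh : LipschitzWith K h)
    (Ω : Set (Eucl n)) : HasWeakGrad Ω h (∇ h) := by
  refine ⟨hh.continuous.locallyIntegrable.locallyIntegrableOn Ω,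
    hh.locallyIntegrable_gradient.locallyIntegrableOn Ω, fun θ hθ => ?_⟩
  rw [setIntegral_eq_integral_of_forall_compl_eq_zero
      (fun x hx => by simp [hθ.gradient_eq_zero hx]),
    setIntegral_eq_integral_of_forall_compl_eq_zero (fun x hx => by simp [hθ.eq_zero hx])]
  have i1 : Integrable (fun x => h x • ∇ θ x) := hθ.integrable_smul_gradient
    (hh.continuous.locallyIntegrable.locallyIntegrableOn Ω)
  have i2 : Integrable (fun x => θ x • ∇ h x) := hθ.integrable_smul
    (hh.locallyIntegrable_gradient.locallyIntegrableOn Ω)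
  obtain ⟨D, hD⟩ := hθ.contDiff_one.lipschitzWith_of_hasCompactSupport hθ.2.1 one_ne_zero
  refine ext_inner_right ℝ fun v => ?_
  -- Integration by parts for Lipschitz functions along lines; Rademacher's theorem identifies line
  -- derivatives with the classical gradient almost everywhere.
  have key := hh.integral_lineDeriv_mul_eq (μ := volume) hD hθ.2.1 v
  rw [inner_neg_left, real_inner_comm, ← integral_inner i1, real_inner_comm, ← integral_inner i2]
  have e1 : ∫ x, inner ℝ v (θ x • ∇ h x) = ∫ x, lineDeriv ℝ h x v * θ x := by
    refine integral_congr_ae ?_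
    filter_upwards [hh.ae_differentiableAt] with x hx
    rw [inner_smul_right, real_inner_comm, inner_gradient, hx.lineDeriv_eq_fderiv, mul_comm]
  rw [e1, key, ← integral_neg]
  congr 1; ext1 x
  rw [inner_smul_right, real_inner_comm, inner_gradient,
    (hθ.differentiable x).lineDeriv_eq_fderiv, map_neg]
  ring

/-- Lipschitz functions with compact support in `Ω` belong to `H^1_0(Ω)`. -/
theorem LipschitzWith.h10Pair {K : NNReal} {h : Eucl n → ℝ} (hh : LipschitzWith K h)
    (hΩ : IsOpen Ω) (hc : HasCompactSupport h) (hs : tsupport h ⊆ Ω) : H10Pair Ω h (∇ h) := by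
  have m1 : MemLp h 2 volume := hh.continuous.memLp_of_hasCompactSupport hc
  have m2 : MemLp (∇ h) 2 volume := hc.gradient.memLp_of_bound
    (measurable_gradient h).aestronglyMeasurable K (ae_of_all _ hh.norm_gradient_le)
  have hw : HasWeakGrad univ h (∇ h) := hh.hasWeakGrad univ
  have hloc := hh.continuous.locallyIntegrable (μ := (volume : Measure (Eucl n)))
  -- Mollifications are smooth, supported in Ω once the kernel is fine enough, and their gradients
  -- are the mollified gradients; so they approximate h in H¹ by test functions.
  have hg : ∀ k x, ∇ (mollify (stdBump n k) h) x = mollify (stdBump n k) (∇ h) x :=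
    fun k x => gradient_mollify hloc hw _ (subset_univ _)
  obtain ⟨δ, δ0, hδ⟩ := hc.isCompact.exists_cthickening_subset_open hΩ hs
  have htest : ∀ᶠ k in atTop, IsTestFun Ω (mollify (stdBump n k) h) := by
    filter_upwards [(tendsto_stdBump n).eventually_lt_const δ0] with k hk
    exact ⟨contDiff_mollify _ hloc, hasCompactSupport_mollify _ hc,
      (tsupport_mollify_subset _ fun _ h => image_eq_zero_of_notMem_tsupport h).trans
        ((Metric.cthickening_mono hk.le _).trans hδ)⟩
  have t1 := tendsto_eLpNorm_mollify_sub (tendsto_stdBump n) one_le_two (by simp) m1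
  have t2 := tendsto_eLpNorm_mollify_sub (tendsto_stdBump n) one_le_two (by simp) m2
  refine H10Pair.of_tendsto (l := atTop) (m1.restrict Ω) (m2.restrict Ω)
    (htest.mono fun k hk => H10Pair.of_test hk) ?_ ?_
  · exact tendsto_of_tendsto_of_tendsto_of_le_of_le tendsto_const_nhds t1 (fun _ => zero_le)
      fun k => eLpNorm_mono_measure _ Measure.restrict_le_self
  · simp only [hg]
    exact tendsto_of_tendsto_of_tendsto_of_le_of_le tendsto_const_nhds t2 (fun _ => zero_le)
      fun k => eLpNorm_mono_measure _ Measure.restrict_le_self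

/-- A bi-Lipschitz bijection of the space, with inverse `S`, that maps `Ω` onto itself. -/
structure IsBiLip (Ω : Set (Eucl n)) (K : NNReal) (T S : Eucl n → Eucl n) : Prop where
  lip : LipschitzWith K T
  lip_inv : LipschitzWith K S
  left_inv : Function.LeftInverse S T
  right_inv : Function.RightInverse S T
  mem_iff : ∀ x, T x ∈ Ω ↔ x ∈ Ω

namespace IsBiLip

variable {K : NNReal} {T S : Eucl n → Eucl n}

theorem symm (h : IsBiLip Ω K T S) : IsBiLip Ω K S T :=
  ⟨h.lip_inv, h.lip, h.right_inv, h.left_inv, fun x => by rw [← h.mem_iff, h.right_inv]⟩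

theorem measurable (h : IsBiLip Ω K T S) : Measurable T := h.lip.continuous.measurable

theorem map_le (h : IsBiLip Ω K T S) :
    (volume : Measure (Eucl n)).map T ≤ ((K : ℝ≥0∞) ^ n) • volume :=
  map_volume_le_of_leftInverse h.lip_inv h.measurable h.left_inv

theorem image_eq (h : IsBiLip Ω K T S) : T '' Ω = Ω := by
  ext x
  constructor
  · rintro ⟨z, hz, rfl⟩; exact (h.mem_iff z).2 hz
  · intro hx; exact ⟨S x, (h.symm.mem_iff x).2 hx, h.right_inv x⟩

theorem map_restrict_le (h : IsBiLip Ω K T S) (hΩ : MeasurableSet Ω) :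
    (volume.restrict Ω).map T ≤ ((K : ℝ≥0∞) ^ n) • volume.restrict Ω := by
  have e : T ⁻¹' Ω = Ω := by ext x; exact h.mem_iff x
  have e1 : (volume.restrict Ω).map T = (volume.map T).restrict Ω := by
    rw [Measure.restrict_map h.measurable hΩ, e]
  rw [e1, ← Measure.restrict_smul]
  exact Measure.restrict_mono subset_rfl h.map_le

theorem memLp_comp (h : IsBiLip Ω K T S) (hΩ : MeasurableSet Ω) {E : Type*}
    [NormedAddCommGroup E] {F : Eucl n → E} {p : ℝ≥0∞} (hF : MemLp F p (volume.restrict Ω)) :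
    MemLp (fun x => F (T x)) p (volume.restrict Ω) :=
  _root_.memLp_comp h.measurable (by finiteness) (h.map_restrict_le hΩ) hF

theorem eLpNorm_comp_le (h : IsBiLip Ω K T S) (hΩ : MeasurableSet Ω) {E : Type*}
    [NormedAddCommGroup E] {F : Eucl n → E} {p : ℝ≥0∞}
    (hF : AEStronglyMeasurable F (volume.restrict Ω)) :
    eLpNorm (fun x => F (T x)) p (volume.restrict Ω)
      ≤ ((K : ℝ≥0∞) ^ n) ^ (1 / p).toReal * eLpNorm F p (volume.restrict Ω) :=
  _root_.eLpNorm_comp_le h.measurable (h.map_restrict_le hΩ) hF p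

/-- Change of variables. -/
theorem setIntegral_comp (h : IsBiLip Ω K T S) (hΩ : MeasurableSet Ω) (F : Eucl n → ℝ) :
    ∫ x in Ω, |(fderiv ℝ T x).det| * F (T x) = ∫ x in Ω, F x := by
  -- The change-of-variables formula is applied on the points of differentiability. By Rademacher
  -- the rest is null, and so is its image, T being Lipschitz.
  set s := Ω ∩ {x | DifferentiableAt ℝ T x} with hs
  have hsm : MeasurableSet s := hΩ.inter (measurableSet_of_differentiableAt ℝ T)
  have hnull : volume (Ω \ s) = 0 := by
    refine measure_mono_null (t := {x | ¬ DifferentiableAt ℝ T x}) ?_ h.lip.ae_differentiableAt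
    intro x hx hd
    exact hx.2 ⟨hx.1, hd⟩
  have key := integral_image_eq_integral_abs_det_fderiv_smul volume hsm
    (f' := fderiv ℝ T) (fun x hx => hx.2.hasFDerivAt.hasFDerivWithinAt)
    h.left_inv.injective.injOn F
  have e1 : ∫ x in Ω, F x = ∫ x in T '' s, F x := by
    refine setIntegral_congr_set ?_
    have hsub : T '' s ⊆ Ω := by rintro _ ⟨x, hx, rfl⟩; exact (h.mem_iff x).2 hx.1
    refine (ae_eq_set.2 ⟨?_, ?_⟩)
    · refine measure_mono_null (t := T '' (Ω \ s)) ?_ ?_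
      · intro x hx
        refine ⟨S x, ⟨(h.symm.mem_iff x).2 hx.1, fun hx' => hx.2 ⟨S x, hx', h.right_inv x⟩⟩,
          h.right_inv x⟩
      · have := h.lip.volume_image_le (Ω \ s)
        rw [hnull, mul_zero] at this
        exact le_antisymm this zero_le
    · rw [sdiff_eq_empty.2 hsub, measure_empty]
  have e2 : ∫ x in Ω, |(fderiv ℝ T x).det| * F (T x) = ∫ x in s, |(fderiv ℝ T x).det| * F (T x) := by
    refine setIntegral_congr_set (ae_eq_set.2 ⟨hnull, ?_⟩)
    rw [sdiff_eq_empty.2 inter_subset_left, measure_empty]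
  rw [e1, e2, key]
  simp only [smul_eq_mul]

theorem aestronglyMeasurable_adjoint_apply {μ : Measure (Eucl n)} {G : Eucl n → Eucl n}
    (hG : AEStronglyMeasurable G μ) :
    AEStronglyMeasurable (fun x => ContinuousLinearMap.adjoint (fderiv ℝ T x) (G x)) μ := by
  have h1 : AEStronglyMeasurable (fun x => ContinuousLinearMap.adjoint (fderiv ℝ T x)) μ :=
    (ContinuousLinearMap.adjoint (𝕜 := ℝ) (E := Eucl n) (F := Eucl n)).continuous.comp_aestronglyMeasurable
      (measurable_fderiv ℝ T).aestronglyMeasurable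
  exact isBoundedBilinearMap_apply.continuous.comp_aestronglyMeasurable (h1.prodMk hG)

/-- Chain rule for the composition of an `H^1_0` function with a bi-Lipschitz map. -/
theorem h10Pair_comp (h : IsBiLip Ω K T S) (hΩ : IsOpen Ω) (hu : H10Pair Ω u g) :
    H10Pair Ω (fun x => u (T x))
      (fun x => ContinuousLinearMap.adjoint (fderiv ℝ T x) (g (T x))) := by
  have hnorm : ∀ x (v : Eucl n), ‖ContinuousLinearMap.adjoint (fderiv ℝ T x) v‖ ≤ K * ‖v‖ := by
    intro x v
    refine (ContinuousLinearMap.le_opNorm _ v).trans ?_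
    gcongr
    rw [LinearIsometryEquiv.norm_map]
    exact norm_fderiv_le_of_lipschitz ℝ h.lip
  have hadj : ∀ {G : Eucl n → Eucl n}, MemLp G 2 (volume.restrict Ω) →
      MemLp (fun x => ContinuousLinearMap.adjoint (fderiv ℝ T x) (G x)) 2 (volume.restrict Ω) :=
    fun hG => hG.of_le_mul (aestronglyMeasurable_adjoint_apply hG.1)
      (ae_of_all _ fun x => hnorm x _)
  set D : ℝ≥0∞ := ((K : ℝ≥0∞) ^ n) ^ (1 / (2 : ℝ≥0∞)).toReal with hD
  have hDt : D ≠ ⊤ := by rw [hD]; exact (ENNReal.rpow_lt_top_of_nonneg (by positivity) (by finiteness)).ne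
  have hDK : D * (K + 1) + 1 ≠ ⊤ := by finiteness
  refine H10Pair.of_approx (h.memLp_comp hΩ.measurableSet hu.1)
    (hadj (h.memLp_comp hΩ.measurableSet hu.2.1)) fun ε he => ?_
  have hle : D * (K + 1) * (ε / (D * (K + 1) + 1)) ≤ ε :=
    (mul_le_mul_left le_self_add _).trans ENNReal.mul_div_le
  obtain ⟨θ, a1, a2, a3⟩ := hu.2.2 (ε / (D * (K + 1) + 1)) (ENNReal.div_ne_zero.2 ⟨he, hDK⟩)
  obtain ⟨C, hC⟩ := a1.contDiff_one.lipschitzWith_of_hasCompactSupport a1.2.1 one_ne_zero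
  -- θ∘T is not smooth, but it is Lipschitz with compact support in Ω, which suffices for H¹₀; its
  -- chain rule, valid almost everywhere, then passes to the limit.
  have hlip : LipschitzWith (C * K) (fun x => θ (T x)) := hC.comp h.lip
  have hsupp : Function.support (fun x => θ (T x)) ⊆ S '' (tsupport θ) := by
    intro x hx
    exact ⟨T x, subset_tsupport θ hx, h.left_inv x⟩
  have hcomp : IsCompact (S '' tsupport θ) := a1.2.1.isCompact.image h.lip_inv.continuous
  have hcs : HasCompactSupport (fun x => θ (T x)) :=
    HasCompactSupport.of_support_subset_isCompact hcomp hsupp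
  have hts : tsupport (fun x => θ (T x)) ⊆ Ω := by
    refine (closure_minimal hsupp hcomp.isClosed).trans ?_
    rintro _ ⟨x, hx, rfl⟩
    exact (h.symm.mem_iff x).2 (a1.2.2 hx)
  refine ⟨fun x => θ (T x), ∇ (fun x => θ (T x)), hlip.h10Pair hΩ hcs hts, ?_, ?_⟩
  · refine (h.eLpNorm_comp_le hΩ.measurableSet ((a1.memLp 2 Ω).sub hu.1).1).trans ?_
    refine le_trans ?_ hle
    refine mul_le_mul' ?_ a2
    rw [mul_add, mul_one]; exact le_add_self
  · have e : (fun x => ∇ (fun x => θ (T x)) x - ContinuousLinearMap.adjoint (fderiv ℝ T x) (g (T x)))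
        =ᵐ[volume.restrict Ω]
        fun x => ContinuousLinearMap.adjoint (fderiv ℝ T x) (∇ θ (T x) - g (T x)) := by
      filter_upwards [ae_restrict_of_ae h.lip.ae_differentiableAt] with x hx
      rw [map_sub]
      congr 1
      refine ext_inner_right ℝ fun v => ?_
      rw [inner_gradient, ContinuousLinearMap.adjoint_inner_left, inner_gradient]
      have := ((a1.differentiable (T x)).hasFDerivAt.comp x hx.hasFDerivAt).fderiv
      rw [show fderiv ℝ (fun x => θ (T x)) x = _ from this]
      rfl
    rw [eLpNorm_congr_ae e]
    have b1 : eLpNorm (fun x => ContinuousLinearMap.adjoint (fderiv ℝ T x) (∇ θ (T x) - g (T x))) 2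
        (volume.restrict Ω) ≤ K * eLpNorm (fun x => ∇ θ (T x) - g (T x)) 2 (volume.restrict Ω) := by
      have := eLpNorm_le_nnreal_smul_eLpNorm_of_ae_le_mul (c := K) (μ := volume.restrict Ω)
        (f := fun x => ContinuousLinearMap.adjoint (fderiv ℝ T x) (∇ θ (T x) - g (T x)))
        (g := fun x => ∇ θ (T x) - g (T x)) (ae_of_all _ fun x => by
          have := hnorm x (∇ θ (T x) - g (T x))
          exact_mod_cast this) 2
      simpa [ENNReal.smul_def] using this
    have b2 := h.eLpNorm_comp_le (p := 2) hΩ.measurableSet ((a1.memLp_gradient 2 Ω).sub hu.2.1).1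
    refine (b1.trans (mul_le_mul_right (b2.trans (mul_le_mul_right a3 _)) _)).trans (le_trans ?_ hle)
    rw [← mul_assoc]
    refine mul_le_mul_left ?_ _
    rw [mul_comm]
    exact mul_le_mul_right le_self_add _

end IsBiLip

end Lipschitz

/-! ### The maps T_t = id + tV for small t. -/

section Perturbation

variable {n : ℕ} {Ω : Set (Eucl n)}

/-- First order expansion of the determinant at the identity, uniform on bounded sets. -/
theorem Matrix.abs_det_one_add_smul_sub_le (n : ℕ) (K : ℝ) {ε : ℝ} (hε : 0 < ε) :
    ∃ δ > 0, ∀ t : ℝ, |t| ≤ δ → ∀ M : Matrix (Fin n) (Fin n) ℝ, (∀ i j, |M i j| ≤ K) →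
      |(1 + t • M).det - 1 - t * M.trace| ≤ ε * |t| := by
  let F : (Fin n → Fin n → ℝ) → ℝ := fun A => (Matrix.of A).det
  have hF : Differentiable ℝ F := by
    have : F = fun A => ∑ σ : Equiv.Perm (Fin n), Equiv.Perm.sign σ • ∏ i, A (σ i) i := by
      ext A; exact Matrix.det_apply _
    rw [this]
    fun_prop
  let I : Fin n → Fin n → ℝ := fun i j => (1 : Matrix (Fin n) (Fin n) ℝ) i j
  have hF1 := (hF I).hasFDerivAt
  -- The expansion det(1 + tN) = 1 + t tr N + t² Q(t) on lines identifies all directional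
  -- derivatives, hence the Fréchet derivative.
  have hL : ∀ N : Fin n → Fin n → ℝ, fderiv ℝ F I N = (Matrix.of N).trace := by
    intro N
    have h1 : HasDerivAt (fun t : ℝ => F (I + t • N)) (fderiv ℝ F I N) 0 := by
      have hl : HasDerivAt (fun t : ℝ => I + t • N) N 0 := by
        simpa using ((hasDerivAt_id (0 : ℝ)).smul_const N).const_add I
      have hF1' : HasFDerivAt F (fderiv ℝ F I) (I + (0 : ℝ) • N) := by simpa using hF1
      exact hF1'.comp_hasDerivAt (0 : ℝ) hl
    have e : (fun t : ℝ => F (I + t • N)) = fun t => 1 + (Matrix.of N).trace * t +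
        (Matrix.det (1 + (Polynomial.X : Polynomial ℝ) • (Matrix.of N).map Polynomial.C)).divX.divX.eval t
          * t ^ 2 := by
      ext t
      rw [← Matrix.det_one_add_smul]
      rfl
    rw [e] at h1
    set Q := (Matrix.det (1 + (Polynomial.X : Polynomial ℝ) • (Matrix.of N).map Polynomial.C)).divX.divX
    have h2 : HasDerivAt (fun t : ℝ => 1 + (Matrix.of N).trace * t + Q.eval t * t ^ 2)
        ((Matrix.of N).trace) 0 := by
      have := (((hasDerivAt_id (0 : ℝ)).const_mul (Matrix.of N).trace).const_add 1).add
        ((Q.hasDerivAt 0).mul ((hasDerivAt_id (0 : ℝ)).pow 2))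
      exact HasDerivAt.congr_deriv this (by simp)
    exact h1.unique h2
  have hlit := hF1.isLittleO
  have hK1 : 0 < |K| + 1 := by positivity
  obtain ⟨ρ, ρ0, hρ⟩ := Metric.eventually_nhds_iff.1
    (hlit.def (c := ε / (|K| + 1)) (by positivity))
  -- With this bound on t the increment tM has sup norm below ρ; |K| + 1 is used because the
  -- prescribed K may be zero or negative.
  refine ⟨ρ / 2 / (|K| + 1), by positivity, fun t ht M hM => ?_⟩
  have hn : ‖t • (fun i j => M i j : Fin n → Fin n → ℝ)‖ ≤ |t| * (|K| + 1) := by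
    rw [norm_smul, Real.norm_eq_abs]
    refine mul_le_mul_of_nonneg_left ?_ (abs_nonneg t)
    refine (pi_norm_le_iff_of_nonneg hK1.le).2 fun i => (pi_norm_le_iff_of_nonneg hK1.le).2 fun j => ?_
    exact (hM i j).trans ((le_abs_self K).trans (by linarith))
  have hlt : |t| * (|K| + 1) < ρ := by
    have := mul_le_mul_of_nonneg_right ht hK1.le
    rw [div_mul_cancel₀ _ hK1.ne'] at this
    linarith
  have := @hρ (I + t • (fun i j => M i j : Fin n → Fin n → ℝ)) (by
    rw [dist_eq_norm, add_sub_cancel_left]; exact hn.trans_lt hlt)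
  rw [add_sub_cancel_left] at this
  have e1 : F (I + t • fun i j => M i j) = (1 + t • M).det := rfl
  have e2 : F I = 1 := Matrix.det_one
  have e3 : fderiv ℝ F I (t • fun i j => M i j) = t * M.trace := by
    rw [map_smul, hL]; rfl
  rw [e1, e2, e3, Real.norm_eq_abs] at this
  refine this.trans ((mul_le_mul_of_nonneg_left hn (by positivity)).trans_eq ?_)
  field_simp

theorem perturb_zero (V : Eucl n → Eucl n) : perturb V 0 = id := by
  ext1 x; simp [perturb]

variable {V : Eucl n → Eucl n} {K : NNReal}

theorem LipschitzWith.perturb_sub_le (hV : LipschitzWith K V) {t : ℝ} (ht : 0 ≤ t)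
    (htK : t * K ≤ 1 / 2) (x z : Eucl n) : ‖t • V x - t • V z‖ ≤ 1 / 2 * ‖x - z‖ := by
  rw [← smul_sub, norm_smul, Real.norm_of_nonneg ht]
  have := hV.norm_sub_le x z
  calc t * ‖V x - V z‖ ≤ t * (K * ‖x - z‖) := by gcongr
    _ = t * K * ‖x - z‖ := by ring
    _ ≤ _ := by gcongr

/-- tV is a contraction with constant ½: two points with equal images coincide, and a preimage of y
is the fixed point of x ↦ y − tV(x). -/
theorem LipschitzWith.bijective_perturb (hV : LipschitzWith K V) {t : ℝ} (ht : 0 ≤ t)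
    (htK : t * K ≤ 1 / 2) : Function.Bijective (perturb V t) := by
  constructor
  · intro x z hxz
    have h := hV.perturb_sub_le ht htK x z
    have e : x - z = -(t • V x - t • V z) := by
      simp only [perturb] at hxz
      have := sub_eq_zero.2 hxz
      rw [← sub_eq_zero]; rw [← this]; abel
    rw [← norm_neg, ← e] at h
    have : ‖x - z‖ = 0 := by have := norm_nonneg (x - z); linarith
    exact sub_eq_zero.1 (norm_eq_zero.1 this)
  · intro y
    have hc : ContractingWith (1 / 2) (fun x => y - t • V x) := by
      refine ⟨by norm_num, LipschitzWith.of_dist_le_mul fun x z => ?_⟩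
      rw [dist_eq_norm, dist_eq_norm, sub_sub_sub_cancel_left, norm_sub_rev]
      exact (hV.perturb_sub_le ht htK x z).trans_eq (by simp)
    refine ⟨ContractingWith.fixedPoint _ hc, ?_⟩
    have := hc.fixedPoint_isFixedPt
    rw [Function.IsFixedPt] at this
    unfold perturb
    nth_rewrite 1 [← this]
    simp

/-- The geometric heart: T_t maps Ω onto itself. Points outside Ω are fixed, so a point of Ω sent
outside would share its image with that fixed outside point, against injectivity. The constant 2
bounds 1 + ½ as well as (1 − ½)⁻¹. -/
theorem LipschitzWith.isBiLip_perturb (hV : LipschitzWith K V) (h0 : ∀ x, x ∉ Ω → V x = 0) {t : ℝ}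
    (ht : 0 ≤ t) (htK : t * K ≤ 1 / 2) :
    IsBiLip Ω 2 (perturb V t) (Function.invFun (perturb V t)) := by
  have hb := hV.bijective_perturb ht htK
  have hli : Function.LeftInverse (Function.invFun (perturb V t)) (perturb V t) :=
    Function.leftInverse_invFun hb.1
  have hri : Function.RightInverse (Function.invFun (perturb V t)) (perturb V t) :=
    Function.rightInverse_invFun hb.2
  refine ⟨?_, ?_, hli, hri, fun x => ?_⟩
  · refine LipschitzWith.of_dist_le_mul fun x z => ?_
    rw [dist_eq_norm, dist_eq_norm]
    have h := hV.perturb_sub_le ht htK x z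
    calc ‖perturb V t x - perturb V t z‖ = ‖(x - z) + (t • V x - t • V z)‖ := by
          unfold perturb; congr 1; abel
      _ ≤ ‖x - z‖ + 1 / 2 * ‖x - z‖ := (norm_add_le _ _).trans (by gcongr)
      _ ≤ _ := by have := norm_nonneg (x - z); simp; linarith
  · have ha : AntilipschitzWith 2 (perturb V t) := by
      refine AntilipschitzWith.of_le_mul_dist fun x z => ?_
      rw [dist_eq_norm, dist_eq_norm]
      have h := hV.perturb_sub_le ht htK x z
      have : ‖x - z‖ ≤ ‖perturb V t x - perturb V t z‖ + ‖t • V x - t • V z‖ := by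
        calc ‖x - z‖ = ‖(perturb V t x - perturb V t z) - (t • V x - t • V z)‖ := by
              unfold perturb; congr 1; abel
          _ ≤ _ := _root_.norm_sub_le _ _
      simp; linarith
    exact ha.to_rightInverse hri
  · constructor
    · intro hx
      by_contra hx'
      rw [perturb, h0 x hx', smul_zero, add_zero] at hx
      exact hx' hx
    · intro hx
      by_contra hx'
      have : perturb V t (perturb V t x) = perturb V t x := by
        conv_lhs => rw [perturb, h0 _ hx', smul_zero, add_zero]
      have := hb.1 this
      rw [this] at hx'
      exact hx' hx

/-- The classical gradient of a Lipschitz field exists almost everywhere and is its weak gradient.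
With the convention (∇V)_{ij} = ∂_iV_j this matrix is the transpose of the Jacobian matrix. -/
theorem LipschitzWith.gradField_ae (hV : LipschitzWith K V) (hΩ : IsOpen Ω) :
    ∀ᵐ x ∂(volume.restrict Ω), DifferentiableAt ℝ V x ∧
      ∀ i j, gradField Ω V x i j = (fderiv ℝ V x (EuclideanSpace.single i 1)) j := by
  have h1 : ∀ j, weakGrad Ω (fun z => V z j) =ᵐ[volume.restrict Ω] ∇ (fun z => V z j) := by
    intro j
    have hj : LipschitzWith K (fun z => V z j) := by
      refine LipschitzWith.of_dist_le_mul fun x z => ?_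
      refine le_trans ?_ (hV.dist_le_mul x z)
      rw [dist_eq_norm, dist_eq_norm]
      exact PiLp.norm_apply_le (V x - V z) j
    exact weakGrad_ae_eq hΩ (hj.hasWeakGrad Ω)
  filter_upwards [ae_restrict_of_ae hV.ae_differentiableAt, ae_all_iff.2 h1] with x hx h
  refine ⟨hx, fun i j => ?_⟩
  rw [gradField, Matrix.of_apply, h j, gradient_apply]
  have := ((EuclideanSpace.proj (𝕜 := ℝ) j : Eucl n →L[ℝ] ℝ).hasFDerivAt.comp x hx.hasFDerivAt).fderiv
  rw [show fderiv ℝ (fun z => V z j) x = _ from this]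
  rfl

theorem LipschitzWith.abs_gradField_le (hV : LipschitzWith K V) (hΩ : IsOpen Ω) :
    ∀ᵐ x ∂(volume.restrict Ω), ∀ i j, |gradField Ω V x i j| ≤ K := by
  filter_upwards [hV.gradField_ae hΩ] with x hx i j
  rw [hx.2]
  refine (PiLp.norm_apply_le (fderiv ℝ V x (EuclideanSpace.single i 1)) j).trans ?_
  refine ((fderiv ℝ V x).le_opNorm _).trans ?_
  simpa using norm_fderiv_le_of_lipschitz ℝ hV

theorem fderiv_perturb {t : ℝ} {x : Eucl n} (h : DifferentiableAt ℝ V x) :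
    fderiv ℝ (perturb V t) x = ContinuousLinearMap.id ℝ _ + t • fderiv ℝ V x :=
  ((hasFDerivAt_id x).add (h.hasFDerivAt.const_smul t)).fderiv

theorem LipschitzWith.det_fderiv_perturb (hV : LipschitzWith K V) (hΩ : IsOpen Ω) (t : ℝ) :
    ∀ᵐ x ∂(volume.restrict Ω),
      (fderiv ℝ (perturb V t) x).det = (1 + t • gradField Ω V x).det := by
  filter_upwards [hV.gradField_ae hΩ] with x hx
  rw [fderiv_perturb hx.1, ← Matrix.det_transpose]
  set b := (EuclideanSpace.basisFun (Fin n) ℝ).toBasis with hb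
  have e := LinearMap.det_toMatrix b
    ((ContinuousLinearMap.id ℝ (Eucl n) + t • fderiv ℝ V x : Eucl n →L[ℝ] Eucl n) : Eucl n →ₗ[ℝ] Eucl n)
  rw [ContinuousLinearMap.det, ← e]
  congr 1
  ext i j
  rw [LinearMap.toMatrix_apply]
  simp [hb, hx.2, Matrix.one_apply, eq_comm]

/-- Chain rule: ∇(u∘T_t) = (DT_t)ᵀ(∇u∘T_t), and (DT_t)ᵀ = I + t∇V by the index convention of
`gradField`. -/
theorem LipschitzWith.weakGrad_comp_perturb (hV : LipschitzWith K V) (hΩ : IsOpen Ω) {t : ℝ}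
    {S : Eucl n → Eucl n} {C : NNReal} (hT : IsBiLip Ω C (perturb V t) S) {u : Eucl n → ℝ}
    (hu : MemH10 Ω u) :
    MemH10 Ω (fun x => u (perturb V t x)) ∧
    ∀ᵐ x ∂(volume.restrict Ω), ∀ i, weakGrad Ω (fun x => u (perturb V t x)) x i
      = weakGrad Ω u (perturb V t x) i
        + t * ∑ j, gradField Ω V x i j * weakGrad Ω u (perturb V t x) j := by
  have hp := hT.h10Pair_comp hΩ hu.pair
  refine ⟨hp.memH10 hΩ, ?_⟩
  filter_upwards [hp.weakGrad_ae hΩ, hV.gradField_ae hΩ] with x h1 h2 i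
  rw [h1]
  set G := weakGrad Ω u (perturb V t x)
  have e : ∀ w : Eucl n, w i = inner ℝ w (EuclideanSpace.single i 1) := fun w => by
    rw [EuclideanSpace.inner_single_right]; simp
  rw [e, ContinuousLinearMap.adjoint_inner_left, fderiv_perturb h2.1]
  simp only [_root_.add_apply, ContinuousLinearMap.id_apply,
    _root_.smul_apply, inner_add_right, inner_smul_right, ← e, h2.2]
  congr 2

end Perturbation

/-! ### The inequality H¹₀ ⊂ L⁴ in dimension at most four, and its transfer by folding. -/

section Sobolev

variable {n : ℕ} {Ω : Set (Eucl n)} {u : Eucl n → ℝ} {g : Eucl n → Eucl n}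

theorem eLpNorm_gradient (θ : Eucl n → ℝ) (p : ℝ≥0∞) (μ : Measure (Eucl n)) :
    eLpNorm (∇ θ) p μ = eLpNorm (fderiv ℝ θ) p μ :=
  eLpNorm_congr_norm_ae (ae_of_all _ fun x => norm_gradient θ x)

theorem eLpNorm_gradient_eq_restrict {θ : Eucl n → ℝ} {R : ℝ}
    (hs : Function.support θ ⊆ Metric.closedBall 0 R) (p : ℝ≥0∞) :
    eLpNorm (∇ θ) p volume = eLpNorm (∇ θ) p (volume.restrict (Metric.closedBall 0 R)) := by
  rw [← eLpNorm_indicator_eq_eLpNorm_restrict Metric.isClosed_closedBall.measurableSet]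
  congr 1
  ext1 x
  by_cases hx : x ∈ Metric.closedBall (0 : Eucl n) R
  · rw [indicator_of_mem hx]
  · rw [indicator_of_notMem hx]
    exact gradient_eq_zero_of_notMem_tsupport fun h =>
      hx (closure_minimal hs Metric.isClosed_closedBall h)

/-- On the line |θ| ≤ ‖θ'‖₁. Hölder on the supporting ball B gives the factor |B|^{1/2}, and passing
from the sup norm to L⁴ the factor |B|^{1/4}. -/
theorem sobolev_one_dim (R : ℝ) : ∃ C : ℝ≥0∞, C ≠ ⊤ ∧ ∀ θ : Eucl 1 → ℝ, ContDiff ℝ 1 θ →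
    Function.support θ ⊆ Metric.closedBall 0 R →
    eLpNorm θ 4 volume ≤ C * eLpNorm (∇ θ) 2 volume := by
  set B : Set (Eucl 1) := Metric.closedBall 0 R with hB
  have hBm : MeasurableSet B := Metric.isClosed_closedBall.measurableSet
  have hBv : volume B ≠ ⊤ := measure_closedBall_lt_top.ne
  refine ⟨volume B ^ (1 / (2 : ℝ)) * volume B ^ (1 / (4 : ℝ)),
    ENNReal.mul_ne_top (by finiteness) (by finiteness), fun θ hθ hs => ?_⟩
  let e : ℝ ≃ₗᵢ[ℝ] Eucl 1 := (stdOrthonormalBasis ℝ ℝ).equiv (EuclideanSpace.basisFun (Fin 1) ℝ)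
    (finCongr (Module.finrank_self ℝ))
  have hcs : HasCompactSupport θ :=
    HasCompactSupport.of_support_subset_isCompact (isCompact_closedBall _ _) hs
  have h1 : ContDiff ℝ 1 (fun t => θ (e t)) := hθ.comp e.toContinuousLinearEquiv.contDiff
  have h2 : HasCompactSupport (fun t => θ (e t)) :=
    hcs.comp_isClosedEmbedding e.toHomeomorph.isClosedEmbedding
  have hder : ∀ t, ‖deriv (fun t => θ (e t)) t‖ₑ ≤ ‖∇ θ (e t)‖ₑ := by
    intro t
    have hd := ((hθ.differentiable (by simp) (e t)).hasFDerivAt.comp_hasDerivAt t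
      (e.toContinuousLinearEquiv.toContinuousLinearMap.hasDerivAt)).deriv
    rw [show deriv (fun t => θ (e t)) t = _ from hd, ← ofReal_norm, ← ofReal_norm, norm_gradient]
    refine ENNReal.ofReal_le_ofReal ((ContinuousLinearMap.le_opNorm _ _).trans ?_)
    have : ‖e.toContinuousLinearEquiv.toContinuousLinearMap 1‖ = 1 :=
      (e.norm_map 1).trans norm_one
    rw [this, mul_one]
  have hsup : ∀ x, ‖θ x‖ₑ ≤ eLpNorm (∇ θ) 1 volume := by
    intro x
    have h3 := HasCompactSupport.enorm_le_lintegral_Ici_deriv h1 h2 (e.symm x)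
    simp only [LinearIsometryEquiv.apply_symm_apply] at h3
    refine h3.trans (le_trans (setLIntegral_le_lintegral _ _) ?_)
    refine (lintegral_mono hder).trans ?_
    have hmp := e.measurePreserving
    rw [eLpNorm_one_eq_lintegral_enorm]
    exact (hmp.lintegral_comp_emb e.toHomeomorph.measurableEmbedding (fun x => ‖∇ θ x‖ₑ)).le
  have hL1 : eLpNorm (∇ θ) 1 volume ≤ eLpNorm (∇ θ) 2 volume * volume B ^ (1 / (2 : ℝ)) := by
    rw [eLpNorm_gradient_eq_restrict hs, eLpNorm_gradient_eq_restrict hs]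
    have := eLpNorm_le_eLpNorm_mul_rpow_measure_univ (p := 1) (q := 2) (μ := volume.restrict B)
      one_le_two (measurable_gradient θ).aestronglyMeasurable
    rw [Measure.restrict_apply_univ] at this
    refine this.trans_eq ?_
    norm_num [hB]
  have hind : θ = B.indicator θ := by
    ext1 x
    by_cases hx : x ∈ B
    · rw [indicator_of_mem hx]
    · rw [indicator_of_notMem hx]
      by_contra h
      exact hx (hs h)
  have hfin : eLpNorm (∇ θ) 1 volume ≠ ⊤ := by
    have := (continuous_gradient hθ).memLp_of_hasCompactSupport (p := 1) (μ := volume) hcs.gradient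
    exact this.2.ne
  calc eLpNorm θ 4 volume = eLpNorm θ 4 (volume.restrict B) := by
        conv_lhs => rw [hind]
        rw [eLpNorm_indicator_eq_eLpNorm_restrict hBm]
    _ ≤ volume.restrict B univ ^ (4 : ℝ≥0∞).toReal⁻¹ *
          ENNReal.ofReal (eLpNorm (∇ θ) 1 volume).toReal := by
        refine eLpNorm_le_of_ae_bound (ae_of_all _ fun x => ?_)
        rw [← toReal_enorm]
        exact ENNReal.toReal_mono hfin (hsup x)
    _ = eLpNorm (∇ θ) 1 volume * volume B ^ (1 / (4 : ℝ)) := by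
        rw [ENNReal.ofReal_toReal hfin, Measure.restrict_apply_univ, mul_comm]
        norm_num
    _ ≤ eLpNorm (∇ θ) 2 volume * volume B ^ (1 / (2 : ℝ)) * volume B ^ (1 / (4 : ℝ)) := by gcongr
    _ = _ := by ring

/-- The Sobolev inequality `H^1 ⊆ L^4` in dimension at most four. -/
theorem sobolev_contDiff (hn1 : 1 ≤ n) (hn4 : n ≤ 4) (R : ℝ) : ∃ C : ℝ≥0∞, C ≠ ⊤ ∧
    ∀ θ : Eucl n → ℝ, ContDiff ℝ 1 θ → Function.support θ ⊆ Metric.closedBall 0 R →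
    eLpNorm θ 4 volume ≤ C * eLpNorm (∇ θ) 2 volume := by
  have hbd : Bornology.IsBounded (Metric.closedBall (0 : Eucl n) R) := Metric.isBounded_closedBall
  have h34 : 3 ≤ n → ∃ C : ℝ≥0∞, C ≠ ⊤ ∧
      ∀ θ : Eucl n → ℝ, ContDiff ℝ 1 θ → Function.support θ ⊆ Metric.closedBall 0 R →
      eLpNorm θ 4 volume ≤ C * eLpNorm (∇ θ) 2 volume := by
    intro h3
    refine ⟨eLpNormLESNormFDerivOfLeConst ℝ (volume : Measure (Eucl n)) (Metric.closedBall 0 R) 2 4,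
      ENNReal.coe_ne_top, fun θ h1 h2 => ?_⟩
    rw [eLpNorm_gradient]
    refine eLpNorm_le_eLpNorm_fderiv_of_le (μ := volume) (p := 2) (q := 4) h1 h2 one_le_two ?_ ?_ hbd
    · rw [finrank_euclideanSpace_fin]; exact_mod_cast h3
    · rw [finrank_euclideanSpace_fin]
      -- The Sobolev condition 1/2 − 1/n ≤ 1/4 says n ≤ 4.
      have : (4 : ℝ)⁻¹ ≤ (n : ℝ)⁻¹ := by
        rw [inv_le_inv₀ (by norm_num) (by positivity)]; exact_mod_cast hn4
      push_cast; norm_num at this ⊢; linarith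
  -- The Gagliardo–Nirenberg–Sobolev inequality with exponent 2 needs 2 < n. In the plane one takes
  -- exponent 4/3, whose Sobolev conjugate is 4, followed by Hölder on the ball; the line is
  -- elementary.
  obtain rfl | rfl | h3 : n = 1 ∨ n = 2 ∨ 3 ≤ n := by omega
  · exact sobolev_one_dim R
  · have hBv : volume (Metric.closedBall (0 : Eucl 2) R) ≠ ⊤ := measure_closedBall_lt_top.ne
    refine ⟨eLpNormLESNormFDerivOfLeConst ℝ (volume : Measure (Eucl 2)) (Metric.closedBall 0 R) (4 / 3) 4 *
      volume (Metric.closedBall (0 : Eucl 2) R) ^ (1 / (4 : ℝ)),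
      ENNReal.mul_ne_top ENNReal.coe_ne_top (by finiteness), fun θ h1 h2 => ?_⟩
    have hp : (1 : NNReal) ≤ 4 / 3 := by rw [← NNReal.coe_le_coe]; push_cast; norm_num
    have key := eLpNorm_le_eLpNorm_fderiv_of_le (μ := volume) (p := 4 / 3) (q := 4) h1 h2
      hp (by rw [finrank_euclideanSpace_fin, ← NNReal.coe_lt_coe]; push_cast; norm_num)
      (by rw [finrank_euclideanSpace_fin]; push_cast; norm_num) hbd
    rw [← eLpNorm_gradient] at key
    refine key.trans ?_
    rw [eLpNorm_gradient_eq_restrict h2, eLpNorm_gradient_eq_restrict h2 2, mul_assoc]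
    gcongr
    have := eLpNorm_le_eLpNorm_mul_rpow_measure_univ (p := ((4 / 3 : NNReal) : ℝ≥0∞)) (q := 2)
      (μ := volume.restrict (Metric.closedBall (0 : Eucl 2) R))
      (by
        have : (4 / 3 : NNReal) ≤ 2 := by rw [← NNReal.coe_le_coe]; push_cast; norm_num
        exact_mod_cast this)
      (measurable_gradient θ).aestronglyMeasurable
    rw [Measure.restrict_apply_univ] at this
    refine this.trans_eq ?_
    rw [mul_comm]
    congr 2
    simp; norm_num
  · exact h34 h3

/-- Fatou's lemma along an almost everywhere convergent subsequence: L^q bounds survive L² limits.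
-/
theorem eLpNorm_le_of_tendsto_two {α : Type*} [MeasurableSpace α] {μ : Measure α} {w : ℕ → α → ℝ}
    {u : α → ℝ} (hw : ∀ k, AEStronglyMeasurable (w k) μ) (hu : AEStronglyMeasurable u μ)
    (h : Tendsto (fun k => eLpNorm (fun x => w k x - u x) 2 μ) atTop (𝓝 0)) {q : ℝ≥0∞}
    {b : ℕ → ℝ≥0∞} {B : ℝ≥0∞} (hb : ∀ᶠ k in atTop, eLpNorm (w k) q μ ≤ b k)
    (hB : Tendsto b atTop (𝓝 B)) : eLpNorm u q μ ≤ B := by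
  obtain ⟨ns, h1, h2⟩ := (tendstoInMeasure_of_tendsto_eLpNorm two_ne_zero hw hu h).exists_seq_tendsto_ae
  refine (Lp.eLpNorm_lim_le_liminf_eLpNorm (fun k => hw (ns k)) u h2).trans ?_
  have h3 : Tendsto (fun k => b (ns k)) atTop (𝓝 B) := hB.comp h1.tendsto_atTop
  rw [← h3.liminf_eq]
  exact liminf_le_liminf (h1.tendsto_atTop.eventually hb)

theorem H10Pair.exists_seq (hu : H10Pair Ω u g) : ∃ θ : ℕ → Eucl n → ℝ, (∀ k, IsTestFun Ω (θ k)) ∧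
    Tendsto (fun k => eLpNorm (fun x => θ k x - u x) 2 (volume.restrict Ω)) atTop (𝓝 0) ∧
    Tendsto (fun k => eLpNorm (fun x => ∇ (θ k) x - g x) 2 (volume.restrict Ω)) atTop (𝓝 0) := by
  obtain ⟨ε, _, hε, hlim⟩ := exists_seq_strictAnti_tendsto' (ENNReal.zero_lt_top)
  choose θ h1 h2 h3 using fun k => hu.2.2 (ε k) (hε k).1.ne'
  exact ⟨θ, h1, tendsto_of_tendsto_of_tendsto_of_le_of_le tendsto_const_nhds hlim
    (fun _ => zero_le) h2, tendsto_of_tendsto_of_tendsto_of_le_of_le tendsto_const_nhds hlim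
    (fun _ => zero_le) h3⟩

theorem sobolev_h10 (hn1 : 1 ≤ n) (hn4 : n ≤ 4) (hΩ : MeasurableSet Ω) (hb : Bornology.IsBounded Ω) :
    ∃ C : ℝ≥0∞, C ≠ ⊤ ∧ ∀ u g, H10Pair Ω u g →
      eLpNorm u 4 (volume.restrict Ω) ≤ C * eLpNorm g 2 (volume.restrict Ω) := by
  obtain ⟨R, hR⟩ := hb.subset_closedBall 0
  obtain ⟨C, hC, H⟩ := sobolev_contDiff hn1 hn4 R
  refine ⟨C, hC, fun u g hu => ?_⟩
  obtain ⟨θ, h1, h2, h3⟩ := hu.exists_seq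
  refine eLpNorm_le_of_tendsto_two (w := θ)
    (b := fun k => C * (eLpNorm g 2 (volume.restrict Ω) +
      eLpNorm (fun x => ∇ (θ k) x - g x) 2 (volume.restrict Ω)))
    (fun k => ((h1 k).memLp 2 Ω).1) hu.1.1 h2 (Eventually.of_forall fun k => ?_) ?_
  · have hs : Function.support (θ k) ⊆ Metric.closedBall 0 R :=
      (subset_tsupport _).trans ((h1 k).2.2.trans hR)
    refine (eLpNorm_mono_measure _ Measure.restrict_le_self).trans
      ((H _ (h1 k).contDiff_one hs).trans ?_)
    gcongr
    have e : eLpNorm (∇ (θ k)) 2 volume = eLpNorm (∇ (θ k)) 2 (volume.restrict Ω) := by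
      rw [← eLpNorm_indicator_eq_eLpNorm_restrict hΩ]
      congr 1
      ext1 x
      by_cases hx : x ∈ Ω
      · rw [indicator_of_mem hx]
      · rw [indicator_of_notMem hx, (h1 k).gradient_eq_zero hx]
    rw [e]
    have : ∇ (θ k) = g + fun x => ∇ (θ k) x - g x := by ext1 x; simp
    conv_lhs => rw [this]
    exact eLpNorm_add_le hu.2.1.1 (((h1 k).memLp_gradient 2 Ω).sub hu.2.1).1 one_le_two
  · have : Tendsto (fun k => C * (eLpNorm g 2 (volume.restrict Ω) +
      eLpNorm (fun x => ∇ (θ k) x - g x) 2 (volume.restrict Ω))) atTop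
      (𝓝 (C * (eLpNorm g 2 (volume.restrict Ω) + 0))) :=
      ENNReal.Tendsto.const_mul (tendsto_const_nhds.add h3) (Or.inr hC)
    simpa using this

/-- Around Φ(x) the increments of v are at most (‖∇v(Φ x)‖ + ε) times the distance, so no
differentiability of Φ is needed; folds have corners. Where v∘Φ is not differentiable its gradient
is 0 by convention. -/
theorem norm_gradient_comp_le {v : Eucl n → ℝ} {Φ : Eucl n → Eucl n} {L : NNReal}
    (hv : Differentiable ℝ v) (hΦ : LipschitzWith L Φ) (x : Eucl n) :
    ‖∇ (fun z => v (Φ z)) x‖ ≤ L * ‖∇ v (Φ x)‖ := by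
  have key : ∀ ε > 0, ‖fderiv ℝ (fun z => v (Φ z)) x‖ ≤ (‖fderiv ℝ v (Φ x)‖ + ε) * L := by
    intro ε hε
    refine norm_fderiv_le_of_lip' ℝ (by positivity) ?_
    have h1 := (hv (Φ x)).hasFDerivAt.isLittleO.def hε
    filter_upwards [hΦ.continuous.continuousAt.eventually h1] with z hz
    have h2 : ‖v (Φ z) - v (Φ x)‖ ≤ (‖fderiv ℝ v (Φ x)‖ + ε) * ‖Φ z - Φ x‖ := by
      calc ‖v (Φ z) - v (Φ x)‖
          = ‖(v (Φ z) - v (Φ x) - fderiv ℝ v (Φ x) (Φ z - Φ x)) + fderiv ℝ v (Φ x) (Φ z - Φ x)‖ := by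
            congr 1; abel
        _ ≤ ε * ‖Φ z - Φ x‖ + ‖fderiv ℝ v (Φ x)‖ * ‖Φ z - Φ x‖ :=
            (norm_add_le _ _).trans (add_le_add hz (ContinuousLinearMap.le_opNorm _ _))
        _ = _ := by ring
    refine h2.trans ?_
    rw [mul_assoc]
    gcongr
    exact hΦ.norm_sub_le z x
  rw [norm_gradient, norm_gradient]
  refine le_of_forall_pos_le_add fun ε hε => ?_
  have := key (ε / (L + 1)) (by positivity)
  refine this.trans ?_
  have h3 : ε / (L + 1) * L ≤ ε := by
    rw [div_mul_eq_mul_div, div_le_iff₀ (by positivity)]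
    nlinarith [L.2]
  linarith [mul_comm (‖fderiv ℝ v (Φ x)‖) (L : ℝ)]

/-- `L^4` integrability on `U` of a compactly supported function with weak gradient in `L^2` on `U`,
when `closure U` is a Lipschitz retract of the space. -/
theorem memLp_four_of_fold (hn1 : 1 ≤ n) (hn4 : n ≤ 4) {U : Set (Eucl n)} (hU : MeasurableSet U)
    {Φ : Eucl n → Eucl n} {L : NNReal} (hΦ : LipschitzWith L Φ) {D : ℝ≥0∞} (hD : D ≠ ⊤)
    (hmap : (volume : Measure (Eucl n)).map Φ ≤ D • volume) (hid : ∀ x ∈ U, Φ x = x)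
    {a b : ℝ} (hab : ∀ x, ‖x‖ ≤ a + b * ‖Φ x‖) (hb : 0 ≤ b) {c : ℕ → Eucl n}
    {φ : ∀ k, ContDiffBump (c k)} (hφ : Tendsto (fun k => ‖c k‖ + (φ k).rOut) atTop (𝓝 0))
    (hball : ∀ k x, Metric.closedBall (Φ x - c k) (φ k).rOut ⊆ U)
    {W : Eucl n → ℝ} {G : Eucl n → Eucl n} (hWG : HasWeakGrad U W G)
    (hW : MemLp W 2 volume) (hG : MemLp G 2 volume) (hc : HasCompactSupport W) :
    MemLp W 4 (volume.restrict U) := by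
  obtain ⟨R, hR⟩ := hc.isCompact.isBounded.subset_closedBall (0 : Eucl n)
  -- A mollification v of W vanishes beyond radius R + 1; the growth condition `hab` then makes v∘Φ
  -- vanish beyond radius R'.
  set R' : ℝ := a + b * (R + 1) with hR'
  obtain ⟨C, hC, H⟩ := sobolev_h10 hn1 hn4 (Ω := Metric.ball (0 : Eucl n) (R' + 1))
    measurableSet_ball Metric.isBounded_ball
  have hloc := hW.locallyIntegrable one_le_two
  have hlocG := hG.locallyIntegrable one_le_two
  refine ⟨hW.1.restrict, ?_⟩
  -- Mollify W, compose with the fold, and apply the Sobolev inequality on a large ball to the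
  -- Lipschitz function v∘Φ, which agrees with v on U. The bound does not depend on k and so passes
  -- to W.
  refine lt_of_le_of_lt (eLpNorm_le_of_tendsto_two (w := fun k => mollify (φ k) W)
    (b := fun _ => C * (L * (D ^ (1 / (2 : ℝ≥0∞)).toReal * eLpNorm G 2 volume)))
    (fun k => (contDiff_mollify (φ k) hloc).continuous.aestronglyMeasurable) hW.1.restrict ?_ ?_
    tendsto_const_nhds) ?_
  · exact tendsto_of_tendsto_of_tendsto_of_le_of_le tendsto_const_nhds
      (tendsto_eLpNorm_mollify_sub hφ one_le_two (by simp) hW) (fun _ => zero_le)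
      fun k => eLpNorm_mono_measure _ Measure.restrict_le_self
  · filter_upwards [hφ.eventually_lt_const one_pos] with k hk
    set v := mollify (φ k) W with hv
    have hv1 : ContDiff ℝ 1 v := (contDiff_mollify (φ k) hloc).of_le (by exact_mod_cast le_top)
    have hvc : HasCompactSupport v := hasCompactSupport_mollify (φ k) hc
    have hvR : ∀ x, R + 1 < ‖x‖ → v x = 0 := by
      intro x hx
      refine mollify_eq_zero_of_notMem (φ k) (K := Metric.closedBall 0 R) (fun z hz => ?_) ?_
      · exact image_eq_zero_of_notMem_tsupport fun h => hz (hR h)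
      · intro h
        have h2 := Metric.cthickening_mono hk.le _ h
        by_cases hR0 : 0 ≤ R
        · rw [cthickening_closedBall zero_le_one hR0] at h2
          rw [mem_closedBall_zero_iff] at h2
          linarith
        · rw [Metric.closedBall_eq_empty.2 (not_le.1 hR0), Metric.cthickening_empty] at h2
          exact h2
    obtain ⟨C₁, hC₁⟩ := hv1.lipschitzWith_of_hasCompactSupport hvc one_ne_zero
    set h : Eucl n → ℝ := fun x => v (Φ x) with hh
    have hlip : LipschitzWith (C₁ * L) h := hC₁.comp hΦ
    have hsupp : Function.support h ⊆ Metric.closedBall 0 R' := by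
      intro x hx
      rw [mem_closedBall_zero_iff]
      by_contra hx'
      refine hx (hvR _ ?_)
      by_contra hx2
      have := hab x
      have : b * ‖Φ x‖ ≤ b * (R + 1) := mul_le_mul_of_nonneg_left (not_lt.1 hx2) hb
      linarith
    have hhc : HasCompactSupport h :=
      HasCompactSupport.of_support_subset_isCompact (isCompact_closedBall _ _) hsupp
    have hhs : tsupport h ⊆ Metric.ball 0 (R' + 1) :=
      (closure_minimal hsupp Metric.isClosed_closedBall).trans
        (Metric.closedBall_subset_ball (by linarith))
    have hS := H h (∇ h) (hlip.h10Pair Metric.isOpen_ball hhc hhs)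
    -- W has a weak gradient in U only; `hball` says that at points of the range of Φ the kernel
    -- sees nothing but U.
    have hgr : ∀ x, ‖∇ h x‖ ≤ L * ‖mollify (φ k) G (Φ x)‖ := by
      intro x
      refine (norm_gradient_comp_le (hv1.differentiable (by simp)) hΦ x).trans ?_
      rw [hv, gradient_mollify hloc hWG (φ k) (hball k x)]
    have hgn : eLpNorm (∇ h) 2 volume
        ≤ L * (D ^ (1 / (2 : ℝ≥0∞)).toReal * eLpNorm G 2 volume) := by
      have h1 := eLpNorm_le_nnreal_smul_eLpNorm_of_ae_le_mul (c := L) (μ := volume)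
        (f := ∇ h) (g := fun x => mollify (φ k) G (Φ x)) (ae_of_all _ fun x => by
          have := hgr x
          exact_mod_cast this) 2
      rw [ENNReal.smul_def, smul_eq_mul] at h1
      refine h1.trans ?_
      gcongr
      refine (eLpNorm_comp_le hΦ.continuous.measurable hmap
        (contDiff_mollify (φ k) hlocG).continuous.aestronglyMeasurable 2).trans ?_
      gcongr
      exact eLpNorm_mollify_le (φ k) hG.1 one_le_two (by simp)
    have e1 : eLpNorm v 4 (volume.restrict U) = eLpNorm h 4 (volume.restrict U) := by
      refine eLpNorm_congr_ae ?_
      filter_upwards [ae_restrict_mem hU] with x hx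
      rw [hh]; simp only [hid x hx]
    have e2 : eLpNorm h 4 volume = eLpNorm h 4 (volume.restrict (Metric.ball 0 (R' + 1))) := by
      rw [← eLpNorm_indicator_eq_eLpNorm_restrict measurableSet_ball]
      congr 1
      ext1 x
      by_cases hx : x ∈ Metric.ball (0 : Eucl n) (R' + 1)
      · rw [indicator_of_mem hx]
      · rw [indicator_of_notMem hx]
        exact image_eq_zero_of_notMem_tsupport fun h' => hx (hhs h')
    rw [e1]
    refine (eLpNorm_mono_measure _ Measure.restrict_le_self).trans (e2.trans_le (hS.trans ?_))
    gcongr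
    exact (eLpNorm_mono_measure _ Measure.restrict_le_self).trans hgn
  · have := hG.2
    finiteness

end Sobolev

/-! ### The embedding H¹ ⊂ L⁴ on bounded Lipschitz domains. -/

section SobolevLipschitz

variable {n : ℕ} {Ω U : Set (Eucl n)} {u : Eucl n → ℝ} {g : Eucl n → Eucl n}

/-- The part of `memLp_four_of_fold` that is independent of the cut-off function. -/
theorem memLp_four_near_of_fold (hn1 : 1 ≤ n) (hn4 : n ≤ 4) (hΩ : IsOpen Ω)
    (hΩb : Bornology.IsBounded Ω) (hU : MeasurableSet U)
    {Φ : Eucl n → Eucl n} {L : NNReal} (hΦ : LipschitzWith L Φ) {D : ℝ≥0∞} (hD : D ≠ ⊤)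
    (hmap : (volume : Measure (Eucl n)).map Φ ≤ D • volume) (hid : ∀ x ∈ U, Φ x = x)
    {a b : ℝ} (hab : ∀ x, ‖x‖ ≤ a + b * ‖Φ x‖) (hb : 0 ≤ b) {c : ℕ → Eucl n}
    {φ : ∀ k, ContDiffBump (c k)} (hφ : Tendsto (fun k => ‖c k‖ + (φ k).rOut) atTop (𝓝 0))
    (hball : ∀ k x, Metric.closedBall (Φ x - c k) (φ k).rOut ⊆ U)
    (hug : HasWeakGrad Ω u g) (hu : MemLp u 2 (volume.restrict Ω))
    (hg : MemLp g 2 (volume.restrict Ω)) {x₀ : Eucl n} {r : ℝ} (hr : 0 < r)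
    (hUΩ : U ∩ Metric.ball x₀ r ⊆ Ω) (hΩU : Ω ∩ Metric.ball x₀ r ⊆ U) :
    MemLp u 4 (volume.restrict (Ω ∩ Metric.ball x₀ (r / 4))) := by
  have : IsFiniteMeasure (volume.restrict Ω) :=
    ⟨by rw [Measure.restrict_apply_univ]; exact hΩb.measure_lt_top⟩
  -- Equal to 1 within radius r/4 and supported within radius r/2, where Ω and U coincide.
  let χ : ContDiffBump x₀ := ⟨r / 4, r / 2, by positivity, by linarith⟩
  have hχs : tsupport χ ⊆ Metric.ball x₀ r := by
    rw [χ.tsupport_eq]; exact Metric.closedBall_subset_ball (by simp [χ]; linarith)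
  have hχ1 : ContDiff ℝ 1 χ := χ.contDiff
  have hcs : HasCompactSupport χ := χ.hasCompactSupport
  have hWG := hug.indicator_mul_cutoff (U := U) hΩ (hu.integrable one_le_two)
    (hg.integrable one_le_two) (χ := χ) χ.contDiff hcs
    (fun x hx => hUΩ ⟨hx.1, hχs hx.2⟩)
  obtain ⟨C, hC⟩ := hχ1.continuous.bounded_above_of_compact_support hcs
  obtain ⟨C', hC'⟩ := (continuous_gradient hχ1).bounded_above_of_compact_support hcs.gradient
  have hW : MemLp (Ω.indicator fun x => χ x * u x) 2 volume := by
    rw [memLp_indicator_iff_restrict hΩ.measurableSet]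
    refine hu.of_le_mul (c := C) (hχ1.continuous.aestronglyMeasurable.mul hu.1)
      (ae_of_all _ fun x => ?_)
    rw [norm_mul]; gcongr; exact hC x
  have hG : MemLp (Ω.indicator fun x => χ x • g x + u x • ∇ χ x) 2 volume := by
    rw [memLp_indicator_iff_restrict hΩ.measurableSet]
    refine MemLp.add (hg.of_le_mul (c := C) (hχ1.continuous.aestronglyMeasurable.smul hg.1)
      (ae_of_all _ fun x => ?_)) (hu.of_le_mul (c := C')
        (hu.1.smul (continuous_gradient hχ1).aestronglyMeasurable) (ae_of_all _ fun x => ?_))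
    · rw [norm_smul]; gcongr; exact hC x
    · rw [norm_smul, mul_comm]; gcongr; exact hC' x
  have hWc : HasCompactSupport (Ω.indicator fun x => χ x * u x) := by
    refine HasCompactSupport.intro hcs fun x hx => ?_
    by_cases hx' : x ∈ Ω
    · rw [indicator_of_mem hx', image_eq_zero_of_notMem_tsupport hx, zero_mul]
    · rw [indicator_of_notMem hx']
  have key := memLp_four_of_fold hn1 hn4 hU hΦ hD hmap hid hab hb hφ hball hWG hW hG hWc
  have h2 : MemLp (Ω.indicator fun x => χ x * u x) 4
      (volume.restrict (Ω ∩ Metric.ball x₀ (r / 4))) :=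
    key.mono_measure (Measure.restrict_mono (fun x hx => hΩU
      ⟨hx.1, Metric.ball_subset_ball (by linarith) hx.2⟩) le_rfl)
  refine h2.ae_eq ?_
  filter_upwards [ae_restrict_mem (hΩ.measurableSet.inter measurableSet_ball)] with x hx
  rw [indicator_of_mem hx.1, χ.one_of_mem_closedBall (Metric.ball_subset_closedBall hx.2), one_mul]

theorem memLp_four_near_interior (hn1 : 1 ≤ n) (hn4 : n ≤ 4) (hΩ : IsOpen Ω)
    (hΩb : Bornology.IsBounded Ω) (hug : HasWeakGrad Ω u g) (hu : MemLp u 2 (volume.restrict Ω))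
    (hg : MemLp g 2 (volume.restrict Ω)) {x₀ : Eucl n} (hx₀ : x₀ ∈ Ω) :
    ∃ r > 0, MemLp u 4 (volume.restrict (Ω ∩ Metric.ball x₀ r)) := by
  obtain ⟨r, hr, hrΩ⟩ := Metric.isOpen_iff.1 hΩ x₀ hx₀
  refine ⟨r / 4, by positivity, ?_⟩
  refine memLp_four_near_of_fold (U := univ) (Φ := id) (D := 1) (a := 0) (b := 1) hn1 hn4 hΩ hΩb
    MeasurableSet.univ LipschitzWith.id (by simp) (by simp) (fun _ _ => rfl) (fun x => by simp)
    zero_le_one (tendsto_stdBump n) (fun _ _ => subset_univ _) hug hu hg hr ?_ (subset_univ _)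
  simpa using hrΩ

/-- Reflection across the graph along ν. Near x₀ the set Ω is {η > 0}, where η is the height of the
graph above the point and decreases at unit speed along ν. The fold Φ fixes {η ≥ 0} and reflects the
rest along ν, so it is Lipschitz and at most two-to-one; no flattening of the boundary is needed. -/
theorem memLp_four_near_boundary (hn1 : 1 ≤ n) (hn4 : n ≤ 4) (hΩ : IsOpen Ω)
    (hΩb : Bornology.IsBounded Ω) (hug : HasWeakGrad Ω u g) (hu : MemLp u 2 (volume.restrict Ω))
    (hg : MemLp g 2 (volume.restrict Ω)) {x₀ ν : Eucl n} {r : ℝ} {K : NNReal} {γ : Eucl n → ℝ}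
    (hν : ‖ν‖ = 1) (hr : 0 < r) (hγ : LipschitzWith K γ) (hgr : ∀ x ∈ Metric.ball x₀ r,
        (x ∈ Ω ↔ inner ℝ ν x < γ (x - (inner ℝ ν x : ℝ) • ν))) :
    MemLp u 4 (volume.restrict (Ω ∩ Metric.ball x₀ (r / 4))) := by
  set η : Eucl n → ℝ := fun x => γ (x - (inner ℝ ν x : ℝ) • ν) - inner ℝ ν x with hη
  have hshift : ∀ x (s : ℝ), η (x + s • ν) = η x - s := by
    intro x s
    have h1 : inner ℝ ν (x + s • ν) = inner ℝ ν x + s := by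
      rw [inner_add_right, inner_smul_right, real_inner_self_eq_norm_sq, hν]; ring
    have h2 : x + s • ν - (inner ℝ ν x + s) • ν = x - (inner ℝ ν x : ℝ) • ν := by
      rw [add_smul]; abel
    simp only [hη, h1, h2]; ring
  set M : NNReal := 2 * K + 1 with hM
  have hinner : ∀ x z : Eucl n, |inner ℝ ν x - inner ℝ ν z| ≤ ‖x - z‖ := by
    intro x z
    rw [← inner_sub_right]
    have := abs_real_inner_le_norm ν (x - z)
    rwa [hν, one_mul] at this
  have hηl : LipschitzWith M η := by
    refine LipschitzWith.of_dist_le_mul fun x z => ?_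
    rw [Real.dist_eq, dist_eq_norm]
    have h1 := hγ.norm_sub_le (x - (inner ℝ ν x : ℝ) • ν) (z - (inner ℝ ν z : ℝ) • ν)
    have h2 : ‖(x - (inner ℝ ν x : ℝ) • ν) - (z - (inner ℝ ν z : ℝ) • ν)‖ ≤ 2 * ‖x - z‖ := by
      have e : (x - (inner ℝ ν x : ℝ) • ν) - (z - (inner ℝ ν z : ℝ) • ν)
          = (x - z) - (inner ℝ ν x - inner ℝ ν z : ℝ) • ν := by rw [sub_smul]; abel
      rw [e]
      refine (norm_sub_le _ _).trans ?_
      rw [norm_smul, hν, mul_one, Real.norm_eq_abs]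
      linarith [hinner x z]
    have h3 : (K : ℝ) * ‖(x - (inner ℝ ν x : ℝ) • ν) - (z - (inner ℝ ν z : ℝ) • ν)‖
        ≤ K * (2 * ‖x - z‖) := by gcongr
    have e : η x - η z = (γ (x - (inner ℝ ν x : ℝ) • ν) - γ (z - (inner ℝ ν z : ℝ) • ν))
        - (inner ℝ ν x - inner ℝ ν z) := by simp only [hη]; ring
    rw [e]
    refine (abs_sub _ _).trans ?_
    rw [← Real.norm_eq_abs (γ _ - γ _)]
    have hMc : (M : ℝ) = 2 * K + 1 := by rw [hM]; push_cast; ring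
    rw [hMc]
    nlinarith [hinner x z]
  -- Reflection along ν: it changes the sign of η and is an involution, hence its inverse has the
  -- same Lipschitz constant.
  set Rf : Eucl n → Eucl n := fun x => x + (2 * η x) • ν with hRf
  have hRR : ∀ x, Rf (Rf x) = x := by
    intro x
    have h1 : η (Rf x) = - η x := by simp only [hRf, hshift]; ring
    show Rf x + (2 * η (Rf x)) • ν = x
    rw [h1, hRf]
    simp only
    rw [add_assoc, ← add_smul]; simp
  set Φ : Eucl n → Eucl n := fun x => x + (2 * min (η x) 0) • ν with hΦ
  have hcase : ∀ x, Φ x = x ∨ Φ x = Rf x := by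
    intro x
    rcases le_total (η x) 0 with h | h
    · right; simp only [hΦ, hRf, min_eq_left h]
    · left; simp only [hΦ, min_eq_right h]; simp
  have hηΦ : ∀ x, 0 ≤ η (Φ x) := by
    intro x
    simp only [hΦ, hshift]
    rcases le_total (η x) 0 with h | h
    · rw [min_eq_left h]; linarith
    · rw [min_eq_right h]; linarith
  have hlin : ∀ f : Eucl n → ℝ, LipschitzWith M f → LipschitzWith (1 + 2 * M) fun x => x + (2 * f x) • ν := by
    intro f hf
    refine LipschitzWith.of_dist_le_mul fun x z => ?_
    rw [dist_eq_norm, dist_eq_norm]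
    have e : x + (2 * f x) • ν - (z + (2 * f z) • ν) = (x - z) + (2 * (f x - f z)) • ν := by
      rw [mul_sub, sub_smul]; abel
    rw [e]
    refine (norm_add_le _ _).trans ?_
    rw [norm_smul, hν, mul_one, norm_mul]
    have := hf.norm_sub_le x z
    push_cast
    rw [Real.norm_two]
    linarith
  have hΦl : LipschitzWith (1 + 2 * M) Φ := hlin _ (hηl.min_const 0)
  have hRl : LipschitzWith (1 + 2 * M) Rf := hlin _ hηl
  have hRmap := map_volume_le_of_leftInverse hRl hRl.continuous.measurable hRR
  have hUo : IsOpen {x | 0 < η x} := isOpen_lt continuous_const hηl.continuous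
  have hrk : ∀ k : ℕ, (0 : ℝ) < 1 / ((k : ℝ) + 1) := fun k => Nat.one_div_pos_of_nat
  -- The kernels have centre (M + 1)/(k + 1) ν and radius 1/(k + 1). Moving against ν raises η by (M
  -- + 1)/(k + 1), and the M-Lipschitz function η varies by at most M/(k + 1) from the centre of the
  -- ball, so the whole ball stays in {η > 0}.
  refine memLp_four_near_of_fold (U := {x | 0 < η x}) (Φ := Φ)
    (D := 1 + ((1 + 2 * M : NNReal) : ℝ≥0∞) ^ n)
    (a := ‖Rf 0‖) (b := 1 + 2 * M) hn1 hn4 hΩ hΩb hUo.measurableSet hΦl (by finiteness) ?_ ?_ ?_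
    (by positivity) (c := fun k => ((M + 1) * (1 / ((k : ℝ) + 1))) • ν)
    (φ := fun k => bumpAt _ (hrk k)) ?_ ?_ hug hu hg hr ?_ ?_
  · refine Measure.le_iff.2 fun A hA => ?_
    rw [Measure.map_apply hΦl.continuous.measurable hA, Measure.smul_apply, smul_eq_mul, add_mul,
      one_mul]
    refine (measure_mono (t := A ∪ Rf ⁻¹' A) fun x hx => ?_).trans
      ((measure_union_le _ _).trans ?_)
    · rcases hcase x with h | h
      · left; rw [mem_preimage, h] at hx; exact hx
      · right; rw [mem_preimage, h] at hx; exact hx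
    · gcongr
      have := Measure.le_iff.1 hRmap A hA
      rwa [Measure.map_apply hRl.continuous.measurable hA] at this
  · intro x hx
    simp only [hΦ, min_eq_right (le_of_lt (show 0 < η x from hx))]; simp
  · intro x
    rcases hcase x with h | h
    · rw [h]
      have := norm_nonneg (Rf 0)
      have := norm_nonneg x
      have : (0 : ℝ) ≤ M := M.2
      nlinarith
    · have h1 := hRl.norm_sub_le (Rf x) 0
      rw [hRR, sub_zero] at h1
      rw [h]
      have h2 : ‖x‖ ≤ ‖x - Rf 0‖ + ‖Rf 0‖ := by
        calc ‖x‖ = ‖(x - Rf 0) + Rf 0‖ := by simp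
          _ ≤ _ := norm_add_le _ _
      push_cast at h1
      linarith
  · have h0 : Tendsto (fun k : ℕ => ((M + 1) * (1 / ((k : ℝ) + 1))) + 1 / ((k : ℝ) + 1)) atTop
        (𝓝 ((M + 1) * 0 + 0)) :=
      (tendsto_one_div_add_atTop_nhds_zero_nat.const_mul _).add
        tendsto_one_div_add_atTop_nhds_zero_nat
    rw [mul_zero, add_zero] at h0
    refine h0.congr fun k => ?_
    rw [norm_smul, hν, mul_one, Real.norm_of_nonneg (by positivity)]
    rfl
  · intro k x z hz
    have hz' : ‖z - (Φ x - ((M + 1) * (1 / ((k : ℝ) + 1))) • ν)‖ ≤ 1 / ((k : ℝ) + 1) := by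
      rw [← dist_eq_norm]; exact hz
    have h1 := hηl.norm_sub_le z (Φ x - ((M + 1) * (1 / ((k : ℝ) + 1))) • ν)
    have h2 : η (Φ x - ((M + 1) * (1 / ((k : ℝ) + 1))) • ν)
        = η (Φ x) + (M + 1) * (1 / ((k : ℝ) + 1)) := by
      rw [sub_eq_add_neg, ← neg_smul, hshift]; ring
    rw [h2, Real.norm_eq_abs] at h1
    have h3 := (abs_le.1 h1).1
    have h4 := hηΦ x
    have h5 : (M : ℝ) * ‖z - (Φ x - ((M + 1) * (1 / ((k : ℝ) + 1))) • ν)‖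
        ≤ M * (1 / ((k : ℝ) + 1)) := by gcongr
    have h6 := hrk k
    show 0 < η z
    linarith
  · intro x hx
    have h0 : 0 < η x := hx.1
    exact (hgr x hx.2).2 (by simp only [hη] at h0; linarith)
  · intro x hx
    have := (hgr x hx.2).1 hx.1
    show 0 < η x
    simp only [hη]; linarith

/-- The Sobolev embedding `H^1(Ω) ⊆ L^4(Ω)` on bounded Lipschitz domains. -/
theorem memLp_four_of_isBoundedLipschitz (hn1 : 1 ≤ n) (hn4 : n ≤ 4) (hΩ : IsBoundedLipschitz Ω)
    (hug : HasWeakGrad Ω u g) (hu : MemLp u 2 (volume.restrict Ω))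
    (hg : MemLp g 2 (volume.restrict Ω)) : MemLp u 4 (volume.restrict Ω) := by
  obtain ⟨hΩo, hΩb, hbdry⟩ := hΩ
  have hloc : ∀ x₀ ∈ closure Ω, ∃ r > 0, MemLp u 4 (volume.restrict (Ω ∩ Metric.ball x₀ r)) := by
    intro x₀ hx₀
    by_cases hx : x₀ ∈ Ω
    · exact memLp_four_near_interior hn1 hn4 hΩo hΩb hug hu hg hx
    · obtain ⟨ν, r, K, γ, h1, h2, h3, h4⟩ := hbdry x₀ ⟨hx₀, by rwa [hΩo.interior_eq]⟩
      exact ⟨r / 4, by positivity, memLp_four_near_boundary hn1 hn4 hΩo hΩb hug hu hg h1 h2 h3 h4⟩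
  have hiff : ∀ s : Set (Eucl n), eLpNorm u 4 (volume.restrict s) < ⊤ ↔
      ∫⁻ x in s, ‖u x‖ₑ ^ (4 : ℝ≥0∞).toReal < ⊤ := fun s =>
    eLpNorm_lt_top_iff_lintegral_rpow_enorm_lt_top (by norm_num) (by norm_num)
  have hcomp : IsCompact (closure Ω) := hΩb.isCompact_closure
  -- Finiteness of ∫ |u|⁴ is a local property on the compact closure.
  have key := hcomp.induction_on
    (p := fun s => ∫⁻ x in Ω ∩ s, ‖u x‖ₑ ^ (4 : ℝ≥0∞).toReal < ⊤) (by simp)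
    (fun s t hst ht => (lintegral_mono_set (inter_subset_inter_right _ hst)).trans_lt ht)
    (fun s t hs ht => by
      rw [inter_union_distrib_left]
      exact (lintegral_union_le _ _ _).trans_lt (ENNReal.add_lt_top.2 ⟨hs, ht⟩))
    (fun x hx => by
      obtain ⟨r, hr, h⟩ := hloc x hx
      exact ⟨Metric.ball x r, mem_nhdsWithin_of_mem_nhds (Metric.ball_mem_nhds x hr),
        (hiff _).1 h.2⟩)
  rw [inter_eq_left.2 subset_closure] at key
  exact ⟨hu.1, (hiff _).2 key⟩

end SobolevLipschitz

/-! ### A calculus of convergence in Lᵖ along filters. -/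

section LpConvergence

variable {α : Type*} [MeasurableSpace α] {μ : Measure α} {ι : Type*} {l : Filter ι}

instance holderTriple_four_four_two : ENNReal.HolderTriple 4 4 2 := by
  constructor
  rw [← ENNReal.toReal_eq_toReal_iff' (by finiteness) (by finiteness),
    ENNReal.toReal_add (by finiteness) (by finiteness)]
  norm_num

theorem MeasureTheory.MemLp.lpNorm_eq {E : Type*} [NormedAddCommGroup E] {f : α → E} {p : ℝ≥0∞}
    (hf : MemLp f p μ) : lpNorm f p μ = (eLpNorm f p μ).toReal := (toReal_eLpNorm hf.1).symm

theorem lpNorm_mul_le {f g : α → ℝ} {p q r : ℝ≥0∞} [ENNReal.HolderTriple p q r]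
    (hf : MemLp f p μ) (hg : MemLp g q μ) :
    lpNorm (fun x => f x * g x) r μ ≤ lpNorm f p μ * lpNorm g q μ := by
  have h : MemLp (fun x => f x * g x) r μ := hg.mul' hf
  have h1 : eLpNorm (f • g) r μ ≤ eLpNorm f p μ * eLpNorm g q μ :=
    eLpNorm_smul_le_mul_eLpNorm hg.1 hf.1
  have h2 := ENNReal.toReal_mono (ENNReal.mul_ne_top hf.2.ne hg.2.ne) h1
  rw [ENNReal.toReal_mul] at h2
  rw [MemLp.lpNorm_eq h, MemLp.lpNorm_eq hf, MemLp.lpNorm_eq hg]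
  exact h2

theorem abs_integral_le_lpNorm {f : α → ℝ} (hf : AEStronglyMeasurable f μ) :
    |∫ x, f x ∂μ| ≤ lpNorm f 1 μ := by
  rw [lpNorm_one_eq_integral_norm hf]
  exact norm_integral_le_integral_norm f

theorem abs_integral_mul_le {f g : α → ℝ} (hf : MemLp f 2 μ) (hg : MemLp g 2 μ) :
    |∫ x, f x * g x ∂μ| ≤ lpNorm f 2 μ * lpNorm g 2 μ :=
  (abs_integral_le_lpNorm (hf.1.mul hg.1)).trans (lpNorm_mul_le hf hg)

theorem lpNorm_mono_ae {E F : Type*} [NormedAddCommGroup E] [NormedAddCommGroup F] {f : α → E}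
    {g : α → F} {p : ℝ≥0∞} (hf : AEStronglyMeasurable f μ) (hg : MemLp g p μ)
    (h : ∀ᵐ x ∂μ, ‖f x‖ ≤ ‖g x‖) : lpNorm f p μ ≤ lpNorm g p μ := by
  have hf' : MemLp f p μ := hg.of_le hf h
  rw [hf'.lpNorm_eq, hg.lpNorm_eq]
  exact ENNReal.toReal_mono hg.2.ne (eLpNorm_mono_ae h)

theorem lpNorm_congr_ae {E : Type*} [NormedAddCommGroup E] {f g : α → E} {p : ℝ≥0∞}
    (h : f =ᵐ[μ] g) : lpNorm f p μ = lpNorm g p μ := by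
  by_cases hf : AEStronglyMeasurable f μ
  · rw [← toReal_eLpNorm hf, ← toReal_eLpNorm (hf.congr h), eLpNorm_congr_ae h]
  · rw [lpNorm_of_not_aestronglyMeasurable hf,
      lpNorm_of_not_aestronglyMeasurable fun h' => hf (h'.congr h.symm)]

theorem lpNorm_two_sq {E : Type*} [NormedAddCommGroup E] {f : α → E} (hf : MemLp f 2 μ) :
    lpNorm f 2 μ ^ 2 = ∫ x, ‖f x‖ ^ 2 ∂μ := by
  rw [lpNorm_eq_integral_norm_rpow_toReal two_ne_zero (by simp) hf.1]
  have h0 : 0 ≤ ∫ x, ‖f x‖ ^ 2 ∂μ := integral_nonneg fun x => by positivity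
  simp only [ENNReal.toReal_ofNat, Real.rpow_ofNat]
  rw [← Real.rpow_natCast, ← Real.rpow_mul h0]
  norm_num

/-- `F i → f` in `L^p(μ)` along the filter `l`. -/
def TendstoLp (p : ℝ≥0∞) (μ : Measure α) (l : Filter ι) (F : ι → α → ℝ) (f : α → ℝ) : Prop :=
  (∀ᶠ i in l, MemLp (F i) p μ) ∧ MemLp f p μ ∧
    Tendsto (fun i => eLpNorm (fun x => F i x - f x) p μ) l (𝓝 0)

namespace TendstoLp

variable {p q r : ℝ≥0∞} {F G : ι → α → ℝ} {f g : α → ℝ}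

theorem const (hf : MemLp f p μ) : TendstoLp p μ l (fun _ => f) f :=
  ⟨Eventually.of_forall fun _ => hf, hf, by simpa using tendsto_const_nhds⟩

theorem congr' (hF : TendstoLp p μ l F f) (h : ∀ᶠ i in l, F i =ᵐ[μ] G i) : TendstoLp p μ l G f := by
  refine ⟨?_, hF.2.1, hF.2.2.congr' ?_⟩
  · filter_upwards [hF.1, h] with i h1 h2 using h1.ae_eq h2
  · filter_upwards [h] with i hi
    refine eLpNorm_congr_ae ?_
    filter_upwards [hi] with x hx; rw [hx]

theorem congr_lim (hF : TendstoLp p μ l F f) (h : f =ᵐ[μ] g) : TendstoLp p μ l F g := by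
  refine ⟨hF.1, hF.2.1.ae_eq h, hF.2.2.congr fun i => eLpNorm_congr_ae ?_⟩
  filter_upwards [h] with x hx; rw [hx]

theorem of_le (hf : MemLp f p μ) (hF : ∀ᶠ i in l, MemLp (F i) p μ) {b : ι → ℝ≥0∞}
    (hb : Tendsto b l (𝓝 0)) (h : ∀ᶠ i in l, eLpNorm (fun x => F i x - f x) p μ ≤ b i) :
    TendstoLp p μ l F f :=
  ⟨hF, hf, tendsto_of_tendsto_of_tendsto_of_le_of_le' tendsto_const_nhds hb
    (Eventually.of_forall fun _ => zero_le) h⟩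

theorem add (hp : 1 ≤ p) (hF : TendstoLp p μ l F f) (hG : TendstoLp p μ l G g) :
    TendstoLp p μ l (fun i x => F i x + G i x) (fun x => f x + g x) := by
  refine of_le (hF.2.1.add hG.2.1) ?_ (by simpa using hF.2.2.add hG.2.2) ?_
  · filter_upwards [hF.1, hG.1] with i h1 h2 using h1.add h2
  · filter_upwards [hF.1, hG.1] with i h1 h2
    have : (fun x => F i x + G i x - (f x + g x))
        = (fun x => F i x - f x) + fun x => G i x - g x := by ext1 x; simp; ring
    rw [this]
    exact eLpNorm_add_le (h1.sub hF.2.1).1 (h2.sub hG.2.1).1 hp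

theorem const_mul (a : ℝ) (hF : TendstoLp p μ l F f) :
    TendstoLp p μ l (fun i x => a * F i x) (fun x => a * f x) := by
  refine ⟨hF.1.mono fun i h => h.const_mul a, hF.2.1.const_mul a, ?_⟩
  have : ∀ i, eLpNorm (fun x => a * F i x - a * f x) p μ
      = ‖a‖ₑ * eLpNorm (fun x => F i x - f x) p μ := fun i => by
    rw [← eLpNorm_const_smul]
    congr 1; ext1 x; simp; ring
  simp only [this]
  simpa using ENNReal.Tendsto.const_mul hF.2.2 (Or.inr enorm_ne_top)

theorem neg (hF : TendstoLp p μ l F f) : TendstoLp p μ l (fun i x => -F i x) (fun x => -f x) := by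
  simpa using hF.const_mul (-1)

theorem sub (hp : 1 ≤ p) (hF : TendstoLp p μ l F f) (hG : TendstoLp p μ l G g) :
    TendstoLp p μ l (fun i x => F i x - G i x) (fun x => f x - g x) := by
  simpa [sub_eq_add_neg] using hF.add hp hG.neg

theorem sum {κ : Type*} (s : Finset κ) (hp : 1 ≤ p) {F : κ → ι → α → ℝ} {f : κ → α → ℝ}
    (h : ∀ k ∈ s, TendstoLp p μ l (F k) (f k)) :
    TendstoLp p μ l (fun i x => ∑ k ∈ s, F k i x) (fun x => ∑ k ∈ s, f k x) := by
  classical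
  induction s using Finset.induction_on with
  | empty => simpa using const (l := l) (MemLp.zero' (p := p) (μ := μ) (ε := ℝ))
  | insert a s ha ih =>
    simp only [Finset.sum_insert ha]
    exact (h a (Finset.mem_insert_self _ _)).add hp
      (ih fun k hk => h k (Finset.mem_insert_of_mem hk))

theorem mono [IsFiniteMeasure μ] (hpq : p ≤ q) (hF : TendstoLp q μ l F f) :
    TendstoLp p μ l F f := by
  have hc : μ univ ^ (1 / p.toReal - 1 / q.toReal) ≠ ⊤ ∨ p = 0 := by
    by_cases hp0 : p = 0
    · exact Or.inr hp0
    left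
    by_cases hq : q = ⊤
    · subst hq; simp only [ENNReal.toReal_top, div_zero, sub_zero]; finiteness
    · have hp : p ≠ ⊤ := ne_top_of_le_ne_top hq hpq
      refine (ENNReal.rpow_lt_top_of_nonneg ?_ (measure_ne_top μ _)).ne
      have h1 : p.toReal ≤ q.toReal := ENNReal.toReal_mono hq hpq
      have h2 : 0 < p.toReal := ENNReal.toReal_pos hp0 hp
      have := one_div_le_one_div_of_le h2 h1
      linarith
  refine ⟨hF.1.mono fun i h => h.mono_exponent hpq, hF.2.1.mono_exponent hpq, ?_⟩
  rcases hc with hc | rfl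
  · have ht : Tendsto (fun i => eLpNorm (fun x => F i x - f x) q μ
        * μ univ ^ (1 / p.toReal - 1 / q.toReal)) l (𝓝 0) := by
      simpa using ENNReal.Tendsto.mul_const hF.2.2 (Or.inr hc)
    refine tendsto_of_tendsto_of_tendsto_of_le_of_le' tendsto_const_nhds ht
      (Eventually.of_forall fun _ => zero_le) ?_
    filter_upwards [hF.1] with i hi
    exact eLpNorm_le_eLpNorm_mul_rpow_measure_univ hpq (hi.sub hF.2.1).1
  · simpa using tendsto_const_nhds

theorem mul [hpqr : ENNReal.HolderTriple p q r] (hr : 1 ≤ r) (hF : TendstoLp p μ l F f)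
    (hG : TendstoLp q μ l G g) : TendstoLp r μ l (fun i x => F i x * G i x) (fun x => f x * g x) := by
  refine of_le (hG.2.1.mul' hF.2.1) ?_ (b := fun i =>
    eLpNorm (fun x => F i x - f x) p μ * eLpNorm (fun x => G i x - g x) q μ
      + eLpNorm (fun x => F i x - f x) p μ * eLpNorm g q μ
      + eLpNorm f p μ * eLpNorm (fun x => G i x - g x) q μ) ?_ ?_
  · filter_upwards [hF.1, hG.1] with i h1 h2 using h2.mul' h1
  · have h1 := ENNReal.Tendsto.mul hF.2.2 (Or.inr ENNReal.zero_ne_top) hG.2.2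
      (Or.inr ENNReal.zero_ne_top)
    have h2 := ENNReal.Tendsto.mul_const (b := eLpNorm g q μ) hF.2.2 (Or.inr hG.2.1.2.ne)
    have h3 := ENNReal.Tendsto.const_mul (a := eLpNorm f p μ) hG.2.2 (Or.inr hF.2.1.2.ne)
    simpa using (h1.add h2).add h3
  · filter_upwards [hF.1, hG.1] with i h1 h2
    have a1 : AEStronglyMeasurable (fun x => F i x - f x) μ := (h1.sub hF.2.1).1
    have a2 : AEStronglyMeasurable (fun x => G i x - g x) μ := (h2.sub hG.2.1).1
    have e : (fun x => F i x * G i x - f x * g x)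
        = ((fun x => F i x - f x) • (fun x => G i x - g x) + (fun x => F i x - f x) • g)
          + f • (fun x => G i x - g x) := by ext1 x; simp; ring
    rw [e]
    refine (eLpNorm_add_le ((a1.smul a2).add (a1.smul hG.2.1.1)) (hF.2.1.1.smul a2) hr).trans ?_
    refine add_le_add ((eLpNorm_add_le (a1.smul a2) (a1.smul hG.2.1.1) hr).trans
      (add_le_add ?_ ?_)) ?_
    · exact eLpNorm_smul_le_mul_eLpNorm a2 a1
    · exact eLpNorm_smul_le_mul_eLpNorm hG.2.1.1 a1
    · exact eLpNorm_smul_le_mul_eLpNorm a2 hF.2.1.1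

theorem integral (hF : TendstoLp 1 μ l F f) :
    Tendsto (fun i => ∫ x, F i x ∂μ) l (𝓝 (∫ x, f x ∂μ)) := by
  refine tendsto_integral_of_L1' f hF.2.1.1
    (hF.1.mono fun i h => memLp_one_iff_integrable.1 h) hF.2.2

theorem tendsto_lpNorm_sub (hF : TendstoLp p μ l F f) :
    Tendsto (fun i => lpNorm (fun x => F i x - f x) p μ) l (𝓝 0) := by
  have h := (ENNReal.tendsto_toReal ENNReal.zero_ne_top).comp hF.2.2
  rw [ENNReal.toReal_zero] at h
  refine h.congr' ?_
  filter_upwards [hF.1] with i hi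
  exact ((hi.sub hF.2.1).lpNorm_eq).symm

end TendstoLp

theorem tendsto_eLpNorm_of_dominated {E F : Type*} [NormedAddCommGroup E] [NormedAddCommGroup F]
    {p : ℝ≥0∞} (hp0 : p ≠ 0) (hp : p ≠ ⊤)
    {w : ℕ → α → E} {h : α → F} (hw : ∀ k, AEStronglyMeasurable (w k) μ) (hh : MemLp h p μ) {C : ℝ}
    (hb : ∀ k, ∀ᵐ x ∂μ, ‖w k x‖ ≤ C * ‖h x‖)
    (hlim : ∀ᵐ x ∂μ, Tendsto (fun k => w k x) atTop (𝓝 0)) :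
    Tendsto (fun k => eLpNorm (w k) p μ) atTop (𝓝 0) := by
  have hpr : 0 < p.toReal := ENNReal.toReal_pos hp0 hp
  have key : Tendsto (fun k => ∫⁻ x, ‖w k x‖ₑ ^ p.toReal ∂μ) atTop (𝓝 (∫⁻ _, 0 ∂μ)) := by
    refine tendsto_lintegral_of_dominated_convergence' (fun x => ‖C • ‖h x‖‖ₑ ^ p.toReal)
      (fun k => (hw k).enorm.pow_const _) (fun k => ?_) ?_ ?_
    · filter_upwards [hb k] with x hx
      refine ENNReal.rpow_le_rpow ?_ hpr.le
      rw [← ofReal_norm, ← ofReal_norm]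
      exact ENNReal.ofReal_le_ofReal (hx.trans (le_abs_self _))
    · exact ((eLpNorm_lt_top_iff_lintegral_rpow_enorm_lt_top hp0 hp).1
        (hh.norm.const_smul C).2).ne
    · filter_upwards [hlim] with x hx
      have h1 : Tendsto (fun k => ‖w k x‖ₑ) atTop (𝓝 0) := by simpa using hx.enorm
      have h2 := (ENNReal.continuous_rpow_const (y := p.toReal)).continuousAt.tendsto.comp h1
      rw [ENNReal.zero_rpow_of_pos hpr] at h2
      exact h2
  rw [lintegral_zero] at key
  have h3 := (ENNReal.continuous_rpow_const (y := 1 / p.toReal)).continuousAt.tendsto.comp key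
  rw [ENNReal.zero_rpow_of_pos (by positivity)] at h3
  refine h3.congr fun k => ?_
  rw [eLpNorm_eq_lintegral_rpow_enorm_toReal hp0 hp]
  rfl

theorem exists_subseq_ae_tendsto {E : Type*} [NormedAddCommGroup E] {p : ℝ≥0∞} (hp0 : p ≠ 0)
    {w : ℕ → α → E} {u : α → E} (hw : ∀ᶠ k in atTop, AEStronglyMeasurable (w k) μ)
    (hu : AEStronglyMeasurable u μ)
    (h : Tendsto (fun k => eLpNorm (fun x => w k x - u x) p μ) atTop (𝓝 0)) :
    ∃ ns : ℕ → ℕ, Tendsto ns atTop atTop ∧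
      ∀ᵐ x ∂μ, Tendsto (fun k => w (ns k) x) atTop (𝓝 (u x)) := by
  obtain ⟨N, hN⟩ := eventually_atTop.1 hw
  have h' := h.comp (tendsto_add_atTop_nat N)
  obtain ⟨ns, h1, h2⟩ := (tendstoInMeasure_of_tendsto_eLpNorm hp0 (fun k => hN (k + N) (by omega)) hu
    (f := fun k => w (k + N)) h').exists_seq_tendsto_ae
  exact ⟨fun k => ns k + N, (tendsto_add_atTop_nat N).comp h1.tendsto_atTop, h2⟩

/-- Dominated convergence in `L^p` when the pointwise convergence is inherited, by continuity, from
two families that converge in `L^2`. -/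
theorem tendsto_eLpNorm_of_continuous_comp [l.IsCountablyGenerated] {p : ℝ≥0∞} (hp0 : p ≠ 0)
    (hp : p ≠ ⊤) {Ψ : ℝ × ℝ × ℝ → ℝ} (hΨ : Continuous Ψ) (hΨ0 : ∀ s, Ψ (s, s, s) = 0) {C : ℝ}
    (hC : ∀ z, |Ψ z| ≤ C) {F G : ι → α → ℝ} {f h : α → ℝ} (hF : TendstoLp 2 μ l F f)
    (hG : TendstoLp 2 μ l G f) (hh : MemLp h p μ) :
    Tendsto (fun i => eLpNorm (fun x => Ψ (F i x, G i x, f x) * h x) p μ) l (𝓝 0) := by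
  -- It suffices to refine every sequence. Two successive extractions give almost everywhere
  -- convergence of both families; the shift by N discards the indices at which measurability may
  -- fail.
  refine tendsto_of_subseq_tendsto fun ts hts => ?_
  obtain ⟨n₁, a1, a2⟩ := exists_subseq_ae_tendsto (w := fun k => F (ts k)) two_ne_zero
    (hts.eventually (hF.1.mono fun i h => h.1)) hF.2.1.1 (hF.2.2.comp hts)
  have hts1 : Tendsto (fun k => ts (n₁ k)) atTop l := hts.comp a1
  obtain ⟨n₂, b1, b2⟩ := exists_subseq_ae_tendsto (w := fun k => G (ts (n₁ k))) two_ne_zero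
    (hts1.eventually (hG.1.mono fun i h => h.1)) hG.2.1.1 (hG.2.2.comp hts1)
  have hts2 : Tendsto (fun k => ts (n₁ (n₂ k))) atTop l := hts1.comp b1
  obtain ⟨N, hN⟩ := eventually_atTop.1 ((hts2.eventually (hF.1.and hG.1)))
  refine ⟨fun k => n₁ (n₂ (k + N)), ?_⟩
  have hm : ∀ k, AEStronglyMeasurable
      (fun x => Ψ (F (ts (n₁ (n₂ (k + N)))) x, G (ts (n₁ (n₂ (k + N)))) x, f x) * h x) μ := fun k => by
    obtain ⟨c1, c2⟩ := hN (k + N) (by omega)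
    exact (hΨ.comp_aestronglyMeasurable (c1.1.prodMk (c2.1.prodMk hF.2.1.1))).mul hh.1
  refine tendsto_eLpNorm_of_dominated hp0 hp hm hh (C := C) (fun k => ae_of_all _ fun x => ?_) ?_
  · rw [norm_mul]; gcongr; exact hC _
  · filter_upwards [a2, b2] with x h1 h2
    have h1' := (h1.comp b1).comp (tendsto_add_atTop_nat N)
    have h2' := h2.comp (tendsto_add_atTop_nat N)
    have h3 := (hΨ.tendsto (f x, f x, f x)).comp (h1'.prodMk_nhds (h2'.prodMk_nhds tendsto_const_nhds))
    rw [hΨ0] at h3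
    have := h3.mul_const (h x)
    rwa [zero_mul] at this

end LpConvergence

/-! ### First-order jets: the form a as a matrix acting on (u, ∇u). -/

section Jets

/-- The space of first-order jets: the value (index `none`) and the partial derivatives. -/
abbrev Jet (n : ℕ) := EuclideanSpace ℝ (Option (Fin n))

/-- The jet with value `s` and gradient `ξ`. -/
def mkJet {n : ℕ} (s : ℝ) (ξ : Eucl n) : Jet n := WithLp.toLp 2 (fun o => o.elim s ξ)

/-- The gradient part of a jet. -/
def Jet.grad {n : ℕ} (U : Jet n) : Eucl n := WithLp.toLp 2 (fun i => U (some i))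

/-- The first-order jet of a weakly differentiable function. -/
noncomputable def jet {n : ℕ} (Ω : Set (Eucl n)) (u : Eucl n → ℝ) (x : Eucl n) : Jet n :=
  mkJet (u x) (weakGrad Ω u x)

/-- The coefficients of the bilinear form, acting on first-order jets. -/
def ProblemData.coeff {n : ℕ} (D : ProblemData n) (x : Eucl n) :
    Option (Fin n) → Option (Fin n) → ℝ
  | some i, some j => D.M x i j
  | some i, none => D.d x i
  | none, some i => D.d x i
  | none, none => D.b x

/-- The bilinear form on first-order jets. -/
def ProblemData.jetForm {n : ℕ} (D : ProblemData n) (x : Eucl n) (U W : Jet n) : ℝ :=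
  ∑ α, ∑ β, D.coeff x α β * U α * W β

variable {n : ℕ} {Ω : Set (Eucl n)} {D : ProblemData n} {u v w : Eucl n → ℝ}

@[simp] theorem mkJet_none (s : ℝ) (ξ : Eucl n) : mkJet s ξ none = s := rfl

@[simp] theorem mkJet_some (s : ℝ) (ξ : Eucl n) (i : Fin n) : mkJet s ξ (some i) = ξ i := rfl

@[simp] theorem Jet.grad_apply (U : Jet n) (i : Fin n) : U.grad i = U (some i) := rfl

@[simp] theorem jet_none (x : Eucl n) : jet Ω u x none = u x := rfl

@[simp] theorem jet_some (x : Eucl n) (i : Fin n) : jet Ω u x (some i) = weakGrad Ω u x i := rfl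

theorem Jet.norm_sq (U : Jet n) : ‖U‖ ^ 2 = U none ^ 2 + ‖U.grad‖ ^ 2 := by
  simp [EuclideanSpace.norm_sq_eq, Fintype.sum_option]

theorem Jet.abs_apply_le (U : Jet n) (o : Option (Fin n)) : |U o| ≤ ‖U‖ := by
  simpa using PiLp.norm_apply_le U o

theorem Jet.norm_grad_le (U : Jet n) : ‖U.grad‖ ≤ ‖U‖ := by
  have h := U.norm_sq
  refine abs_le_of_sq_le_sq' ?_ (norm_nonneg _) |>.2
  nlinarith [sq_nonneg (U none)]

/-- M, d and b become the blocks of a single (n + 1) × (n + 1) matrix, so later expansions treat all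
terms of the form at once. -/
theorem formIntegrand_eq (x : Eucl n) :
    formIntegrand D Ω u v x = D.jetForm x (jet Ω u x) (jet Ω v x) := by
  simp only [formIntegrand, ProblemData.jetForm, Fintype.sum_option, ProblemData.coeff, jet_none,
    jet_some, mul_add, Finset.sum_add_distrib]
  have h : ∀ i, D.d x i * (u x * weakGrad Ω v x i) = D.d x i * u x * weakGrad Ω v x i := fun i => by
    ring
  have h' : ∀ i, D.d x i * (weakGrad Ω u x i * v x) = D.d x i * weakGrad Ω u x i * v x := fun i => by
    ring
  simp only [h, h']
  ring

theorem ProblemData.jetForm_sub_left (x : Eucl n) (U U' W : Jet n) :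
    D.jetForm x (U - U') W = D.jetForm x U W - D.jetForm x U' W := by
  simp only [ProblemData.jetForm, ← Finset.sum_sub_distrib, PiLp.sub_apply]
  exact Finset.sum_congr rfl fun _ _ => Finset.sum_congr rfl fun _ _ => by ring

theorem ProblemData.jetForm_sub_right (x : Eucl n) (U W W' : Jet n) :
    D.jetForm x U (W - W') = D.jetForm x U W - D.jetForm x U W' := by
  simp only [ProblemData.jetForm, ← Finset.sum_sub_distrib, PiLp.sub_apply]
  exact Finset.sum_congr rfl fun _ _ => Finset.sum_congr rfl fun _ _ => by ring

theorem memLp_jet_iff {μ : Measure (Eucl n)} {p : ℝ≥0∞} {U : Eucl n → Jet n} :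
    MemLp U p μ ↔ MemLp (fun x => U x none) p μ ∧ MemLp (fun x => (U x).grad) p μ := by
  rw [memLp_piLp_iff, Option.forall, memLp_piLp_iff]
  rfl

theorem memLp_jet {p : ℝ≥0∞} (hu : MemLp u p (volume.restrict Ω))
    (hg : MemLp (weakGrad Ω u) p (volume.restrict Ω)) : MemLp (jet Ω u) p (volume.restrict Ω) :=
  memLp_jet_iff.2 ⟨hu, hg⟩

theorem MemW1.memLp_jet {p : ℝ≥0∞} (hu : MemW1 Ω p u) : MemLp (jet Ω u) p (volume.restrict Ω) :=
  _root_.memLp_jet hu.1 hu.2.2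

theorem MemH10.memLp_jet (hu : MemH10 Ω u) : MemLp (jet Ω u) 2 (volume.restrict Ω) :=
  MemW1.memLp_jet hu.1

theorem MemH10.memLp (hu : MemH10 Ω u) : MemLp u 2 (volume.restrict Ω) := hu.1.1

theorem H10Pair.jet_ae {g : Eucl n → Eucl n} (hΩ : IsOpen Ω) (hu : H10Pair Ω u g) :
    jet Ω u =ᵐ[volume.restrict Ω] fun x => mkJet (u x) (g x) := by
  filter_upwards [hu.weakGrad_ae hΩ] with x hx
  simp [jet, hx]

theorem mkJet_sub (s s' : ℝ) (ξ ξ' : Eucl n) : mkJet (s - s') (ξ - ξ') = mkJet s ξ - mkJet s' ξ' := by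
  ext o; cases o <;> simp

theorem mkJet_smul (a s : ℝ) (ξ : Eucl n) : mkJet (a * s) (a • ξ) = a • mkJet s ξ := by
  ext o; cases o <;> simp

theorem jet_sub_ae (hΩ : IsOpen Ω) (hu : MemH10 Ω u) (hv : MemH10 Ω v) :
    jet Ω (fun x => u x - v x) =ᵐ[volume.restrict Ω] fun x => jet Ω u x - jet Ω v x := by
  filter_upwards [(hu.pair.sub hv.pair).jet_ae hΩ] with x hx
  rw [hx, mkJet_sub]
  rfl

theorem h1NormSq_eq (hu : MemLp (jet Ω u) 2 (volume.restrict Ω)) :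
    h1NormSq Ω u = lpNorm (jet Ω u) 2 (volume.restrict Ω) ^ 2 := by
  obtain ⟨h1, h2⟩ := memLp_jet_iff.1 hu
  rw [lpNorm_two_sq hu, h1NormSq, ← integral_add]
  · simp only [Jet.norm_sq]; rfl
  · simpa using h1.integrable_norm_pow two_ne_zero
  · exact h2.integrable_norm_pow two_ne_zero

theorem lpNorm_le_lpNorm_jet {p : ℝ≥0∞} (hu : MemLp (jet Ω u) p (volume.restrict Ω)) :
    lpNorm u p (volume.restrict Ω) ≤ lpNorm (jet Ω u) p (volume.restrict Ω) :=
  lpNorm_mono_ae (memLp_jet_iff.1 hu).1.1 hu (ae_of_all _ fun x => (jet Ω u x).abs_apply_le none)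

theorem lpNorm_weakGrad_le_lpNorm_jet {p : ℝ≥0∞} (hu : MemLp (jet Ω u) p (volume.restrict Ω)) :
    lpNorm (weakGrad Ω u) p (volume.restrict Ω) ≤ lpNorm (jet Ω u) p (volume.restrict Ω) :=
  lpNorm_mono_ae (memLp_jet_iff.1 hu).2.1 hu (ae_of_all _ fun x => (jet Ω u x).norm_grad_le)

theorem MeasureTheory.MemLp.exists_ae_abs_le {α : Type*} [MeasurableSpace α] {μ : Measure α}
    {f : α → ℝ} (hf : MemLp f ⊤ μ) : ∃ B : ℝ, 0 ≤ B ∧ ∀ᵐ x ∂μ, |f x| ≤ B := by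
  refine ⟨(eLpNorm f ⊤ μ).toReal, ENNReal.toReal_nonneg, ?_⟩
  have h := ae_le_eLpNormEssSup (f := f) (μ := μ)
  filter_upwards [h] with x hx
  rw [eLpNorm_exponent_top] at *
  have := ENNReal.toReal_mono (by simpa using hf.2.ne) hx
  simpa using this

theorem exists_ae_abs_coeff_le {μ : Measure (Eucl n)}
    (hA : ∀ α β, MemLp (fun x => D.coeff x α β) ⊤ μ) :
    ∃ B : ℝ, 0 ≤ B ∧ ∀ᵐ x ∂μ, ∀ α β, |D.coeff x α β| ≤ B := by
  choose B hB0 hB using fun α β => (hA α β).exists_ae_abs_le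
  refine ⟨∑ α, ∑ β, B α β, Finset.sum_nonneg fun α _ => Finset.sum_nonneg fun β _ => hB0 α β, ?_⟩
  filter_upwards [ae_all_iff.2 fun α => ae_all_iff.2 fun β => hB α β] with x hx α β
  refine (hx α β).trans ?_
  refine (Finset.single_le_sum (f := fun β => B α β) (fun β _ => hB0 α β) (Finset.mem_univ β)).trans ?_
  exact Finset.single_le_sum (f := fun α => ∑ β, B α β)
    (fun α _ => Finset.sum_nonneg fun β _ => hB0 α β) (Finset.mem_univ α)

theorem integrable_jetForm {μ : Measure (Eucl n)} (hA : ∀ α β, MemLp (fun x => D.coeff x α β) ⊤ μ)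
    {U W : Eucl n → Jet n} (hU : MemLp U 2 μ) (hW : MemLp W 2 μ) :
    Integrable (fun x => D.jetForm x (U x) (W x)) μ := by
  refine integrable_finsetSum _ fun α _ => integrable_finsetSum _ fun β _ => ?_
  have h1 : MemLp (fun x => D.coeff x α β * U x α) 2 μ := (hU.eval_piLp α).mul' (hA α β)
  exact memLp_one_iff_integrable.1 ((hW.eval_piLp β).mul' h1)

theorem integrable_formIntegrand (hA : ∀ α β, MemLp (fun x => D.coeff x α β) ⊤ (volume.restrict Ω))
    (hu : MemH10 Ω u) (hv : MemH10 Ω v) :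
    Integrable (formIntegrand D Ω u v) (volume.restrict Ω) := by
  refine (integrable_jetForm hA hu.memLp_jet hv.memLp_jet).congr (ae_of_all _ fun x => ?_)
  exact (formIntegrand_eq x).symm

theorem bilinForm_sub_left (hΩ : IsOpen Ω)
    (hA : ∀ α β, MemLp (fun x => D.coeff x α β) ⊤ (volume.restrict Ω))
    (hu : MemH10 Ω u) (hv : MemH10 Ω v) (hw : MemH10 Ω w) :
    bilinForm D Ω (fun x => u x - v x) w = bilinForm D Ω u w - bilinForm D Ω v w := by
  rw [bilinForm, bilinForm, bilinForm, ← integral_sub (integrable_formIntegrand hA hu hw)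
    (integrable_formIntegrand hA hv hw)]
  refine integral_congr_ae ?_
  filter_upwards [jet_sub_ae hΩ hu hv] with x hx
  rw [formIntegrand_eq, formIntegrand_eq, formIntegrand_eq, hx, D.jetForm_sub_left]

theorem bilinForm_sub_right (hΩ : IsOpen Ω)
    (hA : ∀ α β, MemLp (fun x => D.coeff x α β) ⊤ (volume.restrict Ω))
    (hu : MemH10 Ω u) (hv : MemH10 Ω v) (hw : MemH10 Ω w) :
    bilinForm D Ω w (fun x => u x - v x) = bilinForm D Ω w u - bilinForm D Ω w v := by
  rw [bilinForm, bilinForm, bilinForm, ← integral_sub (integrable_formIntegrand hA hw hu)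
    (integrable_formIntegrand hA hw hv)]
  refine integral_congr_ae ?_
  filter_upwards [jet_sub_ae hΩ hu hv] with x hx
  rw [formIntegrand_eq, formIntegrand_eq, formIntegrand_eq, hx, D.jetForm_sub_right]

end Jets

/-! ### The smoothed maximum as a monotone 1-Lipschitz nonlinearity. -/

section RegularMax

/-- A `C^1` function with derivative in `[0, 1]`. -/
structure IsRegularMax (m : ℝ → ℝ) : Prop where
  contDiff : ContDiff ℝ 1 m
  deriv_mem : ∀ x, deriv m x ∈ Icc (0 : ℝ) 1

namespace IsRegularMax

variable {m : ℝ → ℝ} {α : Type*} [MeasurableSpace α] {μ : Measure α}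

theorem differentiable (hm : IsRegularMax m) : Differentiable ℝ m :=
  hm.contDiff.differentiable one_ne_zero

theorem continuous_deriv (hm : IsRegularMax m) : Continuous (deriv m) :=
  hm.contDiff.continuous_deriv le_rfl

theorem abs_deriv_le (hm : IsRegularMax m) (x : ℝ) : |deriv m x| ≤ 1 :=
  abs_le.2 ⟨by linarith [(hm.deriv_mem x).1], (hm.deriv_mem x).2⟩

theorem lipschitz (hm : IsRegularMax m) : LipschitzWith 1 m :=
  lipschitzWith_of_nnnorm_deriv_le hm.differentiable fun x => by
    rw [← NNReal.coe_le_coe]; simpa using hm.abs_deriv_le x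

theorem abs_sub_le (hm : IsRegularMax m) (a b : ℝ) : |m a - m b| ≤ |a - b| := by
  simpa [Real.dist_eq] using hm.lipschitz.dist_le_mul a b

theorem monotone (hm : IsRegularMax m) : Monotone m :=
  monotone_of_deriv_nonneg hm.differentiable fun x => (hm.deriv_mem x).1

theorem mul_sub_nonneg (hm : IsRegularMax m) (a b : ℝ) : 0 ≤ (m a - m b) * (a - b) := by
  rcases le_total a b with h | h
  · exact mul_nonneg_of_nonpos_of_nonpos (sub_nonpos.2 (hm.monotone h)) (sub_nonpos.2 h)
  · exact mul_nonneg (sub_nonneg.2 (hm.monotone h)) (sub_nonneg.2 h)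

theorem memLp [IsFiniteMeasure μ] (hm : IsRegularMax m) {p : ℝ≥0∞} {u : α → ℝ} (hu : MemLp u p μ) :
    MemLp (fun x => m (u x)) p μ := by
  refine ((memLp_const |m 0|).add hu.norm).of_le
    (hm.contDiff.continuous.comp_aestronglyMeasurable hu.1) (ae_of_all _ fun x => ?_)
  have h := hm.abs_sub_le (u x) 0
  rw [sub_zero] at h
  simp only [Real.norm_eq_abs, Pi.add_apply]
  rw [abs_of_nonneg (by positivity : 0 ≤ |m 0| + |u x|)]
  calc |m (u x)| = |(m (u x) - m 0) + m 0| := by ring_nf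
    _ ≤ |m (u x) - m 0| + |m 0| := abs_add_le _ _
    _ ≤ |m 0| + |u x| := by linarith

theorem memLp_deriv [IsFiniteMeasure μ] (hm : IsRegularMax m) {p : ℝ≥0∞} {u : α → ℝ}
    (hu : AEStronglyMeasurable u μ) : MemLp (fun x => deriv m (u x)) p μ :=
  (memLp_const (1 : ℝ)).of_le (hm.continuous_deriv.comp_aestronglyMeasurable hu)
    (ae_of_all _ fun x => by simpa using hm.abs_deriv_le (u x))

end IsRegularMax

end RegularMax

/-! ### A priori bound and uniqueness for the state equation. -/

section Elliptic

variable {n : ℕ} {Ω : Set (Eucl n)} {D : ProblemData n} {κ c : ℝ} {m : ℝ → ℝ}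

/-- The assumptions on the data under which the state equation is uniquely solvable. -/
structure IsEllipticData (D : ProblemData n) (Ω : Set (Eucl n)) (κ : ℝ) : Prop where
  isOpen : IsOpen Ω
  isBounded : Bornology.IsBounded Ω
  coeff_memLp : ∀ α β, MemLp (fun x => D.coeff x α β) ⊤ (volume.restrict Ω)
  pos : 0 < κ
  coercive : ∀ u, MemH10 Ω u → κ * h1NormSq Ω u ≤ bilinForm D Ω u u
  f_memLp : MemLp D.f 2 (volume.restrict Ω)
  φ_memLp : MemLp D.φ 2 (volume.restrict Ω)
  lam_memLp : MemLp D.lam 2 (volume.restrict Ω)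

theorem Bornology.IsBounded.isFiniteMeasure_restrict (hb : Bornology.IsBounded Ω) :
    IsFiniteMeasure (volume.restrict Ω) := ⟨by simpa using hb.measure_lt_top⟩

namespace IsEllipticData

theorem isFiniteMeasure (h : IsEllipticData D Ω κ) : IsFiniteMeasure (volume.restrict Ω) :=
  h.isBounded.isFiniteMeasure_restrict

theorem memLp_arg (h : IsEllipticData D Ω κ) {u : Eucl n → ℝ} (hu : MemLp u 2 (volume.restrict Ω)) :
    MemLp (fun x => D.lam x + c * (u x - D.φ x)) 2 (volume.restrict Ω) :=
  h.lam_memLp.add ((hu.sub h.φ_memLp).const_mul c)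

/-- Coercivity gives κJ² ≤ a(z, z) ≤ AJ with J the H¹ norm of z; divide by J unless it is zero. -/
theorem lpNorm_jet_le_of_bilinForm_le (h : IsEllipticData D Ω κ) {z : Eucl n → ℝ} (hz : MemH10 Ω z)
    {A : ℝ} (hA0 : 0 ≤ A) (hA : bilinForm D Ω z z ≤ A * lpNorm (jet Ω z) 2 (volume.restrict Ω)) :
    lpNorm (jet Ω z) 2 (volume.restrict Ω) ≤ A / κ := by
  have h1 := h.coercive z hz
  rw [h1NormSq_eq hz.memLp_jet] at h1
  have h0 : 0 ≤ lpNorm (jet Ω z) 2 (volume.restrict Ω) := lpNorm_nonneg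
  rcases h0.eq_or_lt with h0 | h0
  · rw [← h0]
    exact div_nonneg hA0 h.pos.le
  · rw [le_div_iff₀ h.pos]
    nlinarith

/-- The difference of two states, for two shifts, tested with an element of `H^1_0`. -/
theorem bilinForm_state_sub (h : IsEllipticData D Ω κ) (hm : IsRegularMax m) {l₁ l₂ : Eucl n → ℝ}
    (h₁ : MemLp l₁ 2 (volume.restrict Ω)) (h₂ : MemLp l₂ 2 (volume.restrict Ω))
    {y₁ y₂ : Eucl n → ℝ} (hy₁ : IsState { D with lam := l₁ } m c Ω y₁)
    (hy₂ : IsState { D with lam := l₂ } m c Ω y₂) {v : Eucl n → ℝ} (hv : MemH10 Ω v) :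
    bilinForm D Ω (fun x => y₁ x - y₂ x) v
      = - ∫ x in Ω, (m (l₁ x + c * (y₁ x - D.φ x)) - m (l₂ x + c * (y₂ x - D.φ x))) * v x := by
  have := h.isFiniteMeasure
  have e₁ := hy₁.2 v hv
  have e₂ := hy₂.2 v hv
  have i : ∀ {l y : Eucl n → ℝ}, MemLp l 2 (volume.restrict Ω) → MemLp y 2 (volume.restrict Ω) →
      Integrable (fun x => m (l x + c * (y x - D.φ x)) * v x) (volume.restrict Ω) := fun hl hy =>
    MemLp.integrable_mul (hm.memLp (hl.add ((hy.sub h.φ_memLp).const_mul c))) hv.memLp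
  rw [bilinForm_sub_left h.isOpen h.coeff_memLp hy₁.1 hy₂.1 hv]
  simp only [sub_mul]
  rw [integral_sub (i h₁ hy₁.1.memLp) (i h₂ hy₂.1.memLp)]
  have e : ∀ l u, bilinForm { D with lam := l } Ω u v = bilinForm D Ω u v := fun _ _ => rfl
  rw [e] at e₁ e₂
  linarith

/-- Test the difference of the equations with z − y. The nonlinear part has a good sign, since m is
monotone and the two arguments differ by c(z − y); coercivity then forces the L² norm of z − y to
vanish. -/
theorem state_unique (h : IsEllipticData D Ω κ) (hm : IsRegularMax m) (hc : 0 < c)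
    {y z : Eucl n → ℝ} (hy : IsState D m c Ω y) (hz : IsState D m c Ω z) :
    z =ᵐ[volume.restrict Ω] y := by
  have hzy := hz.1.sub h.isOpen hy.1
  have e := h.bilinForm_state_sub hm h.lam_memLp h.lam_memLp hz hy hzy
  have h0 : 0 ≤ ∫ x in Ω, (m (D.lam x + c * (z x - D.φ x)) - m (D.lam x + c * (y x - D.φ x)))
      * (z x - y x) := integral_nonneg fun x => by
    have := hm.mul_sub_nonneg (D.lam x + c * (z x - D.φ x)) (D.lam x + c * (y x - D.φ x))
    have e : D.lam x + c * (z x - D.φ x) - (D.lam x + c * (y x - D.φ x)) = c * (z x - y x) := by ring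
    rw [e, mul_left_comm] at this
    exact nonneg_of_mul_nonneg_right this hc
  have h1 := h.coercive _ hzy
  have h2 : h1NormSq Ω (fun x => z x - y x) ≤ 0 := by
    by_contra h'
    have := mul_pos h.pos (not_le.1 h')
    linarith
  have h3 : ∫ x in Ω, (z x - y x) ^ 2 ≤ 0 :=
    le_trans (le_add_of_nonneg_right (integral_nonneg fun x => by positivity)) h2
  have h4 := (integral_eq_zero_iff_of_nonneg (μ := volume.restrict Ω)
    (f := fun x => (z x - y x) ^ 2) (fun x => by positivity)
    (by simpa using hzy.memLp.integrable_norm_pow two_ne_zero)).1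
    (le_antisymm h3 (integral_nonneg fun x => by positivity))
  filter_upwards [h4] with x hx
  have : (z x - y x) ^ 2 = 0 := hx
  nlinarith [pow_eq_zero_iff (two_ne_zero) |>.1 this]

end IsEllipticData

end Elliptic

/-- A strongly monotone Lipschitz operator on a Hilbert space has a zero. -/
theorem exists_eq_zero_of_strongly_monotone {H : Type*} [NormedAddCommGroup H]
    [InnerProductSpace ℝ H] [CompleteSpace H] {G : H → H} {L κ : ℝ} (hκ : 0 < κ)
    (hL : ∀ u v, ‖G u - G v‖ ≤ L * ‖u - v‖)
    (hmono : ∀ u v, κ * ‖u - v‖ ^ 2 ≤ inner ℝ (G u - G v) (u - v)) : ∃ u, G u = 0 := by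
  -- Enlarging L to at least κ makes 1 − κ²/Λ² nonnegative. With τ = κ/Λ² the map u ↦ u − τG(u)
  -- expands squared distances by at most 1 − 2τκ + τ²Λ² = 1 − κ²/Λ² < 1, so it is a contraction,
  -- and its fixed point is a zero of G.
  set Λ : ℝ := max L κ
  have hΛ : 0 < Λ := hκ.trans_le (le_max_right _ _)
  set τ : ℝ := κ / Λ ^ 2
  have hτ : 0 < τ := by positivity
  set q : ℝ := Real.sqrt (1 - κ ^ 2 / Λ ^ 2)
  have hq0 : 0 ≤ 1 - κ ^ 2 / Λ ^ 2 := by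
    rw [sub_nonneg, div_le_one (by positivity)]
    exact pow_le_pow_left₀ hκ.le (le_max_right _ _) 2
  have hq1 : q < 1 := by
    rw [Real.sqrt_lt' one_pos]
    have : 0 < κ ^ 2 / Λ ^ 2 := by positivity
    linarith
  have key : ∀ u v, ‖(u - τ • G u) - (v - τ • G v)‖ ≤ q * ‖u - v‖ := fun u v => by
    have e : (u - τ • G u) - (v - τ • G v) = (u - v) - τ • (G u - G v) := by
      rw [smul_sub]; abel
    have h1 := hmono u v
    have h2 : ‖G u - G v‖ ^ 2 ≤ (Λ * ‖u - v‖) ^ 2 := by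
      refine pow_le_pow_left₀ (norm_nonneg _) ((hL u v).trans ?_) 2
      gcongr; exact le_max_left _ _
    refine abs_le_of_sq_le_sq' ?_ (by positivity) |>.2
    rw [e, @norm_sub_sq ℝ, norm_smul, mul_pow, mul_pow, Real.sq_sqrt hq0, inner_smul_right,
      real_inner_comm, Real.norm_eq_abs, sq_abs]
    have e3 : τ ^ 2 * (Λ * ‖u - v‖) ^ 2 = τ * κ * ‖u - v‖ ^ 2 := by
      simp only [τ]; field_simp
    have e4 : κ ^ 2 / Λ ^ 2 = τ * κ := by simp only [τ]; ring
    have h3 := mul_le_mul_of_nonneg_left h2 (sq_nonneg τ)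
    have h4 := mul_le_mul_of_nonneg_left h1 hτ.le
    simp only [RCLike.re_to_real] at *
    rw [e4]
    nlinarith
  have hc : ContractingWith (⟨q, Real.sqrt_nonneg _⟩ : NNReal) fun u => u - τ • G u :=
    ⟨NNReal.coe_lt_coe.1 hq1, LipschitzWith.of_dist_le_mul fun u v => by
      simp only [dist_eq_norm]; exact key u v⟩
  refine ⟨hc.fixedPoint, ?_⟩
  have h := hc.fixedPoint_isFixedPt
  have h' : τ • G hc.fixedPoint = 0 := by
    have : hc.fixedPoint - τ • G hc.fixedPoint = hc.fixedPoint := h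
    exact sub_eq_self.1 this
  exact (smul_eq_zero.1 h').resolve_left hτ.ne'

/-! ### Existence of states by a monotone operator argument. -/

section Existence

variable {n : ℕ} {Ω : Set (Eucl n)} {D : ProblemData n} {κ c : ℝ} {m : ℝ → ℝ}

/-- The jets of the elements of `H^1_0(Ω)`, as a subspace of `L^2`. -/
noncomputable def h10Submodule (Ω : Set (Eucl n)) :
    Submodule ℝ (Lp (Jet n) 2 (volume.restrict Ω)) where
  carrier := {U | H10Pair Ω (fun x => U x none) (fun x => (U x).grad)}
  zero_mem' := by
    have h := H10Pair.of_test (IsTestFun.zero Ω)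
    have e : (∇ (fun _ : Eucl n => (0 : ℝ))) = fun _ => 0 := by
      ext1 x; simp [_root_.gradient]
    rw [e] at h
    refine h.congr ?_ ?_ <;>
    · filter_upwards [Lp.coeFn_zero (Jet n) 2 (volume.restrict Ω)] with x hx
      rw [hx]; rfl
  add_mem' := fun {U W} hU hW => by
    refine (H10Pair.add hU hW).congr ?_ ?_ <;>
    · filter_upwards [Lp.coeFn_add U W] with x hx
      rw [hx]; rfl
  smul_mem' := fun a U hU => by
    refine (H10Pair.const_mul hU a).congr ?_ ?_ <;>
    · filter_upwards [Lp.coeFn_smul a U] with x hx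
      rw [hx]; rfl

theorem eLpNorm_none_le {μ : Measure (Eucl n)} (p : ℝ≥0∞) (U : Eucl n → Jet n) :
    eLpNorm (fun x => U x none) p μ ≤ eLpNorm U p μ :=
  eLpNorm_mono fun x => (U x).abs_apply_le none

theorem eLpNorm_grad_le {μ : Measure (Eucl n)} (p : ℝ≥0∞) (U : Eucl n → Jet n) :
    eLpNorm (fun x => (U x).grad) p μ ≤ eLpNorm U p μ :=
  eLpNorm_mono fun x => (U x).norm_grad_le

/-- L² convergence of jets is convergence of values and of gradients, and H¹₀ pairs are stable under
it. Closedness makes the subspace a Hilbert space in which the contraction argument can run. -/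
theorem isClosed_h10Submodule (Ω : Set (Eucl n)) :
    IsClosed (h10Submodule Ω : Set (Lp (Jet n) 2 (volume.restrict Ω))) := by
  refine IsSeqClosed.isClosed fun W U hW h => ?_
  rw [Lp.tendsto_Lp_iff_tendsto_eLpNorm'] at h
  obtain ⟨h1, h2⟩ := memLp_jet_iff.1 (Lp.memLp U)
  refine H10Pair.of_tendsto (l := atTop) h1 h2 (Eventually.of_forall hW) ?_ ?_
  · exact tendsto_of_tendsto_of_tendsto_of_le_of_le tendsto_const_nhds h (fun _ => zero_le)
      fun k => eLpNorm_none_le 2 fun x => W k x - U x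
  · exact tendsto_of_tendsto_of_tendsto_of_le_of_le tendsto_const_nhds h (fun _ => zero_le)
      fun k => eLpNorm_grad_le 2 fun x => W k x - U x

theorem MemH10.toLp_jet_mem {u : Eucl n → ℝ} (hu : MemH10 Ω u) :
    hu.memLp_jet.toLp (jet Ω u) ∈ h10Submodule Ω := by
  refine hu.pair.congr ?_ ?_ <;>
  · filter_upwards [hu.memLp_jet.coeFn_toLp] with x hx
    rw [hx]; rfl

theorem jet_ae_of_mem (hΩ : IsOpen Ω) {U : Lp (Jet n) 2 (volume.restrict Ω)}
    (hU : U ∈ h10Submodule Ω) : jet Ω (fun x => U x none) =ᵐ[volume.restrict Ω] U := by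
  filter_upwards [H10Pair.jet_ae hΩ hU] with x hx
  rw [hx]
  ext o; cases o <;> rfl

/-- The field representing the left-hand side of the state equation minus its right-hand side. -/
noncomputable def ProblemData.stateField (D : ProblemData n) (m : ℝ → ℝ) (c : ℝ) (x : Eucl n) (U : Jet n) :
    Jet n :=
  WithLp.toLp 2 fun β => ∑ α, D.coeff x α β * U α
    + mkJet (m (D.lam x + c * (U none - D.φ x)) - D.f x) 0 β

theorem inner_stateField (x : Eucl n) (U W : Jet n) :
    inner ℝ (D.stateField m c x U) W
      = D.jetForm x U W + (m (D.lam x + c * (U none - D.φ x)) - D.f x) * W none := by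
  rw [PiLp.inner_apply]
  simp only [ProblemData.stateField, ProblemData.jetForm, RCLike.inner_apply, conj_trivial,
    mul_add, Finset.sum_add_distrib, Finset.mul_sum]
  rw [Finset.sum_comm]
  congr 1
  · exact Finset.sum_congr rfl fun _ _ => Finset.sum_congr rfl fun _ _ => by ring
  · simp [Fintype.sum_option, mul_comm]

namespace IsEllipticData

theorem memLp_stateField (h : IsEllipticData D Ω κ) (hm : IsRegularMax m) {U : Eucl n → Jet n}
    (hU : MemLp U 2 (volume.restrict Ω)) :
    MemLp (fun x => D.stateField m c x (U x)) 2 (volume.restrict Ω) := by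
  have := h.isFiniteMeasure
  refine memLp_piLp_iff.2 fun β => ?_
  refine MemLp.add (memLp_finsetSum _ fun α _ => (hU.eval_piLp α).mul' (h.coeff_memLp α β)) ?_
  cases β with
  | none => exact (hm.memLp (h.memLp_arg (c := c) (hU.eval_piLp none))).sub h.f_memLp
  | some i => exact MemLp.zero'

/-- Bounded coefficients control the linear part and the 1-Lipschitz nonlinearity contributes c. One
factor N comes from the sum over α, the other from bounding the norm of a jet by the sum of its
entries. -/
theorem exists_stateField_lipschitz (h : IsEllipticData D Ω κ) (hm : IsRegularMax m) (hc : 0 < c) :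
    ∃ L : ℝ, 0 ≤ L ∧ ∀ᵐ x ∂(volume.restrict Ω), ∀ U W : Jet n,
      ‖D.stateField m c x U - D.stateField m c x W‖ ≤ L * ‖U - W‖ := by
  obtain ⟨B, hB0, hB⟩ := exists_ae_abs_coeff_le h.coeff_memLp
  set N : ℝ := (Fintype.card (Option (Fin n)) : ℝ)
  have hN : 0 ≤ N := by positivity
  refine ⟨N * (N * B + c), by positivity, ?_⟩
  filter_upwards [hB] with x hx U W
  have hβ : ∀ β, ‖(D.stateField m c x U - D.stateField m c x W) β‖ ≤ (N * B + c) * ‖U - W‖ := by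
    intro β
    have e : (D.stateField m c x U - D.stateField m c x W) β
        = ∑ α, D.coeff x α β * (U - W) α + mkJet (m (D.lam x + c * (U none - D.φ x))
          - m (D.lam x + c * (W none - D.φ x))) (0 : Eucl n) β := by
      simp only [ProblemData.stateField, PiLp.sub_apply, mul_sub, Finset.sum_sub_distrib]
      cases β with
      | none => simp; ring
      | some i => simp
    rw [e, add_mul]
    refine (norm_add_le _ _).trans (add_le_add ?_ ?_)
    · refine (norm_sum_le _ _).trans ?_
      have : ∀ α ∈ Finset.univ, ‖D.coeff x α β * (U - W) α‖ ≤ B * ‖U - W‖ := fun α _ => by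
        rw [norm_mul]
        exact mul_le_mul (hx α β) (Jet.abs_apply_le _ α) (norm_nonneg _) hB0
      refine (Finset.sum_le_card_nsmul _ _ _ this).trans ?_
      rw [nsmul_eq_mul, Finset.card_univ]
      simp only [N]; rw [mul_assoc]
    · cases β with
      | none =>
        refine (hm.abs_sub_le _ _).trans ?_
        have e2 : D.lam x + c * (U none - D.φ x) - (D.lam x + c * (W none - D.φ x))
            = c * (U - W) none := by simp; ring
        rw [e2, abs_mul, abs_of_pos hc]
        gcongr
        exact Jet.abs_apply_le _ none
      | some i => simp; positivity
  have hs : ‖D.stateField m c x U - D.stateField m c x W‖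
      ≤ ∑ β, ‖(D.stateField m c x U - D.stateField m c x W) β‖ := by
    set Z := D.stateField m c x U - D.stateField m c x W
    rw [EuclideanSpace.norm_eq, Real.sqrt_le_left (Finset.sum_nonneg fun _ _ => norm_nonneg _)]
    exact Finset.sum_sq_le_sq_sum_of_nonneg fun _ _ => norm_nonneg _
  refine hs.trans ((Finset.sum_le_card_nsmul _ _ _ fun β _ => hβ β).trans ?_)
  rw [nsmul_eq_mul, Finset.card_univ, mul_assoc]

/-- Coercivity on the jet of the difference, plus the nonnegative contribution of the monotone term;
f cancels. -/
theorem mul_norm_sq_le_inner_stateField (h : IsEllipticData D Ω κ) (hm : IsRegularMax m) (hc : 0 < c)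
    {U W Z RU RW : Lp (Jet n) 2 (volume.restrict Ω)}
    (hU : RU =ᵐ[volume.restrict Ω] fun x => D.stateField m c x (U x))
    (hW : RW =ᵐ[volume.restrict Ω] fun x => D.stateField m c x (W x)) (hZ : Z ∈ h10Submodule Ω)
    (hZUW : Z =ᵐ[volume.restrict Ω] fun x => U x - W x) :
    κ * ‖Z‖ ^ 2 ≤ inner ℝ (RU - RW) Z := by
  have hu : MemH10 Ω (fun x => Z x none) := H10Pair.memH10 h.isOpen hZ
  have hj := jet_ae_of_mem h.isOpen hZ
  have h1 := h.coercive _ hu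
  have e1 : h1NormSq Ω (fun x => Z x none) = ‖Z‖ ^ 2 := by
    rw [h1NormSq_eq hu.memLp_jet, lpNorm_congr_ae hj, (Lp.memLp Z).lpNorm_eq, Lp.norm_def]
  have e2 : bilinForm D Ω (fun x => Z x none) (fun x => Z x none)
      = ∫ x in Ω, D.jetForm x (Z x) (Z x) := by
    refine integral_congr_ae ?_
    filter_upwards [hj] with x hx
    rw [formIntegrand_eq, hx]
  rw [e1, e2] at h1
  refine h1.trans ?_
  rw [L2.inner_def]
  refine integral_mono_ae (integrable_jetForm h.coeff_memLp (Lp.memLp Z) (Lp.memLp Z))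
    (L2.integrable_inner _ _) ?_
  filter_upwards [hU, hW, hZUW, Lp.coeFn_sub RU RW] with x h2 h3 h4 h5
  rw [h5, Pi.sub_apply, h2, h3, inner_sub_left, inner_stateField, inner_stateField]
  have e3 : D.jetForm x (Z x) (Z x) = D.jetForm x (U x) (Z x) - D.jetForm x (W x) (Z x) := by
    rw [← D.jetForm_sub_left, ← h4]
  have e4 := hm.mul_sub_nonneg (D.lam x + c * (U x none - D.φ x)) (D.lam x + c * (W x none - D.φ x))
  have e5 : D.lam x + c * (U x none - D.φ x) - (D.lam x + c * (W x none - D.φ x))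
      = c * Z x none := by rw [h4]; simp; ring
  rw [e5, mul_left_comm] at e4
  have e6 := nonneg_of_mul_nonneg_right e4 hc
  rw [e3]
  linarith

theorem exists_state (h : IsEllipticData D Ω κ) (hm : IsRegularMax m) (hc : 0 < c) :
    ∃ y, IsState D m c Ω y := by
  have := h.isFiniteMeasure
  set V := h10Submodule Ω
  have : CompleteSpace V := (isClosed_h10Submodule Ω).completeSpace_coe
  set R : Lp (Jet n) 2 (volume.restrict Ω) → Lp (Jet n) 2 (volume.restrict Ω) :=
    fun U => (h.memLp_stateField (c := c) hm (Lp.memLp U)).toLp _ with hR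
  have hRx : ∀ U, R U =ᵐ[volume.restrict Ω] fun x => D.stateField m c x (U x) := fun U =>
    MemLp.coeFn_toLp _
  -- Orthogonal projection onto the jets of H¹₀ restricts the pointwise operator to admissible test
  -- functions while keeping its Lipschitz and monotonicity bounds; G U = 0 is the weak state
  -- equation.
  set G : V → V := fun U => V.orthogonalProjectionOnto (R U)
  have hG : ∀ U W : V, inner ℝ (G U) W = inner ℝ (R U) (W : Lp (Jet n) 2 (volume.restrict Ω)) :=
    fun U W => Submodule.inner_orthogonalProjectionOnto_eq_of_mem_right W _
  obtain ⟨L, hL0, hL⟩ := h.exists_stateField_lipschitz hm hc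
  obtain ⟨U, hU⟩ := exists_eq_zero_of_strongly_monotone (G := G) (L := L) h.pos (fun U W => by
      have h1 : ‖R U - R W‖ ≤ L * ‖(U : Lp (Jet n) 2 (volume.restrict Ω)) - W‖ := by
        refine Lp.norm_le_mul_norm_of_ae_le_mul ?_
        filter_upwards [hL, hRx U, hRx W, Lp.coeFn_sub (R U) (R W),
          Lp.coeFn_sub (U : Lp (Jet n) 2 (volume.restrict Ω)) W] with x h1 h2 h3 h4 h5
        rw [h4, h5, Pi.sub_apply, Pi.sub_apply, h2, h3]
        exact h1 _ _
      refine le_trans ?_ h1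
      simp only [G]
      rw [← map_sub]
      exact V.norm_orthogonalProjectionOnto_apply_le _) (fun U W => by
      have e : inner ℝ (G U - G W) (U - W)
          = inner ℝ (R U - R W) ((U - W : V) : Lp (Jet n) 2 (volume.restrict Ω)) := by
        rw [inner_sub_left, inner_sub_left, hG, hG]
      rw [e]
      exact h.mul_norm_sq_le_inner_stateField hm hc (hRx U) (hRx W) (U - W).2 (Lp.coeFn_sub _ _))
  refine ⟨fun x => (U : Lp (Jet n) 2 (volume.restrict Ω)) x none, H10Pair.memH10 h.isOpen U.2,
    fun v hv => ?_⟩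
  have e1 : inner ℝ (R U) (hv.memLp_jet.toLp (jet Ω v)) = 0 := by
    have := hG U ⟨_, hv.toLp_jet_mem⟩
    rw [hU, inner_zero_left] at this
    exact this.symm
  have hUL := Lp.memLp (U : Lp (Jet n) 2 (volume.restrict Ω))
  have hmU : MemLp (fun x => m (D.lam x + c * ((U : Lp (Jet n) 2 (volume.restrict Ω)) x none
      - D.φ x))) 2 (volume.restrict Ω) := hm.memLp (h.memLp_arg (hUL.eval_piLp none))
  have e2 : inner ℝ (R U) (hv.memLp_jet.toLp (jet Ω v))
      = ∫ x in Ω, (D.jetForm x ((U : Lp (Jet n) 2 (volume.restrict Ω)) x) (jet Ω v x)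
        + (m (D.lam x + c * ((U : Lp (Jet n) 2 (volume.restrict Ω)) x none - D.φ x)) * v x
          - D.f x * v x)) := by
    rw [L2.inner_def]
    refine integral_congr_ae ?_
    filter_upwards [hRx U, hv.memLp_jet.coeFn_toLp] with x h1 h2
    rw [h1, h2, inner_stateField, jet_none, sub_mul]
  have i1 := integrable_jetForm h.coeff_memLp hUL hv.memLp_jet
  have i2 : Integrable (fun x => m (D.lam x + c * ((U : Lp (Jet n) 2 (volume.restrict Ω)) x none
      - D.φ x)) * v x) (volume.restrict Ω) := MemLp.integrable_mul hmU hv.memLp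
  have i3 : Integrable (fun x => D.f x * v x) (volume.restrict Ω) :=
    MemLp.integrable_mul h.f_memLp hv.memLp
  have e2 := e1.symm.trans (e2.trans ((integral_add i1 (i2.sub i3)).trans
    (congrArg (_ + ·) (integral_sub i2 i3))))
  dsimp only at e2
  have e3 : bilinForm D Ω (fun x => (U : Lp (Jet n) 2 (volume.restrict Ω)) x none) v
      = ∫ x in Ω, D.jetForm x ((U : Lp (Jet n) 2 (volume.restrict Ω)) x) (jet Ω v x) := by
    refine integral_congr_ae ?_
    filter_upwards [jet_ae_of_mem h.isOpen U.2] with x hx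
    rw [formIntegrand_eq, hx]
  rw [e3]
  linarith

end IsEllipticData

end Existence

/-! ### The truncations (u − k)⁺ in H¹₀. -/

section Truncation

variable {n : ℕ} {Ω : Set (Eucl n)} {u : Eucl n → ℝ} {g : Eucl n → Eucl n}

/-- Where θ ≤ k the truncation attains its minimum 0, so its derivative is zero there, by convention
also at points of non-differentiability. -/
theorem gradient_max_sub {θ : Eucl n → ℝ} (hθ : Continuous θ) (k : ℝ) (x : Eucl n) :
    ∇ (fun z => max (θ z - k) 0) x = {z | k < θ z}.indicator (∇ θ) x := by
  by_cases hx : k < θ x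
  · rw [indicator_of_mem (by exact hx)]
    have h : (fun z => max (θ z - k) 0) =ᶠ[𝓝 x] fun z => θ z - k := by
      filter_upwards [(hθ.tendsto x).eventually (lt_mem_nhds hx)] with z hz
      exact max_eq_left (sub_nonneg.2 (le_of_lt hz))
    unfold _root_.gradient
    rw [h.fderiv_eq, fderiv_sub_const]
  · rw [indicator_of_notMem (by exact hx)]
    have h : IsLocalMin (fun z => max (θ z - k) 0) x := by
      refine Eventually.of_forall fun z => ?_
      dsimp only
      rw [max_eq_right (sub_nonpos.2 (not_lt.1 hx))]
      exact le_max_right _ _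
    rw [_root_.gradient, h.fderiv_eq_zero, map_zero]

theorem lipschitzWith_max_sub (k : ℝ) : LipschitzWith 1 fun s : ℝ => max (s - k) 0 := by
  refine LipschitzWith.of_dist_le_mul fun a b => ?_
  rw [NNReal.coe_one, one_mul, Real.dist_eq, Real.dist_eq]
  refine (abs_max_sub_max_le_abs _ _ _).trans (le_of_eq ?_)
  congr 1; ring

theorem IsTestFun.h10Pair_max_sub {θ : Eucl n → ℝ} (hΩ : IsOpen Ω) (hθ : IsTestFun Ω θ) {k : ℝ}
    (hk : 0 ≤ k) :
    H10Pair Ω (fun x => max (θ x - k) 0) ({z | k < θ z}.indicator (∇ θ)) := by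
  obtain ⟨C, hC⟩ := hθ.contDiff_one.lipschitzWith_of_hasCompactSupport hθ.2.1 one_ne_zero
  have h0 : ∀ x, x ∉ tsupport θ → max (θ x - k) 0 = 0 := fun x hx => by
    rw [image_eq_zero_of_notMem_tsupport hx]
    exact max_eq_right (by linarith)
  have hs : tsupport (fun x => max (θ x - k) 0) ⊆ tsupport θ :=
    closure_minimal (fun x hx => by
      by_contra h'
      exact hx (h0 x h')) (isClosed_tsupport θ)
  have h := LipschitzWith.h10Pair ((lipschitzWith_max_sub k).comp hC) hΩ
    (HasCompactSupport.intro hθ.2.1 h0) (hs.trans hθ.2.2)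
  have e : ∇ ((fun s : ℝ => max (s - k) 0) ∘ θ) = {z | k < θ z}.indicator (∇ θ) :=
    funext fun x => gradient_max_sub hθ.continuous k x
  rw [e] at h
  exact h

/-- Truncation at a level `k ≥ 0` whose level set is negligible preserves `H^1_0(Ω)`. -/
theorem H10Pair.max_sub (hΩ : IsOpen Ω) (hu : H10Pair Ω u g) {k : ℝ} (hk : 0 ≤ k)
    (hnull : volume.restrict Ω {x | u x = k} = 0) :
    H10Pair Ω (fun x => max (u x - k) 0) ({x | k < u x}.indicator g) := by
  obtain ⟨θ, hθ, h1, h2⟩ := hu.exists_seq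
  obtain ⟨ns, a1, a2⟩ := exists_subseq_ae_tendsto two_ne_zero
    (Eventually.of_forall fun k => ((hθ k).memLp 2 Ω).1) hu.1.1 h1
  have hA : NullMeasurableSet {x | k < u x} (volume.restrict Ω) :=
    nullMeasurableSet_lt aemeasurable_const hu.1.1.aemeasurable
  have hm : ∀ j, MeasurableSet {x | k < θ j x} := fun j =>
    measurableSet_lt measurable_const (hθ j).continuous.measurable
  have hgi : MemLp ({x | k < u x}.indicator g) 2 (volume.restrict Ω) :=
    hu.2.1.of_le (hu.2.1.1.indicator₀ hA) (ae_of_all _ fun x => norm_indicator_le_norm_self _ _)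
  refine H10Pair.of_tendsto (l := atTop) (w := fun j x => max (θ (ns j) x - k) 0)
    (G := fun j => {x | k < θ (ns j) x}.indicator (∇ (θ (ns j)))) ?_ hgi
    (Eventually.of_forall fun j => (hθ _).h10Pair_max_sub hΩ hk) ?_ ?_
  · refine hu.1.of_le ((lipschitzWith_max_sub k).continuous.comp_aestronglyMeasurable hu.1.1)
      (ae_of_all _ fun x => ?_)
    rw [Real.norm_eq_abs, Real.norm_eq_abs, abs_of_nonneg (le_max_right _ _)]
    exact max_le (by linarith [le_abs_self (u x)]) (abs_nonneg _)
  · refine tendsto_of_tendsto_of_tendsto_of_le_of_le tendsto_const_nhds (h1.comp a1)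
      (fun _ => zero_le) fun j => eLpNorm_mono fun x => ?_
    simpa [Real.dist_eq] using (lipschitzWith_max_sub k).dist_le_mul (θ (ns j) x) (u x)
  -- Split into ∇θ_j − g on {θ_j > k} and g on the change of the level sets. The second part tends
  -- to 0 by dominated convergence: the indicators converge wherever u ≠ k, which is where
  -- negligibility of the level set enters.
  · have e : ∀ j, (fun x => {x | k < θ (ns j) x}.indicator (∇ (θ (ns j))) x
        - {x | k < u x}.indicator g x)
        = ({x | k < θ (ns j) x}.indicator fun x => ∇ (θ (ns j)) x - g x)
          + fun x => {x | k < θ (ns j) x}.indicator g x - {x | k < u x}.indicator g x := fun j => by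
      ext1 x
      by_cases hx : k < θ (ns j) x <;> simp [indicator, hx]
    have hs2 : Tendsto (fun j => eLpNorm (fun x => {x | k < θ (ns j) x}.indicator g x
        - {x | k < u x}.indicator g x) 2 (volume.restrict Ω)) atTop (𝓝 0) := by
      refine tendsto_eLpNorm_of_dominated (C := 2) two_ne_zero (by simp) (fun j =>
        ((hu.2.1.1.indicator (hm _)).sub hgi.1)) hu.2.1 (fun j => ae_of_all _ fun x => ?_) ?_
      · refine (norm_sub_le _ _).trans ?_
        have b1 := norm_indicator_le_norm_self (s := {x | k < θ (ns j) x}) g x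
        have b2 := norm_indicator_le_norm_self (s := {x | k < u x}) g x
        linarith
      · have hn : ∀ᵐ x ∂(volume.restrict Ω), u x ≠ k := by
          rw [ae_iff]; simpa using hnull
        filter_upwards [a2, hn] with x hx hxk
        refine tendsto_const_nhds.congr' ?_
        rcases lt_or_gt_of_ne hxk with h | h
        · filter_upwards [hx.eventually (gt_mem_nhds h)] with j hj
          simp [indicator, not_lt.2 hj.le, not_lt.2 h.le]
        · filter_upwards [hx.eventually (lt_mem_nhds h)] with j hj
          simp [indicator, hj, h]
    have hs := (h2.comp a1).add hs2
    rw [add_zero] at hs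
    refine tendsto_of_tendsto_of_tendsto_of_le_of_le tendsto_const_nhds hs
      (fun _ => zero_le) fun j => ?_
    dsimp only
    rw [e j]
    refine (eLpNorm_add_le ((((hθ _).memLp_gradient 2 Ω).sub hu.2.1).1.indicator (hm _))
      ((hu.2.1.1.indicator (hm _)).sub hgi.1) one_le_two).trans (add_le_add ?_ le_rfl)
    exact eLpNorm_mono fun x => norm_indicator_le_norm_self _ _

end Truncation

/-! ### De Giorgi's iteration in measure-theoretic form. -/

section LevelSets

variable {α : Type*} [MeasurableSpace α] {μ : Measure α}

/-- Both sides equal μ(A)^{1/2}. This square is the source of the superlinear gain in De Giorgi's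
iteration. -/
theorem lpNorm_indicator_one_sq [IsFiniteMeasure μ] {A : Set α} (hA : NullMeasurableSet A μ) :
    lpNorm (A.indicator fun _ => (1 : ℝ)) 4 μ ^ 2 = lpNorm (A.indicator fun _ => (1 : ℝ)) 2 μ := by
  have h : ∀ p : ℝ≥0∞, p ≠ 0 → p ≠ ⊤ →
      lpNorm (A.indicator fun _ => (1 : ℝ)) p μ = μ.real A ^ (1 / p.toReal) := fun p h0 hp => by
    have hi : MemLp (A.indicator fun _ => (1 : ℝ)) p μ := by
      refine (memLp_const (1 : ℝ)).of_le (aestronglyMeasurable_const.indicator₀ hA)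
        (ae_of_all _ fun x => ?_)
      exact norm_indicator_le_norm_self _ _
    rw [hi.lpNorm_eq, eLpNorm_indicator_const₀ hA h0 hp]
    simp [Measure.real, ENNReal.toReal_rpow]
  rw [h 4 (by norm_num) (by norm_num), h 2 (by norm_num) (by norm_num), ← Real.rpow_natCast,
    ← Real.rpow_mul measureReal_nonneg]
  norm_num

/-- De Giorgi's iteration on the super-level sets. -/
theorem exists_ae_le_of_level_estimate [IsFiniteMeasure μ] {p : α → ℝ} (hp : MemLp p 4 μ) {C : ℝ}
    (hC : 0 ≤ C)
    (H : ∀ k, 1 ≤ k → μ {x | p x = k} = 0 → lpNorm (fun x => max (p x - k) 0) 4 μ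
      ≤ C * k * lpNorm ({x | k < p x}.indicator fun _ => (1 : ℝ)) 2 μ) :
    ∃ K : ℝ, ∀ᵐ x ∂μ, p x ≤ K := by
  set φ : ℝ → ℝ := fun k => lpNorm ({x | k < p x}.indicator fun _ => (1 : ℝ)) 4 μ with hφ
  have hA : ∀ k, NullMeasurableSet {x | k < p x} μ := fun k =>
    nullMeasurableSet_lt aemeasurable_const hp.1.aemeasurable
  have hAm : ∀ k, AEStronglyMeasurable ({x | k < p x}.indicator fun _ => (1 : ℝ)) μ := fun k =>
    aestronglyMeasurable_const.indicator₀ (hA k)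
  have hφ0 : ∀ k, 0 ≤ φ k := fun k => lpNorm_nonneg
  have hmaxL : ∀ k, 0 ≤ k → MemLp (fun x => max (p x - k) 0) 4 μ := fun k hk =>
    hp.of_le ((lipschitzWith_max_sub k).continuous.comp_aestronglyMeasurable hp.1)
      (ae_of_all _ fun x => by
        rw [Real.norm_eq_abs, Real.norm_eq_abs, abs_of_nonneg (le_max_right _ _)]
        exact max_le (by linarith [le_abs_self (p x)]) (abs_nonneg _))
  -- Chebyshev's inequality in L⁴: (p − k)⁺ ≥ h − k on {p > h}.
  have cheb : ∀ k h, 0 ≤ k → k ≤ h → (h - k) * φ h ≤ lpNorm (fun x => max (p x - k) 0) 4 μ := by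
    intro k h hk hkh
    have e : (h - k) * φ h
        = lpNorm ((h - k) • ({x | h < p x}.indicator fun _ => (1 : ℝ))) 4 μ := by
      rw [lpNorm_const_smul, coe_nnnorm, Real.norm_eq_abs, abs_of_nonneg (sub_nonneg.2 hkh)]
    rw [e]
    refine lpNorm_mono_ae ((hAm h).const_smul _) (hmaxL k hk) (ae_of_all _ fun x => ?_)
    rw [Real.norm_eq_abs, Real.norm_eq_abs, abs_of_nonneg (le_max_right (p x - k) 0), Pi.smul_apply,
      smul_eq_mul]
    by_cases hx : h < p x
    · rw [indicator_of_mem (by exact hx), mul_one, abs_of_nonneg (sub_nonneg.2 hkh)]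
      exact le_max_of_le_left (by linarith)
    · rw [indicator_of_notMem (by exact hx), mul_zero, abs_zero]
      exact le_max_right _ _
  have step : ∀ k h, 1 ≤ k → k ≤ h → μ {x | p x = k} = 0 → (h - k) * φ h ≤ C * k * φ k ^ 2 :=
    fun k h hk hkh hn => by
      rw [hφ, lpNorm_indicator_one_sq (hA k)]
      exact (cheb k h (by linarith) hkh).trans (H k hk hn)
  -- Chosen so that 8Cδ ≤ 1. If φ(Ka_j) ≤ 2⁻ʲδ, the recursion between consecutive levels gives
  -- φ(Ka_{j+1}) ≤ 4C·2⁻ʲδ², which is at most half of 2⁻ʲδ.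
  set δ : ℝ := 1 / (8 * C + 1) with hδ
  have hδ0 : 0 < δ := by positivity
  have hδ1 : 8 * C * δ ≤ 1 := by
    rw [hδ, mul_one_div, div_le_one (by positivity)]; linarith
  set a : ℕ → ℝ := fun j => 2 - (1 / 2) ^ j with ha
  have ha1 : ∀ j, 1 ≤ a j := fun j => by
    have : ((1 : ℝ) / 2) ^ j ≤ 1 := pow_le_one₀ (by norm_num) (by norm_num)
    simp only [ha]; linarith
  have ha2 : ∀ j, a j ≤ 2 := fun j => by
    have : (0 : ℝ) ≤ (1 / 2) ^ j := by positivity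
    simp only [ha]; linarith
  -- The level estimate is available only at levels of measure zero. Countably many levels are bad,
  -- so all but countably many K make every Ka_j good.
  have hbad : {t : ℝ | 0 < μ {x | p x = t}}.Countable :=
    Measure.countable_meas_level_set_pos₀ hp.1.aemeasurable.nullMeasurable
  have hbad2 : (⋃ j, (fun K => K * a j) ⁻¹' {t : ℝ | 0 < μ {x | p x = t}}).Countable :=
    countable_iUnion fun j => hbad.preimage_of_injOn fun s _ t _ hst =>
      mul_right_cancel₀ (by linarith [ha1 j] : a j ≠ 0) hst
  set N := lpNorm (fun x => max (p x - 0) 0) 4 μ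
  -- K > N/δ starts the induction: Chebyshev from level 0 gives φ(K) ≤ N/K < δ.
  obtain ⟨K, hK1, hK2⟩ := (hbad2.dense_compl ℝ).inter_open_nonempty (Ioi (max 1 (N / δ))) isOpen_Ioi
    nonempty_Ioi
  have hK : 1 < K := (le_max_left _ _).trans_lt hK1
  have hKN : N / δ < K := (le_max_right _ _).trans_lt hK1
  have hKnull : ∀ j, μ {x | p x = K * a j} = 0 := fun j => by
    by_contra h'
    exact hK2 (mem_iUnion.2 ⟨j, pos_iff_ne_zero.2 h'⟩)
  have ind : ∀ j, φ (K * a j) ≤ (1 / 2) ^ j * δ := by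
    intro j
    induction j with
    | zero =>
      have h1 := cheb 0 K le_rfl (by linarith)
      have e : K * a 0 = K := by simp only [ha]; norm_num
      rw [e, pow_zero, one_mul]
      rw [div_lt_iff₀ hδ0] at hKN
      by_contra h'
      have : K * δ < K * φ K := mul_lt_mul_of_pos_left (not_le.1 h') (by linarith)
      simp only [sub_zero] at h1
      have h3 : lpNorm (fun x => max (p x) 0) 4 μ = N := by simp only [N, sub_zero]
      linarith
    | succ j ih =>
      have e : K * a (j + 1) - K * a j = K * ((1 / 2) ^ j / 2) := by
        simp only [ha, pow_succ]; ring
      have hkh : K * a j ≤ K * a (j + 1) := by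
        rw [← sub_nonneg, e]; positivity
      have hk1 : 1 ≤ K * a j := by nlinarith [ha1 j]
      have h1 := step _ _ hk1 hkh (hKnull j)
      rw [e] at h1
      set b : ℝ := (1 / 2) ^ j with hb
      have hb0 : 0 < b := by positivity
      have h2 : C * (K * a j) * φ (K * a j) ^ 2 ≤ C * (K * 2) * (b * δ) ^ 2 := by
        have := ha2 j
        have := hφ0 (K * a j)
        gcongr
      have h3 : K * b * (φ (K * a (j + 1)) / 2) ≤ K * b * (2 * C * b * δ * δ) := by nlinarith
      have h4 := le_of_mul_le_mul_left h3 (by positivity)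
      rw [pow_succ, ← hb]
      have h5 : b * δ * (8 * C * δ) ≤ b * δ * 1 := mul_le_mul_of_nonneg_left hδ1 (by positivity)
      nlinarith
  -- The levels Ka_j stay below 2K, so {p > 2K} lies in every one of their super-level sets, whose
  -- norms tend to 0.
  have h2K : φ (2 * K) = 0 := by
    refine le_antisymm ?_ (hφ0 _)
    have ht : Tendsto (fun j : ℕ => ((1 : ℝ) / 2) ^ j * δ) atTop (𝓝 0) := by
      simpa using (tendsto_pow_atTop_nhds_zero_of_lt_one (by norm_num : (0 : ℝ) ≤ 1 / 2)
        (by norm_num)).mul_const δ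
    refine ge_of_tendsto' ht fun j => le_trans ?_ (ind j)
    refine lpNorm_mono_ae (hAm _) ?_ (ae_of_all _ fun x => ?_)
    · exact (memLp_const (1 : ℝ)).of_le (hAm _) (ae_of_all _ fun x => norm_indicator_le_norm_self _ _)
    · refine norm_indicator_le_of_subset (fun z hz => ?_) _ _
      have hz' : 2 * K < p z := hz
      have := ha2 j
      show K * a j < p z
      nlinarith
  refine ⟨2 * K, ?_⟩
  have h3 := (lpNorm_eq_zero ((memLp_const (1 : ℝ)).of_le (hAm (2 * K))
    (ae_of_all _ fun x => norm_indicator_le_norm_self _ _)) (by norm_num : (4 : ℝ≥0∞) ≠ 0)).1 h2K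
  filter_upwards [h3] with x hx
  by_contra h'
  rw [indicator_of_mem (by exact not_le.1 h')] at hx
  exact one_ne_zero hx

end LevelSets

/-! ### Boundedness of the adjoint state. -/

section Boundedness

variable {n : ℕ} {Ω : Set (Eucl n)} {D : ProblemData n} {κ c : ℝ}

theorem ProblemData.abs_jetForm_le {x : Eucl n} {B : ℝ} (hB : ∀ α β, |D.coeff x α β| ≤ B)
    (U W : Jet n) : |D.jetForm x U W| ≤ (n + 1) ^ 2 * B * (‖U‖ * ‖W‖) := by
  have hN : (Fintype.card (Option (Fin n)) : ℝ) = n + 1 := by simp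
  have h : ∀ α β, |D.coeff x α β * U α * W β| ≤ B * (‖U‖ * ‖W‖) := fun α β => by
    rw [abs_mul, abs_mul, mul_assoc]
    have hB0 : 0 ≤ B := (abs_nonneg _).trans (hB α β)
    gcongr
    · exact hB α β
    · exact U.abs_apply_le α
    · exact W.abs_apply_le β
  have h2 : ∀ α, |∑ β, D.coeff x α β * U α * W β| ≤ (n + 1) * (B * (‖U‖ * ‖W‖)) := fun α => by
    refine (Finset.abs_sum_le_sum_abs _ _).trans ((Finset.sum_le_card_nsmul _ _ _
      fun β _ => h α β).trans (le_of_eq ?_))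
    rw [nsmul_eq_mul, Finset.card_univ, hN]
  refine (Finset.abs_sum_le_sum_abs _ _).trans ((Finset.sum_le_card_nsmul _ _ _
    fun α _ => h2 α).trans (le_of_eq ?_))
  rw [nsmul_eq_mul, Finset.card_univ, hN]
  ring

theorem norm_mkJet_zero (k : ℝ) : ‖mkJet k (0 : Eucl n)‖ = |k| := by
  have h := Jet.norm_sq (mkJet k (0 : Eucl n))
  have e : (mkJet k (0 : Eucl n)).grad = 0 := rfl
  rw [e, norm_zero, mkJet_none] at h
  rw [← abs_of_nonneg (norm_nonneg (mkJet k (0 : Eucl n))), ← sq_eq_sq_iff_abs_eq_abs]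
  linarith

theorem sobolev_jet (hn1 : 1 ≤ n) (hn4 : n ≤ 4) (hΩ : IsOpen Ω) (hb : Bornology.IsBounded Ω) :
    ∃ C : ℝ, 0 ≤ C ∧ ∀ u, MemH10 Ω u → MemLp u 4 (volume.restrict Ω) ∧
      lpNorm u 4 (volume.restrict Ω) ≤ C * lpNorm (jet Ω u) 2 (volume.restrict Ω) := by
  obtain ⟨C, hC, h⟩ := sobolev_h10 hn1 hn4 hΩ.measurableSet hb
  refine ⟨C.toReal, ENNReal.toReal_nonneg, fun u hu => ?_⟩
  have hg : MemLp (weakGrad Ω u) 2 (volume.restrict Ω) := hu.1.2.2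
  have h1 := h u _ hu.pair
  have h4 : MemLp u 4 (volume.restrict Ω) :=
    ⟨hu.memLp.1, h1.trans_lt (ENNReal.mul_lt_top hC.lt_top hg.2)⟩
  refine ⟨h4, ?_⟩
  have h2 := ENNReal.toReal_mono (ENNReal.mul_ne_top hC hg.2.ne) h1
  rw [ENNReal.toReal_mul, ← h4.lpNorm_eq, ← hg.lpNorm_eq] at h2
  exact h2.trans (mul_le_mul_of_nonneg_left (lpNorm_weakGrad_le_lpNorm_jet hu.memLp_jet)
    ENNReal.toReal_nonneg)

namespace IsEllipticData

/-- Truncating the first argument of the bilinear form. -/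
theorem exists_bilinForm_max_sub_le (h : IsEllipticData D Ω κ) : ∃ B : ℝ, 0 ≤ B ∧
    ∀ p, MemH10 Ω p → ∀ k, 0 ≤ k → volume.restrict Ω {x | p x = k} = 0 →
      MemH10 Ω (fun x => max (p x - k) 0) ∧
      bilinForm D Ω (fun x => max (p x - k) 0) (fun x => max (p x - k) 0)
        ≤ bilinForm D Ω p (fun x => max (p x - k) 0)
          + B * k * (lpNorm ({x | k < p x}.indicator fun _ => (1 : ℝ)) 2 (volume.restrict Ω)
            * lpNorm (jet Ω fun x => max (p x - k) 0) 2 (volume.restrict Ω)) := by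
  have := h.isFiniteMeasure
  obtain ⟨B, hB0, hB⟩ := exists_ae_abs_coeff_le h.coeff_memLp
  refine ⟨(n + 1) ^ 2 * B, by positivity, fun p hp k hk hnull => ?_⟩
  set v : Eucl n → ℝ := fun x => max (p x - k) 0 with hv
  have hpair := hp.pair.max_sub h.isOpen hk hnull
  have hvH : MemH10 Ω v := hpair.memH10 h.isOpen
  refine ⟨hvH, ?_⟩
  have hA : NullMeasurableSet {x | k < p x} (volume.restrict Ω) :=
    nullMeasurableSet_lt aemeasurable_const hp.memLp.1.aemeasurable
  have hI : MemLp ({x | k < p x}.indicator fun _ => (1 : ℝ)) 2 (volume.restrict Ω) :=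
    (memLp_const (1 : ℝ)).of_le (aestronglyMeasurable_const.indicator₀ hA)
      (ae_of_all _ fun x => norm_indicator_le_norm_self _ _)
  have hJ : MemLp (fun x => ‖jet Ω v x‖) 2 (volume.restrict Ω) := hvH.memLp_jet.norm
  have i1 := integrable_formIntegrand h.coeff_memLp hvH hvH
  have i2 := integrable_formIntegrand h.coeff_memLp hp hvH
  have i3 : Integrable (fun x => {x | k < p x}.indicator (fun _ => (1 : ℝ)) x * ‖jet Ω v x‖)
    (volume.restrict Ω) := MemLp.integrable_mul hI hJ
  have key : ∀ᵐ x ∂(volume.restrict Ω), formIntegrand D Ω v v x ≤ formIntegrand D Ω p v x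
      + (n + 1) ^ 2 * B * k * ({x | k < p x}.indicator (fun _ => (1 : ℝ)) x * ‖jet Ω v x‖) := by
    filter_upwards [hB, hpair.jet_ae h.isOpen] with x hx hj
    rw [formIntegrand_eq, formIntegrand_eq]
    by_cases hxk : k < p x
    -- On {p > k} the truncation has the jet of p minus (k, 0), and elsewhere its jet is zero. The
    -- shift in the value produces the extra term proportional to k.
    · have e : jet Ω v x = jet Ω p x - mkJet k 0 := by
        rw [hj, indicator_of_mem (by exact hxk), max_eq_left (by linarith)]
        ext o; cases o <;> simp
      have e2 : D.jetForm x (jet Ω v x) (jet Ω v x) = D.jetForm x (jet Ω p x) (jet Ω v x)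
          - D.jetForm x (mkJet k 0) (jet Ω v x) := by
        rw [← D.jetForm_sub_left, ← e]
      have e3 := D.abs_jetForm_le hx (mkJet k 0) (jet Ω v x)
      rw [norm_mkJet_zero, abs_of_nonneg hk] at e3
      rw [e2, indicator_of_mem (by exact hxk)]
      have := (abs_le.1 e3).1
      linarith
    · have e : jet Ω v x = 0 := by
        rw [hj, indicator_of_notMem (by exact hxk), max_eq_right (by linarith)]
        ext o; cases o <;> simp
      rw [e, indicator_of_notMem (by exact hxk)]
      simp [ProblemData.jetForm]
  refine (integral_mono_ae i1 (i2.add (i3.const_mul _)) key).trans ?_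
  rw [integral_add' i2 (i3.const_mul _), integral_const_mul]
  refine add_le_add le_rfl (mul_le_mul_of_nonneg_left ?_ (by positivity))
  refine (le_abs_self _).trans ((abs_integral_mul_le hI hJ).trans (le_of_eq ?_))
  rw [lpNorm_norm hvH.memLp_jet.1]

/-- Test with v = (p − k)⁺. The term with ω is nonnegative, so a(v, v) is bounded by ∫ r v plus the
truncation error. Both carry the factor ‖1_{p>k}‖₂, and the Sobolev inequality turns this into the
hypothesis of De Giorgi's iteration. -/
theorem exists_ae_le_of_weak_solution (h : IsEllipticData D Ω κ) (hn1 : 1 ≤ n) (hn4 : n ≤ 4)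
    (hc : 0 ≤ c) {p ω r : Eucl n → ℝ} (hp : MemH10 Ω p) (hω : ∀ x, 0 ≤ ω x)
    (hr : MemLp r 4 (volume.restrict Ω))
    (H : ∀ v, MemH10 Ω v → bilinForm D Ω p v + c * ∫ x in Ω, ω x * p x * v x
      = ∫ x in Ω, r x * v x) :
    ∃ K : ℝ, ∀ᵐ x ∂(volume.restrict Ω), p x ≤ K := by
  have := h.isFiniteMeasure
  obtain ⟨B, hB0, hB⟩ := h.exists_bilinForm_max_sub_le
  obtain ⟨C, hC0, hC⟩ := sobolev_jet hn1 hn4 h.isOpen h.isBounded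
  set R := lpNorm r 4 (volume.restrict Ω)
  have hR : 0 ≤ R := lpNorm_nonneg
  have hκ := h.pos
  refine exists_ae_le_of_level_estimate (hC p hp).1 (C := C * ((R * C + B) / κ)) (by positivity)
    fun k hk hnull => ?_
  obtain ⟨hvH, hv⟩ := hB p hp k (by linarith) hnull
  set v : Eucl n → ℝ := fun x => max (p x - k) 0 with hvdef
  set I : Eucl n → ℝ := {x | k < p x}.indicator fun _ => (1 : ℝ) with hIdef
  obtain ⟨hv4, hvC⟩ := hC v hvH
  have hA : NullMeasurableSet {x | k < p x} (volume.restrict Ω) :=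
    nullMeasurableSet_lt aemeasurable_const hp.memLp.1.aemeasurable
  have hI : MemLp I 2 (volume.restrict Ω) :=
    (memLp_const (1 : ℝ)).of_le (aestronglyMeasurable_const.indicator₀ hA)
      (ae_of_all _ fun x => norm_indicator_le_norm_self _ _)
  have hrv : MemLp (fun x => r x * v x) 2 (volume.restrict Ω) := hv4.mul' hr
  -- Inserting the indicator makes Hölder with 1/4 + 1/4 + 1/2 = 1 available.
  have e1 : ∫ x in Ω, r x * v x = ∫ x in Ω, (r x * v x) * I x := by
    refine integral_congr_ae (ae_of_all _ fun x => ?_)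
    by_cases hx : k < p x
    · simp [hIdef, hx]
    · have : v x = 0 := max_eq_right (by linarith)
      simp [this]
  set J := lpNorm (jet Ω v) 2 (volume.restrict Ω)
  set a := lpNorm I 2 (volume.restrict Ω)
  have ha0 : 0 ≤ a := lpNorm_nonneg
  have hJ0 : 0 ≤ J := lpNorm_nonneg
  have b1 : ∫ x in Ω, r x * v x ≤ R * (C * J) * a := by
    rw [e1]
    refine (le_abs_self _).trans ((abs_integral_mul_le hrv hI).trans ?_)
    refine mul_le_mul_of_nonneg_right ((lpNorm_mul_le hr hv4).trans ?_) ha0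
    exact mul_le_mul_of_nonneg_left hvC hR
  have b2 : 0 ≤ c * ∫ x in Ω, ω x * p x * v x := by
    refine mul_nonneg hc (integral_nonneg fun x => ?_)
    by_cases hx : k < p x
    · exact mul_nonneg (mul_nonneg (hω x) (by linarith)) (le_max_right _ _)
    · have : v x = 0 := max_eq_right (by linarith)
      simp [this]
  have b3 := H v hvH
  have b4 : bilinForm D Ω v v ≤ ((R * C + B) * k * a) * J := by
    -- k ≥ 1 lets the source term be absorbed into the same factor k as the truncation error.
    have : R * (C * J) * a * 1 ≤ R * (C * J) * a * k :=
      mul_le_mul_of_nonneg_left hk (by positivity)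
    nlinarith
  have b5 := h.lpNorm_jet_le_of_bilinForm_le hvH (by positivity) b4
  calc lpNorm v 4 (volume.restrict Ω) ≤ C * J := hvC
    _ ≤ C * ((R * C + B) * k * a / κ) := mul_le_mul_of_nonneg_left b5 hC0
    _ = C * ((R * C + B) / κ) * k * a := by ring

/-- The one-sided bound applies to −p with source −r as well, the equation being linear in p for
fixed ω. -/
theorem memLp_top_of_weak_solution (h : IsEllipticData D Ω κ) (hn1 : 1 ≤ n) (hn4 : n ≤ 4)
    (hc : 0 ≤ c) {p ω r : Eucl n → ℝ} (hp : MemH10 Ω p) (hω : ∀ x, 0 ≤ ω x)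
    (hr : MemLp r 4 (volume.restrict Ω))
    (H : ∀ v, MemH10 Ω v → bilinForm D Ω p v + c * ∫ x in Ω, ω x * p x * v x
      = ∫ x in Ω, r x * v x) :
    MemLp p ⊤ (volume.restrict Ω) := by
  obtain ⟨K, hK⟩ := h.exists_ae_le_of_weak_solution hn1 hn4 hc hp hω hr H
  have hpn : H10Pair Ω (fun x => -1 * p x) (fun x => (-1 : ℝ) • weakGrad Ω p x) :=
    hp.pair.const_mul (-1)
  have hpn' : MemH10 Ω (fun x => -1 * p x) := hpn.memH10 h.isOpen
  obtain ⟨K', hK'⟩ := h.exists_ae_le_of_weak_solution hn1 hn4 hc hpn' hω hr.neg fun v hv => by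
    have e : bilinForm D Ω (fun x => -1 * p x) v = - bilinForm D Ω p v := by
      rw [bilinForm, bilinForm, ← integral_neg]
      refine integral_congr_ae ?_
      filter_upwards [hpn.jet_ae h.isOpen] with x hx
      rw [formIntegrand_eq, formIntegrand_eq, hx, mkJet_smul]
      simp only [ProblemData.jetForm, ← Finset.sum_neg_distrib]
      exact Finset.sum_congr rfl fun _ _ => Finset.sum_congr rfl fun _ _ => by
        simp [jet]
    have e1 : ∫ x in Ω, ω x * (-1 * p x) * v x = - ∫ x in Ω, ω x * p x * v x := by
      rw [← integral_neg]; congr 1; ext1 x; ring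
    have e2 : ∫ x in Ω, (-r) x * v x = - ∫ x in Ω, r x * v x := by
      rw [← integral_neg]; congr 1; ext1 x; simp
    have := H v hv
    rw [e, e1, e2]
    linarith
  refine memLp_top_of_bound hp.memLp.1 (max K K') ?_
  filter_upwards [hK, hK'] with x h1 h2
  exact abs_le.2 ⟨by linarith [le_max_right K K'], h1.trans (le_max_left _ _)⟩

end IsEllipticData

end Boundedness

/-! ### Taylor's formula along T_t in Sobolev spaces. -/

section DifferenceQuotients

variable {n : ℕ} {Ω : Set (Eucl n)} {V : Eucl n → Eucl n} {K : NNReal} {p : ℝ≥0∞}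

/-- χ equals 1 in a neighbourhood of each point of A, not just on A, so that ∇χ vanishes there too.
-/
theorem exists_cutoff {A : Set (Eucl n)} (hA : IsCompact A) (hΩ : IsOpen Ω) (h : A ⊆ Ω) :
    ∃ χ : Eucl n → ℝ, ContDiff ℝ (⊤ : ℕ∞) χ ∧ HasCompactSupport χ ∧ tsupport χ ⊆ Ω ∧
      ∀ x ∈ A, χ =ᶠ[𝓝 x] 1 := by
  obtain ⟨δ, hδ, hδΩ⟩ := hA.exists_cthickening_subset_open hΩ h
  obtain ⟨χ, h1, -, h2, h3⟩ := exists_contMDiff_support_eq_eq_one_iff (modelWithCornersSelf ℝ (Eucl n))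
    (n := (⊤ : ℕ∞)) (Metric.isOpen_thickening (δ := δ) (E := A)) (Metric.isClosed_cthickening (δ := δ / 2) (E := A))
    (Metric.cthickening_subset_thickening' hδ (by linarith) A)
  have hs : tsupport χ ⊆ Metric.cthickening δ A := by
    refine closure_minimal ?_ Metric.isClosed_cthickening
    rw [h2]
    exact Metric.thickening_subset_cthickening δ A
  refine ⟨χ, contMDiff_iff_contDiff.1 h1, hA.cthickening.of_isClosed_subset (isClosed_tsupport χ) hs,
    hs.trans hδΩ, fun x hx => ?_⟩
  filter_upwards [Metric.isOpen_thickening.mem_nhds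
    (Metric.self_subset_thickening (half_pos hδ) A hx)] with z hz
  exact (h3 z).1 (Metric.thickening_subset_cthickening _ _ hz)

/-- w(T_t x) − w(x) is t times the average over s ∈ [0, 1] of ∇w(T_{st} x)·V(x); Minkowski's
inequality for averages does the rest. The comparison gradient g is left free so that w may be a
mollification of a Sobolev function with gradient g. -/
theorem eLpNorm_perturb_sub_sub_le_of_contDiff {w : Eucl n → ℝ} (hw : ContDiff ℝ 1 w)
    (hV : Continuous V) {μ : Measure (Eucl n)} [SFinite μ] (hp1 : 1 ≤ p) (hp : p ≠ ⊤)
    {g : Eucl n → Eucl n} (hg : AEStronglyMeasurable g μ) {t : ℝ} (ht : 0 ≤ t) {η : ℝ≥0∞}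
    (H : ∀ s ∈ Icc (0 : ℝ) 1,
      eLpNorm (fun x => inner ℝ (∇ w (perturb V (s * t) x) - g x) (V x)) p μ ≤ η) :
    eLpNorm (fun x => w (perturb V t x) - w x - t * inner ℝ (g x) (V x)) p μ
      ≤ ENNReal.ofReal t * η := by
  set ν : Measure ℝ := volume.restrict (Icc 0 1)
  have : IsProbabilityMeasure ν := ⟨by simp [ν]⟩
  have hcont : Continuous fun z : Eucl n × ℝ => ∇ w (perturb V (z.2 * t) z.1) := by
    refine (continuous_gradient hw).comp ?_
    unfold perturb
    fun_prop
  have hc1 : ∀ x, Continuous fun s : ℝ => inner ℝ (∇ w (perturb V (s * t) x)) (V x) := fun x =>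
    (hcont.comp (Continuous.prodMk_right x)).inner continuous_const
  have e : (fun x => w (perturb V t x) - w x - t * inner ℝ (g x) (V x))
      = t • fun x => ∫ s, inner ℝ (∇ w (perturb V (s * t) x) - g x) (V x) ∂ν := by
    ext1 x
    have hi : Integrable (fun s => inner ℝ (∇ w (perturb V (s * t) x)) (V x)) ν :=
      (hc1 x).integrableOn_Icc
    simp only [Pi.smul_apply, smul_eq_mul, inner_sub_left]
    rw [integral_sub hi (integrable_const _), integral_const, probReal_univ, one_smul, mul_sub]
    congr 1
    have hd : ∀ s ∈ uIcc (0 : ℝ) 1, HasDerivAt (fun s : ℝ => w (perturb V (s * t) x))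
        (t * inner ℝ (∇ w (perturb V (s * t) x)) (V x)) s := fun s _ => by
      have h1 : HasDerivAt (fun s : ℝ => perturb V (s * t) x) (t • V x) s := by
        unfold perturb
        have := ((hasDerivAt_id s).mul_const t).smul_const (V x)
        simpa using this.const_add x
      have h2 := ((hw.differentiable one_ne_zero (perturb V (s * t) x)).hasFDerivAt).comp_hasDerivAt s h1
      rw [map_smul] at h2
      rw [inner_gradient]
      exact h2
    have h3 := intervalIntegral.integral_eq_sub_of_hasDerivAt hd
      ((continuous_const.mul (hc1 x)).intervalIntegrable _ _)
    rw [one_mul, zero_mul, perturb_zero, id_eq] at h3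
    rw [← h3, intervalIntegral.integral_of_le zero_le_one, ← integral_Icc_eq_integral_Ioc,
      integral_const_mul]
  rw [e, eLpNorm_const_smul]
  refine mul_le_mul' ?_ ?_
  · rw [Real.enorm_eq_ofReal ht]
  · refine eLpNorm_integral_le_of_forall ?_ hp1 hp ?_
    · exact (hcont.aestronglyMeasurable.sub hg.comp_fst).inner
        (hV.comp continuous_fst).aestronglyMeasurable
    · rw [ae_restrict_iff' measurableSet_Icc]
      exact ae_of_all _ H

/-- Exhaustion by compact subsets and monotone convergence. -/
theorem eLpNorm_le_of_forall_isCompact {E : Type*} [NormedAddCommGroup E] (hΩ : IsOpen Ω)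
    (hb : Bornology.IsBounded Ω) (hp0 : p ≠ 0) (hp : p ≠ ⊤) {F : Eucl n → E} {B : ℝ≥0∞}
    (H : ∀ A, IsCompact A → A ⊆ Ω → eLpNorm F p (volume.restrict A) ≤ B) :
    eLpNorm F p (volume.restrict Ω) ≤ B := by
  obtain ⟨A, hA, hAΩ, hAU, hmono⟩ := hΩ.exists_iUnion_isClosed
  have hAc : ∀ k, IsCompact (A k) := fun k => Metric.isCompact_of_isClosed_isBounded (hA k)
    (hb.subset (hAΩ k))
  have hpr : 0 < p.toReal := ENNReal.toReal_pos hp0 hp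
  rw [eLpNorm_eq_lintegral_rpow_enorm_toReal hp0 hp, one_div, ENNReal.rpow_inv_le_iff hpr, ← hAU,
    setLIntegral_iUnion_of_directed _ hmono.directed_le]
  refine iSup_le fun k => ?_
  rw [← ENNReal.rpow_inv_le_iff hpr, ← one_div, ← eLpNorm_eq_lintegral_rpow_enorm_toReal hp0 hp]
  exact H _ (hAc k) (hAΩ k)

variable {u : Eucl n → ℝ} {g : Eucl n → Eucl n}

/-- The first-order Taylor estimate along the perturbation of the identity. -/
theorem HasWeakGrad.eLpNorm_perturb_sub_sub_le (hΩ : IsOpen Ω) (hb : Bornology.IsBounded Ω)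
    (hug : HasWeakGrad Ω u g) (hp1 : 1 ≤ p) (hp : p ≠ ⊤) (hu : MemLp u p (volume.restrict Ω))
    (hg : MemLp g p (volume.restrict Ω)) (hV : LipschitzWith K V) (h0 : ∀ x, x ∉ Ω → V x = 0)
    {M : ℝ} (hM : ∀ x, ‖V x‖ ≤ M) {t : ℝ} (ht : 0 ≤ t) (htK : t * K ≤ 1 / 2) {η : ℝ≥0∞}
    (H : ∀ s ∈ Icc (0 : ℝ) 1, eLpNorm (fun x => inner ℝ (g (perturb V (s * t) x) - g x) (V x)) p
      (volume.restrict Ω) ≤ η) :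
    eLpNorm (fun x => u (perturb V t x) - u x - t * inner ℝ (g x) (V x)) p (volume.restrict Ω)
      ≤ ENNReal.ofReal t * η := by
  have := hb.isFiniteMeasure_restrict
  have hp0 : p ≠ 0 := (one_pos.trans_le hp1).ne'
  refine eLpNorm_le_of_forall_isCompact hΩ hb hp0 hp fun A hA hAΩ => ?_
  have hst : ∀ s ∈ Icc (0 : ℝ) 1, IsBiLip Ω 2 (perturb V (s * t)) (Function.invFun (perturb V (s * t))) :=
    fun s hs => hV.isBiLip_perturb h0 (mul_nonneg hs.1 ht) (by
      have : s * t * K ≤ 1 * (t * K) := by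
        rw [mul_assoc]
        exact mul_le_mul_of_nonneg_right hs.2 (mul_nonneg ht K.2)
      linarith)
  -- Each T_{st} maps Ω to itself, so the points T_{st}(x) with x ∈ A fill a compact subset of Ω.
  -- Near it u can be cut off without being changed, and then mollified on the whole space.
  set A' : Set (Eucl n) := (fun z : Eucl n × ℝ => perturb V (z.2 * t) z.1) '' (A ×ˢ Icc 0 1)
  have hA' : IsCompact A' := by
    refine (hA.prod isCompact_Icc).image ?_
    have := hV.continuous
    unfold perturb
    fun_prop
  have hA'Ω : A' ⊆ Ω := by
    rintro _ ⟨⟨x, s⟩, ⟨hx, hs⟩, rfl⟩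
    exact ((hst s hs).mem_iff x).2 (hAΩ hx)
  obtain ⟨χ, hχ, hχc, hχs, hχ1⟩ := exists_cutoff hA' hΩ hA'Ω
  have hχ' : ContDiff ℝ 1 χ := hχ.of_le (by exact_mod_cast le_top)
  set W : Eucl n → ℝ := Ω.indicator fun x => χ x * u x with hW
  set G : Eucl n → Eucl n := Ω.indicator fun x => χ x • g x + u x • ∇ χ x with hG
  have hWG : HasWeakGrad univ W G := hug.indicator_mul_cutoff hΩ (hu.integrable hp1)
    (hg.integrable hp1) hχ hχc (by rw [univ_inter]; exact hχs)
  have hχt : MemLp χ ⊤ (volume.restrict Ω) := (hχ.continuous.memLp_of_hasCompactSupport hχc).restrict Ω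
  have hχg : MemLp (∇ χ) ⊤ (volume.restrict Ω) :=
    ((continuous_gradient hχ').memLp_of_hasCompactSupport hχc.gradient).restrict Ω
  have hWp : MemLp W p volume := (memLp_indicator_iff_restrict hΩ.measurableSet).2 (hu.mul' hχt)
  have hGp : MemLp G p volume := (memLp_indicator_iff_restrict hΩ.measurableSet).2
    ((hg.smul hχt).add (hχg.smul hu))
  have hWx : ∀ x ∈ A', W x = u x := fun x hx => by
    rw [hW, indicator_of_mem (hA'Ω hx), (hχ1 x hx).self_of_nhds, Pi.one_apply, one_mul]
  have hGx : ∀ x ∈ A', G x = g x := fun x hx => by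
    have : ∇ χ x = 0 := by
      rw [_root_.gradient, (hχ1 x hx).fderiv_eq]; simp
    rw [hG, indicator_of_mem (hA'Ω hx), (hχ1 x hx).self_of_nhds, Pi.one_apply, one_smul, this,
      smul_zero, add_zero]
  have hmem : ∀ s ∈ Icc (0 : ℝ) 1, ∀ x ∈ A, perturb V (s * t) x ∈ A' := fun s hs x hx =>
    ⟨(x, s), ⟨hx, hs⟩, rfl⟩
  have hmem0 : ∀ x ∈ A, x ∈ A' := fun x hx => by
    have := hmem 0 ⟨le_rfl, zero_le_one⟩ x hx
    rwa [zero_mul, perturb_zero] at this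
  have hmem1 : ∀ x ∈ A, perturb V t x ∈ A' := fun x hx => by
    have := hmem 1 ⟨zero_le_one, le_rfl⟩ x hx
    rwa [one_mul] at this
  have hφ := tendsto_stdBump n
  have hW1 := tendsto_eLpNorm_mollify_sub hφ hp1 hp hWp
  have hG1 := tendsto_eLpNorm_mollify_sub hφ hp1 hp hGp
  have hWloc : LocallyIntegrable W volume := hWp.locallyIntegrable hp1
  have hgrad : ∀ k, ∇ (mollify (stdBump n k) W) = mollify (stdBump n k) G := fun k =>
    funext fun x => gradient_mollify hWloc hWG _ (subset_univ _)
  set C : ℝ≥0∞ := (((2 : NNReal) : ℝ≥0∞) ^ n) ^ (1 / p).toReal with hC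
  have hCt : C ≠ ⊤ := by
    refine ENNReal.rpow_ne_top_of_nonneg ENNReal.toReal_nonneg (by finiteness)
  have hAm : MeasurableSet A := hA.measurableSet
  have hle : volume.restrict A ≤ volume.restrict Ω := Measure.restrict_mono hAΩ le_rfl
  -- For fixed t the mollification errors, with their factors C + 1 and C, vanish as k → ∞; what
  -- remains does not depend on A.
  have est : ∀ k, eLpNorm (fun x => u (perturb V t x) - u x - t * inner ℝ (g x) (V x)) p
      (volume.restrict A) ≤ (C + 1) * eLpNorm (fun x => mollify (stdBump n k) W x - W x) p volume
        + ENNReal.ofReal t * (ENNReal.ofReal M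
          * (C * eLpNorm (fun x => mollify (stdBump n k) G x - G x) p volume) + η) := by
    intro k
    set w := mollify (stdBump n k) W with hw
    have hwc : ContDiff ℝ 1 w := (contDiff_mollify _ hWloc).of_le (by exact_mod_cast le_top)
    have hwp : MemLp (fun x => w x - W x) p volume := (memLp_mollify _ hp1 hp hWp).sub hWp
    have hgp : MemLp (fun x => mollify (stdBump n k) G x - G x) p volume :=
      (memLp_mollify _ hp1 hp hGp).sub hGp
    have h1 : eLpNorm (fun x => w (perturb V t x) - w x - t * inner ℝ (g x) (V x)) p
        (volume.restrict A) ≤ ENNReal.ofReal t * (ENNReal.ofReal M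
          * (C * eLpNorm (fun x => mollify (stdBump n k) G x - G x) p volume) + η) := by
      refine eLpNorm_perturb_sub_sub_le_of_contDiff hwc hV.continuous hp1 hp (hg.1.mono_measure hle)
        ht fun s hs => ?_
      have hcomp := hst s hs
      have m1 : AEStronglyMeasurable (fun x => inner ℝ ((fun x => mollify (stdBump n k) G x - G x)
          (perturb V (s * t) x)) (V x)) (volume.restrict A) :=
        ((aestronglyMeasurable_comp hcomp.measurable hcomp.map_le hgp.1).restrict).inner
          hV.continuous.aestronglyMeasurable
      have m2 : AEStronglyMeasurable (fun x => inner ℝ (g (perturb V (s * t) x) - g x) (V x))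
          (volume.restrict A) :=
        (((hcomp.memLp_comp hΩ.measurableSet hg).sub hg).1.inner
          hV.continuous.aestronglyMeasurable).mono_measure hle
      have e1 : (fun x => inner ℝ (∇ w (perturb V (s * t) x) - g x) (V x)) =ᵐ[volume.restrict A]
          (fun x => inner ℝ ((fun x => mollify (stdBump n k) G x - G x) (perturb V (s * t) x)) (V x))
            + fun x => inner ℝ (g (perturb V (s * t) x) - g x) (V x) := by
        filter_upwards [ae_restrict_mem hAm] with x hx
        rw [Pi.add_apply, ← inner_add_left, hw, hgrad, hGx _ (hmem s hs x hx)]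
        congr 1; abel
      rw [eLpNorm_congr_ae e1]
      refine (eLpNorm_add_le m1 m2 hp1).trans (add_le_add ?_ ?_)
      · have b1 : eLpNorm (fun x => inner ℝ ((fun x => mollify (stdBump n k) G x - G x)
            (perturb V (s * t) x)) (V x)) p (volume.restrict A) ≤ ENNReal.ofReal M
              * eLpNorm (fun x => (fun x => mollify (stdBump n k) G x - G x) (perturb V (s * t) x)) p
                (volume.restrict A) := by
          refine eLpNorm_le_mul_eLpNorm_of_ae_le_mul (ae_of_all _ fun x => ?_) p
          refine (norm_inner_le_norm _ _).trans ?_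
          rw [mul_comm]
          exact mul_le_mul_of_nonneg_right (hM x) (norm_nonneg _)
        refine b1.trans (mul_le_mul' le_rfl ?_)
        exact (eLpNorm_mono_measure _ Measure.restrict_le_self).trans
          (_root_.eLpNorm_comp_le hcomp.measurable hcomp.map_le hgp.1 p)
      · exact (eLpNorm_mono_measure _ hle).trans (H s hs)
    have hcomp := hst 1 ⟨zero_le_one, le_rfl⟩
    rw [one_mul] at hcomp
    have m1 : AEStronglyMeasurable (fun x => w (perturb V t x) - w x - t * inner ℝ (g x) (V x))
        (volume.restrict A) := by
      refine ((hwc.continuous.comp ?_).sub hwc.continuous).aestronglyMeasurable.sub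
        (((hg.1.inner hV.continuous.aestronglyMeasurable).const_mul t).mono_measure hle)
      exact hcomp.lip.continuous
    have m2 := (aestronglyMeasurable_comp hcomp.measurable hcomp.map_le hwp.1).restrict (s := A)
    have e1 : (fun x => u (perturb V t x) - u x - t * inner ℝ (g x) (V x)) =ᵐ[volume.restrict A]
        (((fun x => w x - W x) - fun x => (fun x => w x - W x) (perturb V t x)))
          + fun x => w (perturb V t x) - w x - t * inner ℝ (g x) (V x) := by
      filter_upwards [ae_restrict_mem hAm] with x hx
      simp only [Pi.add_apply, Pi.sub_apply]
      rw [hWx _ (hmem0 x hx), hWx _ (hmem1 x hx)]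
      ring
    rw [eLpNorm_congr_ae e1]
    refine (eLpNorm_add_le (hwp.1.restrict.sub m2) m1 hp1).trans (add_le_add ?_ h1)
    refine (eLpNorm_sub_le hwp.1.restrict m2 hp1).trans ?_
    rw [add_mul, one_mul, add_comm]
    refine add_le_add ?_ (eLpNorm_mono_measure _ Measure.restrict_le_self)
    exact (eLpNorm_mono_measure _ Measure.restrict_le_self).trans
      (_root_.eLpNorm_comp_le hcomp.measurable hcomp.map_le hwp.1 p)
  have l1 := ENNReal.Tendsto.const_mul (a := C + 1) hW1 (Or.inr (by finiteness))
  have l2 := ENNReal.Tendsto.const_mul (a := C) hG1 (Or.inr hCt)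
  have l3 := ENNReal.Tendsto.const_mul (a := ENNReal.ofReal M) l2 (Or.inr ENNReal.ofReal_ne_top)
  have l4 := ENNReal.Tendsto.const_mul (a := ENNReal.ofReal t) (l3.add_const η)
    (Or.inr ENNReal.ofReal_ne_top)
  have l5 := l1.add l4
  simp only [mul_zero, zero_add] at l5
  exact ge_of_tendsto' l5 est

end DifferenceQuotients

/-! ### Lipschitz fields: difference quotients and the Jacobian. -/

section Field

variable {n : ℕ} {Ω : Set (Eucl n)} {V : Eucl n → Eucl n} {K : NNReal} {M : ℝ} {p : ℝ≥0∞}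

/-- A Lipschitz field on a bounded open set that vanishes outside of it, with its constants. -/
structure IsLipField (Ω : Set (Eucl n)) (V : Eucl n → Eucl n) (K : NNReal) (M : ℝ) : Prop where
  isOpen : IsOpen Ω
  isBounded : Bornology.IsBounded Ω
  memH10 : MemH10Vec Ω V
  lip : LipschitzWith K V
  zero : ∀ x, x ∉ Ω → V x = 0
  bound : ∀ x, ‖V x‖ ≤ M

theorem IsAdmissibleField.exists_isLipField (hV : IsAdmissibleField Ω V) (hΩ : IsOpen Ω)
    (hb : Bornology.IsBounded Ω) : ∃ K M, IsLipField Ω V K M := by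
  obtain ⟨K, hK⟩ := hV.2.1
  obtain ⟨M, hM⟩ := (hb.isCompact_closure).exists_bound_of_continuousOn hK.continuous.continuousOn
  refine ⟨K, max M 0, hΩ, hb, hV.1, hK, hV.2.2, fun x => ?_⟩
  by_cases hx : x ∈ Ω
  · exact (hM x (subset_closure hx)).trans (le_max_left _ _)
  · rw [hV.2.2 x hx, norm_zero]; exact le_max_right _ _

theorem eventually_mul_le_half (K : NNReal) : ∀ᶠ t : ℝ in 𝓝[≥] 0, 0 ≤ t ∧ t * K ≤ 1 / 2 := by
  have h : Tendsto (fun t : ℝ => t * K) (𝓝 0) (𝓝 0) := by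
    simpa using (continuous_mul_const (K : ℝ)).tendsto 0
  filter_upwards [self_mem_nhdsWithin,
    nhdsWithin_le_nhds (h.eventually (ge_mem_nhds (by norm_num : (0 : ℝ) < 1 / 2)))] with t h1 h2
  exact ⟨h1, h2⟩

/-- The Jacobian determinant of the perturbation of the identity. -/
noncomputable def jac (V : Eucl n → Eucl n) (t : ℝ) (x : Eucl n) : ℝ := |(fderiv ℝ (perturb V t) x).det|

theorem tendsto_const_mul_nhdsGT (C : ℝ) : Tendsto (fun t : ℝ => C * t) (𝓝[>] 0) (𝓝 0) := by
  simpa using ((continuous_const_mul C).tendsto 0).mono_left nhdsWithin_le_nhds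

theorem tendsto_ofReal_const_mul_nhdsGT (C : ℝ) :
    Tendsto (fun t : ℝ => ENNReal.ofReal (C * t)) (𝓝[>] 0) (𝓝 0) := by
  simpa using ENNReal.tendsto_ofReal (tendsto_const_mul_nhdsGT C)

/-- Convergence in `L^p` of compositions with maps that tend to the identity. -/
theorem tendsto_eLpNorm_comp_sub_restrict {ι : Type*} {l : Filter ι} {E : Type*}
    [NormedAddCommGroup E] [NormedSpace ℝ E] {Φ Ψ : ι → Eucl n → Eucl n} (hΩ : MeasurableSet Ω)
    (h : ∀ᶠ i in l, IsBiLip Ω 2 (Φ i) (Ψ i)) (hid : ∀ ε > 0, ∀ᶠ i in l, ∀ x, dist (Φ i x) x ≤ ε)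
    (hp1 : 1 ≤ p) (hp : p ≠ ⊤) {F : Eucl n → E} (hF : MemLp F p (volume.restrict Ω)) :
    Tendsto (fun i => eLpNorm (fun x => F (Φ i x) - F x) p (volume.restrict Ω)) l (𝓝 0) := by
  have hF' : MemLp (Ω.indicator F) p volume := (memLp_indicator_iff_restrict hΩ).2 hF
  have hC : ((2 : NNReal) : ℝ≥0∞) ^ n ≠ ⊤ := by finiteness
  have h1 : Tendsto (fun i => eLpNorm (fun x => Ω.indicator F (Φ i x) - Ω.indicator F x) p volume)
      l (𝓝 0) :=
    tendsto_eLpNorm_comp_sub hC (h.mono fun i hi => hi.measurable) (h.mono fun i hi => hi.map_le)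
      hid hp1 hp hF'
  refine tendsto_of_tendsto_of_tendsto_of_le_of_le' tendsto_const_nhds h1
    (Eventually.of_forall fun _ => zero_le) ?_
  filter_upwards [h] with i hi
  have e : (fun x => F (Φ i x) - F x) =ᵐ[volume.restrict Ω]
      fun x => Ω.indicator F (Φ i x) - Ω.indicator F x := by
    filter_upwards [ae_restrict_mem hΩ] with x hx
    rw [indicator_of_mem hx, indicator_of_mem ((hi.mem_iff x).2 hx)]
  rw [eLpNorm_congr_ae e]
  exact eLpNorm_mono_measure _ Measure.restrict_le_self

namespace IsLipField

theorem isBiLip (h : IsLipField Ω V K M) :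
    ∀ᶠ t in 𝓝[≥] (0 : ℝ), IsBiLip Ω 2 (perturb V t) (Function.invFun (perturb V t)) :=
  (eventually_mul_le_half K).mono fun _ ht => h.lip.isBiLip_perturb h.zero ht.1 ht.2

theorem isBiLip_gt (h : IsLipField Ω V K M) :
    ∀ᶠ t in 𝓝[>] (0 : ℝ), IsBiLip Ω 2 (perturb V t) (Function.invFun (perturb V t)) :=
  h.isBiLip.filter_mono (nhdsWithin_mono _ Ioi_subset_Ici_self)

theorem dist_perturb_le (h : IsLipField Ω V K M) {t : ℝ} (ht : 0 ≤ t) (x : Eucl n) :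
    dist (perturb V t x) x ≤ M * t := by
  rw [dist_eq_norm, perturb, add_sub_cancel_left, norm_smul, Real.norm_eq_abs, abs_of_nonneg ht,
    mul_comm]
  exact mul_le_mul_of_nonneg_right (h.bound x) ht

theorem eventually_dist_perturb (h : IsLipField Ω V K M) {ε : ℝ} (hε : 0 < ε) :
    ∀ᶠ t in 𝓝[>] (0 : ℝ), ∀ x, dist (perturb V t x) x ≤ ε := by
  filter_upwards [self_mem_nhdsWithin,
    (tendsto_const_mul_nhdsGT M).eventually (ge_mem_nhds hε)] with t ht h1 x
  exact (h.dist_perturb_le (le_of_lt ht) x).trans h1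

theorem eventually_dist_invFun (h : IsLipField Ω V K M) {ε : ℝ} (hε : 0 < ε) :
    ∀ᶠ t in 𝓝[>] (0 : ℝ), ∀ x, dist (Function.invFun (perturb V t) x) x ≤ ε := by
  filter_upwards [h.eventually_dist_perturb hε, h.isBiLip_gt] with t h1 h2 x
  have := h1 (Function.invFun (perturb V t) x)
  rwa [h2.right_inv x, dist_comm] at this

theorem tendsto_comp (h : IsLipField Ω V K M) (hp1 : 1 ≤ p) (hp : p ≠ ⊤) {E : Type*}
    [NormedAddCommGroup E] [NormedSpace ℝ E] {F : Eucl n → E} (hF : MemLp F p (volume.restrict Ω)) :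
    Tendsto (fun t => eLpNorm (fun x => F (perturb V t x) - F x) p (volume.restrict Ω))
      (𝓝[>] 0) (𝓝 0) :=
  tendsto_eLpNorm_comp_sub_restrict h.isOpen.measurableSet h.isBiLip_gt
    (fun _ hε => h.eventually_dist_perturb hε) hp1 hp hF

theorem tendstoLp_comp (h : IsLipField Ω V K M) (hp1 : 1 ≤ p) (hp : p ≠ ⊤) {F : Eucl n → ℝ}
    (hF : MemLp F p (volume.restrict Ω)) :
    TendstoLp p (volume.restrict Ω) (𝓝[>] 0) (fun t x => F (perturb V t x)) F :=
  ⟨h.isBiLip_gt.mono fun _ ht => ht.memLp_comp h.isOpen.measurableSet hF, hF,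
    h.tendsto_comp hp1 hp hF⟩

theorem tendstoLp_comp_invFun (h : IsLipField Ω V K M) (hp1 : 1 ≤ p) (hp : p ≠ ⊤) {F : Eucl n → ℝ}
    (hF : MemLp F p (volume.restrict Ω)) :
    TendstoLp p (volume.restrict Ω) (𝓝[>] 0) (fun t x => F (Function.invFun (perturb V t) x)) F :=
  ⟨h.isBiLip_gt.mono fun _ ht => ht.symm.memLp_comp h.isOpen.measurableSet hF, hF,
    tendsto_eLpNorm_comp_sub_restrict h.isOpen.measurableSet (h.isBiLip_gt.mono fun _ ht => ht.symm)
      (fun _ hε => h.eventually_dist_invFun hε) hp1 hp hF⟩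

theorem eLpNorm_inner_le (h : IsLipField Ω V K M) {μ : Measure (Eucl n)} (G : Eucl n → Eucl n) :
    eLpNorm (fun x => inner ℝ (G x) (V x)) p μ ≤ ENNReal.ofReal M * eLpNorm G p μ := by
  refine eLpNorm_le_mul_eLpNorm_of_ae_le_mul (ae_of_all _ fun x => ?_) p
  refine (norm_inner_le_norm _ _).trans ?_
  rw [mul_comm]
  exact mul_le_mul_of_nonneg_right (h.bound x) (norm_nonneg _)

theorem memLp_inner (h : IsLipField Ω V K M) {μ : Measure (Eucl n)} {G : Eucl n → Eucl n}
    (hG : MemLp G p μ) : MemLp (fun x => inner ℝ (G x) (V x)) p μ :=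
  ⟨hG.1.inner h.lip.continuous.aestronglyMeasurable,
    h.eLpNorm_inner_le G |>.trans_lt (ENNReal.mul_lt_top ENNReal.ofReal_lt_top hG.2)⟩

theorem memLp_dirDeriv (h : IsLipField Ω V K M) {u : Eucl n → ℝ} (hu : MemW1 Ω p u) :
    MemLp (dirDeriv Ω u V) p (volume.restrict Ω) := h.memLp_inner hu.2.2

/-- The difference quotients along the perturbation of the identity converge in `L^p`. -/
theorem tendstoLp_diffQuot (h : IsLipField Ω V K M) (hp1 : 1 ≤ p) (hp : p ≠ ⊤) {u : Eucl n → ℝ}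
    (hu : MemW1 Ω p u) :
    TendstoLp p (volume.restrict Ω) (𝓝[>] 0) (fun t x => (u (perturb V t x) - u x) / t)
      (dirDeriv Ω u V) := by
  have hm : ∀ᶠ t in 𝓝[>] (0 : ℝ),
      MemLp (fun x => (u (perturb V t x) - u x) / t) p (volume.restrict Ω) := by
    filter_upwards [h.isBiLip_gt] with t ht
    simpa [div_eq_inv_mul] using
      ((ht.memLp_comp h.isOpen.measurableSet hu.1).sub hu.1).const_mul t⁻¹
  refine ⟨hm, h.memLp_dirDeriv hu, ?_⟩
  refine ENNReal.tendsto_nhds_zero.2 fun ε hε => ?_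
  -- Continuity of composition makes ∇u∘T_τ − ∇u small for all 0 < τ < δ, so in particular for τ =
  -- st with s ∈ (0, 1]; s = 0 is trivial and is treated apart, being outside the punctured
  -- neighbourhood.
  have hmul := ENNReal.Tendsto.const_mul (a := ENNReal.ofReal M) (h.tendsto_comp hp1 hp hu.2.2)
    (Or.inr ENNReal.ofReal_ne_top)
  rw [mul_zero] at hmul
  have hev := ENNReal.tendsto_nhds_zero.1 hmul ε hε
  obtain ⟨δ, hδ, hδε⟩ := mem_nhdsGT_iff_exists_Ioo_subset.1 hev
  filter_upwards [Ioo_mem_nhdsGT hδ,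
    (eventually_mul_le_half K).filter_mono (nhdsWithin_mono _ Ioi_subset_Ici_self)] with t ht htK
  have ht0 : (0 : ℝ) < t := ht.1
  have key := (weakGrad_spec hu.2.1).eLpNorm_perturb_sub_sub_le h.isOpen h.isBounded hp1 hp hu.1
    hu.2.2 h.lip h.zero h.bound htK.1 htK.2 (η := ε) fun s hs => by
      refine (h.eLpNorm_inner_le fun x => weakGrad Ω u (perturb V (s * t) x) - weakGrad Ω u x).trans ?_
      rcases hs.1.eq_or_lt with h0 | h0
      · rw [← h0, zero_mul, perturb_zero]; simp
      · exact hδε ⟨mul_pos h0 ht0, lt_of_le_of_lt (mul_le_of_le_one_left ht0.le hs.2) ht.2⟩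
  have e : (fun x => (u (perturb V t x) - u x) / t - dirDeriv Ω u V x)
      = t⁻¹ • fun x => u (perturb V t x) - u x - t * inner ℝ (weakGrad Ω u x) (V x) := by
    ext1 x
    simp only [Pi.smul_apply, smul_eq_mul, dirDeriv]
    field_simp
  rw [e, eLpNorm_const_smul]
  refine (mul_le_mul' le_rfl key).trans (le_of_eq ?_)
  rw [← mul_assoc, Real.enorm_eq_ofReal (inv_nonneg.2 ht0.le), ← ENNReal.ofReal_mul
    (inv_nonneg.2 ht0.le), inv_mul_cancel₀ ht0.ne', ENNReal.ofReal_one, one_mul]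

/-- Same Taylor estimate, but uniform in u, since it will be used for test functions that depend on
t. The increment of the gradient is bounded crudely by (A + 1)‖∇u‖. -/
theorem exists_lpNorm_comp_sub_le (h : IsLipField Ω V K M) (hp1 : 1 ≤ p) (hp : p ≠ ⊤) :
    ∃ C : ℝ, 0 ≤ C ∧ ∀ᶠ t in 𝓝[>] (0 : ℝ), ∀ u, MemW1 Ω p u →
      lpNorm (fun x => u (perturb V t x) - u x) p (volume.restrict Ω)
        ≤ C * t * lpNorm (weakGrad Ω u) p (volume.restrict Ω) := by
  set A : ℝ≥0∞ := (((2 : NNReal) : ℝ≥0∞) ^ n) ^ (1 / p).toReal with hA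
  have hAt : A ≠ ⊤ := ENNReal.rpow_ne_top_of_nonneg ENNReal.toReal_nonneg (by finiteness)
  set B : ℝ≥0∞ := ENNReal.ofReal M * (A + 1) + ENNReal.ofReal M with hB
  have hBt : B ≠ ⊤ := by finiteness
  refine ⟨B.toReal, ENNReal.toReal_nonneg, ?_⟩
  filter_upwards [self_mem_nhdsWithin,
    (eventually_mul_le_half K).filter_mono (nhdsWithin_mono _ Ioi_subset_Ici_self)] with t ht0 htK u hu
  have ht0 : (0 : ℝ) < t := ht0
  set g := weakGrad Ω u with hg
  have hst : ∀ s ∈ Icc (0 : ℝ) 1, IsBiLip Ω 2 (perturb V (s * t)) (Function.invFun (perturb V (s * t))) :=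
    fun s hs => h.lip.isBiLip_perturb h.zero (mul_nonneg hs.1 ht0.le) (by
      have : s * t * K ≤ 1 * (t * K) := by
        rw [mul_assoc]
        exact mul_le_mul_of_nonneg_right hs.2 (mul_nonneg ht0.le K.2)
      linarith [htK.2])
  have key := (weakGrad_spec hu.2.1).eLpNorm_perturb_sub_sub_le h.isOpen h.isBounded hp1 hp hu.1
    hu.2.2 h.lip h.zero h.bound htK.1 htK.2 (η := ENNReal.ofReal M * ((A + 1)
      * eLpNorm g p (volume.restrict Ω))) fun s hs => by
      refine (h.eLpNorm_inner_le fun x => g (perturb V (s * t) x) - g x).trans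
        (mul_le_mul' le_rfl ?_)
      have hc := (hst s hs).memLp_comp h.isOpen.measurableSet hu.2.2
      refine (eLpNorm_sub_le hc.1 hu.2.2.1 hp1).trans ?_
      rw [add_mul, one_mul]
      exact add_le_add ((hst s hs).eLpNorm_comp_le h.isOpen.measurableSet hu.2.2.1) le_rfl
  have hT := hst 1 ⟨zero_le_one, le_rfl⟩
  rw [one_mul] at hT
  have hsub : MemLp (fun x => u (perturb V t x) - u x) p (volume.restrict Ω) :=
    (hT.memLp_comp h.isOpen.measurableSet hu.1).sub hu.1
  have hd : MemLp (fun x => t * inner ℝ (g x) (V x)) p (volume.restrict Ω) :=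
    (h.memLp_inner hu.2.2).const_mul t
  have est : eLpNorm (fun x => u (perturb V t x) - u x) p (volume.restrict Ω)
      ≤ B * ENNReal.ofReal t * eLpNorm g p (volume.restrict Ω) := by
    have e : (fun x => u (perturb V t x) - u x)
        = (fun x => u (perturb V t x) - u x - t * inner ℝ (g x) (V x))
          + fun x => t * inner ℝ (g x) (V x) := by ext1 x; simp
    have e2 : eLpNorm (fun x => t * inner ℝ (g x) (V x)) p (volume.restrict Ω)
        ≤ ENNReal.ofReal t * (ENNReal.ofReal M * eLpNorm g p (volume.restrict Ω)) := by
      have : (fun x => t * inner ℝ (g x) (V x)) = t • fun x => inner ℝ (g x) (V x) := rfl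
      rw [this, eLpNorm_const_smul, Real.enorm_eq_ofReal ht0.le]
      exact mul_le_mul' le_rfl (h.eLpNorm_inner_le g)
    rw [e]
    refine (eLpNorm_add_le (hsub.sub hd).1 hd.1 hp1).trans ((add_le_add key e2).trans (le_of_eq ?_))
    rw [hB]; ring
  rw [hsub.lpNorm_eq, hu.2.2.lpNorm_eq]
  have := ENNReal.toReal_mono (by finiteness [hu.2.2.2.ne]) est
  rwa [ENNReal.toReal_mul, ENNReal.toReal_mul, ENNReal.toReal_ofReal ht0.le] at this

theorem memLp_gradField (h : IsLipField Ω V K M) (i j : Fin n) :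
    MemLp (fun x => gradField Ω V x i j) ⊤ (volume.restrict Ω) :=
  memLp_top_of_bound ((memLp_piLp_iff.1 (h.memH10 j).1.2.2) i).1 K
    ((h.lip.abs_gradField_le h.isOpen).mono fun _ hx => hx i j)

theorem memLp_divField (h : IsLipField Ω V K M) : MemLp (divField Ω V) ⊤ (volume.restrict Ω) :=
  memLp_finsetSum Finset.univ fun i _ => h.memLp_gradField i i

theorem aestronglyMeasurable_jac (V : Eucl n → Eucl n) (t : ℝ) (μ : Measure (Eucl n)) :
    AEStronglyMeasurable (jac V t) μ :=
  ((ContinuousLinearMap.continuous_det.measurable.comp (measurable_fderiv ℝ _)).aestronglyMeasurable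
    (μ := μ)).norm

/-- The uniform expansion of det(I + t∇V), available because the entries of ∇V are bounded by K
almost everywhere. -/
theorem jac_sub_le (h : IsLipField Ω V K M) {ε : ℝ} (hε : 0 < ε) :
    ∀ᶠ t in 𝓝[>] (0 : ℝ), ∀ᵐ x ∂(volume.restrict Ω), |jac V t x - 1 - t * divField Ω V x| ≤ ε * t := by
  obtain ⟨δ, hδ, hdet⟩ := Matrix.abs_det_one_add_smul_sub_le n K hε
  -- Keeps the determinant nonnegative, so that the absolute value in `jac` can be dropped.
  have hsmall : ∀ᶠ t in 𝓝[>] (0 : ℝ), (n * K + ε) * t ≤ 1 :=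
    (tendsto_const_mul_nhdsGT _).eventually (ge_mem_nhds one_pos)
  filter_upwards [Ioo_mem_nhdsGT hδ, hsmall] with t ht hts
  filter_upwards [h.lip.det_fderiv_perturb h.isOpen t, h.lip.abs_gradField_le h.isOpen] with x h1 h2
  have h3 := hdet t (by rw [abs_of_pos ht.1]; exact ht.2.le) _ h2
  rw [abs_of_pos ht.1] at h3
  have h4 : |(gradField Ω V x).trace| ≤ n * K := by
    refine (Finset.abs_sum_le_sum_abs _ _).trans ((Finset.sum_le_card_nsmul _ _ (K : ℝ)
      fun i _ => h2 i i).trans (le_of_eq ?_))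
    simp
  have h5 : 0 ≤ (fderiv ℝ (perturb V t) x).det := by
    rw [h1]
    have a1 := (abs_le.1 h3).1
    have a2 := (abs_le.1 h4).1
    have a3 := ht.1
    nlinarith
  rw [jac, abs_of_nonneg h5, h1]
  exact h3

/-- The convergence is uniform, hence holds in every Lᵖ on the bounded set Ω. The case p = ∞ allows
multiplication with sequences converging in any Lᵖ, without loss of exponent. -/
theorem tendstoLp_jac_sub_div (h : IsLipField Ω V K M) :
    TendstoLp p (volume.restrict Ω) (𝓝[>] 0) (fun t x => (jac V t x - 1) / t) (divField Ω V) := by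
  have := h.isBounded.isFiniteMeasure_restrict
  have hdiv : MemLp (divField Ω V) p (volume.restrict Ω) := h.memLp_divField.mono_exponent le_top
  have hb : ∀ ε > 0, ∀ᶠ t in 𝓝[>] (0 : ℝ), ∀ᵐ x ∂(volume.restrict Ω),
      ‖(jac V t x - 1) / t - divField Ω V x‖ ≤ ε := fun ε hε => by
    filter_upwards [h.jac_sub_le hε, self_mem_nhdsWithin] with t ht ht0
    have ht0 : (0 : ℝ) < t := ht0
    filter_upwards [ht] with x hx
    have e : (jac V t x - 1) / t - divField Ω V x = (jac V t x - 1 - t * divField Ω V x) / t := by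
      field_simp
    rw [e, Real.norm_eq_abs, abs_div, abs_of_pos ht0, div_le_iff₀ ht0]
    exact hx
  have hm : ∀ t, AEStronglyMeasurable (fun x => (jac V t x - 1) / t - divField Ω V x)
      (volume.restrict Ω) := fun t => by
    simp only [div_eq_mul_inv]
    exact (((aestronglyMeasurable_jac V t _).sub aestronglyMeasurable_const).mul_const _).sub hdiv.1
  refine ⟨?_, hdiv, ?_⟩
  · filter_upwards [hb 1 one_pos] with t ht
    have h1 : MemLp (fun x => (jac V t x - 1) / t - divField Ω V x) p (volume.restrict Ω) :=
      MemLp.of_bound (hm t) 1 ht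
    have h2 := h1.add hdiv
    refine h2.ae_eq (ae_of_all _ fun x => ?_)
    simp
  · refine ENNReal.tendsto_nhds_zero.2 fun ε hε => ?_
    set A : ℝ≥0∞ := (volume.restrict Ω) univ ^ p.toReal⁻¹ with hA
    have hAt : A ≠ ⊤ := ENNReal.rpow_ne_top_of_nonneg (by positivity) (measure_ne_top _ _)
    obtain ⟨η, hη, hηε⟩ : ∃ η : ℝ, 0 < η ∧ A * ENNReal.ofReal η ≤ ε := by
      have ht : Tendsto (fun η : ℝ => A * ENNReal.ofReal η) (𝓝[>] 0) (𝓝 0) := by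
        have := ENNReal.Tendsto.const_mul (a := A) (tendsto_ofReal_const_mul_nhdsGT 1) (Or.inr hAt)
        simpa using this
      obtain ⟨η, h1, h2⟩ := ((ENNReal.tendsto_nhds_zero.1 ht ε hε).and self_mem_nhdsWithin).exists
      exact ⟨η, h2, h1⟩
    filter_upwards [hb η hη] with t ht
    exact (eLpNorm_le_of_ae_bound ht).trans hηε

theorem exists_jac_sub_one_le (h : IsLipField Ω V K M) : ∃ C : ℝ, 0 ≤ C ∧
    ∀ᶠ t in 𝓝[>] (0 : ℝ), ∀ᵐ x ∂(volume.restrict Ω), |jac V t x - 1| ≤ C * t := by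
  obtain ⟨B, hB0, hB⟩ := h.memLp_divField.exists_ae_abs_le
  refine ⟨1 + B, by positivity, ?_⟩
  filter_upwards [h.jac_sub_le one_pos, self_mem_nhdsWithin] with t ht ht0
  have ht0 : (0 : ℝ) < t := ht0
  filter_upwards [ht, hB] with x h1 h2
  have h3 : |t * divField Ω V x| ≤ t * B := by
    rw [abs_mul, abs_of_pos ht0]; exact mul_le_mul_of_nonneg_left h2 ht0.le
  calc |jac V t x - 1| = |(jac V t x - 1 - t * divField Ω V x) + t * divField Ω V x| := by ring_nf
    _ ≤ _ := abs_add_le _ _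
    _ ≤ (1 + B) * t := by linarith

theorem jac_bound (h : IsLipField Ω V K M) :
    ∀ᶠ t in 𝓝[>] (0 : ℝ), ∀ᵐ x ∂(volume.restrict Ω), |jac V t x| ≤ 2 := by
  obtain ⟨C, -, hC⟩ := h.exists_jac_sub_one_le
  filter_upwards [hC, (tendsto_const_mul_nhdsGT C).eventually (ge_mem_nhds one_pos)] with t h1 h2
  filter_upwards [h1] with x hx
  have := abs_le.1 (hx.trans h2)
  exact abs_le.2 ⟨by linarith, by linarith⟩

theorem tendstoLp_jac (h : IsLipField Ω V K M) (hp1 : 1 ≤ p) :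
    TendstoLp p (volume.restrict Ω) (𝓝[>] 0) (jac V) (fun _ => 1) := by
  have := h.isBounded.isFiniteMeasure_restrict
  have h1 := h.tendstoLp_jac_sub_div (p := p)
  have h2 : TendstoLp ⊤ (volume.restrict Ω) (𝓝[>] (0 : ℝ)) (fun t _ => t) (fun _ => 0) := by
    refine ⟨Eventually.of_forall fun t => memLp_const t, memLp_const 0, ?_⟩
    have h3 : Tendsto (fun t : ℝ => ENNReal.ofReal (1 * t)) (𝓝[>] 0) (𝓝 0) :=
      tendsto_ofReal_const_mul_nhdsGT 1
    refine tendsto_of_tendsto_of_tendsto_of_le_of_le' tendsto_const_nhds h3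
      (Eventually.of_forall fun _ => zero_le) ?_
    filter_upwards [self_mem_nhdsWithin] with t ht
    have ht : (0 : ℝ) < t := ht
    refine (eLpNorm_le_of_ae_bound (C := t) (ae_of_all _ fun x => ?_)).trans (le_of_eq (by simp))
    simp [abs_of_pos ht]
  have h4 := (TendstoLp.mul (r := p) hp1 h2 h1).add hp1 (TendstoLp.const (memLp_const (1 : ℝ)))
  refine (h4.congr' ?_).congr_lim (ae_of_all _ fun x => by simp)
  filter_upwards [self_mem_nhdsWithin] with t ht
  have ht : (0 : ℝ) < t := ht
  refine ae_of_all _ fun x => ?_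
  field_simp
  ring

theorem setIntegral_jac_comp (h : IsLipField Ω V K M) (F : Eucl n → ℝ) :
    ∀ᶠ t in 𝓝[>] (0 : ℝ), ∫ x in Ω, jac V t x * F (perturb V t x) = ∫ x in Ω, F x :=
  h.isBiLip_gt.mono fun _ ht => ht.setIntegral_comp h.isOpen.measurableSet F

end IsLipField

end Field

/-! ### The averaged derivative of the nonlinearity. -/

section AverageDerivative

/-- The average of the derivative of `m` over the segment from `b` to `a`. -/
noncomputable def avgDeriv (m : ℝ → ℝ) (a b : ℝ) : ℝ := ∫ s in (0 : ℝ)..1, deriv m (b + s * (a - b))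

namespace IsRegularMax

variable {m : ℝ → ℝ}

theorem sub_eq_avgDeriv_mul (hm : IsRegularMax m) (a b : ℝ) :
    m a - m b = avgDeriv m a b * (a - b) := by
  have hd : ∀ s ∈ uIcc (0 : ℝ) 1, HasDerivAt (fun s => m (b + s * (a - b)))
      (deriv m (b + s * (a - b)) * (a - b)) s := fun s _ => by
    have h1 : HasDerivAt (fun s : ℝ => b + s * (a - b)) (a - b) s := by
      simpa using ((hasDerivAt_id s).mul_const (a - b)).const_add b
    exact (hm.differentiable _).hasDerivAt.comp s h1
  have hc : Continuous fun s : ℝ => deriv m (b + s * (a - b)) * (a - b) := by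
    have := hm.continuous_deriv
    fun_prop
  have h := intervalIntegral.integral_eq_sub_of_hasDerivAt hd (hc.intervalIntegrable _ _)
  rw [intervalIntegral.integral_mul_const] at h
  rw [avgDeriv, h]
  congr 2 <;> ring

theorem avgDeriv_self (a : ℝ) : avgDeriv m a a = deriv m a := by simp [avgDeriv]

theorem abs_avgDeriv_le (hm : IsRegularMax m) (a b : ℝ) : |avgDeriv m a b| ≤ 1 := by
  have h := intervalIntegral.norm_integral_le_of_norm_le_const (a := (0 : ℝ)) (b := 1) (C := 1)
    (f := fun s => deriv m (b + s * (a - b))) fun s _ => hm.abs_deriv_le _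
  simpa [avgDeriv] using h

theorem continuous_avgDeriv (hm : IsRegularMax m) :
    Continuous fun z : ℝ × ℝ => avgDeriv m z.1 z.2 := by
  unfold avgDeriv
  have := hm.continuous_deriv
  exact intervalIntegral.continuous_parametric_intervalIntegral_of_continuous' (by
    simp only [Function.uncurry_def]; fun_prop) 0 1

end IsRegularMax

variable {α : Type*} [MeasurableSpace α] {μ : Measure α} {ι : Type*} {l : Filter ι}
  {p : ℝ≥0∞} {m : ℝ → ℝ}

theorem lpNorm_const_mul_eq (a : ℝ) (f : α → ℝ) (p : ℝ≥0∞) (μ : Measure α) :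
    lpNorm (fun x => a * f x) p μ = |a| * lpNorm f p μ := by
  have h := lpNorm_const_smul a f (p := p) μ
  rw [coe_nnnorm, Real.norm_eq_abs] at h
  exact h

theorem lpNorm_mul_le_of_bound {f g : α → ℝ} {B : ℝ} (hf : AEStronglyMeasurable f μ)
    (hB : ∀ᵐ x ∂μ, |f x| ≤ B) (hg : MemLp g p μ) :
    lpNorm (fun x => f x * g x) p μ ≤ |B| * lpNorm g p μ := by
  rw [← lpNorm_const_mul_eq]
  refine lpNorm_mono_ae (hf.mul hg.1) (hg.const_mul B) ?_
  filter_upwards [hB] with x hx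
  rw [norm_mul, norm_mul]
  exact mul_le_mul_of_nonneg_right (hx.trans (le_abs_self B)) (norm_nonneg _)

namespace TendstoLp

/-- `avgDeriv` is bounded by 1 and jointly continuous. Against the fixed function x dominated
convergence applies, although the base points converge only in L²; the part with X − x needs the
bound alone. -/
theorem avgDeriv_mul [l.IsCountablyGenerated] (hm : IsRegularMax m) (hp1 : 1 ≤ p) (hp : p ≠ ⊤)
    {F G X : ι → α → ℝ} {f x : α → ℝ} (hF : TendstoLp 2 μ l F f) (hG : TendstoLp 2 μ l G f)
    (hX : TendstoLp p μ l X x) :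
    TendstoLp p μ l (fun i z => avgDeriv m (F i z) (G i z) * X i z)
      (fun z => deriv m (f z) * x z) := by
  have hmeas : ∀ᶠ i in l, AEStronglyMeasurable (fun z => avgDeriv m (F i z) (G i z)) μ := by
    filter_upwards [hF.1, hG.1] with i h1 h2
    exact hm.continuous_avgDeriv.comp_aestronglyMeasurable (h1.1.prodMk h2.1)
  have hfm : AEStronglyMeasurable (fun z => deriv m (f z)) μ :=
    hm.continuous_deriv.comp_aestronglyMeasurable hF.2.1.1
  have hbd : ∀ {ψ w : α → ℝ}, AEStronglyMeasurable ψ μ → (∀ z, |ψ z| ≤ 1) → MemLp w p μ →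
      MemLp (fun z => ψ z * w z) p μ := fun hψ h1 hw =>
    hw.of_le (hψ.mul hw.1) (ae_of_all _ fun z => by
      rw [norm_mul]; exact mul_le_of_le_one_left (norm_nonneg _) (h1 z))
  have hΨ : Continuous fun z : ℝ × ℝ × ℝ => avgDeriv m z.1 z.2.1 - deriv m z.2.2 :=
    (hm.continuous_avgDeriv.comp (continuous_fst.prodMk (continuous_fst.comp continuous_snd))).sub
      (hm.continuous_deriv.comp (continuous_snd.comp continuous_snd))
  have key := tendsto_eLpNorm_of_continuous_comp (one_pos.trans_le hp1).ne' hp hΨ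
    (fun s => by simp [IsRegularMax.avgDeriv_self]) (C := 2) (fun z => by
      have h1 := hm.abs_avgDeriv_le z.1 z.2.1
      have h2 := hm.abs_deriv_le z.2.2
      exact (abs_sub _ _).trans (by linarith)) hF hG hX.2.1
  have hs := hX.2.2.add key
  rw [add_zero] at hs
  refine of_le (hbd hfm (fun z => hm.abs_deriv_le _) hX.2.1) ?_ hs ?_
  · filter_upwards [hmeas, hX.1] with i h1 h2 using hbd h1 (fun z => hm.abs_avgDeriv_le _ _) h2
  · filter_upwards [hmeas, hX.1] with i h1 h2
    have e : (fun z => avgDeriv m (F i z) (G i z) * X i z - deriv m (f z) * x z)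
        = (fun z => avgDeriv m (F i z) (G i z) * (X i z - x z))
          + fun z => (avgDeriv m (F i z) (G i z) - deriv m (f z)) * x z := by
      ext1 z; simp; ring
    rw [e]
    refine (eLpNorm_add_le (h1.mul (h2.sub hX.2.1).1) ((h1.sub hfm).mul hX.2.1.1) hp1).trans
      (add_le_add ?_ le_rfl)
    refine eLpNorm_mono fun z => ?_
    rw [Pi.mul_apply, norm_mul]
    exact mul_le_of_le_one_left (norm_nonneg _) (hm.abs_avgDeriv_le _ _)

end TendstoLp

end AverageDerivative

/-! ### The derivative of the cost through the adjoint state. -/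

section CostDerivative

variable {n : ℕ} {Ω : Set (Eucl n)} {D : ProblemData n} {κ c : ℝ} {m : ℝ → ℝ}
  {V : Eucl n → Eucl n} {K : NNReal} {M : ℝ}

instance holderTriple_two_top_two : ENNReal.HolderTriple 2 ⊤ 2 := inferInstance

theorem MeasureTheory.MemLp.integrable_fun_mul {α : Type*} [MeasurableSpace α] {μ : Measure α}
    {f g : α → ℝ} (hf : MemLp f 2 μ) (hg : MemLp g 2 μ) : Integrable (fun x => f x * g x) μ :=
  hf.integrable_mul hg

theorem MeasureTheory.MemLp.fun_sub {α : Type*} [MeasurableSpace α] {μ : Measure α} {p : ℝ≥0∞}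
    {f g : α → ℝ} (hf : MemLp f p μ) (hg : MemLp g p μ) : MemLp (fun x => f x - g x) p μ :=
  hf.sub hg

namespace IsLipField

theorem tendstoLp_comp_mul_jac (hV : IsLipField Ω V K M) {p : ℝ≥0∞} (hp1 : 1 ≤ p) (hp : p ≠ ⊤)
    {u : Eucl n → ℝ} (hu : MemLp u p (volume.restrict Ω)) :
    TendstoLp p (volume.restrict Ω) (𝓝[>] 0) (fun t x => u (perturb V t x) * jac V t x) u :=
  ((hV.tendstoLp_comp hp1 hp hu).mul (q := ⊤) hp1 (hV.tendstoLp_jac le_top)).congr_lim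
    (ae_of_all _ fun _ => mul_one _)

/-- The transported density `u ∘ T_t · |det DT_t|` is differentiable at `t = 0`. -/
theorem tendstoLp_diffQuot_mul_jac (hV : IsLipField Ω V K M) {p : ℝ≥0∞} (hp1 : 1 ≤ p) (hp : p ≠ ⊤)
    {u : Eucl n → ℝ} (hu : MemW1 Ω p u) :
    TendstoLp p (volume.restrict Ω) (𝓝[>] 0)
      (fun t x => (u (perturb V t x) * jac V t x - u x) / t)
      (fun x => dirDeriv Ω u V x + u x * divField Ω V x) := by
  have h1 := (hV.tendstoLp_diffQuot hp1 hp hu).mul (q := ⊤) hp1 (hV.tendstoLp_jac le_top)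
  have h2 := (TendstoLp.const (l := 𝓝[>] (0 : ℝ)) hu.1).mul (q := ⊤) hp1
    (hV.tendstoLp_jac_sub_div (p := ⊤))
  refine ((h1.add hp1 h2).congr' (Eventually.of_forall fun t => ae_of_all _ fun x => ?_)).congr_lim
    (ae_of_all _ fun x => ?_)
  · dsimp only; ring
  · simp

/-- Split into jac·(v∘T_t − v) and (jac − 1)v; each is O(t) times the H¹ norm of v. -/
theorem exists_lpNorm_comp_mul_jac_sub_le (hV : IsLipField Ω V K M) : ∃ C : ℝ, 0 ≤ C ∧
    ∀ᶠ t in 𝓝[>] (0 : ℝ), ∀ v, MemH10 Ω v →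
      lpNorm (fun x => v (perturb V t x) * jac V t x - v x) 2 (volume.restrict Ω)
        ≤ C * t * lpNorm (jet Ω v) 2 (volume.restrict Ω) := by
  obtain ⟨C₀, hC₀, h₀⟩ := hV.exists_lpNorm_comp_sub_le (p := 2) one_le_two (by simp)
  obtain ⟨C₁, hC₁, h₁⟩ := hV.exists_jac_sub_one_le
  refine ⟨2 * C₀ + C₁, by positivity, ?_⟩
  filter_upwards [h₀, h₁, hV.jac_bound, hV.isBiLip_gt, self_mem_nhdsWithin] with t a₀ a₁ a₂ hT ht v hv
  have ht : (0 : ℝ) < t := ht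
  have hsub : MemLp (fun x => v (perturb V t x) - v x) 2 (volume.restrict Ω) :=
    (hT.memLp_comp hV.isOpen.measurableSet hv.memLp).sub hv.memLp
  have b₁ := lpNorm_mul_le_of_bound (IsLipField.aestronglyMeasurable_jac V t _) a₂ hsub
  have b₂ := lpNorm_mul_le_of_bound ((IsLipField.aestronglyMeasurable_jac V t _).sub
    aestronglyMeasurable_const) a₁ hv.memLp
  have m₁ : MemLp (fun x => jac V t x * (v (perturb V t x) - v x)) 2 (volume.restrict Ω) :=
    hsub.mul' (memLp_top_of_bound (IsLipField.aestronglyMeasurable_jac V t _) 2 a₂)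
  have e : (fun x => v (perturb V t x) * jac V t x - v x)
      = (fun x => jac V t x * (v (perturb V t x) - v x)) + fun x => (jac V t x - 1) * v x := by
    ext1 x; simp; ring
  have b₃ := a₀ v hv.1
  have b₄ := lpNorm_weakGrad_le_lpNorm_jet hv.memLp_jet
  have b₅ := lpNorm_le_lpNorm_jet hv.memLp_jet
  have hCt : 0 ≤ C₀ * t := by positivity
  have hCt1 : 0 ≤ C₁ * t := by positivity
  rw [e]
  refine (lpNorm_add_le m₁ one_le_two).trans ?_
  refine (add_le_add b₁ b₂).trans ?_
  rw [abs_of_nonneg hCt1, abs_of_pos (two_pos (α := ℝ))]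
  have b₆ := mul_le_mul_of_nonneg_left b₄ hCt
  have b₇ := mul_le_mul_of_nonneg_left b₅ hCt1
  linarith

end IsLipField

/-- The change of the nonlinear term, tested with `v`, when the shift is transported. -/
noncomputable def shiftDefect (D : ProblemData n) (m : ℝ → ℝ) (c : ℝ) (Ω : Set (Eucl n)) (V : Eucl n → Eucl n)
    (y : Eucl n → ℝ) (t : ℝ) (v : Eucl n → ℝ) : ℝ :=
  ∫ x in Ω, (m (D.lam (Function.invFun (perturb V t) x) + c * (y x - D.φ x))
    - m (D.lam x + c * (y x - D.φ x))) * v x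

namespace IsEllipticData

theorem memLp_shift_arg (h : IsEllipticData D Ω κ) {l u : Eucl n → ℝ}
    (hl : MemLp l 2 (volume.restrict Ω)) (hu : MemLp u 2 (volume.restrict Ω)) :
    MemLp (fun x => l x + c * (u x - D.φ x)) 2 (volume.restrict Ω) :=
  hl.add ((hu.sub h.φ_memLp).const_mul c)

theorem memLp_comp_arg (h : IsEllipticData D Ω κ) (hV : IsLipField Ω V K M) {y : Eucl n → ℝ}
    (hy : MemLp y 2 (volume.restrict Ω)) : ∀ᶠ t in 𝓝[>] (0 : ℝ),
      MemLp (fun x => D.lam x + c * (y (perturb V t x) - D.φ (perturb V t x))) 2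
        (volume.restrict Ω) ∧
      MemLp (fun x => D.lam (Function.invFun (perturb V t) x)) 2 (volume.restrict Ω) := by
  filter_upwards [hV.isBiLip_gt] with t ht
  have hm := hV.isOpen.measurableSet
  exact ⟨h.lam_memLp.add (((ht.memLp_comp hm hy).sub (ht.memLp_comp hm h.φ_memLp)).const_mul c),
    ht.symm.memLp_comp hm h.lam_memLp⟩

/-- The change of variables by T_t undoes the transport: λ∘T_t⁻¹ becomes λ, and all increments fall
on y, φ, v and the Jacobian, which are differentiable along V. This is why λ need not be
differentiable. -/
theorem shiftDefect_eq (h : IsEllipticData D Ω κ) (hm : IsRegularMax m) (hV : IsLipField Ω V K M)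
    {y : Eucl n → ℝ} (hy : MemLp y 2 (volume.restrict Ω)) :
    ∀ᶠ t in 𝓝[>] (0 : ℝ), ∀ v, MemLp v 2 (volume.restrict Ω) →
      shiftDefect D m c Ω V y t v
        = (∫ x in Ω, (m (D.lam x + c * (y (perturb V t x) - D.φ (perturb V t x)))
            - m (D.lam x + c * (y x - D.φ x))) * (v (perturb V t x) * jac V t x))
          + ∫ x in Ω, m (D.lam x + c * (y x - D.φ x)) * (v (perturb V t x) * jac V t x - v x) := by
  have := h.isFiniteMeasure
  filter_upwards [hV.isBiLip_gt, h.memLp_comp_arg (c := c) hV hy, hV.jac_bound] with t ht hmem hj v hv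
  have hq := hm.memLp (h.memLp_arg (c := c) hy)
  have hqT := hm.memLp hmem.1
  have hqS := hm.memLp (h.memLp_shift_arg (c := c) hmem.2 hy)
  have hvT : MemLp (fun x => v (perturb V t x) * jac V t x) 2 (volume.restrict Ω) :=
    (memLp_top_of_bound (IsLipField.aestronglyMeasurable_jac V t _) 2 hj).mul'
      (ht.memLp_comp hV.isOpen.measurableSet hv)
  have e0 : shiftDefect D m c Ω V y t v
      = (∫ x in Ω, m (D.lam (Function.invFun (perturb V t) x) + c * (y x - D.φ x)) * v x)
        - ∫ x in Ω, m (D.lam x + c * (y x - D.φ x)) * v x := by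
    rw [← integral_sub (hqS.integrable_fun_mul hv) (hq.integrable_fun_mul hv)]
    exact integral_congr_ae (ae_of_all _ fun x => sub_mul _ _ _)
  have e1 := ht.setIntegral_comp hV.isOpen.measurableSet fun x =>
    m (D.lam (Function.invFun (perturb V t) x) + c * (y x - D.φ x)) * v x
  simp only [ht.left_inv _] at e1
  rw [e0, ← e1, ← integral_add ((hqT.fun_sub hq).integrable_fun_mul hvT) (hq.integrable_fun_mul (hvT.fun_sub hv)),
    ← integral_sub]
  · refine integral_congr_ae (ae_of_all _ fun x => ?_)
    simp only [jac]
    ring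
  · refine (hqT.integrable_fun_mul hvT).congr (ae_of_all _ fun x => ?_)
    simp only [jac]; ring
  · exact hq.integrable_fun_mul hv

/-- m is 1-Lipschitz, so the increments of y and φ control the first integral; the increment of
v·jac controls the second. Uniformity in v matters because v will be the difference of two states.
-/
theorem exists_shiftDefect_le (h : IsEllipticData D Ω κ) (hm : IsRegularMax m)
    (hV : IsLipField Ω V K M) {y : Eucl n → ℝ} (hy : MemW1 Ω 2 y) (hφ : MemW1 Ω 2 D.φ) :
    ∃ C : ℝ, 0 ≤ C ∧ ∀ᶠ t in 𝓝[>] (0 : ℝ), ∀ v, MemH10 Ω v →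
      |shiftDefect D m c Ω V y t v| ≤ C * t * lpNorm (jet Ω v) 2 (volume.restrict Ω) := by
  have := h.isFiniteMeasure
  obtain ⟨C₀, hC₀, h₀⟩ := hV.exists_lpNorm_comp_sub_le (p := 2) one_le_two (by simp)
  obtain ⟨C₁, hC₁, h₁⟩ := hV.exists_lpNorm_comp_mul_jac_sub_le
  set A := |c| * (C₀ * (lpNorm (weakGrad Ω y) 2 (volume.restrict Ω)
    + lpNorm (weakGrad Ω D.φ) 2 (volume.restrict Ω)))
  have hA : 0 ≤ A := mul_nonneg (abs_nonneg _) (mul_nonneg hC₀ (add_nonneg lpNorm_nonneg lpNorm_nonneg))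
  set Q := lpNorm (fun x => m (D.lam x + c * (y x - D.φ x))) 2 (volume.restrict Ω)
  have hQ : 0 ≤ Q := lpNorm_nonneg
  refine ⟨A * (1 + C₁) + Q * C₁, by positivity, ?_⟩
  filter_upwards [h₀, h₁, h.shiftDefect_eq (c := c) hm hV hy.1, hV.isBiLip_gt,
    h.memLp_comp_arg (c := c) hV hy.1, hV.jac_bound, Ioo_mem_nhdsGT one_pos]
    with t a₀ a₁ a₂ hT hmem hj ht v hv
  have hq := hm.memLp (h.memLp_arg (c := c) hy.1)
  have hqT := hm.memLp hmem.1
  have hvT : MemLp (fun x => v (perturb V t x) * jac V t x) 2 (volume.restrict Ω) :=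
    (memLp_top_of_bound (IsLipField.aestronglyMeasurable_jac V t _) 2 hj).mul'
      (hT.memLp_comp hV.isOpen.measurableSet hv.memLp)
  have hyT := (hT.memLp_comp hV.isOpen.measurableSet hy.1).fun_sub hy.1
  have hφT := (hT.memLp_comp hV.isOpen.measurableSet hφ.1).fun_sub hφ.1
  set J := lpNorm (jet Ω v) 2 (volume.restrict Ω)
  have hJ : 0 ≤ J := lpNorm_nonneg
  have b₁ := a₁ v hv
  have b₂ : lpNorm (fun x => v (perturb V t x) * jac V t x) 2 (volume.restrict Ω) ≤ (1 + C₁) * J := by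
    have e : (fun x => v (perturb V t x) * jac V t x)
        = (fun x => v (perturb V t x) * jac V t x - v x) + v := by ext1 x; simp
    rw [e]
    refine (lpNorm_add_le (hvT.fun_sub hv.memLp) one_le_two).trans ?_
    have b5 := lpNorm_le_lpNorm_jet hv.memLp_jet
    have : C₁ * t * J ≤ C₁ * 1 * J := by gcongr; exact ht.2.le
    refine (add_le_add (b₁.trans this) b5).trans (le_of_eq (by ring))
  have b₃ : lpNorm (fun x => m (D.lam x + c * (y (perturb V t x) - D.φ (perturb V t x)))
      - m (D.lam x + c * (y x - D.φ x))) 2 (volume.restrict Ω) ≤ A * t := by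
    have hd : MemLp (fun x => c * ((y (perturb V t x) - y x) - (D.φ (perturb V t x) - D.φ x))) 2
      (volume.restrict Ω) := (hyT.sub hφT).const_mul c
    refine (lpNorm_mono_ae (hqT.fun_sub hq).1 hd (ae_of_all _ fun x => ?_)).trans ?_
    · refine (hm.abs_sub_le _ _).trans (le_of_eq ?_)
      rw [Real.norm_eq_abs]; congr 1; ring
    · rw [lpNorm_const_mul_eq]
      have := lpNorm_sub_le hyT (g := fun x => D.φ (perturb V t x) - D.φ x) one_le_two
      have b := mul_le_mul_of_nonneg_left (this.trans (add_le_add (a₀ y hy) (a₀ D.φ hφ))) (abs_nonneg c)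
      refine b.trans (le_of_eq ?_)
      ring
  rw [a₂ v hv.memLp]
  refine (abs_add_le _ _).trans ?_
  have d₁ := abs_integral_mul_le (hqT.fun_sub hq) hvT
  have d₂ := abs_integral_mul_le hq (hvT.fun_sub hv.memLp)
  have d₃ := mul_le_mul b₃ b₂ lpNorm_nonneg (mul_nonneg hA ht.1.le)
  have d₄ := mul_le_mul_of_nonneg_left b₁ hQ
  refine (add_le_add (d₁.trans d₃) (d₂.trans d₄)).trans (le_of_eq ?_)
  ring

/-- With v = p fixed, both terms of `shiftDefect_eq` can be divided by t. The increment of m is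
written with `avgDeriv`, and products of two L² limits converge in L¹. -/
theorem tendsto_shiftDefect_div (h : IsEllipticData D Ω κ) (hm : IsRegularMax m)
    (hV : IsLipField Ω V K M) {y p : Eucl n → ℝ} (hy : MemW1 Ω 2 y) (hφ : MemW1 Ω 2 D.φ)
    (hp : MemW1 Ω 2 p) :
    Tendsto (fun t => shiftDefect D m c Ω V y t p / t) (𝓝[>] 0)
      (𝓝 (∫ x in Ω, (deriv m (D.lam x + c * (y x - D.φ x))
          * (c * (dirDeriv Ω y V x - dirDeriv Ω D.φ V x) * p x)
        + m (D.lam x + c * (y x - D.φ x)) * (dirDeriv Ω p V x + p x * divField Ω V x)))) := by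
  have := h.isFiniteMeasure
  have h2 : (2 : ℝ≥0∞) ≠ ⊤ := by simp
  have hF : TendstoLp 2 (volume.restrict Ω) (𝓝[>] 0)
      (fun t x => D.lam x + c * (y (perturb V t x) - D.φ (perturb V t x)))
      (fun x => D.lam x + c * (y x - D.φ x)) :=
    (TendstoLp.const h.lam_memLp).add one_le_two (((hV.tendstoLp_comp one_le_two h2 hy.1).sub
      one_le_two (hV.tendstoLp_comp one_le_two h2 hφ.1)).const_mul c)
  have hG := TendstoLp.const (l := 𝓝[>] (0 : ℝ)) (h.memLp_arg (c := c) hy.1)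
  have hA := ((hV.tendstoLp_diffQuot one_le_two h2 hy).sub one_le_two
    (hV.tendstoLp_diffQuot one_le_two h2 hφ)).const_mul c
  have hB := hV.tendstoLp_comp_mul_jac one_le_two h2 hp.1
  have h1 := (TendstoLp.avgDeriv_mul hm le_rfl ENNReal.one_ne_top hF hG (hA.mul (r := 1) le_rfl hB))
  have h3 := (TendstoLp.const (l := 𝓝[>] (0 : ℝ)) (hm.memLp (h.memLp_arg (c := c) hy.1))).mul
    (r := 1) le_rfl (hV.tendstoLp_diffQuot_mul_jac one_le_two h2 hp)
  have h4 := (h1.add le_rfl h3).integral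
  refine h4.congr' ?_
  filter_upwards [h.shiftDefect_eq (c := c) hm hV hy.1, h1.1, h3.1] with t ht i1 i3
  rw [ht p hp.1, integral_add (memLp_one_iff_integrable.1 i1) (memLp_one_iff_integrable.1 i3), add_div,
    ← integral_div, ← integral_div]
  congr 1
  · refine integral_congr_ae (ae_of_all _ fun x => ?_)
    dsimp only
    rw [hm.sub_eq_avgDeriv_mul]
    ring
  · refine integral_congr_ae (ae_of_all _ fun x => ?_)
    dsimp only
    ring

/-- The derivative of the tracking functional along the transported states. -/
theorem tendsto_cost_diffQuot (h : IsEllipticData D Ω κ) (hm : IsRegularMax m)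
    (hV : IsLipField Ω V K M) (hc : 0 < c)
    (hsymm : ∀ u v, MemH10 Ω u → MemH10 Ω v → bilinForm D Ω u v = bilinForm D Ω v u)
    (hφ : MemW1 Ω 2 D.φ) (hybar : MemLp D.ybar 2 (volume.restrict Ω)) {y p : Eucl n → ℝ}
    (hy : IsState D m c Ω y) (hp : IsAdjoint D m c Ω y p) {w : ℝ → Eucl n → ℝ}
    (hw : ∀ᶠ t in 𝓝[>] (0 : ℝ), IsState (D.deform (perturb V t)) m c Ω (w t)) :
    Tendsto (fun t => ((1 / 2) * (∫ x in Ω, |w t x - D.ybar x| ^ 2)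
        - (1 / 2) * ∫ x in Ω, |y x - D.ybar x| ^ 2) / t) (𝓝[>] 0)
      (𝓝 (∫ x in Ω, (deriv m (D.lam x + c * (y x - D.φ x))
          * (c * (dirDeriv Ω y V x - dirDeriv Ω D.φ V x) * p x)
        + m (D.lam x + c * (y x - D.φ x)) * (dirDeriv Ω p V x + p x * divField Ω V x)))) := by
  have := h.isFiniteMeasure
  have h2 : (2 : ℝ≥0∞) ≠ ⊤ := by simp
  obtain ⟨C, hC, hdef⟩ := h.exists_shiftDefect_le (c := c) hm hV hy.1.1 hφ
  have hlim := h.tendsto_shiftDefect_div (c := c) hm hV hy.1.1 hφ hp.1.1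
  have hq2 := h.memLp_arg (c := c) hy.1.memLp
  -- the difference of the states is of first order
  have hz : ∀ᶠ t in 𝓝[>] (0 : ℝ), MemH10 Ω (fun x => w t x - y x) ∧
      lpNorm (jet Ω fun x => w t x - y x) 2 (volume.restrict Ω) ≤ C / κ * t := by
    filter_upwards [hdef, hw, h.memLp_comp_arg (c := c) hV hy.1.memLp, self_mem_nhdsWithin]
      with t a₁ a₂ a₃ ht
    have ht : (0 : ℝ) < t := ht
    have hzm : MemH10 Ω (fun x => w t x - y x) := a₂.1.sub h.isOpen hy.1
    refine ⟨hzm, ?_⟩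
    have e := h.bilinForm_state_sub hm a₃.2 h.lam_memLp a₂ hy hzm
    have hmw := hm.memLp (h.memLp_shift_arg (c := c) a₃.2 a₂.1.memLp)
    have hms := hm.memLp (h.memLp_shift_arg (c := c) a₃.2 hy.1.memLp)
    have hmq := hm.memLp hq2
    -- Inserting the mixed argument λ∘T_t⁻¹ + c(y − φ) splits the nonlinear difference into a
    -- monotone part of good sign and the defect.
    have e1 : ∫ x in Ω, (m (D.lam (Function.invFun (perturb V t) x) + c * (w t x - D.φ x))
        - m (D.lam x + c * (y x - D.φ x))) * (w t x - y x)
        = (∫ x in Ω, (m (D.lam (Function.invFun (perturb V t) x) + c * (w t x - D.φ x))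
            - m (D.lam (Function.invFun (perturb V t) x) + c * (y x - D.φ x))) * (w t x - y x))
          + shiftDefect D m c Ω V y t fun x => w t x - y x := by
      rw [shiftDefect, ← integral_add ((hmw.fun_sub hms).integrable_fun_mul hzm.memLp)
        ((hms.fun_sub hmq).integrable_fun_mul hzm.memLp)]
      refine integral_congr_ae (ae_of_all _ fun x => ?_)
      ring
    have e2 : 0 ≤ ∫ x in Ω, (m (D.lam (Function.invFun (perturb V t) x) + c * (w t x - D.φ x))
        - m (D.lam (Function.invFun (perturb V t) x) + c * (y x - D.φ x))) * (w t x - y x) :=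
      integral_nonneg fun x => by
        have := hm.mul_sub_nonneg (D.lam (Function.invFun (perturb V t) x) + c * (w t x - D.φ x))
          (D.lam (Function.invFun (perturb V t) x) + c * (y x - D.φ x))
        have e : D.lam (Function.invFun (perturb V t) x) + c * (w t x - D.φ x)
          - (D.lam (Function.invFun (perturb V t) x) + c * (y x - D.φ x)) = c * (w t x - y x) := by ring
        rw [e, mul_left_comm] at this
        exact nonneg_of_mul_nonneg_right this hc
    have e3 := (abs_le.1 (a₁ _ hzm)).1
    have b := h.lpNorm_jet_le_of_bilinForm_le hzm (A := C * t) (by positivity) (by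
      rw [e, e1]; linarith)
    refine b.trans (le_of_eq ?_)
    ring
  have hz0 : TendstoLp 2 (volume.restrict Ω) (𝓝[>] 0) (fun t x => w t x - y x) (fun _ => 0) := by
    refine TendstoLp.of_le MemLp.zero' (hz.mono fun t ht => ht.1.memLp)
      (tendsto_ofReal_const_mul_nhdsGT (C / κ)) ?_
    filter_upwards [hz] with t ht
    simp only [sub_zero]
    rw [ENNReal.le_ofReal_iff_toReal_le ht.1.memLp.2.ne (by
      exact le_trans lpNorm_nonneg ht.2), ← ht.1.memLp.lpNorm_eq]
    exact (lpNorm_le_lpNorm_jet ht.1.memLp_jet).trans ht.2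
  have hS := hV.tendstoLp_comp_invFun one_le_two h2 h.lam_memLp
  have hG : TendstoLp 2 (volume.restrict Ω) (𝓝[>] 0)
      (fun t x => D.lam (Function.invFun (perturb V t) x) + c * (y x - D.φ x))
      (fun x => D.lam x + c * (y x - D.φ x)) :=
    hS.add one_le_two (TendstoLp.const ((hy.1.memLp.sub h.φ_memLp).const_mul c))
  have hF : TendstoLp 2 (volume.restrict Ω) (𝓝[>] 0)
      (fun t x => D.lam (Function.invFun (perturb V t) x) + c * (w t x - D.φ x))
      (fun x => D.lam x + c * (y x - D.φ x)) :=
    ((hG.add one_le_two (hz0.const_mul c)).congr' (Eventually.of_forall fun t =>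
      ae_of_all _ fun x => by dsimp only; ring)).congr_lim (ae_of_all _ fun x => by simp)
  -- Against the fixed factor p ∈ L² the averaged derivative between the arguments at y_t and at y
  -- tends to m'(q)p. This is the o(1) that makes the remainder o(t).
  have hX := TendstoLp.avgDeriv_mul hm one_le_two h2 hF hG (TendstoLp.const hp.1.memLp)
  have hXn := hX.tendsto_lpNorm_sub
  -- the expansion of the functional
  have hrem : Tendsto (fun t => ((1 / 2) * (∫ x in Ω, |w t x - D.ybar x| ^ 2)
        - (1 / 2) * ∫ x in Ω, |y x - D.ybar x| ^ 2) / t - shiftDefect D m c Ω V y t p / t)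
      (𝓝[>] 0) (𝓝 0) := by
    have hb : Tendsto (fun t => c * (lpNorm (fun x => avgDeriv m
          (D.lam (Function.invFun (perturb V t) x) + c * (w t x - D.φ x))
          (D.lam (Function.invFun (perturb V t) x) + c * (y x - D.φ x)) * p x
          - deriv m (D.lam x + c * (y x - D.φ x)) * p x) 2 (volume.restrict Ω) * (C / κ))
        + (1 / 2) * (C / κ) ^ 2 * t) (𝓝[>] 0) (𝓝 0) := by
      have := ((hXn.mul_const (C / κ)).const_mul c).add
        (tendsto_const_mul_nhdsGT ((1 / 2) * (C / κ) ^ 2))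
      simpa using this
    refine squeeze_zero_norm' ?_ hb
    filter_upwards [hz, hw, h.memLp_comp_arg (c := c) hV hy.1.memLp, hX.1, self_mem_nhdsWithin]
      with t ⟨hzm, hzn⟩ a₂ a₃ a₄ ht
    have ht : (0 : ℝ) < t := ht
    have e := h.bilinForm_state_sub hm a₃.2 h.lam_memLp a₂ hy hp.1
    have e' := hp.2 _ hzm
    -- Symmetry lets the adjoint equation tested with y_t − y meet the difference of the state
    -- equations tested with p.
    rw [hsymm _ _ hp.1 hzm, e] at e'
    have hmw := hm.memLp (h.memLp_shift_arg (c := c) a₃.2 a₂.1.memLp)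
    have hms := hm.memLp (h.memLp_shift_arg (c := c) a₃.2 hy.1.memLp)
    have hmq := hm.memLp hq2
    have hr := hy.1.memLp.fun_sub hybar
    have hrz : Integrable (fun x => (y x - D.ybar x) * (w t x - y x)) (volume.restrict Ω) :=
      hr.integrable_fun_mul hzm.memLp
    have hzz : Integrable (fun x => (w t x - y x) * (w t x - y x)) (volume.restrict Ω) :=
      hzm.memLp.integrable_fun_mul hzm.memLp
    have hdp : MemLp (fun x => deriv m (D.lam x + c * (y x - D.φ x)) * p x) 2 (volume.restrict Ω) :=
      hX.2.1
    have c₁ : ∫ x in Ω, (m (D.lam (Function.invFun (perturb V t) x) + c * (w t x - D.φ x))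
        - m (D.lam x + c * (y x - D.φ x))) * p x
        = c * (∫ x in Ω, avgDeriv m (D.lam (Function.invFun (perturb V t) x) + c * (w t x - D.φ x))
            (D.lam (Function.invFun (perturb V t) x) + c * (y x - D.φ x)) * p x * (w t x - y x))
          + shiftDefect D m c Ω V y t p := by
      rw [shiftDefect, ← integral_const_mul, ← integral_add ((a₄.integrable_fun_mul hzm.memLp).const_mul c)
        ((hms.fun_sub hmq).integrable_fun_mul hp.1.memLp)]
      refine integral_congr_ae (ae_of_all _ fun x => ?_)
      have := hm.sub_eq_avgDeriv_mul (D.lam (Function.invFun (perturb V t) x) + c * (w t x - D.φ x))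
        (D.lam (Function.invFun (perturb V t) x) + c * (y x - D.φ x))
      linear_combination p x * this
    have c₂ : (1 / 2) * (∫ x in Ω, |w t x - D.ybar x| ^ 2)
        - (1 / 2) * (∫ x in Ω, |y x - D.ybar x| ^ 2)
        = (∫ x in Ω, (y x - D.ybar x) * (w t x - y x))
          + (1 / 2) * ∫ x in Ω, (w t x - y x) * (w t x - y x) := by
      have i1 : Integrable (fun x => |w t x - D.ybar x| ^ 2) (volume.restrict Ω) := by
        simpa using (a₂.1.memLp.sub hybar).integrable_norm_pow two_ne_zero
      have i2 : Integrable (fun x => |y x - D.ybar x| ^ 2) (volume.restrict Ω) := by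
        simpa using hr.integrable_norm_pow two_ne_zero
      rw [← integral_const_mul, ← integral_const_mul, ← integral_const_mul,
        ← integral_sub (i1.const_mul _) (i2.const_mul _), ← integral_add hrz (hzz.const_mul _)]
      refine integral_congr_ae (ae_of_all _ fun x => ?_)
      simp only [sq_abs]
      ring
    have c₃ : (∫ x in Ω, avgDeriv m (D.lam (Function.invFun (perturb V t) x) + c * (w t x - D.φ x))
            (D.lam (Function.invFun (perturb V t) x) + c * (y x - D.φ x)) * p x * (w t x - y x))
        - (∫ x in Ω, deriv m (D.lam x + c * (y x - D.φ x)) * p x * (w t x - y x))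
        = ∫ x in Ω, (avgDeriv m (D.lam (Function.invFun (perturb V t) x) + c * (w t x - D.φ x))
            (D.lam (Function.invFun (perturb V t) x) + c * (y x - D.φ x)) * p x
            - deriv m (D.lam x + c * (y x - D.φ x)) * p x) * (w t x - y x) := by
      rw [← integral_sub (a₄.integrable_fun_mul hzm.memLp) (hdp.integrable_fun_mul hzm.memLp)]
      refine integral_congr_ae (ae_of_all _ fun x => ?_)
      ring
    have d₁ := abs_integral_mul_le (a₄.fun_sub hdp) hzm.memLp
    have d₂ := abs_integral_mul_le hzm.memLp hzm.memLp
    have d₃ := (lpNorm_le_lpNorm_jet hzm.memLp_jet).trans hzn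
    have d₄ : 0 ≤ lpNorm (fun x => w t x - y x) 2 (volume.restrict Ω) := lpNorm_nonneg
    set E := lpNorm (fun x => avgDeriv m
          (D.lam (Function.invFun (perturb V t) x) + c * (w t x - D.φ x))
          (D.lam (Function.invFun (perturb V t) x) + c * (y x - D.φ x)) * p x
          - deriv m (D.lam x + c * (y x - D.φ x)) * p x) 2 (volume.restrict Ω)
    have hE : 0 ≤ E := lpNorm_nonneg
    have d₅ := d₁.trans (mul_le_mul_of_nonneg_left d₃ hE)
    have d₆ := d₂.trans (mul_le_mul d₃ d₃ d₄ (d₄.trans d₃))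
    rw [← sub_div, c₂, Real.norm_eq_abs, abs_div, abs_of_pos ht, div_le_iff₀ ht]
    -- With z = y_t − y, the remainder is c ∫ (averaged m' − m'(q)) p z + ½ ∫ z², at most cE(C/κ)t +
    -- ½((C/κ)t)² in modulus.
    have c₄ : (∫ x in Ω, (y x - D.ybar x) * (w t x - y x))
          + (1 / 2) * (∫ x in Ω, (w t x - y x) * (w t x - y x)) - shiftDefect D m c Ω V y t p
        = c * (∫ x in Ω, (avgDeriv m (D.lam (Function.invFun (perturb V t) x) + c * (w t x - D.φ x))
            (D.lam (Function.invFun (perturb V t) x) + c * (y x - D.φ x)) * p x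
            - deriv m (D.lam x + c * (y x - D.φ x)) * p x) * (w t x - y x))
          + (1 / 2) * ∫ x in Ω, (w t x - y x) * (w t x - y x) := by
      rw [← c₃]
      linarith
    rw [c₄]
    refine (abs_add_le _ _).trans ?_
    rw [abs_mul, abs_mul, abs_of_pos hc, abs_of_pos (by norm_num : (0 : ℝ) < 1 / 2)]
    have d₇ := mul_le_mul_of_nonneg_left d₅ hc.le
    refine (add_le_add d₇ (mul_le_mul_of_nonneg_left d₆ (by norm_num))).trans (le_of_eq ?_)
    ring
  have := hrem.add hlim
  rw [zero_add] at this
  exact this.congr fun t => by ring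

end IsEllipticData

end CostDerivative

/-! ### First-order expansion of the bilinear form under transport. -/

section Transport

variable {n : ℕ} {Ω : Set (Eucl n)} {D : ProblemData n} {κ c : ℝ} {m : ℝ → ℝ}
  {V : Eucl n → Eucl n} {K : NNReal} {M : ℝ}

theorem TendstoLp.mul₃ {α ι : Type*} [MeasurableSpace α] {μ : Measure α} [IsFiniteMeasure μ]
    {l : Filter ι} {F₁ F₂ F₃ : ι → α → ℝ} {f₁ f₂ f₃ : α → ℝ} (h₁ : TendstoLp 4 μ l F₁ f₁)
    (h₂ : TendstoLp 4 μ l F₂ f₂) (h₃ : TendstoLp 4 μ l F₃ f₃) :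
    TendstoLp 1 μ l (fun i x => F₁ i x * F₂ i x * F₃ i x) (fun x => f₁ x * f₂ x * f₃ x) := by
  have a : TendstoLp 2 μ l (fun i x => F₁ i x * F₂ i x) _ := h₁.mul one_le_two h₂
  have b : TendstoLp 2 μ l F₃ f₃ := h₃.mono (by norm_num)
  exact a.mul le_rfl b

/-- The action of the gradient of a vector field on first-order jets. -/
noncomputable def nablaJet (Ω : Set (Eucl n)) (V : Eucl n → Eucl n) (x : Eucl n) (U : Jet n) : Jet n :=
  mkJet 0 (WithLp.toLp 2 fun i => ∑ j, gradField Ω V x i j * U (some j))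

/-- The bilinear form on jets whose coefficients are differentiated in direction `V`. -/
noncomputable def ProblemData.dirForm (D : ProblemData n) (Ω : Set (Eucl n)) (V : Eucl n → Eucl n)
    (x : Eucl n) (U W : Jet n) : ℝ :=
  ∑ α, ∑ β, dirDeriv Ω (fun z => D.coeff z α β) V x * U α * W β

theorem MemW1.sub {p : ℝ≥0∞} (hΩ : IsOpen Ω) {u v : Eucl n → ℝ} (hu : MemW1 Ω p u)
    (hv : MemW1 Ω p v) : MemW1 Ω p (fun x => u x - v x) ∧
      weakGrad Ω (fun x => u x - v x) =ᵐ[volume.restrict Ω] fun x => weakGrad Ω u x - weakGrad Ω v x := by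
  have h : HasWeakGrad Ω (fun x => u x - v x) fun x => weakGrad Ω u x - weakGrad Ω v x := by
    refine ((weakGrad_spec hu.2.1).add ((weakGrad_spec hv.2.1).const_mul (-1))).congr
      (ae_of_all _ fun x => ?_) (ae_of_all _ fun x => ?_)
    · dsimp only; ring
    · dsimp only; rw [neg_one_smul, sub_eq_add_neg]
  have e := weakGrad_ae_eq hΩ h
  exact ⟨⟨hu.1.sub hv.1, ⟨_, h⟩, (hu.2.2.sub hv.2.2).ae_eq e.symm⟩, e⟩

theorem jetForm_nablaJet_left (x : Eucl n) (U W : Jet n) : D.jetForm x (nablaJet Ω V x U) W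
    = ∑ i, ∑ j, gradField Ω V x i j * (U (some j) * ∑ β, D.coeff x (some i) β * W β) := by
  rw [ProblemData.jetForm, Fintype.sum_option]
  simp only [nablaJet, mkJet_none, mkJet_some, mul_zero, zero_mul, Finset.sum_const_zero, zero_add,
    Finset.mul_sum, Finset.sum_mul]
  refine Finset.sum_congr rfl fun i _ => ?_
  rw [Finset.sum_comm]
  exact Finset.sum_congr rfl fun j _ => Finset.sum_congr rfl fun β _ => by ring

theorem jetForm_nablaJet_right (x : Eucl n) (U W : Jet n) : D.jetForm x U (nablaJet Ω V x W)
    = ∑ i, ∑ j, gradField Ω V x i j * (W (some j) * ∑ α, D.coeff x α (some i) * U α) := by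
  rw [ProblemData.jetForm, Finset.sum_comm, Fintype.sum_option]
  simp only [nablaJet, mkJet_none, mkJet_some, mul_zero, Finset.sum_const_zero, zero_add,
    Finset.mul_sum]
  refine Finset.sum_congr rfl fun i _ => ?_
  rw [Finset.sum_comm]
  exact Finset.sum_congr rfl fun j _ => Finset.sum_congr rfl fun β _ => by ring

namespace IsLipField

/-- The integral of the divergence of `u v V` vanishes. -/
theorem integral_div_mul_eq_zero (hV : IsLipField Ω V K M) {u v : Eucl n → ℝ} (hu : MemW1 Ω 2 u)
    (hv : MemW1 Ω 2 v) :
    ∫ x in Ω, (dirDeriv Ω u V x * v x + u x * (dirDeriv Ω v V x + v x * divField Ω V x)) = 0 := by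
  have h2 : (2 : ℝ≥0∞) ≠ ⊤ := by simp
  have h1 := (hV.tendstoLp_diffQuot one_le_two h2 hu).mul (r := 1) le_rfl
    (hV.tendstoLp_comp_mul_jac one_le_two h2 hv.1)
  have h3 := (TendstoLp.const (l := 𝓝[>] (0 : ℝ)) hu.1).mul (r := 1) le_rfl
    (hV.tendstoLp_diffQuot_mul_jac one_le_two h2 hv)
  have h4 := (h1.add le_rfl h3).integral
  -- The functions (uv)∘T_t·|det DT_t| − uv have integral zero, so the integrated difference
  -- quotients vanish identically: a divergence theorem that sees no boundary.
  refine tendsto_nhds_unique h4 (tendsto_const_nhds.congr' ?_)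
  filter_upwards [hV.setIntegral_jac_comp fun x => u x * v x, hV.isBiLip_gt, hV.jac_bound]
    with t ht hT hj
  have huT := hT.memLp_comp hV.isOpen.measurableSet hu.1
  have hvT := hT.memLp_comp hV.isOpen.measurableSet hv.1
  have hvj : MemLp (fun x => v (perturb V t x) * jac V t x) 2 (volume.restrict Ω) :=
    (memLp_top_of_bound (aestronglyMeasurable_jac V t _) 2 hj).mul' hvT
  have e : ∀ x, (u (perturb V t x) - u x) / t * (v (perturb V t x) * jac V t x)
      + u x * ((v (perturb V t x) * jac V t x - v x) / t)
      = (u (perturb V t x) * (v (perturb V t x) * jac V t x) - u x * v x) / t := fun x => by ring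
  simp only [e]
  rw [integral_div, integral_sub (huT.integrable_fun_mul hvj) (hu.1.integrable_fun_mul hv.1), ← ht]
  have e2 : ∫ x in Ω, jac V t x * (u (perturb V t x) * v (perturb V t x))
      = ∫ x in Ω, u (perturb V t x) * (v (perturb V t x) * jac V t x) := by
    congr 1; ext1 x; ring
  rw [e2, sub_self, zero_div]

theorem memH10_comp_invFun (hV : IsLipField Ω V K M) {p : Eucl n → ℝ} (hp : MemH10 Ω p) :
    ∀ᶠ t in 𝓝[>] (0 : ℝ), MemH10 Ω fun x => p (Function.invFun (perturb V t) x) :=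
  hV.isBiLip_gt.mono fun _ ht => (ht.symm.h10Pair_comp hV.isOpen hp.pair).memH10 hV.isOpen

/-- The chain rule on jets: the value is merely transported, and the gradient part is in addition
multiplied by I + t∇V. -/
theorem jet_comp_perturb (hV : IsLipField Ω V K M) : ∀ᶠ t in 𝓝[>] (0 : ℝ), ∀ u, MemH10 Ω u →
    MemH10 Ω (fun x => u (perturb V t x)) ∧
    ∀ᵐ x ∂(volume.restrict Ω), jet Ω (fun x => u (perturb V t x)) x
      = jet Ω u (perturb V t x) + t • nablaJet Ω V x (jet Ω u (perturb V t x)) := by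
  filter_upwards [hV.isBiLip_gt] with t ht u hu
  obtain ⟨h1, h2⟩ := hV.lip.weakGrad_comp_perturb hV.isOpen ht hu
  refine ⟨h1, ?_⟩
  filter_upwards [h2] with x hx
  ext o
  cases o with
  | none => simp [nablaJet]
  | some i => simp [nablaJet, hx i]

theorem exists_norm_nablaJet_le (hV : IsLipField Ω V K M) : ∃ B : ℝ, 0 ≤ B ∧
    ∀ᵐ x ∂(volume.restrict Ω), ∀ U, ‖nablaJet Ω V x U‖ ≤ B * ‖U‖ := by
  refine ⟨n * (n * K), by positivity, ?_⟩
  filter_upwards [hV.lip.abs_gradField_le hV.isOpen] with x hx U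
  have h1 : ∀ i, |∑ j, gradField Ω V x i j * U (some j)| ≤ n * K * ‖U‖ := fun i => by
    refine (Finset.abs_sum_le_sum_abs _ _).trans ((Finset.sum_le_card_nsmul _ _ (K * ‖U‖)
      fun j _ => ?_).trans (le_of_eq ?_))
    · rw [abs_mul]
      exact mul_le_mul (hx i j) (U.abs_apply_le _) (abs_nonneg _) K.2
    · simp [mul_assoc]
  have h2 : ‖nablaJet Ω V x U‖ ≤ ∑ o, |nablaJet Ω V x U o| := by
    rw [EuclideanSpace.norm_eq, Real.sqrt_le_left (Finset.sum_nonneg fun _ _ => abs_nonneg _)]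
    exact Finset.sum_sq_le_sq_sum_of_nonneg fun _ _ => abs_nonneg _
  refine h2.trans ?_
  rw [Fintype.sum_option]
  simp only [nablaJet, mkJet_none, mkJet_some, abs_zero, zero_add]
  refine (Finset.sum_le_card_nsmul _ _ _ fun i _ => h1 i).trans (le_of_eq ?_)
  simp [mul_assoc]

/-- The jets of `p ∘ T_t⁻¹`, evaluated along `T_t`, converge to the jet of `p`. -/
theorem tendstoLp_jet_comp_invFun (hV : IsLipField Ω V K M) {q : ℝ≥0∞} {p : Eucl n → ℝ}
    (hp : MemH10 Ω p) (hpq : MemLp (jet Ω p) q (volume.restrict Ω)) (β : Option (Fin n)) :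
    TendstoLp q (volume.restrict Ω) (𝓝[>] 0)
      (fun t x => jet Ω (fun z => p (Function.invFun (perturb V t) z)) (perturb V t x) β)
      (fun x => jet Ω p x β) := by
  obtain ⟨B, hB0, hB⟩ := hV.exists_norm_nablaJet_le
  have hev : ∀ᶠ t in 𝓝[>] (0 : ℝ), AEStronglyMeasurable
      (fun x => jet Ω (fun z => p (Function.invFun (perturb V t) z)) (perturb V t x) β)
        (volume.restrict Ω) ∧ ∀ᵐ x ∂(volume.restrict Ω),
      |jet Ω (fun z => p (Function.invFun (perturb V t) z)) (perturb V t x) β - jet Ω p x β|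
        ≤ 2 * B * t * ‖jet Ω p x‖ := by
    filter_upwards [hV.jet_comp_perturb, hV.memH10_comp_invFun hp, hV.isBiLip_gt,
      self_mem_nhdsWithin, (tendsto_const_mul_nhdsGT B).eventually
        (ge_mem_nhds (by norm_num : (0 : ℝ) < 1 / 2))] with t h1 h2 hT ht hBt
    have ht : (0 : ℝ) < t := ht
    obtain ⟨-, h3⟩ := h1 _ h2
    refine ⟨((hT.memLp_comp hV.isOpen.measurableSet h2.memLp_jet).eval_piLp β).1, ?_⟩
    simp only [hT.left_inv _] at h3
    filter_upwards [h3, hB] with x hx hBx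
    set P := jet Ω (fun z => p (Function.invFun (perturb V t) z)) (perturb V t x)
    have e1 : ‖t • nablaJet Ω V x P‖ ≤ t * (B * ‖P‖) := by
      rw [norm_smul, Real.norm_eq_abs, abs_of_pos ht]
      exact mul_le_mul_of_nonneg_left (hBx P) ht.le
    have hx : jet Ω p x = P + t • nablaJet Ω V x P := hx
    -- The chain rule for p = (p∘T_t⁻¹)∘T_t expresses jet p through P. Solving for P, with tB ≤ ½ to
    -- absorb the last term, gives a pointwise error O(t)|jet p|, hence convergence in every L^q
    -- that contains jet p.
    have e2 : P = jet Ω p x - t • nablaJet Ω V x P := by rw [hx]; simp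
    have e3 : ‖P‖ ≤ ‖jet Ω p x‖ + t * (B * ‖P‖) := by
      conv_lhs => rw [e2]
      exact (norm_sub_le _ _).trans (add_le_add le_rfl e1)
    have e4 : ‖P‖ ≤ 2 * ‖jet Ω p x‖ := by nlinarith [norm_nonneg P]
    have e5 : P β - jet Ω p x β = (-(t • nablaJet Ω V x P)) β := by
      rw [hx]; simp
    rw [e5]
    refine (Jet.abs_apply_le _ β).trans ?_
    rw [norm_neg]
    refine e1.trans ?_
    have : t * (B * ‖P‖) ≤ t * (B * (2 * ‖jet Ω p x‖)) := by gcongr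
    linarith
  have hsub : ∀ᶠ t in 𝓝[>] (0 : ℝ), eLpNorm
      (fun x => jet Ω (fun z => p (Function.invFun (perturb V t) z)) (perturb V t x) β - jet Ω p x β) q
        (volume.restrict Ω)
        ≤ ENNReal.ofReal (2 * B * t) * eLpNorm (jet Ω p) q (volume.restrict Ω) :=
    hev.mono fun t ht => eLpNorm_le_mul_eLpNorm_of_ae_le_mul ht.2 q
  refine TendstoLp.of_le (hpq.eval_piLp β) ?_ ?_ hsub
  · filter_upwards [hev, hsub] with t h1 h2
    have h3 : MemLp (fun x => jet Ω (fun z => p (Function.invFun (perturb V t) z)) (perturb V t x) β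
        - jet Ω p x β) q (volume.restrict Ω) :=
      ⟨h1.1.sub (hpq.eval_piLp β).1,
        h2.trans_lt (ENNReal.mul_lt_top ENNReal.ofReal_lt_top hpq.2)⟩
    have h4 := h3.add (hpq.eval_piLp β)
    refine h4.ae_eq (ae_of_all _ fun x => ?_)
    simp
  · have := ENNReal.Tendsto.mul_const (b := eLpNorm (jet Ω p) q (volume.restrict Ω))
      (tendsto_ofReal_const_mul_nhdsGT (2 * B)) (Or.inr hpq.2.ne)
    rwa [zero_mul] at this

end IsLipField

/-- The integrand of the first-order change of the bilinear form under the transport. -/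
noncomputable def transportIntegrand (D : ProblemData n) (Ω : Set (Eucl n)) (V : Eucl n → Eucl n) (y p : Eucl n → ℝ)
    (x : Eucl n) : ℝ :=
  D.jetForm x (nablaJet Ω V x (jet Ω y x)) (jet Ω p x)
    + D.jetForm x (jet Ω y x) (nablaJet Ω V x (jet Ω p x))
    - D.dirForm Ω V x (jet Ω y x) (jet Ω p x)
    - D.jetForm x (jet Ω y x) (jet Ω p x) * divField Ω V x

/-- Change variables in a(y, p∘T_t⁻¹), so that it involves Y = (jet y)∘T_t and P =
(jet(p∘T_t⁻¹))∘T_t. With N = `nablaJet`, the chain rules jet(y∘T_t) = Y + tNY and jet p = P + tNP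
turn the quotient into an exact sum of four products, without remainder and without second
derivatives of y or p. Apart from the Jacobian quotient, which converges in L^∞, each product has
three factors converging in L⁴. -/
theorem tendsto_bilinForm_transport (hV : IsLipField Ω V K M)
    (hA : ∀ α β, MemLp (fun x => D.coeff x α β) ⊤ (volume.restrict Ω))
    (hA4 : ∀ α β, MemW1 Ω 4 (fun x => D.coeff x α β)) {y p : Eucl n → ℝ} (hy : MemH10 Ω y)
    (hp : MemH10 Ω p) (hy4 : MemW1 Ω 4 y) (hp4 : MemW1 Ω 4 p) :
    Integrable (transportIntegrand D Ω V y p) (volume.restrict Ω) ∧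
    Tendsto (fun t => (bilinForm D Ω (fun x => y (perturb V t x)) p
      - bilinForm D Ω y fun x => p (Function.invFun (perturb V t) x)) / t) (𝓝[>] 0)
      (𝓝 (∫ x in Ω, transportIntegrand D Ω V y p x)) := by
  have := hV.isBounded.isFiniteMeasure_restrict
  have h14 : (1 : ℝ≥0∞) ≤ 4 := by norm_num
  have h4 : (4 : ℝ≥0∞) ≠ ⊤ := by norm_num
  set l : Filter ℝ := 𝓝[>] 0
  set μ := volume.restrict Ω
  set Y : ℝ → Eucl n → Jet n := fun t x => jet Ω y (perturb V t x) with hYdef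
  set P : ℝ → Eucl n → Jet n :=
    fun t x => jet Ω (fun z => p (Function.invFun (perturb V t) z)) (perturb V t x) with hPdef
  have hY : ∀ α, TendstoLp 4 μ l (fun t x => Y t x α) (fun x => jet Ω y x α) := fun α =>
    hV.tendstoLp_comp h14 h4 (hy4.memLp_jet.eval_piLp α)
  have hP : ∀ β, TendstoLp 4 μ l (fun t x => P t x β) (fun x => jet Ω p x β) := fun β =>
    hV.tendstoLp_jet_comp_invFun hp hp4.memLp_jet β
  have hN : ∀ {Z : ℝ → Eucl n → Jet n} {z : Eucl n → Jet n},
      (∀ α, TendstoLp 4 μ l (fun t x => Z t x α) (fun x => z x α)) →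
      ∀ α, TendstoLp 4 μ l (fun t x => nablaJet Ω V x (Z t x) α) (fun x => nablaJet Ω V x (z x) α) := by
    intro Z z hZ α
    cases α with
    | none => exact TendstoLp.const (MemLp.zero' (ε := ℝ))
    | some i =>
      refine TendstoLp.sum Finset.univ h14 (F := fun j t x => gradField Ω V x i j * Z t x (some j))
        (f := fun j x => gradField Ω V x i j * z x (some j)) fun j _ => ?_
      exact (TendstoLp.const (hV.memLp_gradField i j)).mul (p := ⊤) h14 (hZ (some j))
  have hAc : ∀ α β, TendstoLp 4 μ l (fun _ x => D.coeff x α β) (fun x => D.coeff x α β) := fun α β =>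
    TendstoLp.const (hA4 α β).1
  -- The four contributions: ∇V acting on the side of y, ∇V acting on the side of p, the increment
  -- of the coefficients and the increment of the Jacobian.
  have key : ∀ α β, TendstoLp 1 μ l
      (fun t x => D.coeff x α β * nablaJet Ω V x (Y t x) α * jet Ω p x β
        + D.coeff x α β * Y t x α * nablaJet Ω V x (P t x) β
        - (D.coeff (perturb V t x) α β - D.coeff x α β) / t * Y t x α * P t x β
        - D.coeff (perturb V t x) α β * Y t x α * P t x β * ((jac V t x - 1) / t))
      (fun x => D.coeff x α β * nablaJet Ω V x (jet Ω y x) α * jet Ω p x β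
        + D.coeff x α β * jet Ω y x α * nablaJet Ω V x (jet Ω p x) β
        - dirDeriv Ω (fun z => D.coeff z α β) V x * jet Ω y x α * jet Ω p x β
        - D.coeff x α β * jet Ω y x α * jet Ω p x β * divField Ω V x) := fun α β => by
    refine TendstoLp.sub le_rfl (TendstoLp.sub le_rfl (TendstoLp.add le_rfl ?_ ?_) ?_) ?_
    · exact (hAc α β).mul₃ (hN hY α) (TendstoLp.const (hp4.memLp_jet.eval_piLp β))
    · exact (hAc α β).mul₃ (hY α) (hN hP β)
    · exact (hV.tendstoLp_diffQuot h14 h4 (hA4 α β)).mul₃ (hY α) (hP β)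
    · exact ((hV.tendstoLp_comp h14 h4 (hA4 α β).1).mul₃ (hY α) (hP β)).mul (q := ⊤) le_rfl
        (hV.tendstoLp_jac_sub_div (p := ⊤))
  have hsum := TendstoLp.sum Finset.univ le_rfl fun α _ =>
    TendstoLp.sum Finset.univ le_rfl fun β _ => key α β
  have hlim := hsum.congr_lim (g := transportIntegrand D Ω V y p) (ae_of_all _ fun x => by
    simp only [transportIntegrand, ProblemData.jetForm, ProblemData.dirForm, Finset.sum_mul,
      ← Finset.sum_add_distrib, ← Finset.sum_sub_distrib])
  refine ⟨memLp_one_iff_integrable.1 hlim.2.1, hlim.integral.congr' ?_⟩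
  filter_upwards [hV.jet_comp_perturb, hV.memH10_comp_invFun hp, hV.isBiLip_gt, self_mem_nhdsWithin,
    (hV.tendstoLp_jac (p := ⊤) le_top).1] with t h1 h2 hT ht hjac
  have ht : (0 : ℝ) < t := ht
  obtain ⟨hyT, hjy⟩ := h1 y hy
  obtain ⟨-, hjp⟩ := h1 _ h2
  simp only [hT.left_inv _] at hjp
  have i1 := integrable_formIntegrand hA hyT hp
  have e2 := hT.setIntegral_comp hV.isOpen.measurableSet fun z =>
    formIntegrand D Ω y (fun x => p (Function.invFun (perturb V t) x)) z
  have i2 : Integrable (fun x => jac V t x * formIntegrand D Ω y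
      (fun x => p (Function.invFun (perturb V t) x)) (perturb V t x)) μ := by
    have hi : MemLp (formIntegrand D Ω y fun x => p (Function.invFun (perturb V t) x)) 1 μ :=
      memLp_one_iff_integrable.2 (integrable_formIntegrand hA hy h2)
    exact memLp_one_iff_integrable.1 ((hT.memLp_comp hV.isOpen.measurableSet hi).mul' (p := ⊤) hjac)
  rw [bilinForm, bilinForm, ← e2]
  refine Eq.trans ?_ ((integral_div t _).trans (congrArg (· / t) (integral_sub i1 i2)))
  refine integral_congr_ae ?_
  filter_upwards [hjy, hjp] with x hxy hxp
  have hxp : jet Ω p x = P t x + t • nablaJet Ω V x (P t x) := hxp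
  rw [formIntegrand_eq, formIntegrand_eq, hxy]
  simp only [ProblemData.jetForm, Finset.mul_sum, ← Finset.sum_sub_distrib, Finset.sum_div]
  refine Finset.sum_congr rfl fun α _ => Finset.sum_congr rfl fun β _ => ?_
  rw [hxp]
  simp only [PiLp.add_apply, PiLp.smul_apply, smul_eq_mul, hYdef, hPdef, jac]
  field_simp
  ring

end Transport

/-! ### From the limit to the volume formula. -/

section VolumeFormula

variable {n : ℕ} {Ω : Set (Eucl n)} {D : ProblemData n} {κ c : ℝ} {m : ℝ → ℝ}
  {V : Eucl n → Eucl n} {K : NNReal} {M : ℝ} {y p : Eucl n → ℝ}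

theorem ProblemData.jetForm_eq (x : Eucl n) (U W : Jet n) :
    D.jetForm x U W = (fun i => U (some i)) ⬝ᵥ (D.M x *ᵥ fun i => W (some i))
      + W none * (D.d x ⬝ᵥ fun i => U (some i)) + U none * (D.d x ⬝ᵥ fun i => W (some i))
      + D.b x * U none * W none := by
  simp only [ProblemData.jetForm, Fintype.sum_option, ProblemData.coeff, dotProduct, Matrix.mulVec,
    Finset.sum_add_distrib, Finset.mul_sum]
  have e1 : ∀ i, D.d x i * U (some i) * W none = W none * (D.d x i * U (some i)) := fun i => by ring
  have e2 : ∀ i, D.d x i * U none * W (some i) = U none * (D.d x i * W (some i)) := fun i => by ring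
  have e3 : ∀ i j, D.M x i j * U (some i) * W (some j) = U (some i) * (D.M x i j * W (some j)) :=
    fun i j => by ring
  simp only [e1, e2, e3]
  ring

theorem ProblemData.dirForm_eq (x : Eucl n) (U W : Jet n) :
    D.dirForm Ω V x U W
      = (fun i => U (some i)) ⬝ᵥ ((Matrix.of fun i j => dirDeriv Ω (fun z => D.M z i j) V x)
          *ᵥ fun i => W (some i))
      + W none * ((fun i => dirDeriv Ω (fun z => D.d z i) V x) ⬝ᵥ fun i => U (some i))
      + U none * ((fun i => dirDeriv Ω (fun z => D.d z i) V x) ⬝ᵥ fun i => W (some i))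
      + dirDeriv Ω D.b V x * U none * W none := by
  -- Data whose coefficients are the directional derivatives of the given ones, so that `jetForm_eq`
  -- applies verbatim.
  let D' : ProblemData n := { D with
    M := fun x => Matrix.of fun i j => dirDeriv Ω (fun z => D.M z i j) V x
    d := fun x i => dirDeriv Ω (fun z => D.d z i) V x
    b := dirDeriv Ω D.b V }
  have h : D.dirForm Ω V x U W = D'.jetForm x U W := by
    simp only [ProblemData.dirForm, ProblemData.jetForm, Fintype.sum_option]
    rfl
  rw [h, D'.jetForm_eq]

theorem nablaJet_some (x : Eucl n) (U : Jet n) :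
    (fun i => nablaJet Ω V x U (some i)) = gradField Ω V x *ᵥ fun i => U (some i) := rfl

theorem nablaJet_none (x : Eucl n) (U : Jet n) : nablaJet Ω V x U none = 0 := rfl

/-- The integrand of the volume formula in terms of first-order jets. -/
theorem shapeDerivIntegrand_eq (x : Eucl n) :
    shapeDerivIntegrand D m c Ω y p V x =
      -(y x - D.ybar x) * dirDeriv Ω D.ybar V x
      - (D.jetForm x (nablaJet Ω V x (jet Ω y x)) (jet Ω p x)
        + D.jetForm x (jet Ω y x) (nablaJet Ω V x (jet Ω p x))
        - D.dirForm Ω V x (jet Ω y x) (jet Ω p x))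
      - c * deriv m (D.lam x + c * (y x - D.φ x)) * dirDeriv Ω D.φ V x * p x
      - dirDeriv Ω D.f V x * p x
      + divField Ω V x * ((1 / 2) * (y x - D.ybar x) ^ 2 + D.jetForm x (jet Ω y x) (jet Ω p x)
        + m (D.lam x + c * (y x - D.φ x)) * p x - D.f x * p x) := by
  have hf : D.jetForm x (jet Ω y x) (jet Ω p x) = D.b x * y x * p x
        + (∑ i, ∑ j, D.M x i j * weakGrad Ω y x i * weakGrad Ω p x j)
        + (∑ i, D.d x i * (weakGrad Ω y x i * p x + y x * weakGrad Ω p x i)) := by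
    rw [← formIntegrand_eq, formIntegrand]; ring
  rw [hf, D.jetForm_eq, D.jetForm_eq, D.dirForm_eq, nablaJet_some, nablaJet_some]
  simp only [nablaJet_none, jet_none, jet_some, shapeDerivIntegrand]
  have e : ∀ a b : Fin n → ℝ, a ⬝ᵥ ((gradField Ω V x)ᵀ *ᵥ (D.M x *ᵥ b))
      = (gradField Ω V x *ᵥ a) ⬝ᵥ (D.M x *ᵥ b) := fun a b => by
    rw [Matrix.dotProduct_mulVec, Matrix.vecMul_transpose]
  simp only [Matrix.add_mulVec, Matrix.sub_mulVec, dotProduct_add, dotProduct_sub,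
    ← Matrix.mulVec_mulVec, e]
  ring

namespace IsEllipticData

/-- The state and the adjoint equation, tested with the difference quotients along `V`. -/
theorem integral_transportIntegrand (h : IsEllipticData D Ω κ) (hm : IsRegularMax m)
    (hV : IsLipField Ω V K M)
    (hsymm : ∀ u v, MemH10 Ω u → MemH10 Ω v → bilinForm D Ω u v = bilinForm D Ω v u)
    (hybar : MemLp D.ybar 2 (volume.restrict Ω))
    (hA4 : ∀ α β, MemW1 Ω 4 (fun x => D.coeff x α β)) (hy : IsState D m c Ω y)
    (hp : IsAdjoint D m c Ω y p) (hy4 : MemW1 Ω 4 y) (hp4 : MemW1 Ω 4 p) :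
    ∫ x in Ω, transportIntegrand D Ω V y p x
      = (-∫ x in Ω, (y x - D.ybar x) * dirDeriv Ω y V x)
        - c * (∫ x in Ω, deriv m (D.lam x + c * (y x - D.φ x)) * p x * dirDeriv Ω y V x)
        + ∫ x in Ω, (D.f x - m (D.lam x + c * (y x - D.φ x))) * dirDeriv Ω p V x := by
  have := h.isFiniteMeasure
  have h2 : (2 : ℝ≥0∞) ≠ ⊤ := by simp
  have hr := hy.1.memLp.fun_sub hybar
  have harg := h.memLp_arg (c := c) hy.1.memLp
  have hmp : MemLp (fun x => deriv m (D.lam x + c * (y x - D.φ x)) * p x) 2 (volume.restrict Ω) :=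
    hp.1.memLp.mul' (p := ⊤) (hm.memLp_deriv harg.1)
  have hG : MemLp (fun x => D.f x - m (D.lam x + c * (y x - D.φ x))) 2 (volume.restrict Ω) :=
    h.f_memLp.fun_sub (hm.memLp harg)
  have dy := hV.tendstoLp_diffQuot one_le_two h2 hy.1.1
  have dp := hV.tendstoLp_diffQuot one_le_two h2 hp.1.1
  have l1 := ((TendstoLp.const hr).mul (r := 1) le_rfl dy).integral
  have l2 := ((TendstoLp.const hmp).mul (r := 1) le_rfl dy).integral
  have l3 := ((hV.tendstoLp_comp_mul_jac one_le_two h2 hG).mul (r := 1) le_rfl dp).integral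
  refine tendsto_nhds_unique
    (tendsto_bilinForm_transport hV h.coeff_memLp hA4 hy.1 hp.1 hy4 hp4).2
    (((l1.neg.sub (l2.const_mul c)).add l3).congr' ?_)
  filter_upwards [hV.jet_comp_perturb, hV.memH10_comp_invFun hp.1, hV.isBiLip_gt, hV.jac_bound]
    with t h1 h2 hT hj
  obtain ⟨hyT, -⟩ := h1 y hy.1
  -- The increments y∘T_t − y and p∘T_t⁻¹ − p lie in H¹₀; divided by t they stand in for the
  -- possibly inadmissible test functions ∇yᵀV and −∇pᵀV.
  have ea := hp.2 _ (hyT.sub h.isOpen hy.1)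
  have es := hy.2 _ (h2.sub h.isOpen hp.1)
  rw [hsymm _ _ hp.1 (hyT.sub h.isOpen hy.1), bilinForm_sub_left h.isOpen h.coeff_memLp hyT hy.1 hp.1]
    at ea
  rw [bilinForm_sub_right h.isOpen h.coeff_memLp h2 hp.1 hy.1] at es
  have e3 := hT.setIntegral_comp h.isOpen.measurableSet fun x =>
    (D.f x - m (D.lam x + c * (y x - D.φ x))) * (p (Function.invFun (perturb V t) x) - p x)
  have hpS := h2.memLp
  have e4 : ∫ x in Ω, (D.f x - m (D.lam x + c * (y x - D.φ x)))
        * (p (Function.invFun (perturb V t) x) - p x)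
      = (∫ x in Ω, D.f x * (p (Function.invFun (perturb V t) x) - p x))
        - ∫ x in Ω, m (D.lam x + c * (y x - D.φ x)) * (p (Function.invFun (perturb V t) x) - p x) := by
    rw [← integral_sub (h.f_memLp.integrable_fun_mul (hpS.fun_sub hp.1.memLp))
      ((hm.memLp harg).integrable_fun_mul (hpS.fun_sub hp.1.memLp))]
    simp only [sub_mul]
  simp only [mul_div_assoc', integral_div]
  -- The change of variables turns the increment of p∘T_t⁻¹ into minus that of p∘T_t. The weight
  -- becomes (f − m(q))∘T_t times the Jacobian, which still converges in L².
  have e5 : ∫ x in Ω, (D.f (perturb V t x) - m (D.lam (perturb V t x)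
        + c * (y (perturb V t x) - D.φ (perturb V t x)))) * jac V t x * (p (perturb V t x) - p x)
      = -∫ x in Ω, (D.f x - m (D.lam x + c * (y x - D.φ x)))
        * (p (Function.invFun (perturb V t) x) - p x) := by
    rw [← e3, ← integral_neg]
    refine integral_congr_ae (ae_of_all _ fun x => ?_)
    simp only [hT.left_inv x, jac]
    ring
  rw [e5, e4]
  have hd : ∀ {a b : ℝ}, a = b → a / t = b / t := fun h => by rw [h]
  rw [← neg_div, ← sub_div, ← add_div]
  refine hd ?_
  linarith

/-- The limit of the difference quotients of the functional is given by the volume formula. -/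
theorem integral_shapeDerivIntegrand (h : IsEllipticData D Ω κ) (hm : IsRegularMax m)
    (hV : IsLipField Ω V K M)
    (hsymm : ∀ u v, MemH10 Ω u → MemH10 Ω v → bilinForm D Ω u v = bilinForm D Ω v u)
    (hf : MemW1 Ω 2 D.f) (hφ : MemW1 Ω 2 D.φ) (hybar : MemW1 Ω 2 D.ybar)
    (hA4 : ∀ α β, MemW1 Ω 4 (fun x => D.coeff x α β)) (hy : IsState D m c Ω y)
    (hp : IsAdjoint D m c Ω y p) (hy4 : MemW1 Ω 4 y) (hp4 : MemW1 Ω 4 p) :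
    ∫ x in Ω, shapeDerivIntegrand D m c Ω y p V x
      = ∫ x in Ω, (deriv m (D.lam x + c * (y x - D.φ x))
            * (c * (dirDeriv Ω y V x - dirDeriv Ω D.φ V x) * p x)
          + m (D.lam x + c * (y x - D.φ x)) * (dirDeriv Ω p V x + p x * divField Ω V x)) := by
  have := h.isFiniteMeasure
  obtain ⟨hr, hrg⟩ := hy.1.1.sub h.isOpen hybar
  have harg := h.memLp_arg (c := c) hy.1.memLp
  have hm' := hm.memLp_deriv (p := ⊤) harg.1
  have hmL := hm.memLp harg
  have dy := hV.memLp_dirDeriv hy.1.1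
  have dp := hV.memLp_dirDeriv hp.1.1
  have dφ := hV.memLp_dirDeriv hφ
  have hdiv : ∀ {u : Eucl n → ℝ}, MemLp u 2 (volume.restrict Ω) →
      MemLp (fun x => u x * divField Ω V x) 2 (volume.restrict Ω) := fun hu =>
    hV.memLp_divField.mul' hu
  have hmp : MemLp (fun x => deriv m (D.lam x + c * (y x - D.φ x)) * p x) 2 (volume.restrict Ω) :=
    hp.1.memLp.mul' (p := ⊤) hm'
  have iT := (tendsto_bilinForm_transport hV h.coeff_memLp hA4 hy.1 hp.1 hy4 hp4).1
  have i1 := hr.1.integrable_fun_mul dy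
  have i2 := hmp.integrable_fun_mul dy
  have i3 := (hf.1.fun_sub hmL).integrable_fun_mul dp
  have i0 : Integrable (fun x => deriv m (D.lam x + c * (y x - D.φ x))
            * (c * (dirDeriv Ω y V x - dirDeriv Ω D.φ V x) * p x)
          + m (D.lam x + c * (y x - D.φ x)) * (dirDeriv Ω p V x + p x * divField Ω V x))
      (volume.restrict Ω) := by
    refine ((hmp.integrable_fun_mul ((dy.fun_sub dφ).const_mul c)).congr (ae_of_all _ fun x => ?_)).add
      (hmL.integrable_fun_mul (dp.add (hdiv hp.1.memLp)))
    dsimp only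
    ring
  have ir := ((hV.memLp_dirDeriv hr).integrable_fun_mul hr.1).add
    (hr.1.integrable_fun_mul ((hV.memLp_dirDeriv hr).add (hdiv hr.1)))
  have ifp := ((hV.memLp_dirDeriv hf).integrable_fun_mul hp.1.memLp).add
    (hf.1.integrable_fun_mul (dp.add (hdiv hp.1.memLp)))
  have zr := hV.integral_div_mul_eq_zero hr hr
  have zfp := hV.integral_div_mul_eq_zero hf hp.1.1
  have zT := h.integral_transportIntegrand hm hV hsymm hybar.1 hA4 hy hp hy4 hp4
  -- Bookkeeping: the volume integrand is the limit integrand, plus the terms of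
  -- `integral_transportIntegrand`, whose total integral is zero, plus ½ div((y − ȳ)²V) − div(f p
  -- V).
  have key : shapeDerivIntegrand D m c Ω y p V =ᵐ[volume.restrict Ω] fun x =>
      (deriv m (D.lam x + c * (y x - D.φ x))
            * (c * (dirDeriv Ω y V x - dirDeriv Ω D.φ V x) * p x)
          + m (D.lam x + c * (y x - D.φ x)) * (dirDeriv Ω p V x + p x * divField Ω V x))
      + (-transportIntegrand D Ω V y p x
        + (-((y x - D.ybar x) * dirDeriv Ω y V x)
          + (-(c * (deriv m (D.lam x + c * (y x - D.φ x)) * p x * dirDeriv Ω y V x))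
          + (D.f x - m (D.lam x + c * (y x - D.φ x))) * dirDeriv Ω p V x)))
      + ((1 / 2) * (dirDeriv Ω (fun x => y x - D.ybar x) V x * (y x - D.ybar x)
        + (y x - D.ybar x) * (dirDeriv Ω (fun x => y x - D.ybar x) V x
          + (y x - D.ybar x) * divField Ω V x))
      + -(dirDeriv Ω D.f V x * p x + D.f x * (dirDeriv Ω p V x + p x * divField Ω V x))) := by
    filter_upwards [hrg] with x hx
    have e : dirDeriv Ω (fun x => y x - D.ybar x) V x = dirDeriv Ω y V x - dirDeriv Ω D.ybar V x := by
      rw [dirDeriv, hx, inner_sub_left]; rfl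
    rw [shapeDerivIntegrand_eq, e, transportIntegrand]
    ring
  have j1 := (i2.const_mul c).neg.add i3
  have j2 := i1.neg.add j1
  have j3 := iT.neg.add j2
  have j4 := (ir.const_mul (1 / 2)).add ifp.neg
  refine (integral_congr_ae key).trans <| (integral_add (i0.add j3) j4).trans ?_
  have k1 := integral_add i0 j3
  have k2 := integral_add iT.neg j2
  have k3 := integral_add i1.neg j1
  have k4 := integral_add (i2.const_mul c).neg i3
  have k5 := integral_add (ir.const_mul (1 / 2)) ifp.neg
  simp only [Pi.add_apply, Pi.neg_apply, integral_neg, integral_const_mul] at k1 k2 k3 k4 k5 ⊢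
  rw [k1, k2, k3, k4, k5, zr, zfp, zT]
  ring

end IsEllipticData

end VolumeFormula

/-! ### Linearity and continuity of the volume formula on H¹₀. -/

section FirstOrderFunctional

variable {n : ℕ} {Ω : Set (Eucl n)} {D : ProblemData n} {κ c : ℝ} {m : ℝ → ℝ}
  {V W : Eucl n → Eucl n} {y p : Eucl n → ℝ}

theorem inv_four_add_inv_two : (4 : ℝ≥0∞)⁻¹ + 2⁻¹ = (4 / 3)⁻¹ := by
  rw [← ENNReal.toReal_eq_toReal_iff' (by finiteness) (by simp),
    ENNReal.toReal_add (by finiteness) (by finiteness)]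
  simp only [ENNReal.toReal_inv, ENNReal.toReal_div, ENNReal.toReal_ofNat]
  norm_num

instance holderTriple_four_two : ENNReal.HolderTriple 4 2 (4 / 3) := ⟨inv_four_add_inv_two⟩

instance holderTriple_four_fourThirds : ENNReal.HolderTriple 4 (4 / 3) 1 := by
  constructor
  rw [← inv_four_add_inv_two, ← ENNReal.toReal_eq_toReal_iff' (by finiteness) (by finiteness),
    ENNReal.toReal_add (by finiteness) (by finiteness),
    ENNReal.toReal_add (by finiteness) (by finiteness)]
  norm_num

/-- The pairing of a vector field and its gradient with given densities. -/
noncomputable def fieldPairing (Ω : Set (Eucl n)) (G : Fin n → Eucl n → ℝ) (H : Fin n → Fin n → Eucl n → ℝ)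
    (V : Eucl n → Eucl n) (x : Eucl n) : ℝ :=
  (∑ k, V x k * G k x) + ∑ i, ∑ j, gradField Ω V x i j * H i j x

theorem gradField_smul_add_smul (hΩ : IsOpen Ω) (hV : MemH10Vec Ω V) (hW : MemH10Vec Ω W) (a b : ℝ) :
    ∀ᵐ x ∂(volume.restrict Ω), ∀ i j, gradField Ω (fun x => a • V x + b • W x) x i j
      = a * gradField Ω V x i j + b * gradField Ω W x i j := by
  have h : ∀ j, ∀ᵐ x ∂(volume.restrict Ω), weakGrad Ω (fun x => (a • V x + b • W x) j) x
      = a • weakGrad Ω (fun z => V z j) x + b • weakGrad Ω (fun z => W z j) x := fun j =>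
    (((hV j).pair.const_mul a).add ((hW j).pair.const_mul b)).weakGrad_ae hΩ
  filter_upwards [ae_all_iff.2 h] with x hx i j
  simp only [gradField, Matrix.of_apply]
  rw [hx j]
  simp

theorem fieldPairing_smul_add_smul (hΩ : IsOpen Ω) (hV : MemH10Vec Ω V) (hW : MemH10Vec Ω W) (a b : ℝ)
    (G : Fin n → Eucl n → ℝ) (H : Fin n → Fin n → Eucl n → ℝ) :
    fieldPairing Ω G H (fun x => a • V x + b • W x) =ᵐ[volume.restrict Ω] fun x =>
      a * fieldPairing Ω G H V x + b * fieldPairing Ω G H W x := by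
  filter_upwards [gradField_smul_add_smul hΩ hV hW a b] with x hx
  simp only [fieldPairing, hx, PiLp.add_apply, PiLp.smul_apply, smul_eq_mul, mul_add, Finset.mul_sum,
    add_mul, Finset.sum_add_distrib, mul_assoc]
  ring

theorem MemH10Vec.memLp_gradField (hV : MemH10Vec Ω V) (i j : Fin n) :
    MemLp (fun x => gradField Ω V x i j) 2 (volume.restrict Ω) :=
  (hV j).memLp_jet.eval_piLp (some i)

theorem lpNorm_jet_le_h1NormVec (hV : MemH10Vec Ω V) (k : Fin n) :
    lpNorm (jet Ω fun x => V x k) 2 (volume.restrict Ω) ≤ h1NormVec Ω V := by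
  refine Real.le_sqrt_of_sq_le ?_
  rw [← h1NormSq_eq (hV k).memLp_jet]
  refine Finset.single_le_sum (f := fun k => h1NormSq Ω fun x => V x k) (fun j _ => ?_)
    (Finset.mem_univ k)
  rw [h1NormSq_eq (hV j).memLp_jet]
  positivity

theorem lpNorm_gradField_le (hV : MemH10Vec Ω V) (i j : Fin n) :
    lpNorm (fun x => gradField Ω V x i j) 2 (volume.restrict Ω) ≤ h1NormVec Ω V :=
  (lpNorm_mono_ae (hV.memLp_gradField i j).1 (hV j).memLp_jet
    (ae_of_all _ fun x => (jet Ω (fun z => V z j) x).abs_apply_le (some i))).trans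
    (lpNorm_jet_le_h1NormVec hV j)

/-- Hölder with 1/4 + 3/4 = 1 for V, which is in L⁴ by Sobolev, and with 1/2 + 1/2 = 1 for ∇V. -/
theorem integrable_fieldPairing (hn1 : 1 ≤ n) (hn4 : n ≤ 4) (hΩ : IsOpen Ω)
    (hb : Bornology.IsBounded Ω) {G : Fin n → Eucl n → ℝ} {H : Fin n → Fin n → Eucl n → ℝ}
    (hG : ∀ k, MemLp (G k) (4 / 3) (volume.restrict Ω))
    (hH : ∀ i j, MemLp (H i j) 2 (volume.restrict Ω)) (hV : MemH10Vec Ω V) :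
    Integrable (fieldPairing Ω G H V) (volume.restrict Ω) := by
  obtain ⟨C, -, hS⟩ := sobolev_jet hn1 hn4 hΩ hb
  refine (integrable_finsetSum _ fun k _ => ?_).add
    (integrable_finsetSum _ fun i _ => integrable_finsetSum _ fun j _ => ?_)
  · exact memLp_one_iff_integrable.1 ((hG k).mul' (hS _ (hV k)).1)
  · exact (hV.memLp_gradField i j).integrable_fun_mul (hH i j)

/-- A pairing with densities in `L^{4/3}` and `L^2` is continuous on `H^1_0`. -/
theorem exists_integral_fieldPairing_le (hn1 : 1 ≤ n) (hn4 : n ≤ 4) (hΩ : IsOpen Ω)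
    (hb : Bornology.IsBounded Ω) {G : Fin n → Eucl n → ℝ} {H : Fin n → Fin n → Eucl n → ℝ}
    (hG : ∀ k, MemLp (G k) (4 / 3) (volume.restrict Ω))
    (hH : ∀ i j, MemLp (H i j) 2 (volume.restrict Ω)) :
    ∃ C : ℝ, ∀ V, MemH10Vec Ω V → |∫ x in Ω, fieldPairing Ω G H V x| ≤ C * h1NormVec Ω V := by
  obtain ⟨C, hC, hS⟩ := sobolev_jet hn1 hn4 hΩ hb
  refine ⟨(∑ k, C * lpNorm (G k) (4 / 3) (volume.restrict Ω))
    + ∑ i, ∑ j, lpNorm (H i j) 2 (volume.restrict Ω), fun V hV => ?_⟩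
  have i1 : ∀ k, MemLp (fun x => V x k * G k x) 1 (volume.restrict Ω) := fun k =>
    (hG k).mul' (hS _ (hV k)).1
  have i2 : ∀ i j, MemLp (fun x => gradField Ω V x i j * H i j x) 1 (volume.restrict Ω) := fun i j =>
    (hH i j).mul' (hV.memLp_gradField i j)
  have e : ∫ x in Ω, fieldPairing Ω G H V x = (∑ k, ∫ x in Ω, V x k * G k x)
      + ∑ i, ∑ j, ∫ x in Ω, gradField Ω V x i j * H i j x := by
    have j2 : ∀ i, Integrable (fun x => ∑ j, gradField Ω V x i j * H i j x) (volume.restrict Ω) :=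
      fun i => integrable_finsetSum _ fun j _ => memLp_one_iff_integrable.1 (i2 i j)
    simp only [fieldPairing]
    rw [integral_add (integrable_finsetSum _ fun k _ => memLp_one_iff_integrable.1 (i1 k))
      (integrable_finsetSum _ fun i _ => j2 i),
      integral_finsetSum _ fun k _ => memLp_one_iff_integrable.1 (i1 k),
      integral_finsetSum _ fun i _ => j2 i]
    congr 1
    exact Finset.sum_congr rfl fun i _ =>
      integral_finsetSum _ fun j _ => memLp_one_iff_integrable.1 (i2 i j)
  rw [e, add_mul, Finset.sum_mul, Finset.sum_mul]
  refine (abs_add_le _ _).trans (add_le_add ((Finset.abs_sum_le_sum_abs _ _).trans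
    (Finset.sum_le_sum fun k _ => ?_)) ((Finset.abs_sum_le_sum_abs _ _).trans
    (Finset.sum_le_sum fun i _ => ?_)))
  · refine (abs_integral_le_lpNorm (i1 k).1).trans ((lpNorm_mul_le (hS _ (hV k)).1 (hG k)).trans ?_)
    rw [mul_right_comm]
    exact mul_le_mul_of_nonneg_right ((hS _ (hV k)).2.trans
      (mul_le_mul_of_nonneg_left (lpNorm_jet_le_h1NormVec hV k) hC)) lpNorm_nonneg
  · rw [Finset.sum_mul]
    refine (Finset.abs_sum_le_sum_abs _ _).trans (Finset.sum_le_sum fun j _ => ?_)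
    refine (abs_integral_mul_le (hV.memLp_gradField i j) (hH i j)).trans ?_
    rw [mul_comm]
    exact mul_le_mul_of_nonneg_left (lpNorm_gradField_le hV i j) lpNorm_nonneg

/-- The density of the volume formula that is paired with the vector field. -/
noncomputable def shapeDensity (D : ProblemData n) (m : ℝ → ℝ) (c : ℝ) (Ω : Set (Eucl n)) (y p : Eucl n → ℝ)
    (k : Fin n) (x : Eucl n) : ℝ :=
  -((y x - D.ybar x) * weakGrad Ω D.ybar x k)
    + (∑ α, ∑ β, weakGrad Ω (fun z => D.coeff z α β) x k * (jet Ω y x α * jet Ω p x β))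
    - c * (deriv m (D.lam x + c * (y x - D.φ x)) * (p x * weakGrad Ω D.φ x k))
    - p x * weakGrad Ω D.f x k

/-- The density of the volume formula that is paired with the gradient of the vector field. -/
noncomputable def shapeTensor (D : ProblemData n) (m : ℝ → ℝ) (c : ℝ) (Ω : Set (Eucl n)) (y p : Eucl n → ℝ)
    (i j : Fin n) (x : Eucl n) : ℝ :=
  -(jet Ω y x (some j) * ∑ β, D.coeff x (some i) β * jet Ω p x β)
    - jet Ω p x (some j) * (∑ α, D.coeff x α (some i) * jet Ω y x α)
    + if i = j then (1 / 2) * ((y x - D.ybar x) * (y x - D.ybar x))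
        + (∑ α, jet Ω y x α * ∑ β, D.coeff x α β * jet Ω p x β)
        + (m (D.lam x + c * (y x - D.φ x)) * p x - D.f x * p x) else 0

theorem dirDeriv_eq_sum (u : Eucl n → ℝ) (x : Eucl n) :
    dirDeriv Ω u V x = ∑ k, V x k * weakGrad Ω u x k := by
  simp [dirDeriv, PiLp.inner_apply]

theorem divField_mul_eq_sum (x : Eucl n) (s : ℝ) :
    divField Ω V x * s = ∑ i, ∑ j, gradField Ω V x i j * if i = j then s else 0 := by
  simp [divField, Matrix.trace, Finset.sum_mul]

/-- The formula is sorted by V and ∇V, with div V as the trace of ∇V. Integrability, linearity and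
continuity then reduce to the integrability of two densities. -/
theorem shapeDerivIntegrand_eq_fieldPairing : shapeDerivIntegrand D m c Ω y p V
    = fieldPairing Ω (shapeDensity D m c Ω y p) (shapeTensor D m c Ω y p) V := by
  ext1 x
  have e1 : D.dirForm Ω V x (jet Ω y x) (jet Ω p x) = ∑ k, V x k *
      ∑ α, ∑ β, weakGrad Ω (fun z => D.coeff z α β) x k * (jet Ω y x α * jet Ω p x β) := by
    simp only [ProblemData.dirForm, dirDeriv_eq_sum, Finset.mul_sum, Finset.sum_mul]
    refine (Finset.sum_comm.trans (Finset.sum_congr rfl fun α _ => Finset.sum_comm.trans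
      (Finset.sum_congr rfl fun β _ => Finset.sum_congr rfl fun k _ => ?_))).symm
    ring
  have e2 : D.jetForm x (jet Ω y x) (jet Ω p x)
      = ∑ α, jet Ω y x α * ∑ β, D.coeff x α β * jet Ω p x β := by
    simp only [ProblemData.jetForm, Finset.mul_sum]
    exact Finset.sum_congr rfl fun α _ => Finset.sum_congr rfl fun β _ => by ring
  have e3 : ∀ (s : ℝ) (g : Eucl n), ∑ k, V x k * (s * g k) = s * ∑ k, V x k * g k := fun s g => by
    rw [Finset.mul_sum]
    exact Finset.sum_congr rfl fun k _ => by ring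
  have e4 : (1 / 2) * (y x - D.ybar x) ^ 2 + D.jetForm x (jet Ω y x) (jet Ω p x)
        + m (D.lam x + c * (y x - D.φ x)) * p x - D.f x * p x
      = (1 / 2) * ((y x - D.ybar x) * (y x - D.ybar x))
        + (∑ α, jet Ω y x α * ∑ β, D.coeff x α β * jet Ω p x β)
        + (m (D.lam x + c * (y x - D.φ x)) * p x - D.f x * p x) := by
    rw [← e2]; ring
  rw [shapeDerivIntegrand_eq, jetForm_nablaJet_left, jetForm_nablaJet_right, e1, e4,
    divField_mul_eq_sum]
  have e5 : ∀ k, c * (deriv m (D.lam x + c * (y x - D.φ x)) * (p x * weakGrad Ω D.φ x k))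
      = c * deriv m (D.lam x + c * (y x - D.φ x)) * p x * weakGrad Ω D.φ x k := fun k => by ring
  simp only [dirDeriv_eq_sum, fieldPairing, shapeDensity, shapeTensor, e5]
  generalize (1 / 2) * ((y x - D.ybar x) * (y x - D.ybar x))
        + (∑ α, jet Ω y x α * ∑ β, D.coeff x α β * jet Ω p x β)
        + (m (D.lam x + c * (y x - D.φ x)) * p x - D.f x * p x) = s
  simp only [mul_add, mul_sub,
    Finset.sum_add_distrib, Finset.sum_sub_distrib, mul_neg, Finset.sum_neg_distrib, e3]
  ring

/-- Each summand is an L⁴ function times an L² function: y − ȳ and ∇ȳ, a coefficient gradient and a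
product of jets of y and p, p and ∇φ (with the bounded factor m'), p and ∇f. -/
theorem memLp_shapeDensity [IsFiniteMeasure (volume.restrict Ω)] (hm : IsRegularMax m)
    (hl : MemLp D.lam 2 (volume.restrict Ω)) (hf : MemW1 Ω 2 D.f) (hφ : MemW1 Ω 2 D.φ)
    (hybar : MemW1 Ω 2 D.ybar) (hybar4 : MemLp D.ybar 4 (volume.restrict Ω))
    (hA4 : ∀ α β, MemW1 Ω 4 (fun x => D.coeff x α β)) (hy4 : MemW1 Ω 4 y) (hp4 : MemW1 Ω 4 p)
    (k : Fin n) : MemLp (shapeDensity D m c Ω y p k) (4 / 3) (volume.restrict Ω) := by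
  have hg : ∀ {q : ℝ≥0∞} {u : Eucl n → ℝ}, MemW1 Ω q u →
      MemLp (fun x => weakGrad Ω u x k) q (volume.restrict Ω) := fun hu => hu.2.2.eval_piLp k
  have harg : AEStronglyMeasurable (fun x => D.lam x + c * (y x - D.φ x)) (volume.restrict Ω) :=
    hl.1.add ((hy4.1.1.sub hφ.1.1).const_mul c)
  refine MemLp.sub (MemLp.sub (MemLp.add (MemLp.neg ?_) (memLp_finsetSum _ fun α _ =>
    memLp_finsetSum _ fun β _ => ?_)) (MemLp.const_mul ?_ c)) ?_
  · exact (hg hybar).mul' (p := 4) (hy4.1.sub hybar4)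
  · have : MemLp (fun x => jet Ω y x α * jet Ω p x β) 2 (volume.restrict Ω) :=
      (hp4.memLp_jet.eval_piLp β).mul' (hy4.memLp_jet.eval_piLp α)
    exact this.mul' (hg (hA4 α β))
  · have : MemLp (fun x => p x * weakGrad Ω D.φ x k) (4 / 3) (volume.restrict Ω) :=
      (hg hφ).mul' hp4.1
    exact this.mul' (p := ⊤) (hm.memLp_deriv harg)
  · exact (hg hf).mul' hp4.1

/-- Products of the L⁴ jets of y and p, with bounded coefficients, lie in L². In m(q)p and f p the
other factor is just L², which is why p ∈ L^∞ is required. -/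
theorem memLp_shapeTensor [IsFiniteMeasure (volume.restrict Ω)] (hm : IsRegularMax m)
    (hl : MemLp D.lam 2 (volume.restrict Ω)) (hf : MemLp D.f 2 (volume.restrict Ω))
    (hφ : MemLp D.φ 2 (volume.restrict Ω)) (hybar4 : MemLp D.ybar 4 (volume.restrict Ω))
    (hA : ∀ α β, MemLp (fun x => D.coeff x α β) ⊤ (volume.restrict Ω))
    (hy4 : MemW1 Ω 4 y) (hp4 : MemW1 Ω 4 p) (hp : MemLp p ⊤ (volume.restrict Ω))
    (i j : Fin n) : MemLp (shapeTensor D m c Ω y p i j) 2 (volume.restrict Ω) := by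
  have hm2 : MemLp (fun x => m (D.lam x + c * (y x - D.φ x))) 2 (volume.restrict Ω) :=
    hm.memLp (hl.add (((hy4.1.mono_exponent (by norm_num)).sub hφ).const_mul c))
  have hP : ∀ α, MemLp (fun x => ∑ β, D.coeff x α β * jet Ω p x β) 4 (volume.restrict Ω) := fun α =>
    memLp_finsetSum _ fun β _ => (hp4.memLp_jet.eval_piLp β).mul' (hA α β)
  have hY : ∀ β, MemLp (fun x => ∑ α, D.coeff x α β * jet Ω y x α) 4 (volume.restrict Ω) := fun β =>
    memLp_finsetSum _ fun α _ => (hy4.memLp_jet.eval_piLp α).mul' (hA α β)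
  refine MemLp.add (MemLp.sub (MemLp.neg ?_) ?_) ?_
  · exact (hP (some i)).mul' (hy4.memLp_jet.eval_piLp (some j))
  · exact (hY (some i)).mul' (hp4.memLp_jet.eval_piLp (some j))
  · by_cases hij : i = j
    · simp only [if_pos hij]
      have hr := hy4.1.fun_sub hybar4
      refine ((MemLp.mul' (r := 2) hr hr).const_mul (1 / 2)).add (memLp_finsetSum _ fun α _ => ?_)
        |>.add ((hp.mul' hm2).sub (hp.mul' hf))
      exact (hP α).mul' (hy4.memLp_jet.eval_piLp α)
    · simp only [if_neg hij]
      exact MemLp.zero' (ε := ℝ)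

end FirstOrderFunctional

/-! ### The shape functional and the assembly of the theorem. -/

section ShapeDerivative

variable {n : ℕ} {Ω : Set (Eucl n)} {D : ProblemData n} {κ c : ℝ} {m : ℝ → ℝ}
  {V : Eucl n → Eucl n} {K : NNReal} {M : ℝ} {y p : Eucl n → ℝ}

theorem IsSmoothedMax.isRegularMax {maxγ : ℝ → ℝ → ℝ} (h : IsSmoothedMax maxγ) {γ : ℝ} (hγ : 0 < γ) :
    IsRegularMax (maxγ γ) := ⟨h.contDiff γ hγ, h.deriv_mem γ hγ⟩

theorem ProblemData.deform_id : D.deform id = D := by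
  have : Function.invFun (id : Eucl n → Eucl n) = id :=
    funext fun x => Function.leftInverse_invFun Function.injective_id x
  simp [ProblemData.deform, this]

namespace IsEllipticData

theorem deform (h : IsEllipticData D Ω κ) {T : Eucl n → Eucl n}
    (hT : IsBiLip Ω K T (Function.invFun T)) : IsEllipticData (D.deform T) Ω κ :=
  { h with lam_memLp := hT.symm.memLp_comp h.isOpen.measurableSet h.lam_memLp }

/-- `reducedCost` is evaluated at a chosen state; uniqueness almost everywhere makes the choice
irrelevant. -/
theorem reducedCost_eq (h : IsEllipticData D Ω κ) (hm : IsRegularMax m) (hc : 0 < c)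
    (hy : IsState D m c Ω y) : reducedCost D m c Ω = (1 / 2) * ∫ x in Ω, |y x - D.ybar x| ^ 2 := by
  have hex : ∃ y, IsState D m c Ω y := ⟨y, hy⟩
  rw [reducedCost, dif_pos hex]
  congr 1
  refine integral_congr_ae ?_
  filter_upwards [h.state_unique hm hc hy hex.choose_spec] with x hx
  rw [hx]

theorem eventually_exists_unique_state (h : IsEllipticData D Ω κ) (hm : IsRegularMax m) (hc : 0 < c)
    (hV : IsLipField Ω V K M) : ∀ᶠ t in 𝓝[≥] (0 : ℝ), Function.Bijective (perturb V t) ∧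
      ∃ yt, IsState (D.deform (perturb V t)) m c (perturb V t '' Ω) yt ∧
        ∀ z, IsState (D.deform (perturb V t)) m c (perturb V t '' Ω) z →
          z =ᵐ[volume.restrict (perturb V t '' Ω)] yt := by
  filter_upwards [hV.isBiLip] with t hT
  refine ⟨⟨hT.left_inv.injective, hT.right_inv.surjective⟩, ?_⟩
  rw [hT.image_eq]
  obtain ⟨yt, hyt⟩ := (h.deform hT).exists_state hm hc
  exact ⟨yt, hyt, fun z hz => (h.deform hT).state_unique hm hc hyt hz⟩

/-- As T_t(Ω) = Ω, the difference quotient compares the costs of two states on the same set Ω, one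
for the transported and one for the original shift. -/
theorem tendsto_shapeFunctional_diffQuot (h : IsEllipticData D Ω κ) (hm : IsRegularMax m) (hc : 0 < c)
    (hV : IsLipField Ω V K M)
    (hsymm : ∀ u v, MemH10 Ω u → MemH10 Ω v → bilinForm D Ω u v = bilinForm D Ω v u)
    (hf : MemW1 Ω 2 D.f) (hφ : MemW1 Ω 2 D.φ) (hybar : MemW1 Ω 2 D.ybar)
    (hA4 : ∀ α β, MemW1 Ω 4 (fun x => D.coeff x α β)) (hy : IsState D m c Ω y)
    (hp : IsAdjoint D m c Ω y p) (hy4 : MemW1 Ω 4 y) (hp4 : MemW1 Ω 4 p) :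
    Tendsto (fun t : ℝ => (shapeFunctional D m c Ω (perturb V t) - shapeFunctional D m c Ω id) / t)
      (𝓝[>] 0) (𝓝 (∫ x in Ω, shapeDerivIntegrand D m c Ω y p V x)) := by
  have hex : ∀ᶠ t in 𝓝[>] (0 : ℝ), ∃ w, IsState (D.deform (perturb V t)) m c Ω w :=
    hV.isBiLip_gt.mono fun t hT => (h.deform hT).exists_state hm hc
  obtain ⟨w, hw⟩ := hex.choice
  rw [h.integral_shapeDerivIntegrand hm hV hsymm hf hφ hybar hA4 hy hp hy4 hp4]
  refine (h.tendsto_cost_diffQuot hm hV hc hsymm hφ hybar.1 hy hp hw).congr' ?_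
  filter_upwards [hw, hV.isBiLip_gt] with t ht hT
  rw [shapeFunctional, shapeFunctional, image_id, ProblemData.deform_id, hT.image_eq,
    h.reducedCost_eq hm hc hy, (h.deform hT).reducedCost_eq hm hc ht]
  rfl

end IsEllipticData

end ShapeDerivative

theorem mainTheorem3 (n : ℕ) (hn1 : 1 ≤ n) (hn4 : n ≤ 4)
    (Ω : Set (Eucl n)) (hΩ : IsBoundedLipschitz Ω)
    (D : ProblemData n)
    (hM : ∀ i j, MemLp (fun x => D.M x i j) ⊤ (volume.restrict Ω) ∧
      MemW1 Ω 4 (fun x => D.M x i j))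
    (hd : ∀ i, MemLp (fun x => D.d x i) ⊤ (volume.restrict Ω) ∧ MemW1 Ω 4 (fun x => D.d x i))
    (hb : MemLp D.b ⊤ (volume.restrict Ω) ∧ MemW1 Ω 4 D.b)
    (hf : MemW1 Ω 2 D.f) (hφ : MemW1 Ω 2 D.φ) (hybar : MemW1 Ω 2 D.ybar)
    (hlam : MemLp D.lam 2 (volume.restrict Ω))
    (hsymm : ∀ u v, MemH10 Ω u → MemH10 Ω v → bilinForm D Ω u v = bilinForm D Ω v u)
    (hcoer : ∃ K > 0, ∀ u, MemH10 Ω u → K * h1NormSq Ω u ≤ bilinForm D Ω u u)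
    (maxγ : ℝ → ℝ → ℝ) (hmax : IsSmoothedMax maxγ)
    (γ c : ℝ) (hγ : 0 < γ) (hc : 0 < c)
    (y p : Eucl n → ℝ)
    (hy : IsState D (maxγ γ) c Ω y) (hp : IsAdjoint D (maxγ γ) c Ω y p)
    (hy4 : MemW1 Ω 4 y) (hp4 : MemW1 Ω 4 p) :
    -- the shape functional is well defined along every admissible deformation
    (∀ V, IsAdmissibleField Ω V → ∀ᶠ t in 𝓝[≥] (0 : ℝ),
      Function.Bijective (perturb V t) ∧
      ∃ yt, IsState (D.deform (perturb V t)) (maxγ γ) c (perturb V t '' Ω) yt ∧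
        ∀ z, IsState (D.deform (perturb V t)) (maxγ γ) c (perturb V t '' Ω) z →
          z =ᵐ[volume.restrict (perturb V t '' Ω)] yt) ∧
    -- the volume formula makes sense for every direction
    (∀ V, MemH10Vec Ω V →
      IntegrableOn (shapeDerivIntegrand D (maxγ γ) c Ω y p V) Ω) ∧
    -- the shape derivative exists and is given by the volume formula
    HasShapeDerivative Ω (shapeFunctional D (maxγ γ) c Ω)
      (fun V => ∫ x in Ω, shapeDerivIntegrand D (maxγ γ) c Ω y p V x) := by
  have hΩo := hΩ.1
  have hΩb := hΩ.2.1
  have hA : ∀ α β, MemLp (fun x => D.coeff x α β) ⊤ (volume.restrict Ω) ∧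
      MemW1 Ω 4 (fun x => D.coeff x α β) := by
    rintro (_ | i) (_ | j)
    exacts [hb, hd j, hd i, hM i j]
  have hm := hmax.isRegularMax hγ
  obtain ⟨κ, hκ, hcoer⟩ := hcoer
  have h : IsEllipticData D Ω κ :=
    ⟨hΩo, hΩb, fun α β => (hA α β).1, hκ, hcoer, hf.1, hφ.1, hlam⟩
  have := h.isFiniteMeasure
  -- Used for the source ȳ − y of the adjoint equation and for the densities of the volume formula.
  have hybar4 : MemLp D.ybar 4 (volume.restrict Ω) :=
    memLp_four_of_isBoundedLipschitz hn1 hn4 hΩ (weakGrad_spec hybar.2.1) hybar.1 hybar.2.2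
  -- The adjoint equation is a linear problem with nonnegative potential c·m'(q) and source ȳ − y ∈
  -- L⁴.
  have hpt : MemLp p ⊤ (volume.restrict Ω) :=
    h.memLp_top_of_weak_solution hn1 hn4 hc.le hp.1
      (ω := fun x => deriv (maxγ γ) (D.lam x + c * (y x - D.φ x))) (fun x => (hm.deriv_mem _).1)
      (r := fun x => -(y x - D.ybar x)) (hy4.1.sub hybar4).neg fun v hv => by
        rw [hp.2 v hv, ← integral_neg]
        simp only [neg_mul]
  have hG := memLp_shapeDensity (c := c) hm hlam hf hφ hybar hybar4 (fun α β => (hA α β).2) hy4 hp4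
  have hH := memLp_shapeTensor (c := c) hm hlam hf.1 hφ.1 hybar4 h.coeff_memLp hy4 hp4 hpt
  have hint : ∀ V, MemH10Vec Ω V →
      IntegrableOn (shapeDerivIntegrand D (maxγ γ) c Ω y p V) Ω := fun V hV => by
    rw [shapeDerivIntegrand_eq_fieldPairing]
    exact integrable_fieldPairing hn1 hn4 hΩo hΩb hG hH hV
  refine ⟨fun V hV => ?_, hint, fun V hV => ?_, fun V W hV hW a b => ?_, ?_⟩
  · obtain ⟨K, M, hVl⟩ := hV.exists_isLipField hΩo hΩb
    exact h.eventually_exists_unique_state hm hc hVl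
  · obtain ⟨K, M, hVl⟩ := hV.exists_isLipField hΩo hΩb
    exact h.tendsto_shapeFunctional_diffQuot hm hc hVl hsymm hf hφ hybar (fun α β => (hA α β).2)
      hy hp hy4 hp4
  · have iV := hint V hV
    have iW := hint W hW
    simp only [shapeDerivIntegrand_eq_fieldPairing] at iV iW ⊢
    rw [integral_congr_ae (fieldPairing_smul_add_smul hΩo hV hW a b _ _),
      integral_add (iV.const_mul a) (iW.const_mul b), integral_const_mul, integral_const_mul]
  · simp only [shapeDerivIntegrand_eq_fieldPairing]
    exact exists_integral_fieldPairing_le hn1 hn4 hΩo hΩb hG hH
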